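/- **Setting (one-step POMDP with missing observations).** One trial of the observational process is $(O^-,S,O,A,Y,S^+,O^+,A^+,R_O,R_{O^-},R_{O^+})$, with $O^-\sim p$, $S\sim p(\cdot\mid O^-)$, $O\sim p(\cdot\mid S)$, $A\sim\pi_{\rm ob}(\cdot\mid S)$, $Y\sim p(\cdot\mid S,O,A)$, $|Y|\le L_Y$ a.s., $S^+\sim p(\cdot\mid S,A)$, $O^+\sim p(\cdot\mid S^+)$, $A^+\sim\pi_{\rm ob}(\cdot\mid S^+)$; the missingness indicators are drawn as $R_O\sim p(\cdot\mid O,A)$, $R_{O^-}\sim p(\cdot\mid O^-)$, $R_{O^+}\sim p(\cdot\mid O^+,A^+)$ ($1$ = recorded). The spaces are arbitrary measurable spaces and $\mathcal A$ is finite. The data $\mathcal D$ are $T$ i.i.d. trials. Let $E_1=\{R_{O^-}=R_{O^+}=1\}$, $E_2=\{R_O=R_{O^-}=R_{O^+}=1\}$, $E_3=\{R_O=R_{O^-}=1\}$, $E_4=\{R_{O^-}=1\}$; $\mu_k$ is the law of a trial given $E_k$, $\mathcal D_k$ the trials of $\mathcal D$ in $E_k$, $T_k=|\mathcal D_k|$.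 A policy $\pi(a\mid o,o^-)$ has value $v^\pi=\mathbb E[Y]$ when $O^-\sim\tilde p$, $S\sim p(\cdot\mid O^-)$, $O\sim p(\cdot\mid S)$, $A\sim\pi(\cdot\mid O,O^-)$, $Y\sim p(\cdot\mid S,O,A)$. The class $\Pi$ is any subset of the softmax class $\pi(a\mid o,o^-)\propto\exp(w_0^\top\phi_0(a,o,o^-))$, $\|w_0\|\le C_0$, and $\mathrm{SubOpt}(\pi)=\sup_{\pi'\in\Pi}v^{\pi'}-v^{\pi}$. **Moment functions.** For $h=(h_1,h_2,h_3,g)$ put $\alpha_1^\pi(h)=h_1(Y,A,O^-,O^+)$, $\alpha_2^\pi(h)=h_2(A,O,O^-)-h_1(Y,A,O^-,O^+)-Y\pi(A\mid O,O^-)$, $\alpha_3^\pi(h)=h_3(Y,A,O^-)-\sum_{a'}h_2(a',O,O^-)$, $\alpha_4^\pi(h)=g(O^-)-h_3(Y,A,O^-)$, and $Z_1=(A,O^-,O^+)$, $Z_2=(A,O,O^-,O^+)$, $Z_3=(A,O,O^-)$, $Z_4=O^-$. **Classes and assumptions.** All feature maps $\phi_k,\psi_k$ are measurable with Euclidean norm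 at most $1$; $\mathcal H_k=\{w^\top\phi_k:\|w\|\le C_k\}$ $(k=1,2,3)$, $\mathcal G=\{w^\top\psi_4:\|w\|\le C_4\}$ with $C_4=C_3\|W_6\|_F$, $\mathcal H=\mathcal H_1\times\mathcal H_2\times\mathcal H_3\times\mathcal G$, $\Theta_k=\{\beta^\top\psi_k(Z_k):\|\beta\|\le D_k\}$ $(k\le 4)$. (a) For each $\pi\in\Pi$ some $h$ with $h_k\in\mathcal H_k$ $(k\le3)$ solves $\mathbb E_{\mu_k}[\alpha_k^\pi(h)\mid Z_k]=0$, $k=1,\dots,4$. (b) There are matrices $W_1,\dots,W_6$ with $\mathbb E[\phi_1\mid Z_1,R_{O^+}=1]=W_1\psi_1$, $\mathbb E[\phi_1\mid Z_2,R_{O^+}=1]=W_2\psi_2$, $\mathbb E[\phi_2\mid Z_2,R_{O^+}=1]=W_3\psi_2$, $\sum_{a'}\phi_2(a',o,o^-)=W_4\psi_3(a,o,o^-)$ for all $a,o,o^-$, $\mathbb E[\phi_3\mid Z_3]=W_5\psi_3$, $\mathbb E[\phi_3\mid Z_4]=W_6\psi_4$. (c) $D_1>2C_1\|W_1\|_F$,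 $D_2>2(C_1\|W_2\|_F+C_2\|W_3\|_F)$, $D_3>2(C_3\|W_5\|_F+C_2\|W_4\|_F)$, $D_4>2(C_4+C_3\|W_6\|_F)$. (d) $L_\alpha$ bounds all $|\alpha_k^\pi(h)|$, $h\in\mathcal H$, $\pi\in\Pi$, $k\le 4$, whenever $|Y|\le L_Y$. **Pessimistic policy.** With empirical means $\mathbb E_{\mathcal D_k}$, let $\mathcal L^\pi_{\mathcal D}(h)=\sum_{k}\sup_{\theta\in\Theta_k}\{\mathbb E_{\mathcal D_k}[\alpha_k^\pi(h)\theta]-\tfrac12\mathbb E_{\mathcal D_k}[\theta^2]\}$, $\mathrm{CI}^\pi_{\mathcal D}(e)=\{g:\exists h\in\mathcal H,\ h^{(4)}=g,\ \mathcal L_{\mathcal D}^\pi(h)\le\inf_{\mathcal H}\mathcal L^\pi_{\mathcal D}+e\}$. A policy $\hat\pi\in\Pi$ is pessimistic if it maximizes $\inf_{g\in \mathrm{CI}^\pi_{\mathcal D}(e_{\mathcal D})}\int g\,d\tilde p$ over $\pi\in\Pi$. **Critical radii.** A critical radius, on data $x_1,\dots,x_n$, of a class $F$ of functions bounded by $b$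 is any $r>0$ with $\mathbb E_\varepsilon\sup_{f\in F,\ \frac1n\sum f(x_i)^2\le r^2}\frac1n\sum_i\varepsilon_i f(x_i)\le r^2/b$ ($\varepsilon_i$ i.i.d. random signs). Let $\mathcal Q_k=\{\alpha_k^\pi(h)\theta:\pi\in\Pi,h\in\mathcal H,\theta\in\Theta_k\}$ and $B_k=\max(1,L_\alpha)\max(1,D_k)$. For $c_0>0$ and $\xi\in(0,1)$, say that $\eta_1,\dots,\eta_4$ *bound the critical radii at level $\xi$ (with constant $c_0$)* if for every $k$ there is $r_k$, a critical radius on $\mathcal D_k$ of both $\mathcal Q_k$ and $\Theta_k$ (with bound $b=B_k$), with $\eta_k\ge c_0\big(r_k+B_k\sqrt{\log(1/\xi)/T_k}\big)$. Put $\eta=(\sum_{k=1}^4\eta_k^2)^{1/2}$. **Shift functions.** Assume that a measurable $b_1(o^-,a,o^+)$, $\mu_1$-integrable, satisfies $$\mathbb E_{\mu_1}[b_1(O^-,A,O^+)\mid o^-,s,a]=\frac{p(s\mid o^-)\,\tilde p(o^-)}{p_{\rm ob}(s,o^-,a\mid R_{O^-}=R_{O^+}=1)},$$ and put $$b_2=b_1\,\frac{p_{\rm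 ob}(a,o,o^-\mid E_1)}{p_{\rm ob}(a,o,o^-\mid E_2)},\qquad b_3=\frac{\tilde p(o^-)\,p_{\rm ob}(a,o\mid o^-,R_{O^-}=1)}{p_{\rm ob}(o^-,a,o\mid E_3)},\qquad b_4=\frac{\tilde p(o^-)}{p_{\rm ob}(o^-\mid E_4)},$$ the ratios being Radon–Nikodym derivatives (counting measure on $\mathcal A$), which are assumed to exist. **Corollary.** There are universal constants $c_0,C>0$ such that in this setting, for all $T$ and $\xi\in(0,1)$: (1) with probability at least $1-8\xi$ over $\mathcal D$, if $T_2\ge1$ then, for all $\eta_1,\dots,\eta_4$ that bound the critical radii at level $\xi$ with constant $c_0$, all $e_{\mathcal D}>(2L_\alpha^2+\tfrac54)\eta^2$ and all pessimistic policies $\hat\pi$ with threshold $e_{\mathcal D}$, $$\mathrm{SubOpt}(\hat\pi)\le\sum_{k=1}^4\|b_k\|_{L^2(\mu_k)}\big(C\sqrt{e_{\mathcal D}}+C\eta\big);$$ (2) if $L_\alpha\le\kappa|\mathcal A|$, then almost surely, if $T_2\ge2$, there are $\eta_1,\dots,\eta_4$ that bound the critical radii at level $\xi$ with constant $c_0$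 and satisfy $$\eta\le C'\,|\mathcal A|\sqrt{\frac{\log T_2+\log(1/\xi)}{T_2}},$$ where $C'$ depends only on $\kappa$, $L_Y$, the dimensions of the features and the radii $C_k,D_k$. In particular $\eta=O(|\mathcal A|\sqrt{\log T_2/T_2})$ for fixed $\xi$. (By (d), $L_\alpha$ can always be taken to be $O(|\mathcal A|)$.) -/

import Mathlib

open MeasureTheory ProbabilityTheory

noncomputable section

namespace LinPOMDP

/-! ### The one-step POMDP -/

/-- A one-step POMDP: pre-observation space `Om`, hidden state space `S`, observation space `O`,
action space `A`, next observation space `Op`.  The reward is real.  Arrows of the causal graph are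
Markov kernels; the missingness indicators are Boolean (`true` means that the value is recorded). -/
structure Model (Om S O A Op : Type*) [MeasurableSpace Om] [MeasurableSpace S] [MeasurableSpace O]
    [MeasurableSpace A] [MeasurableSpace Op] where
  /-- law of the pre-observation in the observational data -/
  pOm : Measure Om
  /-- law of the pre-observation in the interventional population -/
  pTilde : Measure Om
  /-- hidden state given the pre-observation -/
  kS : Kernel Om S
  /-- observation given the hidden state -/
  kO : Kernel S O
  /-- observational policy, which sees the hidden state -/
  piOb : Kernel S A
  /-- reward given hidden state, observation and action -/
  kY : Kernel (S × O × A) ℝ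
  /-- next hidden state given hidden state and action -/
  kSnext : Kernel (S × A) S
  /-- next observation given the next hidden state -/
  kOp : Kernel S Op
  /-- missingness of the observation, caused by the observation and the action -/
  rO : Kernel (O × A) Bool
  /-- missingness of the pre-observation, caused by the pre-observation -/
  rOm : Kernel Om Bool
  /-- missingness of the next observation, caused by the next observation and the next action -/
  rOp : Kernel (Op × A) Bool
  [prob_pOm : IsProbabilityMeasure pOm]
  [prob_pTilde : IsProbabilityMeasure pTilde]
  [markov_kS : IsMarkovKernel kS]
  [markov_kO : IsMarkovKernel kO]
  [markov_piOb : IsMarkovKernel piOb]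
  [markov_kY : IsMarkovKernel kY]
  [markov_kSnext : IsMarkovKernel kSnext]
  [markov_kOp : IsMarkovKernel kOp]
  [markov_rO : IsMarkovKernel rO]
  [markov_rOm : IsMarkovKernel rOm]
  [markov_rOp : IsMarkovKernel rOp]

attribute [instance] Model.prob_pOm Model.prob_pTilde Model.markov_kS Model.markov_kO
  Model.markov_piOb Model.markov_kY Model.markov_kSnext Model.markov_kOp Model.markov_rO
  Model.markov_rOm Model.markov_rOp

/-- One full observational trial, in causal order: pre-observation, hidden state, observation,
action, reward, next hidden state, next observation, next action, and the three missingness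
indicators (of the observation, of the pre-observation, of the next observation). -/
abbrev Trial (Om S O A Op : Type*) : Type _ :=
  ((((((((((Om × S) × O) × A) × ℝ) × S) × Op) × A) × Bool) × Bool) × Bool)

section Coordinates

variable {Om S O A Op : Type*}

def preObs (t : Trial Om S O A Op) : Om := t.1.1.1.1.1.1.1.1.1.1
def state (t : Trial Om S O A Op) : S := t.1.1.1.1.1.1.1.1.1.2
def obs (t : Trial Om S O A Op) : O := t.1.1.1.1.1.1.1.1.2
def act (t : Trial Om S O A Op) : A := t.1.1.1.1.1.1.1.2
def rew (t : Trial Om S O A Op) : ℝ := t.1.1.1.1.1.1.2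
def nextObs (t : Trial Om S O A Op) : Op := t.1.1.1.1.2
def seenObs (t : Trial Om S O A Op) : Bool := t.1.1.2
def seenPreObs (t : Trial Om S O A Op) : Bool := t.1.2
def seenNextObs (t : Trial Om S O A Op) : Bool := t.2

end Coordinates

section Laws

variable {Om S O A Op : Type*} [MeasurableSpace Om] [MeasurableSpace S] [MeasurableSpace O]
  [MeasurableSpace A] [MeasurableSpace Op]

/-- The joint law of one trial in the observational regime: the product of the kernels along the
causal graph. The next action follows the same observational policy at the next hidden state. -/
def obLaw (M : Model Om S O A Op) : Measure (Trial Om S O A Op) :=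
  M.pOm ⊗ₘ M.kS
    ⊗ₘ M.kO.comap (fun x : Om × S => x.2) (by fun_prop)
    ⊗ₘ M.piOb.comap (fun x : (Om × S) × O => x.1.2) (by fun_prop)
    ⊗ₘ M.kY.comap (fun x : ((Om × S) × O) × A => (x.1.1.2, x.1.2, x.2)) (by fun_prop)
    ⊗ₘ M.kSnext.comap (fun x : (((Om × S) × O) × A) × ℝ => (x.1.1.1.2, x.1.2)) (by fun_prop)
    ⊗ₘ M.kOp.comap (fun x : ((((Om × S) × O) × A) × ℝ) × S => x.2) (by fun_prop)
    ⊗ₘ M.piOb.comap (fun x : (((((Om × S) × O) × A) × ℝ) × S) × Op => x.1.2) (by fun_prop)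
    ⊗ₘ M.rO.comap (fun x : ((((((Om × S) × O) × A) × ℝ) × S) × Op) × A =>
        (x.1.1.1.1.1.2, x.1.1.1.1.2)) (by fun_prop)
    ⊗ₘ M.rOm.comap (fun x : (((((((Om × S) × O) × A) × ℝ) × S) × Op) × A) × Bool =>
        x.1.1.1.1.1.1.1.1) (by fun_prop)
    ⊗ₘ M.rOp.comap (fun x : ((((((((Om × S) × O) × A) × ℝ) × S) × Op) × A) × Bool) × Bool =>
        (x.1.1.1.2, x.1.1.2)) (by fun_prop)

instance (M : Model Om S O A Op) : IsProbabilityMeasure (obLaw M) := by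
  unfold obLaw; infer_instance

/-- The joint law of (pre-observation, state, observation, action, reward) when the interventional
policy `π` acts on (pre-observation, observation). -/
def inLaw (M : Model Om S O A Op) (π : Kernel (Om × O) A) :
    Measure ((((Om × S) × O) × A) × ℝ) :=
  M.pTilde ⊗ₘ M.kS
    ⊗ₘ M.kO.comap (fun x : Om × S => x.2) (by fun_prop)
    ⊗ₘ π.comap (fun x : (Om × S) × O => (x.1.1, x.2)) (by fun_prop)
    ⊗ₘ M.kY.comap (fun x : ((Om × S) × O) × A => (x.1.1.2, x.1.2, x.2)) (by fun_prop)

/-- The average reward of an interventional policy. -/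
def value (M : Model Om S O A Op) (π : Kernel (Om × O) A) : ℝ := ∫ x, x.2 ∂(inLaw M π)

/-- The sub-optimality of `π` relative to the policy class `Pol`. -/
def subOpt (M : Model Om S O A Op) (Pol : Set (Kernel (Om × O) A)) (π : Kernel (Om × O) A) : ℝ :=
  sSup (value M '' Pol) - value M π

/-- The reward is almost surely bounded by `L`. -/
def RewardBounded (M : Model Om S O A Op) (L : ℝ) : Prop :=
  ∀ x, ∀ᵐ y ∂(M.kY x), |y| ≤ L

/-! ### The four moment equations -/

/-- The missingness pattern under which the `k`-th moment equation is stated. -/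
def pattern : Fin 4 → Set (Trial Om S O A Op)
  | 0 => {t | seenPreObs t = true ∧ seenNextObs t = true}
  | 1 => {t | seenObs t = true ∧ seenPreObs t = true ∧ seenNextObs t = true}
  | 2 => {t | seenObs t = true ∧ seenPreObs t = true}
  | 3 => {t | seenPreObs t = true}

/-- The observational law conditioned on the `k`-th missingness pattern. -/
def condLaw (M : Model Om S O A Op) (k : Fin 4) : Measure (Trial Om S O A Op) :=
  ProbabilityTheory.cond (obLaw M) (pattern k)

/-- The sigma-algebra generated by the variables conditioned on in the `k`-th moment equation. -/
@[reducible] def sigmaZ (k : Fin 4) : MeasurableSpace (Trial Om S O A Op) :=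
  match k with
  | 0 => MeasurableSpace.comap (fun t => (act t, preObs t, nextObs t)) inferInstance
  | 1 => MeasurableSpace.comap (fun t => (act t, obs t, preObs t, nextObs t)) inferInstance
  | 2 => MeasurableSpace.comap (fun t => (act t, obs t, preObs t)) inferInstance
  | 3 => MeasurableSpace.comap (fun t => preObs t) inferInstance

/-- A tuple of candidate bridge functions. -/
structure Bridge (Om O A Op : Type*) where
  h₁ : ℝ × A × Om × Op → ℝ
  h₂ : A × O × Om → ℝ
  h₃ : ℝ × A × Om → ℝ
  g : Om → ℝ

/-- The integrand of the `k`-th moment equation for the policy `π`. -/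
def alpha [Fintype A] (π : Kernel (Om × O) A) (h : Bridge Om O A Op) (k : Fin 4)
    (t : Trial Om S O A Op) : ℝ :=
  match k with
  | 0 => h.h₁ (rew t, act t, preObs t, nextObs t)
  | 1 => h.h₂ (act t, obs t, preObs t) - h.h₁ (rew t, act t, preObs t, nextObs t)
          - rew t * (π (preObs t, obs t)).real {act t}
  | 2 => h.h₃ (rew t, act t, preObs t) - ∑ a : A, h.h₂ (a, obs t, preObs t)
  | 3 => h.g (preObs t) - h.h₃ (rew t, act t, preObs t)

/-- `h` solves the integral equation system of the policy `π`: each `alpha π h k` has zero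
conditional expectation. -/
def IsSolution [Fintype A] (M : Model Om S O A Op) (π : Kernel (Om × O) A)
    (h : Bridge Om O A Op) : Prop :=
  ∀ k, Integrable (alpha (S := S) π h k) (condLaw M k) ∧
    (condLaw M k)[alpha (S := S) π h k | sigmaZ k] =ᵐ[condLaw M k] 0

end Laws

/-! ### Linear classes -/

/-- Dimensions, radii of the parameter balls, and the reward bound. -/
structure Constants where
  (m₀ m₁ m₂ m₃ m₄ d₁ d₂ d₃ : ℕ)
  (C₀ C₁ C₂ C₃ C₄ : ℝ)
  /-- radii of the four dual balls -/
  D : Fin 4 → ℝ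
  LY : ℝ

/-- Frobenius norm. -/
def frob {p q : ℕ} (W : Matrix (Fin p) (Fin q) ℝ) : ℝ := √(∑ i, ∑ j, W i j ^ 2)

/-- Feature maps (measurable, of Euclidean norm at most one) and coefficient matrices. -/
structure Features (c : Constants) (Om O A Op : Type*) [MeasurableSpace Om] [MeasurableSpace O]
    [MeasurableSpace A] [MeasurableSpace Op] where
  φ₀ : A × O × Om → EuclideanSpace ℝ (Fin c.m₀)
  φ₁ : ℝ × A × Om × Op → EuclideanSpace ℝ (Fin c.m₁)
  φ₂ : A × O × Om → EuclideanSpace ℝ (Fin c.m₂)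
  φ₃ : ℝ × A × Om → EuclideanSpace ℝ (Fin c.m₃)
  ψ₁ : A × Om × Op → EuclideanSpace ℝ (Fin c.d₁)
  ψ₂ : A × O × Om × Op → EuclideanSpace ℝ (Fin c.d₂)
  ψ₃ : A × O × Om → EuclideanSpace ℝ (Fin c.d₃)
  ψ₄ : Om → EuclideanSpace ℝ (Fin c.m₄)
  W₁ : Matrix (Fin c.m₁) (Fin c.d₁) ℝ
  W₂ : Matrix (Fin c.m₁) (Fin c.d₂) ℝ
  W₃ : Matrix (Fin c.m₂) (Fin c.d₂) ℝ
  W₄ : Matrix (Fin c.m₂) (Fin c.d₃) ℝ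
  W₅ : Matrix (Fin c.m₃) (Fin c.d₃) ℝ
  W₆ : Matrix (Fin c.m₃) (Fin c.m₄) ℝ
  meas_φ₀ : Measurable φ₀
  meas_φ₁ : Measurable φ₁
  meas_φ₂ : Measurable φ₂
  meas_φ₃ : Measurable φ₃
  meas_ψ₁ : Measurable ψ₁
  meas_ψ₂ : Measurable ψ₂
  meas_ψ₃ : Measurable ψ₃
  meas_ψ₄ : Measurable ψ₄
  norm_φ₀ : ∀ x, ‖φ₀ x‖ ≤ 1
  norm_φ₁ : ∀ x, ‖φ₁ x‖ ≤ 1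
  norm_φ₂ : ∀ x, ‖φ₂ x‖ ≤ 1
  norm_φ₃ : ∀ x, ‖φ₃ x‖ ≤ 1
  norm_ψ₁ : ∀ x, ‖ψ₁ x‖ ≤ 1
  norm_ψ₂ : ∀ x, ‖ψ₂ x‖ ≤ 1
  norm_ψ₃ : ∀ x, ‖ψ₃ x‖ ≤ 1
  norm_ψ₄ : ∀ x, ‖ψ₄ x‖ ≤ 1

/-- The bounded linear class with feature map `φ` and radius `C`. -/
def linClass {X : Type*} {d : ℕ} (φ : X → EuclideanSpace ℝ (Fin d)) (C : ℝ) : Set (X → ℝ) :=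
  {f | ∃ w : EuclideanSpace ℝ (Fin d), ‖w‖ ≤ C ∧ f = fun x => inner ℝ w (φ x)}

section Classes

variable {Om S O A Op : Type*} [MeasurableSpace Om] [MeasurableSpace S] [MeasurableSpace O]
  [MeasurableSpace A] [MeasurableSpace Op] {c : Constants}

/-- Softmax-linear policies with parameter in the ball of radius `C₀`. -/
def softmaxClass [Fintype A] (Φ : Features c Om O A Op) : Set (Kernel (Om × O) A) :=
  {π | ∃ w : EuclideanSpace ℝ (Fin c.m₀), ‖w‖ ≤ c.C₀ ∧ ∀ om o a,
    π (om, o) {a} = ENNReal.ofReal (Real.exp (inner ℝ w (Φ.φ₀ (a, o, om))) /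
      ∑ a' : A, Real.exp (inner ℝ w (Φ.φ₀ (a', o, om))))}

/-- The hypothesis class: the product of the four bounded linear classes. -/
def hypClass (Φ : Features c Om O A Op) : Set (Bridge Om O A Op) :=
  {h | h.h₁ ∈ linClass Φ.φ₁ c.C₁ ∧ h.h₂ ∈ linClass Φ.φ₂ c.C₂ ∧ h.h₃ ∈ linClass Φ.φ₃ c.C₃ ∧
    h.g ∈ linClass Φ.ψ₄ c.C₄}

/-- The `k`-th dual class, as functions of a trial. -/
def dualClass (Φ : Features c Om O A Op) (k : Fin 4) : Set (Trial Om S O A Op → ℝ) :=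
  match k with
  | 0 => linClass (fun t => Φ.ψ₁ (act t, preObs t, nextObs t)) (c.D 0)
  | 1 => linClass (fun t => Φ.ψ₂ (act t, obs t, preObs t, nextObs t)) (c.D 1)
  | 2 => linClass (fun t => Φ.ψ₃ (act t, obs t, preObs t)) (c.D 2)
  | 3 => linClass (fun t => Φ.ψ₄ (preObs t)) (c.D 3)

/-- The product class `{alpha * θ}`, over all policies, hypotheses and dual functions. -/
def prodClass [Fintype A] (Φ : Features c Om O A Op) (Pol : Set (Kernel (Om × O) A)) (k : Fin 4) :
    Set (Trial Om S O A Op → ℝ) :=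
  {q | ∃ π ∈ Pol, ∃ h ∈ hypClass Φ, ∃ θ ∈ dualClass (S := S) Φ k,
    q = fun t => alpha π h k t * θ t}

/-- The radii are nonnegative, the radius of the last hypothesis class is the Frobenius bound, and
the dual balls are large enough. -/
def RadiiOK (Φ : Features c Om O A Op) : Prop :=
  0 ≤ c.C₁ ∧ 0 ≤ c.C₂ ∧ 0 ≤ c.C₃ ∧ c.C₄ = c.C₃ * frob Φ.W₆ ∧
  2 * c.C₁ * frob Φ.W₁ < c.D 0 ∧
  2 * (c.C₁ * frob Φ.W₂ + c.C₂ * frob Φ.W₃) < c.D 1 ∧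
  2 * (c.C₃ * frob Φ.W₅ + c.C₂ * frob Φ.W₄) < c.D 2 ∧
  2 * (c.C₄ + c.C₃ * frob Φ.W₆) < c.D 3

/-- For each policy of the class the integral equation system has a solution whose first three
components lie in the linear classes. -/
def LinearBridgeExists [Fintype A] (M : Model Om S O A Op) (Φ : Features c Om O A Op)
    (Pol : Set (Kernel (Om × O) A)) : Prop :=
  ∀ π ∈ Pol, ∃ h : Bridge Om O A Op, IsSolution M π h ∧ Measurable h.g ∧
    h.h₁ ∈ linClass Φ.φ₁ c.C₁ ∧ h.h₂ ∈ linClass Φ.φ₂ c.C₂ ∧ h.h₃ ∈ linClass Φ.φ₃ c.C₃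

/-- Under `ν`, the conditional expectation of the vector `f` given `m` is `W` times `g`. -/
def CondExpEqLin {Ω : Type*} [MeasurableSpace Ω] {p q : ℕ} (ν : Measure Ω)
    (m : MeasurableSpace Ω) (f : Ω → EuclideanSpace ℝ (Fin p)) (W : Matrix (Fin p) (Fin q) ℝ)
    (g : Ω → EuclideanSpace ℝ (Fin q)) : Prop :=
  ∀ i, ν[fun ω => f ω i | m] =ᵐ[ν] fun ω => ∑ j, W i j * g ω j

/-- The conditional moments of the features of the bridge functions are linear in the dual
features. -/
def DualLinear [Fintype A] (M : Model Om S O A Op) (Φ : Features c Om O A Op) : Prop :=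
  let P := obLaw M
  let Pp := ProbabilityTheory.cond P {t | seenNextObs t = true}
  CondExpEqLin Pp (sigmaZ 0) (fun t => Φ.φ₁ (rew t, act t, preObs t, nextObs t)) Φ.W₁
    (fun t => Φ.ψ₁ (act t, preObs t, nextObs t)) ∧
  CondExpEqLin Pp (sigmaZ 1) (fun t => Φ.φ₁ (rew t, act t, preObs t, nextObs t)) Φ.W₂
    (fun t => Φ.ψ₂ (act t, obs t, preObs t, nextObs t)) ∧
  CondExpEqLin Pp (sigmaZ 1) (fun t => Φ.φ₂ (act t, obs t, preObs t)) Φ.W₃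
    (fun t => Φ.ψ₂ (act t, obs t, preObs t, nextObs t)) ∧
  (∀ a o om i, (∑ a' : A, Φ.φ₂ (a', o, om)) i = ∑ j, Φ.W₄ i j * Φ.ψ₃ (a, o, om) j) ∧
  CondExpEqLin P (sigmaZ 2) (fun t => Φ.φ₃ (rew t, act t, preObs t)) Φ.W₅
    (fun t => Φ.ψ₃ (act t, obs t, preObs t)) ∧
  CondExpEqLin P (sigmaZ 3) (fun t => Φ.φ₃ (rew t, act t, preObs t)) Φ.W₆
    (fun t => Φ.ψ₄ (preObs t))

/-- `L` is a uniform bound for the integrands of the moment equations (for rewards within the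
reward bound). -/
def AlphaBounded [Fintype A] (S : Type*) (Φ : Features c Om O A Op)
    (Pol : Set (Kernel (Om × O) A)) (L : ℝ) : Prop :=
  ∀ π ∈ Pol, ∀ h ∈ hypClass Φ, ∀ k, ∀ t : Trial Om S O A Op, |rew t| ≤ c.LY → |alpha π h k t| ≤ L

end Classes

/-! ### Empirical quantities and critical radius -/

section Empirical

variable {Ω ι : Type*} [Fintype ι]

/-- Empirical mean over the data `x`. -/
def empMean (x : ι → Ω) (f : Ω → ℝ) : ℝ := (∑ i, f (x i)) / Fintype.card ι

open Classical in
/-- Localized empirical Rademacher complexity of the class `F` on the data `x` at radius `η`; the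
outer sum averages over all sign vectors. -/
def locRademacher (x : ι → Ω) (F : Set (Ω → ℝ)) (η : ℝ) : ℝ :=
  (∑ ε : ι → Bool, sSup {r | ∃ f ∈ F, √(empMean x (fun ω => f ω ^ 2)) ≤ η ∧
      r = (∑ i, (if ε i then (1 : ℝ) else -1) * f (x i)) / Fintype.card ι})
    / 2 ^ Fintype.card ι

/-- `r` is a critical radius on the data `x` of the class `F`, whose members are bounded by `b`. -/
def IsCriticalRadius (x : ι → Ω) (F : Set (Ω → ℝ)) (b r : ℝ) : Prop :=
  0 < r ∧ locRademacher x F r ≤ r ^ 2 / b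

end Empirical

section Algorithm

variable {Om S O A Op : Type*} [MeasurableSpace Om] [MeasurableSpace S] [MeasurableSpace O]
  [MeasurableSpace A] [MeasurableSpace Op] {c : Constants} {T : ℕ}

open Classical in
instance instFintypeSub (D : Fin T → Trial Om S O A Op) (k : Fin 4) :
    Fintype {t : Fin T // D t ∈ pattern k} := inferInstance

/-- The part of the data set with the `k`-th missingness pattern. -/
def subData (D : Fin T → Trial Om S O A Op) (k : Fin 4) :
    {t : Fin T // D t ∈ pattern k} → Trial Om S O A Op := fun t => D t

/-- The number of trials with the `k`-th missingness pattern; the index `1` counts the trials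
without any missing value. -/
def size (D : Fin T → Trial Om S O A Op) (k : Fin 4) : ℕ :=
  Fintype.card {t : Fin T // D t ∈ pattern k}

/-- The minimax loss of `h` on the data. -/
def loss [Fintype A] (Φ : Features c Om O A Op) (D : Fin T → Trial Om S O A Op)
    (π : Kernel (Om × O) A) (h : Bridge Om O A Op) : ℝ :=
  ∑ k, sSup ((fun θ : Trial Om S O A Op → ℝ =>
    empMean (subData D k) (fun t => alpha π h k t * θ t)
      - 1 / 2 * empMean (subData D k) (fun t => θ t ^ 2)) '' dualClass Φ k)

/-- The confidence set of the policy `π` with threshold `e`. -/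
def confSet [Fintype A] (Φ : Features c Om O A Op) (D : Fin T → Trial Om S O A Op) (e : ℝ)
    (π : Kernel (Om × O) A) : Set (Om → ℝ) :=
  {g | ∃ h ∈ hypClass Φ, h.g = g ∧ loss Φ D π h ≤ sInf (loss Φ D π '' hypClass Φ) + e}

/-- The pessimistic value of the policy `π`. -/
def pessValue [Fintype A] (M : Model Om S O A Op) (Φ : Features c Om O A Op)
    (D : Fin T → Trial Om S O A Op) (e : ℝ) (π : Kernel (Om × O) A) : ℝ :=
  sInf ((fun g : Om → ℝ => ∫ om, g om ∂M.pTilde) '' confSet Φ D e π)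

/-- `π` is a pessimistic policy: it maximizes the pessimistic value over the class. -/
def IsPessimistic [Fintype A] (M : Model Om S O A Op) (Φ : Features c Om O A Op)
    (Pol : Set (Kernel (Om × O) A)) (D : Fin T → Trial Om S O A Op) (e : ℝ)
    (π : Kernel (Om × O) A) : Prop :=
  π ∈ Pol ∧ ∀ π' ∈ Pol, pessValue M Φ D e π' ≤ pessValue M Φ D e π

/-- A uniform bound, at least one, of the product class and of the dual class. -/
def classBound (c : Constants) (L : ℝ) (k : Fin 4) : ℝ := max 1 L * max 1 (c.D k)

/-- `η k` bounds, at confidence level `ξ` and up to the factor `c₀`, the critical radii of the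
product class and of the dual class on the data with the `k`-th missingness pattern. -/
def BoundsCriticalRadii [Fintype A] (c₀ ξ L : ℝ) (Φ : Features c Om O A Op)
    (Pol : Set (Kernel (Om × O) A)) (D : Fin T → Trial Om S O A Op) (η : Fin 4 → ℝ) : Prop :=
  ∀ k, ∃ r, IsCriticalRadius (subData D k) (prodClass Φ Pol k) (classBound c L k) r ∧
    IsCriticalRadius (subData D k) (dualClass Φ k) (classBound c L k) r ∧
    c₀ * (r + classBound c L k * √(Real.log (1 / ξ) / size D k)) ≤ η k

end Algorithm

/-! ### Distribution shift -/

section Shift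

variable {Om S O A Op : Type*} [MeasurableSpace Om] [MeasurableSpace S] [MeasurableSpace O]
  [MeasurableSpace A] [MeasurableSpace Op]

/-- The measure with density `p(s | om) * pTilde(om)` in `(om, s, a)`, the actions carrying the
counting measure. -/
def shiftNum₁ (M : Model Om S O A Op) : Measure ((Om × S) × A) :=
  (M.pTilde ⊗ₘ M.kS).prod Measure.count

/-- The law with density `p(s, om, a | pattern 0)`. -/
def shiftDen₁ (M : Model Om S O A Op) : Measure ((Om × S) × A) :=
  (condLaw M 0).map (fun t => ((preObs t, state t), act t))

/-- `b` is a shift function: its conditional expectation given pre-observation, state and action is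
the density ratio of `shiftNum₁` and `shiftDen₁`. -/
def IsShift (M : Model Om S O A Op) (b : Om × A × Op → ℝ) : Prop :=
  Measurable b ∧ shiftNum₁ M ≪ shiftDen₁ M ∧
  Integrable (fun t => b (preObs t, act t, nextObs t)) (condLaw M 0) ∧
  (condLaw M 0)[fun t => b (preObs t, act t, nextObs t) |
      MeasurableSpace.comap (fun t => ((preObs t, state t), act t)) inferInstance]
    =ᵐ[condLaw M 0]
      fun t => ((shiftNum₁ M).rnDeriv (shiftDen₁ M) ((preObs t, state t), act t)).toReal

/-- The law of (action, observation, pre-observation) given the `k`-th missingness pattern. -/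
def lawAOOm (M : Model Om S O A Op) (k : Fin 4) : Measure (A × O × Om) :=
  (condLaw M k).map (fun t => (act t, obs t, preObs t))

/-- The measure with density `pTilde(om) * p(a, o | om)`.  The missingness of the pre-observation
is caused by the pre-observation alone, so conditioning `p(a, o | om)` on it changes nothing. -/
def shiftNum₃ (M : Model Om S O A Op) : Measure (A × O × Om) :=
  (M.pTilde ⊗ₘ ((M.piOb ×ₖ M.kO) ∘ₖ M.kS)).map (fun x => (x.2.1, x.2.2, x.1))

/-- The law of the pre-observation given that it is recorded. -/
def lawOm (M : Model Om S O A Op) : Measure Om := (condLaw M 3).map preObs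

/-- The density ratios defining the second, third and fourth weights exist. -/
def RatiosExist (M : Model Om S O A Op) : Prop :=
  lawAOOm M 0 ≪ lawAOOm M 1 ∧ shiftNum₃ M ≪ lawAOOm M 2 ∧ M.pTilde ≪ lawOm M

/-- The four weights attached to the shift function `b`. -/
def weight (M : Model Om S O A Op) (b : Om × A × Op → ℝ) (k : Fin 4) (t : Trial Om S O A Op) : ℝ :=
  match k with
  | 0 => b (preObs t, act t, nextObs t)
  | 1 => b (preObs t, act t, nextObs t) *
      ((lawAOOm M 0).rnDeriv (lawAOOm M 1) (act t, obs t, preObs t)).toReal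
  | 2 => ((shiftNum₃ M).rnDeriv (lawAOOm M 2) (act t, obs t, preObs t)).toReal
  | 3 => (M.pTilde.rnDeriv (lawOm M) (preObs t)).toReal

end Shift

end LinPOMDP

end

noncomputable section

set_option linter.unusedSectionVars false

namespace LinPOMDP

/-! ### Averages over sign vectors -/

/-! The regret bound rests on an exact identity and a duality.

Identity (`sum_integral_alpha_mul_weight`): for every `h` in the hypothesis class, solution or not,
the weighted moments `∑ E_{μ_k}[α_k(h) b_k]` equal `∫ g dp̃ - v^π`. Once the missingness indicators
are integrated out, the weights give the first two moments one common density and the last two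
another, so `h₁` and `h₃` telescope. Given `(O⁻,S,A)`, the pair `(O,Y)` is independent of the next
step, so `b₁` may be replaced by its conditional mean, a density ratio that turns the law into the
interventional one. There the two remaining `h₂` terms cancel.

Duality (`exists_bridge_moments`): linearity of the conditional feature moments makes `E[α_k(h) |
Z_k]` a member `f_k` of the dual class, and some bridge in the class has all `f_k = 0`.
Cauchy-Schwarz then bounds the error of `g` by `∑ ‖f_k‖ ‖b_k‖`. Testing the loss with `f_k / 2`
bounds `‖f_k‖²` by the loss plus `O(η²)`, while the exact bridge has loss `O(η²)`. So each
confidence set contains a function with the exact value and all its members err by `O(√e)`; the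
usual chain value, pessimistic value, pessimistic value of the maximizer, value of the maximizer
gives the regret.

The deviations must hold simultaneously for all critical radii computed on the data. The bridge is a
self-normalized symmetrization (`lintegral_pair_ratio_le`): the exponential of the offset difference
of two samples, divided by the product of their empirical Rademacher exponential moments, has mean
at most one. Averaging the second sample over an event of not too small probability turns this into
a bound for one sample (`measure_devOff_le`). The empirical exponential moment is bounded from a
critical radius by peeling over Euclidean norms, each shell being handled by concentration of convex
Lipschitz functions of signs (from Maurey's infimum-convolution inequality); contraction passes to
squares. Given which trials show a pattern, these trials are i.i.d. from the conditional law, which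
transfers everything to the subsamples.

For the rate, a grid of side `1/n` in the finite-dimensional parameter space and Massart's bound
give a critical radius of order `|A| √(log n / n)`. Every subsample contains the complete trials,
and `log n / n` is decreasing up to a factor `3`. -/

/-- The sign encoded by a Boolean. -/
def sgn (b : Bool) : ℝ := if b then 1 else -1

theorem sgn_sq (b : Bool) : sgn b ^ 2 = 1 := by cases b <;> simp [sgn]

theorem abs_sgn (b : Bool) : |sgn b| = 1 := by cases b <;> simp [sgn]

theorem sgn_not (b : Bool) : sgn (!b) = -sgn b := by cases b <;> simp [sgn]

theorem sum_fin_succ_bool {n : ℕ} {R : Type*} [AddCommMonoid R] (F : (Fin (n + 1) → Bool) → R) :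
    ∑ ε, F ε = ∑ b : Bool, ∑ ε : Fin n → Bool, F (Fin.cons b ε) := by
  rw [← Fintype.sum_prod_type']
  exact (Fintype.sum_equiv (Fin.consEquiv (fun _ : Fin (n + 1) => Bool)) _ _ (fun x => rfl)).symm

/-! ### Infimum convolution on the discrete cube -/

theorem exp_neg_le_quadratic {x : ℝ} (hx : 0 ≤ x) : Real.exp (-x) ≤ 1 - x + x ^ 2 / 2 := by
  rw [Real.exp_neg]
  have h := Real.quadratic_le_exp_of_nonneg hx
  rw [inv_le_comm₀ (Real.exp_pos _) (by nlinarith [sq_nonneg (x - 1)])]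
  refine le_trans ?_ h
  rw [inv_le_iff_one_le_mul₀ (by nlinarith [sq_nonneg (x - 1)])]
  nlinarith [sq_nonneg (x ^ 2)]

theorem exp_le_quadratic {x : ℝ} (hx : |x| ≤ 1) : Real.exp x ≤ 1 + x + x ^ 2 := by
  have := Real.abs_exp_sub_one_sub_id_le hx
  linarith [le_abs_self (Real.exp x - 1 - x)]

/-- Scalar core of the induction on the dimension. Here `u` is the logarithmic ratio of the masses
of the two slices, `θ` the fraction by which the poorer slice moves towards the richer one, and `θ²
/ 4 = (2θ)² / 16` the price of that move. The choice is `θ = min u 1`: for small `u` the left side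
is `4 - u² / 2` to second order. -/
theorem two_point_inequality {u : ℝ} (hu : 0 ≤ u) : ∃ θ : ℝ, 0 ≤ θ ∧ θ ≤ 1 ∧
    (Real.exp (-u) + Real.exp (-θ * u + θ ^ 2 / 4)) * (1 + Real.exp u) ≤ 4 := by
  rcases le_total u 1 with h | h
  · refine ⟨u, hu, h, ?_⟩
    have e : (Real.exp (-u) + Real.exp (-u * u + u ^ 2 / 4)) * (1 + Real.exp u)
        = 1 + Real.exp (-u) + Real.exp (u - 3 / 4 * u ^ 2) + Real.exp (-(3 / 4 * u ^ 2)) := by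
      have h1 : Real.exp (-u) * Real.exp u = 1 := by rw [← Real.exp_add]; simp
      have h2 : Real.exp (-u * u + u ^ 2 / 4) * Real.exp u = Real.exp (u - 3 / 4 * u ^ 2) := by
        rw [← Real.exp_add]; ring_nf
      have h3 : Real.exp (-u * u + u ^ 2 / 4) = Real.exp (-(3 / 4 * u ^ 2)) := by ring_nf
      linear_combination h1 + h2 + h3
    rw [e]
    have h1 := exp_neg_le_quadratic hu
    have h2 := exp_neg_le_quadratic (x := 3 / 4 * u ^ 2) (by positivity)
    have h3 := exp_le_quadratic (x := u - 3 / 4 * u ^ 2)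
      (abs_le.2 ⟨by nlinarith, by nlinarith⟩)
    have : u ^ 3 ≥ u ^ 4 := by nlinarith [pow_nonneg hu 3]
    nlinarith [pow_nonneg hu 3, pow_nonneg hu 4]
  · refine ⟨1, zero_le_one, le_rfl, ?_⟩
    have e : (Real.exp (-u) + Real.exp (-1 * u + 1 ^ 2 / 4)) * (1 + Real.exp u)
        = (1 + Real.exp (1 / 4)) * (1 + Real.exp (-u)) := by
      have h1 : Real.exp (-u) * Real.exp u = 1 := by rw [← Real.exp_add]; simp
      have h2 : Real.exp (-1 * u + 1 ^ 2 / 4) = Real.exp (1 / 4) * Real.exp (-u) := by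
        rw [← Real.exp_add]; ring_nf
      rw [h2]; linear_combination (1 + Real.exp (1 / 4)) * h1
    rw [e]
    have h1 : Real.exp (-u) ≤ 1 / 2 := by
      have := exp_neg_le_quadratic (x := 1) (by norm_num)
      have h2 : Real.exp (-u) ≤ Real.exp (-1) := Real.exp_le_exp.2 (by linarith)
      linarith
    have h2 := exp_le_quadratic (x := 1 / 4) (by rw [abs_of_pos] <;> norm_num)
    nlinarith [Real.exp_pos (-u), Real.exp_pos (1 / 4)]

/-- Convexity of log-sum-exp, that is, Hölder's inequality. Convexity of `exp` after normalizing
both sums covers the endpoints `θ = 0, 1` as well. -/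
theorem sum_exp_convex_comb_le {κ : Type*} [Fintype κ] [Nonempty κ] (P R : κ → ℝ) {θ : ℝ}
    (h0 : 0 ≤ θ) (h1 : θ ≤ 1) :
    ∑ k, Real.exp ((1 - θ) * P k + θ * R k) ≤
      Real.exp ((1 - θ) * Real.log (∑ k, Real.exp (P k)) + θ * Real.log (∑ k, Real.exp (R k))) := by
  set p := Real.log (∑ k, Real.exp (P k)) with hp
  set r := Real.log (∑ k, Real.exp (R k)) with hr
  have hP : Real.exp p = ∑ k, Real.exp (P k) := Real.exp_log (by positivity)
  have hR : Real.exp r = ∑ k, Real.exp (R k) := Real.exp_log (by positivity)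
  have key : ∀ k, Real.exp ((1 - θ) * P k + θ * R k) ≤
      Real.exp ((1 - θ) * p + θ * r) *
        ((1 - θ) * (Real.exp (P k) / Real.exp p) + θ * (Real.exp (R k) / Real.exp r)) := by
    intro k
    have h := convexOn_exp.2 (Set.mem_univ (P k - p)) (Set.mem_univ (R k - r))
      (sub_nonneg.2 h1) h0 (by ring)
    simp only [smul_eq_mul, Real.exp_sub] at h
    refine le_trans (le_of_eq ?_) (mul_le_mul_of_nonneg_left h (Real.exp_pos _).le)
    rw [← Real.exp_add]; ring_nf
  refine (Finset.sum_le_sum fun k _ => key k).trans (le_of_eq ?_)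
  rw [← Finset.mul_sum, Finset.sum_add_distrib, ← Finset.mul_sum, ← Finset.mul_sum,
    ← Finset.sum_div, ← Finset.sum_div, ← hP, ← hR, div_self (Real.exp_pos _).ne',
    div_self (Real.exp_pos _).ne']
  ring

/-- Infimum convolution with a quadratic. -/
def infConv {n : ℕ} (f : (Fin n → ℝ) → ℝ) (x : Fin n → ℝ) : ℝ :=
  ⨅ y : Fin n → ℝ, f y + (∑ i, (x i - y i) ^ 2) / 16

theorem infConv_bdd {n : ℕ} {f : (Fin n → ℝ) → ℝ} (h0 : ∀ y, 0 ≤ f y) (x : Fin n → ℝ) :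
    BddBelow (Set.range fun y : Fin n → ℝ => f y + (∑ i, (x i - y i) ^ 2) / 16) :=
  ⟨0, by
    rintro _ ⟨y, rfl⟩
    have : 0 ≤ ∑ i, (x i - y i) ^ 2 := Finset.sum_nonneg fun i _ => sq_nonneg _
    have := h0 y
    simp only; positivity⟩

/-- Test the infimum with the convex combination of near-minimizers of the two slices. Convexity of
`f` and of the square handles the last `n` coordinates; the first is displaced by `θ (a - b)`, which
costs at most `4 θ² / 16`. -/
theorem infConv_cons_le {n : ℕ} {f : (Fin (n + 1) → ℝ) → ℝ} (hf : ConvexOn ℝ Set.univ f)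
    (h0 : ∀ y, 0 ≤ f y) (a b : ℝ) (hab : (a - b) ^ 2 ≤ 4) (x : Fin n → ℝ) {θ : ℝ} (hθ0 : 0 ≤ θ)
    (hθ1 : θ ≤ 1) :
    infConv f (Fin.cons a x) ≤ (1 - θ) * infConv (fun y => f (Fin.cons a y)) x
      + θ * infConv (fun y => f (Fin.cons b y)) x + θ ^ 2 / 4 := by
  refine le_of_forall_pos_le_add fun δ hδ => ?_
  obtain ⟨y, hy⟩ := exists_lt_of_ciInf_lt (lt_add_of_pos_right
    (infConv (fun y => f (Fin.cons a y)) x) hδ)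
  obtain ⟨z, hz⟩ := exists_lt_of_ciInf_lt (lt_add_of_pos_right
    (infConv (fun y => f (Fin.cons b y)) x) hδ)
  have hc := hf.2 (Set.mem_univ (Fin.cons a y : Fin (n + 1) → ℝ))
    (Set.mem_univ (Fin.cons b z : Fin (n + 1) → ℝ)) (sub_nonneg.2 hθ1) hθ0 (by ring)
  have hle := ciInf_le (infConv_bdd h0 (Fin.cons a x : Fin (n + 1) → ℝ))
    ((1 - θ) • (Fin.cons a y : Fin (n + 1) → ℝ) + θ • (Fin.cons b z : Fin (n + 1) → ℝ))
  refine hle.trans ?_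
  rw [Fin.sum_univ_succ]
  simp only [Pi.add_apply, Pi.smul_apply, Fin.cons_zero, Fin.cons_succ, smul_eq_mul] at hc ⊢
  have hs : ∑ i, (x i - ((1 - θ) * y i + θ * z i)) ^ 2 ≤
      (1 - θ) * ∑ i, (x i - y i) ^ 2 + θ * ∑ i, (x i - z i) ^ 2 := by
    rw [Finset.mul_sum, Finset.mul_sum, ← Finset.sum_add_distrib]
    refine Finset.sum_le_sum fun i _ => ?_
    nlinarith [mul_nonneg (mul_nonneg hθ0 (sub_nonneg.2 hθ1)) (sq_nonneg (y i - z i))]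
  have hq : (a - ((1 - θ) * a + θ * b)) ^ 2 ≤ 4 * θ ^ 2 := by
    have : (a - ((1 - θ) * a + θ * b)) ^ 2 = θ ^ 2 * (a - b) ^ 2 := by ring
    rw [this]; nlinarith [sq_nonneg θ]
  nlinarith [mul_le_mul_of_nonneg_left hy.le (sub_nonneg.2 hθ1),
    mul_le_mul_of_nonneg_left hz.le hθ0]

theorem sgn_sub_sq_le (b b' : Bool) : (sgn b - sgn b') ^ 2 ≤ 4 := by
  cases b <;> cases b' <;> norm_num [sgn]

/-- Maurey's infimum-convolution inequality for convex functions on the discrete cube. -/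
theorem infConv_inequality {n : ℕ} {f : (Fin n → ℝ) → ℝ} (hf : ConvexOn ℝ Set.univ f)
    (h0 : ∀ y, 0 ≤ f y) :
    (∑ ε : Fin n → Bool, Real.exp (infConv f (fun i => sgn (ε i)))) *
      (∑ ε : Fin n → Bool, Real.exp (-f (fun i => sgn (ε i)))) ≤ 4 ^ n := by
  induction n with
  | zero =>
    rw [Fintype.sum_unique, Fintype.sum_unique, pow_zero, ← Real.exp_add, Real.exp_le_one_iff]
    rw [← sub_eq_add_neg, sub_nonpos]
    refine (ciInf_le (infConv_bdd h0 _) (fun i => i.elim0)).trans (le_of_eq ?_)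
    simp only [Finset.univ_eq_empty, Finset.sum_empty, zero_div, add_zero]
    exact congrArg f (Subsingleton.elim _ _)
  | succ n ih =>
    have hcons : ∀ (b : Bool) (ε : Fin n → Bool), (fun i => sgn ((Fin.cons b ε : Fin (n+1) → Bool) i))
        = (Fin.cons (sgn b) (fun i => sgn (ε i)) : Fin (n + 1) → ℝ) := by
      intro b ε; funext i; refine Fin.cases ?_ (fun j => ?_) i <;> simp
    have hconv : ∀ b : Bool, ConvexOn ℝ Set.univ (fun y : Fin n → ℝ => f (Fin.cons (sgn b) y)) := by
      intro b
      refine ⟨convex_univ, fun x _ y _ s t hs ht hst => ?_⟩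
      have := hf.2 (Set.mem_univ (Fin.cons (sgn b) x : Fin (n + 1) → ℝ))
        (Set.mem_univ (Fin.cons (sgn b) y : Fin (n + 1) → ℝ)) hs ht hst
      convert this using 2
      funext i
      refine Fin.cases ?_ (fun j => ?_) i
      · simp [← add_mul, hst]
      · simp
    set A : Bool → ℝ := fun b => Real.log (∑ ε : Fin n → Bool,
      Real.exp (-f (Fin.cons (sgn b) (fun i => sgn (ε i))))) with hA
    set Q : Bool → ℝ := fun b => Real.log (∑ ε : Fin n → Bool,
      Real.exp (infConv (fun y => f (Fin.cons (sgn b) y)) (fun i => sgn (ε i)))) with hQ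
    have hAe : ∀ b, Real.exp (A b) = ∑ ε : Fin n → Bool,
      Real.exp (-f (Fin.cons (sgn b) (fun i => sgn (ε i)))) := fun b =>
        Real.exp_log (by positivity)
    have hQe : ∀ b, Real.exp (Q b) = ∑ ε : Fin n → Bool,
      Real.exp (infConv (fun y => f (Fin.cons (sgn b) y)) (fun i => sgn (ε i))) := fun b =>
        Real.exp_log (by positivity)
    have hQA : ∀ b, Q b ≤ n * Real.log 4 - A b := by
      intro b
      have := ih (hconv b) (fun y => h0 _)
      rw [← hQe, ← hAe, ← Real.exp_add] at this
      have h4 : (4 : ℝ) ^ n = Real.exp (n * Real.log 4) := by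
        rw [mul_comm, Real.exp_mul, Real.exp_log (by norm_num), Real.rpow_natCast]
      rw [h4, Real.exp_le_exp] at this
      linarith
    -- Slice comparison, Hölder, and the induction hypothesis in the form `Q ≤ n log 4 - A`; `θ`
    -- stays free.
    have hS : ∀ (b : Bool) (θ : ℝ), 0 ≤ θ → θ ≤ 1 →
        ∑ ε : Fin n → Bool, Real.exp (infConv f (Fin.cons (sgn b) (fun i => sgn (ε i)))) ≤
          4 ^ n * Real.exp (-A b + θ * (A b - A (!b)) + θ ^ 2 / 4) := by
      intro b θ hθ0 hθ1
      calc ∑ ε : Fin n → Bool, Real.exp (infConv f (Fin.cons (sgn b) (fun i => sgn (ε i))))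
          ≤ ∑ ε : Fin n → Bool, Real.exp ((1 - θ) *
              infConv (fun y => f (Fin.cons (sgn b) y)) (fun i => sgn (ε i))
              + θ * infConv (fun y => f (Fin.cons (sgn (!b)) y)) (fun i => sgn (ε i))) *
              Real.exp (θ ^ 2 / 4) := by
            refine Finset.sum_le_sum fun ε _ => ?_
            rw [← Real.exp_add, Real.exp_le_exp]
            exact infConv_cons_le hf h0 _ _ (sgn_sub_sq_le _ _) _ hθ0 hθ1
        _ ≤ Real.exp ((1 - θ) * Q b + θ * Q (!b)) * Real.exp (θ ^ 2 / 4) := by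
            rw [← Finset.sum_mul]
            exact mul_le_mul_of_nonneg_right (sum_exp_convex_comb_le _ _ hθ0 hθ1)
              (Real.exp_pos _).le
        _ ≤ 4 ^ n * Real.exp (-A b + θ * (A b - A (!b)) + θ ^ 2 / 4) := by
            have h4 : (4 : ℝ) ^ n = Real.exp (n * Real.log 4) := by
              rw [mul_comm, Real.exp_mul, Real.exp_log (by norm_num), Real.rpow_natCast]
            rw [h4, ← Real.exp_add, ← Real.exp_add, Real.exp_le_exp]
            nlinarith [mul_le_mul_of_nonneg_left (hQA b) (sub_nonneg.2 hθ1),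
              mul_le_mul_of_nonneg_left (hQA (!b)) hθ0]
    -- On the slice `b` of larger mass take `θ = 0`; the other slice borrows from it with the `θ` of
    -- the two-point inequality at `u = A b - A (!b)`.
    have main : ∀ b : Bool, A (!b) ≤ A b →
        (∑ ε : Fin n → Bool, Real.exp (infConv f (Fin.cons (sgn b) (fun i => sgn (ε i)))) +
         ∑ ε : Fin n → Bool, Real.exp (infConv f (Fin.cons (sgn (!b)) (fun i => sgn (ε i))))) *
        (Real.exp (A b) + Real.exp (A (!b))) ≤ 4 ^ (n + 1) := by
      intro b hb
      obtain ⟨θ, hθ0, hθ1, hθ⟩ := two_point_inequality (sub_nonneg.2 hb)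
      have h1 := hS b 0 le_rfl zero_le_one
      have h2 := hS (!b) θ hθ0 hθ1
      rw [Bool.not_not] at h2
      have e1 : Real.exp (-A b + 0 * (A b - A (!b)) + 0 ^ 2 / 4)
          = Real.exp (-A (!b)) * Real.exp (-(A b - A (!b))) := by
        rw [← Real.exp_add]; ring_nf
      have e2 : Real.exp (-A (!b) + θ * (A (!b) - A b) + θ ^ 2 / 4)
          = Real.exp (-A (!b)) * Real.exp (-θ * (A b - A (!b)) + θ ^ 2 / 4) := by
        rw [← Real.exp_add]; ring_nf
      have e3 : Real.exp (A b) = Real.exp (A (!b)) * Real.exp (A b - A (!b)) := by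
        rw [← Real.exp_add]; ring_nf
      have e4 : Real.exp (-A (!b)) * Real.exp (A (!b)) = 1 := by
        rw [← Real.exp_add]; simp
      rw [e1] at h1
      rw [e2] at h2
      calc _ ≤ (4 ^ n * (Real.exp (-A (!b)) * Real.exp (-(A b - A (!b)))) +
            4 ^ n * (Real.exp (-A (!b)) * Real.exp (-θ * (A b - A (!b)) + θ ^ 2 / 4))) *
            (Real.exp (A b) + Real.exp (A (!b))) :=
              mul_le_mul_of_nonneg_right (add_le_add h1 h2) (by positivity)
        _ = 4 ^ n * (Real.exp (-A (!b)) * Real.exp (A (!b))) *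
            ((Real.exp (-(A b - A (!b))) + Real.exp (-θ * (A b - A (!b)) + θ ^ 2 / 4)) *
              (1 + Real.exp (A b - A (!b)))) := by rw [e3]; ring
        _ ≤ 4 ^ n * 1 * 4 := by
              rw [e4]; exact mul_le_mul_of_nonneg_left hθ (by positivity)
        _ = _ := by ring
    rw [sum_fin_succ_bool, sum_fin_succ_bool]
    simp only [hcons, Fintype.sum_bool, ← hAe]
    rcases le_total (A false) (A true) with h | h
    · exact main true h
    · have := main false h
      simp only [Bool.not_false] at this
      linarith

/-! ### Averages over signs and concentration of convex Lipschitz functions -/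

open Classical in
/-- Average over sign vectors. -/
def signAvg {ι : Type*} [Fintype ι] (F : (ι → Bool) → ℝ) : ℝ :=
  (∑ ε : ι → Bool, F ε) / 2 ^ Fintype.card ι

section SignAvg

variable {ι : Type*} [Fintype ι]

theorem signAvg_mono {F G : (ι → Bool) → ℝ} (h : ∀ ε, F ε ≤ G ε) : signAvg F ≤ signAvg G :=
  div_le_div_of_nonneg_right (Finset.sum_le_sum fun ε _ => h ε) (by positivity)

theorem signAvg_const (a : ℝ) : signAvg (fun _ : ι → Bool => a) = a := by
  classical
  simp only [signAvg, Finset.sum_const, nsmul_eq_mul]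
  have : ((Finset.univ : Finset (ι → Bool)).card : ℝ) = 2 ^ Fintype.card ι := by
    simp
  rw [show ((@Finset.univ (ι → Bool) _).card : ℝ) = 2 ^ Fintype.card ι by
    rw [← this]]
  field_simp

theorem signAvg_add (F G : (ι → Bool) → ℝ) :
    signAvg (fun ε => F ε + G ε) = signAvg F + signAvg G := by
  simp only [signAvg, Finset.sum_add_distrib, add_div]

theorem signAvg_const_mul (a : ℝ) (F : (ι → Bool) → ℝ) :
    signAvg (fun ε => a * F ε) = a * signAvg F := by
  simp only [signAvg, ← Finset.mul_sum, mul_div_assoc]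

theorem signAvg_finsetSum {κ : Type*} (s : Finset κ) (F : κ → (ι → Bool) → ℝ) :
    signAvg (fun ε => ∑ k ∈ s, F k ε) = ∑ k ∈ s, signAvg (F k) := by
  simp only [signAvg, Finset.sum_comm (t := s), Finset.sum_div]

theorem signAvg_nonneg {F : (ι → Bool) → ℝ} (h : ∀ ε, 0 ≤ F ε) : 0 ≤ signAvg F :=
  div_nonneg (Finset.sum_nonneg fun ε _ => h ε) (by positivity)

theorem signAvg_comp_equiv (e : (ι → Bool) ≃ (ι → Bool)) (F : (ι → Bool) → ℝ) :
    signAvg (fun ε => F (e ε)) = signAvg F := by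
  classical
  simp only [signAvg]
  congr 1
  exact Fintype.sum_equiv e _ _ (fun x => rfl)

theorem signAvg_reindex {κ : Type*} [Fintype κ] (e : ι ≃ κ) (F : (κ → Bool) → ℝ) :
    signAvg (fun ε : ι → Bool => F (fun k => ε (e.symm k))) = signAvg F := by
  classical
  simp only [signAvg, Fintype.card_congr e]
  congr 1
  exact Fintype.sum_equiv (Equiv.arrowCongr e (Equiv.refl Bool)) _ _ (fun x => rfl)

theorem signAvg_fin {n : ℕ} (F : (Fin n → Bool) → ℝ) : signAvg F = (∑ ε, F ε) / 2 ^ n := by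
  simp only [signAvg, Fintype.card_fin]
  congr!

theorem exp_signAvg_le (F : (ι → Bool) → ℝ) :
    Real.exp (signAvg F) ≤ signAvg (fun ε => Real.exp (F ε)) := by
  have h : ∀ ε, Real.exp (signAvg F) * (F ε - signAvg F) + Real.exp (signAvg F) ≤
      Real.exp (F ε) := by
    intro ε
    have := Real.add_one_le_exp (F ε - signAvg F)
    calc _ = Real.exp (signAvg F) * (F ε - signAvg F + 1) := by ring
      _ ≤ Real.exp (signAvg F) * Real.exp (F ε - signAvg F) := by gcongr
      _ = _ := by rw [← Real.exp_add]; ring_nf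
  refine le_trans (le_of_eq ?_) (signAvg_mono h)
  simp only [sub_eq_add_neg, signAvg_add, signAvg_const, signAvg_const_mul]
  ring

theorem signAvg_fin_succ {n : ℕ} (F : (Fin (n + 1) → Bool) → ℝ) :
    signAvg F = signAvg (fun ε : Fin n → Bool =>
      (F (Fin.cons true ε) + F (Fin.cons false ε)) / 2) := by
  simp only [signAvg_fin, sum_fin_succ_bool, Fintype.sum_bool, ← Finset.sum_add_distrib,
    ← Finset.sum_div, pow_succ]
  field_simp

/-- Maurey's inequality for `l Z` bounds the product of the averages of `e^{lZ}` and `e^{-lZ}`;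
Jensen bounds the second factor below by `e^{-l E Z}`. -/
theorem signAvg_exp_lipschitz_fin {n : ℕ} {Z : (Fin n → ℝ) → ℝ} (hZ : ConvexOn ℝ Set.univ Z)
    (h0 : ∀ y, 0 ≤ Z y) {σ : ℝ}
    (hL : ∀ x y, Z x ≤ Z y + σ * √(∑ i, (x i - y i) ^ 2)) {l : ℝ} (hl : 0 ≤ l) :
    signAvg (fun ε : Fin n → Bool => Real.exp (l * Z (fun i => sgn (ε i)))) ≤
      Real.exp (l * signAvg (fun ε : Fin n → Bool => Z (fun i => sgn (ε i)))
        + 4 * l ^ 2 * σ ^ 2) := by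
  have hf : ConvexOn ℝ Set.univ (fun y => l * Z y) := hZ.smul hl
  have hM := infConv_inequality hf (fun y => mul_nonneg hl (h0 y))
  -- With `d = |x - y|`, the Lipschitz bound leaves `d² / 16 - l σ d`, minimal at `d = 8 l σ` with
  -- value `-4 l² σ²`.
  have hQ : ∀ x, l * Z x - 4 * l ^ 2 * σ ^ 2 ≤ infConv (fun y => l * Z y) x := by
    intro x
    refine le_ciInf fun y => ?_
    have h1 := mul_le_mul_of_nonneg_left (hL x y) hl
    have h2 := Real.sq_sqrt (Finset.sum_nonneg fun i (_ : i ∈ Finset.univ) => sq_nonneg (x i - y i))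
    nlinarith [sq_nonneg (√(∑ i, (x i - y i) ^ 2) - 8 * l * σ)]
  have h1 : signAvg (fun ε : Fin n → Bool => Real.exp (l * Z (fun i => sgn (ε i)))) *
      signAvg (fun ε : Fin n → Bool => Real.exp (-(l * Z (fun i => sgn (ε i))))) ≤
      Real.exp (4 * l ^ 2 * σ ^ 2) := by
    rw [signAvg_fin, signAvg_fin, div_mul_div_comm, div_le_iff₀ (by positivity), ← mul_pow]
    norm_num only
    refine le_trans ?_ (mul_le_mul_of_nonneg_left hM (Real.exp_pos _).le)
    rw [← mul_assoc]
    refine mul_le_mul_of_nonneg_right ?_ (by positivity)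
    rw [Finset.mul_sum]
    refine Finset.sum_le_sum fun ε _ => ?_
    rw [← Real.exp_add, Real.exp_le_exp]
    linarith [hQ (fun i => sgn (ε i))]
  have h2 := exp_signAvg_le (fun ε : Fin n → Bool => -(l * Z (fun i => sgn (ε i))))
  have h3 : signAvg (fun ε : Fin n → Bool => -(l * Z (fun i => sgn (ε i)))) =
      -(l * signAvg (fun ε : Fin n → Bool => Z (fun i => sgn (ε i)))) := by
    simp only [← neg_mul, signAvg_const_mul]
  rw [h3] at h2
  have h4 := (mul_le_mul_of_nonneg_left h2 (signAvg_nonneg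
    (F := fun ε : Fin n → Bool => Real.exp (l * Z (fun i => sgn (ε i))))
    fun ε => (Real.exp_pos _).le)).trans h1
  rw [Real.exp_neg, ← div_eq_mul_inv, div_le_iff₀ (Real.exp_pos _), ← Real.exp_add] at h4
  rwa [add_comm] at h4

/-- Exponential concentration of convex Lipschitz functions of random signs. -/
theorem signAvg_exp_lipschitz {Z : (ι → ℝ) → ℝ} (hZ : ConvexOn ℝ Set.univ Z)
    (h0 : ∀ y, 0 ≤ Z y) {σ : ℝ}
    (hL : ∀ x y, Z x ≤ Z y + σ * √(∑ i, (x i - y i) ^ 2)) {l : ℝ} (hl : 0 ≤ l) :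
    signAvg (fun ε : ι → Bool => Real.exp (l * Z (fun i => sgn (ε i)))) ≤
      Real.exp (l * signAvg (fun ε : ι → Bool => Z (fun i => sgn (ε i)))
        + 4 * l ^ 2 * σ ^ 2) := by
  set e := Fintype.equivFin ι
  have h := signAvg_exp_lipschitz_fin (n := Fintype.card ι) (Z := fun y => Z (fun i => y (e i)))
    (σ := σ) ⟨convex_univ, fun x _ y _ s t hs ht hst =>
      hZ.2 (Set.mem_univ (fun i => x (e i))) (Set.mem_univ (fun i => y (e i))) hs ht hst⟩
    (fun y => h0 _) (fun x y => by
      have := hL (fun i => x (e i)) (fun i => y (e i))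
      rwa [Equiv.sum_comp e (fun i => (x i - y i) ^ 2)] at this) hl
  rw [← signAvg_reindex e, ← signAvg_reindex e (fun ε => Z _)] at h
  simpa using h

/-! ### Contraction -/

/-- Two-point core of the contraction principle. `h1` and `h2` say that the two indices are maximal
for the signs plus and minus; they order the points so that increments of the exponential, which
grow to the right, can be compared. The alternatives correspond to keeping or exchanging the two
indices. -/
theorem exp_add_exp_le_of_abs {a b s t d d' : ℝ} (ha : |a| ≤ |s|) (hb : |b| ≤ |t|)
    (hab : |a - b| ≤ |s - t|) (h1 : d' + b ≤ d + a) (h2 : d - a ≤ d' - b) :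
    Real.exp (d + a) + Real.exp (d' - b) ≤ Real.exp (d + s) + Real.exp (d' - t) ∨
    Real.exp (d + a) + Real.exp (d' - b) ≤ Real.exp (d - s) + Real.exp (d' + t) := by
  have incr : ∀ x y v : ℝ, x ≤ y → 0 ≤ v →
      Real.exp (x + v) - Real.exp x ≤ Real.exp (y + v) - Real.exp y := by
    intro x y v hxy hv
    have h := Real.exp_le_exp.2 hxy
    have h' := Real.one_le_exp hv
    rw [Real.exp_add, Real.exp_add]
    nlinarith
  -- the case of nonnegative `s`, `t`
  have pos : ∀ s t : ℝ, 0 ≤ s → 0 ≤ t → |a| ≤ s → |b| ≤ t → |a - b| ≤ |s - t| →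
      Real.exp (d + a) + Real.exp (d' - b) ≤ Real.exp (d + s) + Real.exp (d' - t) ∨
      Real.exp (d + a) + Real.exp (d' - b) ≤ Real.exp (d - s) + Real.exp (d' + t) := by
    intro s t hs ht ha hb hab
    obtain ⟨ha1, ha2⟩ := abs_le.1 ha
    obtain ⟨hb1, hb2⟩ := abs_le.1 hb
    rcases le_total t s with h | h
    · left
      rw [abs_of_nonneg (sub_nonneg.2 h)] at hab
      have hab' := (abs_le.1 hab)
      have := incr (d' - t) (d + a) (t - b) (by linarith) (by linarith)
      have h3 : Real.exp (d + a + (t - b)) ≤ Real.exp (d + s) := Real.exp_le_exp.2 (by linarith)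
      rw [show d' - t + (t - b) = d' - b by ring] at this
      linarith
    · right
      rw [abs_of_nonpos (sub_nonpos.2 h)] at hab
      have hab' := (abs_le.1 hab)
      have := incr (d - s) (d' - b) (s + a) (by linarith) (by linarith)
      have h3 : Real.exp (d' - b + (s + a)) ≤ Real.exp (d' + t) := Real.exp_le_exp.2 (by linarith)
      rw [show d - s + (s + a) = d + a by ring] at this
      linarith
  rcases le_total 0 s with hs | hs <;> rcases le_total 0 t with ht | ht
  · rw [abs_of_nonneg hs] at ha
    rw [abs_of_nonneg ht] at hb
    exact pos s t hs ht ha hb hab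
  · left
    rw [abs_of_nonneg hs] at ha
    rw [abs_of_nonpos ht] at hb
    have := abs_le.1 ha
    have := abs_le.1 hb
    exact add_le_add (Real.exp_le_exp.2 (by linarith)) (Real.exp_le_exp.2 (by linarith))
  · right
    rw [abs_of_nonpos hs] at ha
    rw [abs_of_nonneg ht] at hb
    have := abs_le.1 ha
    have := abs_le.1 hb
    exact add_le_add (Real.exp_le_exp.2 (by linarith)) (Real.exp_le_exp.2 (by linarith))
  · rw [abs_of_nonpos hs] at ha
    rw [abs_of_nonpos ht] at hb
    have := pos (-s) (-t) (by linarith) (by linarith) ha hb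
      (by rwa [show -s - -t = -(s - t) by ring, abs_neg])
    rw [← sub_eq_add_neg, sub_neg_eq_add, sub_neg_eq_add, ← sub_eq_add_neg] at this
    exact this.symm

variable {J : Type*} [Finite J]

theorem le_ciSup_finite (F : J → ℝ) (j : J) : F j ≤ ⨆ j, F j :=
  le_ciSup (Set.finite_range F).bddAbove j

theorem exp_ciSup_le [Nonempty J] {F : J → ℝ} {a : ℝ} (h : ∀ j, Real.exp (F j) ≤ a) :
    Real.exp (⨆ j, F j) ≤ a := by
  obtain ⟨j, hj⟩ := exists_eq_ciSup_of_finite (f := F)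
  rw [← hj]; exact h j

/-- The hypotheses say that `u` is the image of `w` under a contraction fixing zero. Finiteness of
`J` provides the maximizers to which the scalar inequality is applied. -/
theorem two_sign_contraction [Nonempty J] (u w d : J → ℝ) (h1 : ∀ j, |u j| ≤ |w j|)
    (h2 : ∀ j k, |u j - u k| ≤ |w j - w k|) :
    Real.exp (⨆ j, (u j + d j)) + Real.exp (⨆ j, (-u j + d j)) ≤
      Real.exp (⨆ j, (w j + d j)) + Real.exp (⨆ j, (-w j + d j)) := by
  obtain ⟨j, hj⟩ := exists_eq_ciSup_of_finite (f := fun j => u j + d j)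
  obtain ⟨k, hk⟩ := exists_eq_ciSup_of_finite (f := fun j => -u j + d j)
  have hj' := le_ciSup_finite (fun j => u j + d j) k
  have hk' := le_ciSup_finite (fun j => -u j + d j) j
  rw [← hj] at hj'
  rw [← hk] at hk'
  rw [← hj, ← hk]
  rcases exp_add_exp_le_of_abs (h1 j) (h1 k) (h2 j k) (d := d j) (d' := d k)
    (by linarith) (by linarith) with h | h
  · rw [add_comm (u j), neg_add_eq_sub]
    refine h.trans (add_le_add (Real.exp_le_exp.2 ?_) (Real.exp_le_exp.2 ?_))
    · rw [add_comm]; exact le_ciSup_finite (fun j => w j + d j) j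
    · rw [← neg_add_eq_sub]; exact le_ciSup_finite (fun j => -w j + d j) k
  · rw [add_comm (u j), neg_add_eq_sub, add_comm (Real.exp (⨆ j, (w j + d j)))]
    refine h.trans (add_le_add (Real.exp_le_exp.2 ?_) (Real.exp_le_exp.2 ?_))
    · rw [← neg_add_eq_sub]; exact le_ciSup_finite (fun j => -w j + d j) j
    · rw [add_comm]; exact le_ciSup_finite (fun j => w j + d j) k

/-- Coordinates are replaced one at a time; those not being replaced are absorbed into the offset
`d`, which is why the statement carries it. -/
theorem signAvg_contraction_fin [Nonempty J] {n : ℕ} (u w : J → Fin n → ℝ) (d : J → ℝ)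
    (h1 : ∀ j i, |u j i| ≤ |w j i|) (h2 : ∀ j k i, |u j i - u k i| ≤ |w j i - w k i|) :
    signAvg (fun ε : Fin n → Bool => Real.exp (⨆ j, (∑ i, sgn (ε i) * u j i + d j))) ≤
      signAvg (fun ε : Fin n → Bool => Real.exp (⨆ j, (∑ i, sgn (ε i) * w j i + d j))) := by
  induction n generalizing d with
  | zero => simp
  | succ n ih =>
    rw [signAvg_fin_succ, signAvg_fin_succ]
    have step : ∀ b : Bool,
        signAvg (fun ε : Fin n → Bool => Real.exp (⨆ j,
          (∑ i, sgn ((Fin.cons b ε : Fin (n + 1) → Bool) i) * u j i + d j))) ≤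
        signAvg (fun ε : Fin n → Bool => Real.exp (⨆ j,
          (sgn b * u j 0 + (∑ i, sgn (ε i) * w j i.succ + d j)))) := by
      intro b
      have := ih (fun j i => u j i.succ) (fun j i => w j i.succ) (fun j => sgn b * u j 0 + d j)
        (fun j i => h1 j _) (fun j k i => h2 j k _)
      simp only [Fin.sum_univ_succ, Fin.cons_zero, Fin.cons_succ]
      have hr : ∀ (v : Fin (n + 1) → ℝ) (ε : Fin n → Bool) (c : ℝ) (a : ℝ),
          ∑ i, sgn (ε i) * v i.succ + (c + a) = c + (∑ i, sgn (ε i) * v i.succ + a) := by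
        intros; ring
      simpa only [hr, add_assoc] using this
    calc _ ≤ signAvg (fun ε : Fin n → Bool => (Real.exp (⨆ j,
          (sgn true * u j 0 + (∑ i, sgn (ε i) * w j i.succ + d j))) + Real.exp (⨆ j,
          (sgn false * u j 0 + (∑ i, sgn (ε i) * w j i.succ + d j)))) / 2) := by
          simp only [div_eq_inv_mul, signAvg_const_mul, signAvg_add]
          gcongr ?_ * (?_ + ?_)
          · exact step true
          · exact step false
      _ ≤ _ := by
          refine signAvg_mono fun ε => ?_
          have := two_sign_contraction (fun j => u j 0) (fun j => w j 0)
            (fun j => ∑ i, sgn (ε i) * w j i.succ + d j) (fun j => h1 j 0) (fun j k => h2 j k 0)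
          simp only [Fin.sum_univ_succ, Fin.cons_zero, Fin.cons_succ, add_assoc]
          simp only [sgn, if_true, one_mul, Bool.false_eq_true, if_false, neg_one_mul] at this ⊢
          linarith

/-- The contraction principle for exponential moments. -/
theorem signAvg_contraction [Nonempty J] (u w : J → ι → ℝ) (d : J → ℝ)
    (h1 : ∀ j i, |u j i| ≤ |w j i|) (h2 : ∀ j k i, |u j i - u k i| ≤ |w j i - w k i|) :
    signAvg (fun ε : ι → Bool => Real.exp (⨆ j, (∑ i, sgn (ε i) * u j i + d j))) ≤
      signAvg (fun ε : ι → Bool => Real.exp (⨆ j, (∑ i, sgn (ε i) * w j i + d j))) := by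
  set e := Fintype.equivFin ι
  have h := signAvg_contraction_fin (fun j i => u j (e.symm i)) (fun j i => w j (e.symm i)) d
    (fun j i => h1 j _) (fun j k i => h2 j k _)
  rw [← signAvg_reindex e, ← signAvg_reindex e (fun ε => Real.exp (⨆ j, (∑ i, sgn (ε i) * w j (e.symm i) + d j)))] at h
  have hs : ∀ (ε : ι → Bool) (v : ι → ℝ),
      ∑ i, sgn (ε (e.symm i)) * v (e.symm i) = ∑ i, sgn (ε i) * v i := fun ε v =>
    Equiv.sum_comp e.symm (fun i => sgn (ε i) * v i)
  simpa only [hs] using h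

end SignAvg

/-! ### Localized suprema and the offset Rademacher process -/

section LocalSup

variable {ι : Type*} [Fintype ι] {J : Type*}

/-- The largest correlation of `y` with the vectors of the family `v`, after shrinking each to
Euclidean norm at most `σ`. -/
def localSup (v : J → ι → ℝ) (σ : ℝ) (y : ι → ℝ) : ℝ :=
  ⨆ j, max 0 (min 1 (σ / √(∑ i, v j i ^ 2)) * ∑ i, y i * v j i)

theorem localSup_nonneg (v : J → ι → ℝ) (σ : ℝ) (y : ι → ℝ) : 0 ≤ localSup v σ y :=
  Real.iSup_nonneg fun _ => le_max_left _ _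

variable [Finite J]

theorem le_localSup (v : J → ι → ℝ) (σ : ℝ) (y : ι → ℝ) (j : J) :
    min 1 (σ / √(∑ i, v j i ^ 2)) * ∑ i, y i * v j i ≤ localSup v σ y :=
  (le_max_right _ _).trans (le_ciSup_finite
    (fun j => max 0 (min 1 (σ / √(∑ i, v j i ^ 2)) * ∑ i, y i * v j i)) j)

theorem localSup_convex (v : J → ι → ℝ) (σ : ℝ) : ConvexOn ℝ Set.univ (localSup v σ) := by
  refine ⟨convex_univ, fun x _ y _ s t hs ht hst => ?_⟩
  have hnn : 0 ≤ s • localSup v σ x + t • localSup v σ y :=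
    add_nonneg (mul_nonneg hs (localSup_nonneg v σ x)) (mul_nonneg ht (localSup_nonneg v σ y))
  refine Real.iSup_le (fun j => max_le hnn ?_) hnn
  have hx := mul_le_mul_of_nonneg_left (le_localSup v σ x j) hs
  have hy := mul_le_mul_of_nonneg_left (le_localSup v σ y j) ht
  refine le_trans (le_of_eq ?_) (add_le_add hx hy)
  simp only [Pi.add_apply, Pi.smul_apply, smul_eq_mul, add_mul, Finset.sum_add_distrib, mul_assoc,
    ← Finset.mul_sum]
  ring

/-- Cauchy-Schwarz: after shrinking, every vector has norm at most `σ`. -/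
theorem localSup_lipschitz (v : J → ι → ℝ) {σ : ℝ} (hσ : 0 ≤ σ) (x y : ι → ℝ) :
    localSup v σ x ≤ localSup v σ y + σ * √(∑ i, (x i - y i) ^ 2) := by
  have hnn : 0 ≤ localSup v σ y + σ * √(∑ i, (x i - y i) ^ 2) :=
    add_nonneg (localSup_nonneg v σ y) (by positivity)
  refine Real.iSup_le (fun j => max_le hnn ?_) hnn
  set c := min 1 (σ / √(∑ i, v j i ^ 2)) with hc
  have hc0 : 0 ≤ c := le_min zero_le_one (by positivity)
  have hcv : c * √(∑ i, v j i ^ 2) ≤ σ := by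
    rcases (Real.sqrt_nonneg (∑ i, v j i ^ 2)).eq_or_lt with h | h
    · rw [← h]; simpa using hσ
    · calc _ ≤ (σ / √(∑ i, v j i ^ 2)) * √(∑ i, v j i ^ 2) := by
            gcongr; exact min_le_right _ _
        _ = σ := by field_simp
  have hcs := Real.sum_mul_le_sqrt_mul_sqrt Finset.univ (fun i => x i - y i) (v j)
  have hsplit : ∑ i, x i * v j i = ∑ i, y i * v j i + ∑ i, (x i - y i) * v j i := by
    rw [← Finset.sum_add_distrib]; exact Finset.sum_congr rfl fun i _ => by ring
  rw [hsplit, mul_add]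
  refine add_le_add (le_localSup v σ y j) ?_
  calc _ ≤ c * (√(∑ i, (x i - y i) ^ 2) * √(∑ i, v j i ^ 2)) := by gcongr
    _ = (c * √(∑ i, v j i ^ 2)) * √(∑ i, (x i - y i) ^ 2) := by ring
    _ ≤ _ := by gcongr

theorem sum_half_pow_le (N : ℕ) : ∑ m ∈ Finset.range N, (1 / 2 : ℝ) ^ (m + 1) ≤ 1 := by
  have : ∑ m ∈ Finset.range N, (1 / 2 : ℝ) ^ (m + 1) = 1 - (1 / 2) ^ N := by
    induction N with
    | zero => simp
    | succ N ih => rw [Finset.sum_range_succ, ih, pow_succ]; ring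
  rw [this]; linarith [pow_pos (show (0 : ℝ) < 1 / 2 by norm_num) N]

theorem exp_neg_one_le_half : Real.exp (-1) ≤ 1 / 2 := by
  have := exp_neg_le_quadratic (x := 1) (by norm_num)
  linarith

/-- Peeling: in the shell `m = ⌊‖v_j‖ / σ⌋` undoing the shrinkage costs a factor at most `m + 1`,
while the quadratic offset gains at least `m² σ²` times its coefficient, since `102400 = 2560 · 40`.
-/
theorem offset_le (v : J → ι → ℝ) {σ : ℝ} (hσ : 0 < σ) (y : ι → ℝ) (j : J) :
    ∑ i, (y i * (v j i / 2560) - v j i ^ 2 / 102400) ≤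
      (1 / 2560) * ((⌊√(∑ i, v j i ^ 2) / σ⌋₊ + 1) * localSup v σ y
        - ⌊√(∑ i, v j i ^ 2) / σ⌋₊ ^ 2 * σ ^ 2 / 40) := by
  set V := √(∑ i, v j i ^ 2) with hV
  set m := ⌊V / σ⌋₊
  have hV0 : 0 ≤ V := Real.sqrt_nonneg _
  have hVsq : ∑ i, v j i ^ 2 = V ^ 2 :=
    (Real.sq_sqrt (Finset.sum_nonneg fun i _ => sq_nonneg _)).symm
  have hs : ∑ i, (y i * (v j i / 2560) - v j i ^ 2 / 102400) =
      (1 / 2560) * (∑ i, y i * v j i - (∑ i, v j i ^ 2) / 40) := by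
    rw [Finset.sum_sub_distrib, ← Finset.sum_div, mul_sub, Finset.mul_sum]
    congr 1
    · exact Finset.sum_congr rfl fun i _ => by ring
    · ring
  have hm : (m : ℝ) * σ ≤ V := by
    have := Nat.floor_le (div_nonneg hV0 hσ.le)
    rwa [le_div_iff₀ hσ] at this
  have hm2 : V < (m + 1) * σ := by
    have := Nat.lt_floor_add_one (V / σ)
    rwa [div_lt_iff₀ hσ] at this
  have hZ := le_localSup v σ y j
  rw [← hV] at hZ
  have hZ0 := localSup_nonneg v σ y
  have hcorr : ∑ i, y i * v j i ≤ (m + 1) * localSup v σ y := by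
    rcases le_total V σ with h | h
    · rcases hV0.eq_or_lt with h0 | h0
      · have hv : ∀ i, v j i = 0 := by
          intro i
          have h3 : ∑ i, v j i ^ 2 = 0 := by rw [hVsq, ← h0]; ring
          have := (Finset.sum_eq_zero_iff_of_nonneg (fun i _ => sq_nonneg (v j i))).1 h3 i
            (Finset.mem_univ i)
          exact pow_eq_zero_iff two_ne_zero |>.1 this
        simp only [hv, mul_zero, Finset.sum_const_zero]
        positivity
      · rw [min_eq_left ((one_le_div h0).2 h), one_mul] at hZ
        nlinarith [Nat.cast_nonneg (α := ℝ) m]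
    · have h0 : 0 < V := hσ.trans_le h
      rw [min_eq_right ((div_le_one h0).2 h)] at hZ
      have : ∑ i, y i * v j i = (V / σ) * (σ / V * ∑ i, y i * v j i) := by field_simp
      rw [this]
      have h1 : V / σ ≤ m + 1 := (Nat.lt_floor_add_one _).le
      calc _ ≤ (V / σ) * localSup v σ y := by gcongr
        _ ≤ _ := by gcongr
  rw [hs, hVsq]
  have : (m : ℝ) ^ 2 * σ ^ 2 ≤ V ^ 2 := by
    rw [← mul_pow]; exact pow_le_pow_left₀ (by positivity) hm 2
  linarith

/-- Exponential moments of the offset process are controlled by the local averages. -/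
theorem signAvg_exp_offset_le [Nonempty J] (v : J → ι → ℝ) {σ : ℝ} (hσ : 640 ≤ σ)
    (hZ : signAvg (fun ε : ι → Bool => localSup v σ (fun i => sgn (ε i))) ≤ σ ^ 2 / 160) :
    signAvg (fun ε : ι → Bool => Real.exp (⨆ j,
      ∑ i, (sgn (ε i) * (v j i / 2560) - v j i ^ 2 / 102400))) ≤ Real.exp (σ ^ 2) := by
  have hσ0 : 0 < σ := by linarith
  obtain ⟨N, hN⟩ := (Set.finite_range fun j => ⌊√(∑ i, v j i ^ 2) / σ⌋₊).bddAbove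
  have hN' : ∀ j, ⌊√(∑ i, v j i ^ 2) / σ⌋₊ ≤ N := fun j => hN ⟨j, rfl⟩
  set Z : (ι → Bool) → ℝ := fun ε => localSup v σ (fun i => sgn (ε i)) with hZdef
  have conc : ∀ m : ℕ, signAvg (fun ε => Real.exp ((m + 1) / 2560 * Z ε)) ≤
      Real.exp ((m + 1) / 2560 * (σ ^ 2 / 160) + 4 * ((m + 1) / 2560) ^ 2 * σ ^ 2) := by
    intro m
    refine (signAvg_exp_lipschitz (localSup_convex v σ) (localSup_nonneg v σ)
      (localSup_lipschitz v hσ0.le) (by positivity)).trans (Real.exp_le_exp.2 ?_)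
    gcongr
  -- The supremum is attained in one of finitely many shells, so its exponential is at most the sum
  -- over shells of exponentials of the same variable `Z`.
  have hpt : ∀ ε : ι → Bool, Real.exp (⨆ j,
      ∑ i, (sgn (ε i) * (v j i / 2560) - v j i ^ 2 / 102400)) ≤
      Real.exp ((0 + 1) / 2560 * Z ε) + ∑ m ∈ Finset.range N,
        Real.exp (-(((m + 1 : ℕ) : ℝ) ^ 2 * σ ^ 2 / 102400)) *
          Real.exp ((((m + 1 : ℕ) : ℝ) + 1) / 2560 * Z ε) := by
    intro ε
    refine exp_ciSup_le fun j => ?_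
    have h := offset_le v hσ0 (fun i => sgn (ε i)) j
    rcases hm : ⌊√(∑ i, v j i ^ 2) / σ⌋₊ with _ | m
    · rw [hm] at h
      refine le_add_of_le_of_nonneg (Real.exp_le_exp.2 (h.trans (le_of_eq ?_)))
        (Finset.sum_nonneg fun _ _ => by positivity)
      simp only [hZdef]; push_cast; ring
    · rw [hm] at h
      refine le_add_of_nonneg_of_le (Real.exp_pos _).le ?_
      have hmN : m ∈ Finset.range N := Finset.mem_range.2 (by have := hN' j; omega)
      refine le_trans ?_ (Finset.single_le_sum (f := fun m : ℕ =>
        Real.exp (-(((m + 1 : ℕ) : ℝ) ^ 2 * σ ^ 2 / 102400)) *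
          Real.exp ((((m + 1 : ℕ) : ℝ) + 1) / 2560 * Z ε))
        (fun _ _ => by positivity) hmN)
      rw [← Real.exp_add, Real.exp_le_exp]
      refine h.trans (le_of_eq ?_)
      simp only [hZdef]; ring
  have hσ2 : 409600 ≤ σ ^ 2 := by nlinarith
  refine (signAvg_mono hpt).trans ?_
  rw [signAvg_add, signAvg_finsetSum]
  have hterm : ∀ m ∈ Finset.range N, signAvg (fun ε : ι → Bool =>
      Real.exp (-(((m + 1 : ℕ) : ℝ) ^ 2 * σ ^ 2 / 102400)) *
          Real.exp ((((m + 1 : ℕ) : ℝ) + 1) / 2560 * Z ε)) ≤ (1 / 2) ^ (m + 1) := by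
    intro m _
    rw [signAvg_const_mul]
    refine (mul_le_mul_of_nonneg_left (conc (m + 1)) (Real.exp_pos _).le).trans ?_
    rw [← Real.exp_add]
    set k : ℝ := ((m + 1 : ℕ) : ℝ) with hk
    have hk1 : 1 ≤ k := by rw [hk]; exact_mod_cast Nat.le_add_left 1 m
    -- All three terms are multiples of `σ² / 409600`, where `409600 = 2560 · 160 = 640²`; hence the
    -- requirement `640 ≤ σ`, which makes shell `k` contribute at most `e^{-k}`.
    have hexp : -(k ^ 2 * σ ^ 2 / 102400) + ((k + 1) / 2560 * (σ ^ 2 / 160) +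
        4 * ((k + 1) / 2560) ^ 2 * σ ^ 2) ≤ k * (-1) := by
      have e : -(k ^ 2 * σ ^ 2 / 102400) + ((k + 1) / 2560 * (σ ^ 2 / 160) +
        4 * ((k + 1) / 2560) ^ 2 * σ ^ 2) =
          σ ^ 2 / 409600 * (-4 * k ^ 2 + (k + 1) + (k + 1) ^ 2 / 4) := by ring
      rw [e]
      have h1 : -4 * k ^ 2 + (k + 1) + (k + 1) ^ 2 / 4 ≤ -k := by nlinarith
      have h2 : 1 ≤ σ ^ 2 / 409600 := by linarith
      nlinarith
    calc _ ≤ Real.exp (k * (-1)) := Real.exp_le_exp.2 hexp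
      _ = Real.exp (-1) ^ (m + 1) := by rw [hk, Real.exp_nat_mul]
      _ ≤ _ := pow_le_pow_left₀ (Real.exp_pos _).le exp_neg_one_le_half _
  have h0 := conc 0
  have hsum := (Finset.sum_le_sum hterm).trans (sum_half_pow_le N)
  have hbig : Real.exp ((((0 : ℕ) : ℝ) + 1) / 2560 * (σ ^ 2 / 160) +
      4 * ((((0 : ℕ) : ℝ) + 1) / 2560) ^ 2 * σ ^ 2) ≤ Real.exp (σ ^ 2 / 2) :=
    Real.exp_le_exp.2 (by push_cast; nlinarith)
  have hE : 2 ≤ Real.exp (σ ^ 2 / 2) := by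
    have := Real.add_one_le_exp (σ ^ 2 / 2); linarith
  have hE2 : Real.exp (σ ^ 2) = Real.exp (σ ^ 2 / 2) * Real.exp (σ ^ 2 / 2) := by
    rw [← Real.exp_add]; ring_nf
  rw [hE2]
  push_cast at h0 hbig
  nlinarith [h0.trans hbig]

end LocalSup

/-! ### Self-normalized symmetrization -/

section Symmetrization

variable {ι : Type*} [Fintype ι] {J : Type*} [Finite J] [Nonempty J] {Ω : Type*}

theorem signAvg_mul_const (F : (ι → Bool) → ℝ) (a : ℝ) :
    signAvg (fun ε => F ε * a) = signAvg F * a := by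
  simp only [mul_comm _ a, signAvg_const_mul]

theorem signAvg_comm {κ : Type*} [Fintype κ] (F : (ι → Bool) → (κ → Bool) → ℝ) :
    signAvg (fun ε => signAvg (fun τ => F ε τ)) = signAvg (fun τ => signAvg (fun ε => F ε τ)) := by
  simp only [signAvg, ← Finset.sum_div]
  rw [Finset.sum_comm, div_right_comm]

/-- Coordinatewise negation of Boolean vectors. -/
def flipEquiv : (ι → Bool) ≃ (ι → Bool) where
  toFun ε := fun i => !(ε i)
  invFun ε := fun i => !(ε i)
  left_inv ε := by funext i; simp
  right_inv ε := by funext i; simp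

theorem signAvg_flip (F : (ι → Bool) → ℝ) :
    signAvg (fun ε => F (fun i => !(ε i))) = signAvg F := signAvg_comp_equiv flipEquiv F

theorem signAvg_pair_swap (η : ι → Bool) (F : (ι → Bool) → (ι → Bool) → ℝ) :
    signAvg (fun ε => signAvg (fun τ => F (fun i => if η i then ε i else τ i)
      (fun i => if η i then τ i else ε i))) = signAvg (fun ε => signAvg (fun τ => F ε τ)) := by
  classical
  simp only [signAvg, ← Finset.sum_div]
  congr 2
  rw [← Fintype.sum_prod_type', ← Fintype.sum_prod_type']
  let e : ((ι → Bool) × (ι → Bool)) ≃ ((ι → Bool) × (ι → Bool)) :=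
    { toFun := fun p => (fun i => if η i then p.1 i else p.2 i,
        fun i => if η i then p.2 i else p.1 i)
      invFun := fun p => (fun i => if η i then p.1 i else p.2 i,
        fun i => if η i then p.2 i else p.1 i)
      left_inv := fun p => by
        ext i <;> by_cases h : η i <;> simp [h]
      right_inv := fun p => by
        ext i <;> by_cases h : η i <;> simp [h] }
  exact Fintype.sum_equiv e _ _ (fun x => rfl)

variable (g q : J → Ω → ℝ)

/-- Exponential moment of the offset Rademacher process of the family `(g, q)`. -/
def expOff (x : ι → Ω) : ℝ :=
  signAvg fun ε : ι → Bool => Real.exp (⨆ j, ∑ i, (sgn (ε i) * g j (x i) - q j (x i)))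

/-- Exponential of the offset difference process of two samples. -/
def pairOff (x x' : ι → Ω) : ℝ :=
  Real.exp (⨆ j, ∑ i, ((g j (x' i) - g j (x i)) / 2 - q j (x i) - q j (x' i)))

/-- Exponential of the offset Rademacher process of the union of two samples. -/
def unionTerm (x x' : ι → Ω) (ε τ : ι → Bool) : ℝ :=
  Real.exp (⨆ j, ∑ i, (sgn (ε i) * g j (x i) + sgn (τ i) * g j (x' i) - q j (x i) - q j (x' i)))

theorem expOff_pos (x : ι → Ω) : 0 < expOff g q x := by
  classical
  exact div_pos (Finset.sum_pos (fun ε _ => Real.exp_pos _) Finset.univ_nonempty) (by positivity)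

/-- The supremum of a sum is at most the sum of the suprema, and the two sign vectors are averaged
independently. -/
theorem unionOff_le (x x' : ι → Ω) :
    signAvg (fun ε => signAvg (fun τ => unionTerm g q x x' ε τ)) ≤
      expOff g q x * expOff g q x' := by
  have h : ∀ ε τ : ι → Bool, unionTerm g q x x' ε τ ≤
      Real.exp (⨆ j, ∑ i, (sgn (ε i) * g j (x i) - q j (x i))) *
      Real.exp (⨆ j, ∑ i, (sgn (τ i) * g j (x' i) - q j (x' i))) := by
    intro ε τ
    refine exp_ciSup_le fun j => ?_
    rw [← Real.exp_add, Real.exp_le_exp]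
    refine le_trans (le_of_eq ?_) (add_le_add
      (le_ciSup_finite (fun j => ∑ i, (sgn (ε i) * g j (x i) - q j (x i))) j)
      (le_ciSup_finite (fun j => ∑ i, (sgn (τ i) * g j (x' i) - q j (x' i))) j))
    rw [← Finset.sum_add_distrib]
    exact Finset.sum_congr rfl fun i _ => by ring
  refine (signAvg_mono fun ε => signAvg_mono fun τ => h ε τ).trans (le_of_eq ?_)
  simp only [signAvg_const_mul, signAvg_mul_const]
  rfl

/-- Exchange the two members of the pairs whose sign is negative. -/
def exchange (η : ι → Bool) (z : ι → Ω × Ω) : ι → Ω × Ω :=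
  fun i => if η i then z i else (z i).swap

/-- Exchanging members of pairs only permutes the corresponding pairs of signs. The union average is
thus an exchange-invariant lower bound of the product of the two exponential moments, which itself
is not invariant. -/
theorem unionOff_exchange (η : ι → Bool) (z : ι → Ω × Ω) :
    signAvg (fun ε => signAvg (fun τ => unionTerm g q (fun i => (exchange η z i).1)
      (fun i => (exchange η z i).2) ε τ)) =
    signAvg (fun ε => signAvg (fun τ => unionTerm g q (fun i => (z i).1)
      (fun i => (z i).2) ε τ)) := by
  rw [← signAvg_pair_swap η (fun ε τ => unionTerm g q (fun i => (z i).1) (fun i => (z i).2) ε τ)]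
  congr 1; funext ε; congr 1; funext τ
  unfold unionTerm
  congr 2; funext j
  refine Finset.sum_congr rfl fun i _ => ?_
  by_cases h : η i <;> simp [exchange, h] <;> ring

/-- The signed half-difference is the mean of four union processes: averaging over `τ` and its
negative erases one sample and leaves the other with sign `η` or `-η`. Jensen moves the exponential
inside. This is where the factor one half of the difference is needed. -/
theorem pairOff_exchange_le (η τ : ι → Bool) (z : ι → Ω × Ω) :
    pairOff g q (fun i => (exchange η z i).1) (fun i => (exchange η z i).2) ≤
    (unionTerm g q (fun i => (z i).1) (fun i => (z i).2) τ η +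
      unionTerm g q (fun i => (z i).1) (fun i => (z i).2) (fun i => !(τ i)) η +
      unionTerm g q (fun i => (z i).1) (fun i => (z i).2) (fun i => !(η i)) τ +
      unionTerm g q (fun i => (z i).1) (fun i => (z i).2) (fun i => !(η i)) (fun i => !(τ i))) / 4 := by
  refine exp_ciSup_le fun j => ?_
  set X : (ι → Bool) → (ι → Bool) → ℝ := fun ε τ => ∑ i, (sgn (ε i) * g j (z i).1 +
    sgn (τ i) * g j (z i).2 - q j (z i).1 - q j (z i).2) with hX
  have hle : ∀ ε τ, Real.exp (X ε τ) ≤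
      unionTerm g q (fun i => (z i).1) (fun i => (z i).2) ε τ := fun ε τ =>
    Real.exp_le_exp.2 (le_ciSup_finite (fun j => ∑ i, (sgn (ε i) * g j (z i).1 +
    sgn (τ i) * g j (z i).2 - q j (z i).1 - q j (z i).2)) j)
  have hsum : ∑ i, ((g j (exchange η z i).2 - g j (exchange η z i).1) / 2
      - q j (exchange η z i).1 - q j (exchange η z i).2) =
      (X τ η + X (fun i => !(τ i)) η + X (fun i => !(η i)) τ +
        X (fun i => !(η i)) (fun i => !(τ i))) / 4 := by
    simp only [hX, ← Finset.sum_add_distrib, Finset.sum_div]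
    refine Finset.sum_congr rfl fun i _ => ?_
    simp only [sgn_not]
    by_cases h : η i <;> simp [exchange, h, sgn] <;> ring
  have jensen : ∀ a b c d : ℝ, Real.exp ((a + b + c + d) / 4) ≤
      (Real.exp a + Real.exp b + Real.exp c + Real.exp d) / 4 := by
    intro a b c d
    set m := (a + b + c + d) / 4 with hm
    have h : ∀ y, Real.exp m * (1 + (y - m)) ≤ Real.exp y := by
      intro y
      calc _ ≤ Real.exp m * Real.exp (y - m) := by
            gcongr; linarith [Real.add_one_le_exp (y - m)]
        _ = _ := by rw [← Real.exp_add]; ring_nf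
    have h5 : Real.exp m * (1 + (a - m)) + Real.exp m * (1 + (b - m)) +
      Real.exp m * (1 + (c - m)) + Real.exp m * (1 + (d - m)) = 4 * Real.exp m := by
      rw [hm]; ring
    linarith [h a, h b, h c, h d]
  rw [hsum]
  refine (jensen _ _ _ _).trans ?_
  linarith [hle τ η, hle (fun i => !(τ i)) η, hle (fun i => !(η i)) τ,
    hle (fun i => !(η i)) (fun i => !(τ i))]

/-- Averaged over `η` and `τ`, each of the four terms becomes the same union average, by flip
invariance and by exchanging the two averages. -/
theorem signAvg_pairOff_exchange_le (z : ι → Ω × Ω) :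
    signAvg (fun η => pairOff g q (fun i => (exchange η z i).1) (fun i => (exchange η z i).2)) ≤
      signAvg (fun ε => signAvg (fun τ => unionTerm g q (fun i => (z i).1)
        (fun i => (z i).2) ε τ)) := by
  set F := unionTerm g q (fun i => (z i).1) (fun i => (z i).2)
  have h : ∀ τ : ι → Bool,
      signAvg (fun η => pairOff g q (fun i => (exchange η z i).1) (fun i => (exchange η z i).2)) ≤
      signAvg (fun η => (F τ η + F (fun i => !(τ i)) η + F (fun i => !(η i)) τ +
        F (fun i => !(η i)) (fun i => !(τ i))) / 4) := fun τ =>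
    signAvg_mono fun η => pairOff_exchange_le g q η τ z
  have h2 := signAvg_mono (ι := ι) h
  rw [signAvg_const] at h2
  refine h2.trans (le_of_eq ?_)
  simp only [div_eq_inv_mul, signAvg_const_mul, signAvg_add]
  rw [signAvg_flip (fun τ => signAvg (F τ)),
    signAvg_comm (fun τ η : ι → Bool => F (fun i => !(η i)) τ),
    signAvg_flip (fun η => signAvg (fun τ => F η τ)),
    signAvg_comm (fun τ η : ι → Bool => F (fun i => !(η i)) (fun i => !(τ i))),
    signAvg_flip (fun η => signAvg (fun τ : ι → Bool => F η (fun i => !(τ i))))]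
  have : ∀ η, signAvg (fun τ : ι → Bool => F η (fun i => !(τ i))) = signAvg (F η) :=
    fun η => signAvg_flip (F η)
  simp only [this]
  ring

variable [MeasurableSpace Ω]

theorem measurable_exchange (η : ι → Bool) : Measurable (exchange (Ω := Ω) η) := by
  refine measurable_pi_lambda _ fun i => ?_
  by_cases h : η i <;> simp only [exchange, h, if_true, Bool.false_eq_true, if_false] <;> fun_prop

theorem measurePreserving_exchange (μ : Measure Ω) [IsProbabilityMeasure μ] (η : ι → Bool) :
    MeasurePreserving (exchange (Ω := Ω) η) (Measure.pi fun _ : ι => μ.prod μ)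
      (Measure.pi fun _ : ι => μ.prod μ) := by
  have := measurePreserving_pi (fun _ : ι => μ.prod μ) (fun _ : ι => μ.prod μ)
    (f := fun i => if η i then id else Prod.swap) (fun i => by
      by_cases h : η i
      · simpa [h] using MeasurePreserving.id _
      · simpa [h] using Measure.measurePreserving_swap)
  convert this using 1
  funext z i
  by_cases h : η i <;> simp [exchange, h]

variable {g q}

theorem measurable_expOff (hg : ∀ j, Measurable (g j)) (hq : ∀ j, Measurable (q j)) :
    Measurable (expOff (ι := ι) g q) := by
  classical
  unfold expOff signAvg
  refine Measurable.div_const (Finset.measurable_sum _ fun ε _ => ?_) _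
  refine Real.measurable_exp.comp (Measurable.iSup fun j => Finset.measurable_sum _ fun i _ => ?_)
  have := hg j
  have := hq j
  fun_prop

theorem measurable_pairOff (hg : ∀ j, Measurable (g j)) (hq : ∀ j, Measurable (q j)) :
    Measurable (fun p : (ι → Ω) × (ι → Ω) => pairOff g q p.1 p.2) := by
  unfold pairOff
  refine Real.measurable_exp.comp (Measurable.iSup fun j => Finset.measurable_sum _ fun i _ => ?_)
  have := hg j
  have := hq j
  fun_prop

/-- The law of i.i.d. pairs is invariant under exchange, so the ratio may be averaged over
exchanges. After bounding its denominator below by the invariant union average, that average is at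
most one pointwise. Normalizing by empirical quantities is what permits data-dependent radii later.
-/
theorem lintegral_pair_ratio_le (μ : Measure Ω) [IsProbabilityMeasure μ]
    (hg : ∀ j, Measurable (g j)) (hq : ∀ j, Measurable (q j)) :
    ∫⁻ x, ∫⁻ x', ENNReal.ofReal (pairOff g q x x' / (expOff g q x * expOff g q x'))
      ∂(Measure.pi fun _ : ι => μ) ∂(Measure.pi fun _ : ι => μ) ≤ 1 := by
  classical
  set K : (ι → Ω) × (ι → Ω) → ENNReal := fun p =>
    ENNReal.ofReal (pairOff g q p.1 p.2 / (expOff g q p.1 * expOff g q p.2)) with hK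
  have hKm : Measurable K := by
    have h1 := measurable_expOff (ι := ι) hg hq
    have h2 := measurable_pairOff (ι := ι) hg hq
    exact ENNReal.measurable_ofReal.comp (h2.div ((h1.comp measurable_fst).mul
      (h1.comp measurable_snd)))
  have hmp := measurePreserving_arrowProdEquivProdArrow Ω Ω ι (fun _ => μ) (fun _ => μ)
  rw [← lintegral_prod (f := K) hKm.aemeasurable, ← hmp.lintegral_comp hKm]
  set P := Measure.pi fun _ : ι => μ.prod μ with hP
  set K' : (ι → Ω × Ω) → ENNReal := fun z => K (fun i => (z i).1, fun i => (z i).2) with hK'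
  have hK'm : Measurable K' := hKm.comp (by fun_prop)
  change ∫⁻ z, K' z ∂P ≤ 1
  have h1 : ∀ η : ι → Bool, ∫⁻ z, K' (exchange η z) ∂P = ∫⁻ z, K' z ∂P := fun η =>
    (measurePreserving_exchange μ η).lintegral_comp hK'm
  have h2 : ∀ z, ∑ η : ι → Bool, K' (exchange η z) ≤ ENNReal.ofReal (2 ^ Fintype.card ι) := by
    intro z
    set U := signAvg (fun ε => signAvg (fun τ => unionTerm g q (fun i => (z i).1)
        (fun i => (z i).2) ε τ)) with hU
    have hpos : 0 < U := by
      have hp : 0 < signAvg (fun η => pairOff g q (fun i => (exchange η z i).1)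
          (fun i => (exchange η z i).2)) :=
        div_pos (Finset.sum_pos (fun ε _ => Real.exp_pos _) Finset.univ_nonempty) (by positivity)
      exact hp.trans_le (signAvg_pairOff_exchange_le g q z)
    have h3 : ∀ η : ι → Bool, K' (exchange η z) ≤ ENNReal.ofReal
        (pairOff g q (fun i => (exchange η z i).1) (fun i => (exchange η z i).2) / U) := by
      intro η
      refine ENNReal.ofReal_le_ofReal ?_
      refine div_le_div_of_nonneg_left (Real.exp_pos _).le hpos ?_
      rw [hU, ← unionOff_exchange g q η z]
      exact unionOff_le g q _ _
    refine (Finset.sum_le_sum fun η _ => h3 η).trans ?_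
    rw [← ENNReal.ofReal_sum_of_nonneg fun η _ =>
      div_nonneg (show 0 ≤ pairOff g q (fun i => (exchange η z i).1) (fun i => (exchange η z i).2)
        from (Real.exp_pos _).le) hpos.le]
    refine ENNReal.ofReal_le_ofReal ?_
    rw [← Finset.sum_div, div_le_iff₀ hpos]
    have := signAvg_pairOff_exchange_le g q z
    rw [← hU, signAvg, div_le_iff₀ (by positivity)] at this
    rw [mul_comm]
    convert this using 2
  have h4 : ∑ η : ι → Bool, ∫⁻ z, K' (exchange η z) ∂P ≤ ENNReal.ofReal (2 ^ Fintype.card ι) := by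
    rw [← lintegral_finsetSum (f := fun η z => K' (exchange η z)) _
      fun η _ => hK'm.comp (measurable_exchange η)]
    refine (lintegral_mono h2).trans ?_
    simp
  simp only [h1, Finset.sum_const, nsmul_eq_mul] at h4
  have hc : ((Finset.univ : Finset (ι → Bool)).card : ENNReal) =
      ENNReal.ofReal (2 ^ Fintype.card ι) := by
    simp [ENNReal.ofReal_pow]
  rw [hc] at h4
  have hne : ENNReal.ofReal (2 ^ Fintype.card ι) ≠ 0 := by
    simp
  nth_rw 2 [← mul_one (ENNReal.ofReal (2 ^ Fintype.card ι))] at h4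
  exact (ENNReal.mul_le_mul_iff_right hne ENNReal.ofReal_ne_top).1 h4

end Symmetrization

/-! ### From pairs of samples to the deviation of one sample -/

theorem integral_cond_eq {α : Type*} [MeasurableSpace α] (P : Measure α) (A : Set α) (f : α → ℝ) :
    ∫ x, f x ∂(ProbabilityTheory.cond P A) = (P.real A)⁻¹ * ∫ x in A, f x ∂P := by
  rw [ProbabilityTheory.cond, integral_smul_measure, ENNReal.toReal_inv, smul_eq_mul]
  rfl

theorem integrable_of_abs_le {α : Type*} [MeasurableSpace α] {ν : Measure α} [IsFiniteMeasure ν]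
    {f : α → ℝ} (hf : Measurable f) {C : ℝ} (h : ∀ x, |f x| ≤ C) : Integrable f ν :=
  Integrable.of_bound hf.aestronglyMeasurable C (ae_of_all _ fun x => by
    rw [Real.norm_eq_abs]; exact h x)

theorem exp_integral_le {α : Type*} [MeasurableSpace α] {ν : Measure α} [IsProbabilityMeasure ν]
    {f : α → ℝ} (hf : Measurable f) {C : ℝ} (h : ∀ x, |f x| ≤ C) :
    Real.exp (∫ x, f x ∂ν) ≤ ∫ x, Real.exp (f x) ∂ν :=
  convexOn_exp.map_integral_le Real.continuous_exp.continuousOn isClosed_univ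
    (ae_of_all _ fun _ => Set.mem_univ _) (integrable_of_abs_le hf h)
    (integrable_of_abs_le (C := Real.exp C) (Real.measurable_exp.comp hf) fun x => by
      simp only [Function.comp, abs_of_pos (Real.exp_pos _)]
      exact Real.exp_le_exp.2 ((le_abs_self _).trans (h x)))

/-- The deviation of the sample from the population, minus the offsets. -/
def devOff {ι J Ω : Type*} [Fintype ι] [MeasurableSpace Ω] (μ : Measure Ω) (g q : J → Ω → ℝ)
    (x : ι → Ω) (j : J) : ℝ :=
  (Fintype.card ι * ∫ ω, g j ω ∂μ - ∑ i, g j (x i)) / 2 - ∑ i, q j (x i)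
    - 5 / 2 * (Fintype.card ι * ∫ ω, q j ω ∂μ)

section Deviation

variable {ι : Type*} [Fintype ι] {J : Type*} [Finite J] [Nonempty J] {Ω : Type*}
  [MeasurableSpace Ω] (μ : Measure Ω) [IsProbabilityMeasure μ]

theorem abs_sum_comp_le {f : Ω → ℝ} {C : ℝ} (h : ∀ ω, |f ω| ≤ C) (x : ι → Ω) :
    |∑ i, f (x i)| ≤ Fintype.card ι * C := by
  refine (Finset.abs_sum_le_sum_abs _ _).trans ((Finset.sum_le_sum fun i _ => h (x i)).trans ?_)
  simp

/-- Change of measure: means under a conditioned product measure are controlled by exponential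
moments. -/
theorem integral_cond_pi_sum_le {A : Set (ι → Ω)}
    (hA0 : (Measure.pi fun _ : ι => μ) A ≠ 0) {f : Ω → ℝ} (hf : Measurable f) {C c : ℝ}
    (hC : ∀ ω, |f ω| ≤ C) (hc : ∫ ω, Real.exp (f ω) ∂μ ≤ Real.exp c) :
    ∫ x, ∑ i, f (x i) ∂(ProbabilityTheory.cond (Measure.pi fun _ : ι => μ) A) ≤
      -Real.log ((Measure.pi fun _ : ι => μ).real A) + Fintype.card ι * c := by
  set P := Measure.pi fun _ : ι => μ with hP
  have : IsProbabilityMeasure (ProbabilityTheory.cond P A) :=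
    ProbabilityTheory.cond_isProbabilityMeasure hA0
  have hpos : 0 < P.real A := ENNReal.toReal_pos hA0 (measure_ne_top _ _)
  have hm : Measurable fun x : ι → Ω => ∑ i, f (x i) := by fun_prop
  have h1 := exp_integral_le (ν := ProbabilityTheory.cond P A) hm (abs_sum_comp_le hC)
  rw [integral_cond_eq P A (fun x => Real.exp (∑ i, f (x i)))] at h1
  have hint : Integrable (fun x : ι → Ω => Real.exp (∑ i, f (x i))) P :=
    integrable_of_abs_le (C := Real.exp (Fintype.card ι * C)) (Real.measurable_exp.comp hm)
      fun x => by
        rw [abs_of_pos (Real.exp_pos _)]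
        exact Real.exp_le_exp.2 ((le_abs_self _).trans (abs_sum_comp_le hC x))
  have h2 : ∫ x in A, Real.exp (∑ i, f (x i)) ∂P ≤ Real.exp (Fintype.card ι * c) := by
    refine (setIntegral_le_integral hint (ae_of_all _ fun x => (Real.exp_pos _).le)).trans ?_
    simp only [Real.exp_sum]
    rw [hP, integral_fintype_prod_eq_pow (fun ω => Real.exp (f ω)), Real.exp_nat_mul]
    exact pow_le_pow_left₀ (integral_nonneg fun _ => (Real.exp_pos _).le) hc _
  have h3 := h1.trans (mul_le_mul_of_nonneg_left h2 (inv_nonneg.2 hpos.le))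
  rw [← Real.exp_log (inv_pos.2 hpos), ← Real.exp_add, Real.exp_le_exp, Real.log_inv] at h3
  exact h3

variable {g q : J → Ω → ℝ}

/-- A Bernstein-type bound: `|f| ≤ 1/2` keeps the centred variable in the range of `e^x ≤ 1 + x +
x²`, and the variance is at most the mean of `r`. -/
theorem integral_exp_mean_sub_le {f r : Ω → ℝ} (hf : Measurable f) (hr : Measurable r)
    (hf1 : ∀ ω, |f ω| ≤ 1 / 2) (hr1 : ∀ ω, r ω ≤ 1) (hfr : ∀ ω, f ω ^ 2 ≤ r ω) :
    ∫ ω, Real.exp (∫ ω', f ω' ∂μ - f ω) ∂μ ≤ Real.exp (∫ ω, r ω ∂μ) := by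
  set m := ∫ ω', f ω' ∂μ with hm
  have hm1 : |m| ≤ 1 / 2 := by
    have := norm_integral_le_of_norm_le_const (μ := μ) (f := f) (C := 1 / 2)
      (ae_of_all _ fun x => by rw [Real.norm_eq_abs]; exact hf1 x)
    simpa using this
  have hfi : Integrable f μ := integrable_of_abs_le hf hf1
  have hri : Integrable r μ := integrable_of_abs_le (C := 1) hr fun x => by
    rw [abs_of_nonneg ((sq_nonneg _).trans (hfr x))]; exact hr1 x
  have hpt : ∀ ω, Real.exp (m - f ω) ≤ 1 + (m - f ω) + (m ^ 2 - 2 * m * f ω + r ω) := by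
    intro ω
    have h1 := abs_le.1 hm1
    have h2 := abs_le.1 (hf1 ω)
    have := exp_le_quadratic (x := m - f ω) (abs_le.2 ⟨by linarith, by linarith⟩)
    nlinarith [hfr ω]
  have hi1 : Integrable (fun ω => m - f ω) μ := (integrable_const m).sub hfi
  have hi2 : Integrable (fun ω => m ^ 2 - 2 * m * f ω) μ :=
    (integrable_const _).sub (hfi.const_mul _)
  have hi3 : Integrable (fun ω => 1 + (m - f ω)) μ := (integrable_const _).add hi1
  have hi4 : Integrable (fun ω => m ^ 2 - 2 * m * f ω + r ω) μ := hi2.add hri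
  calc ∫ ω, Real.exp (m - f ω) ∂μ
      ≤ ∫ ω, (1 + (m - f ω) + (m ^ 2 - 2 * m * f ω + r ω)) ∂μ := by
        refine integral_mono_of_nonneg (ae_of_all _ fun _ => (Real.exp_pos _).le) (hi3.add hi4)
          (ae_of_all _ hpt)
    _ = 1 - m ^ 2 + ∫ ω, r ω ∂μ := by
        rw [integral_add hi3 hi4, integral_add (integrable_const _) hi1,
          integral_sub (integrable_const m) hfi, integral_add hi2 hri,
          integral_sub (integrable_const _) (hfi.const_mul _), integral_const_mul, ← hm]
        simp; ring
    _ ≤ 1 + ∫ ω, r ω ∂μ := by nlinarith [sq_nonneg m]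
    _ ≤ _ := by linarith [Real.add_one_le_exp (∫ ω, r ω ∂μ)]

theorem integral_exp_le_of_le_one {r : Ω → ℝ} (hr : Measurable r) (hr0 : ∀ ω, 0 ≤ r ω)
    (hr1 : ∀ ω, r ω ≤ 1) : ∫ ω, Real.exp (r ω) ∂μ ≤ Real.exp (2 * ∫ ω, r ω ∂μ) := by
  have hri : Integrable r μ := integrable_of_abs_le (C := 1) hr fun x => by
    rw [abs_of_nonneg (hr0 x)]; exact hr1 x
  have hpt : ∀ ω, Real.exp (r ω) ≤ 1 + 2 * r ω := by
    intro ω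
    have := exp_le_quadratic (x := r ω) (by rw [abs_of_nonneg (hr0 ω)]; exact hr1 ω)
    nlinarith [hr0 ω, hr1 ω]
  calc ∫ ω, Real.exp (r ω) ∂μ ≤ ∫ ω, (1 + 2 * r ω) ∂μ :=
        integral_mono_of_nonneg (ae_of_all _ fun _ => (Real.exp_pos _).le)
          ((integrable_const _).add (hri.const_mul _)) (ae_of_all _ hpt)
    _ = 1 + 2 * ∫ ω, r ω ∂μ := by
        rw [integral_add (integrable_const _) (hri.const_mul _), integral_const_mul]; simp
    _ ≤ _ := by linarith [Real.add_one_le_exp (2 * ∫ ω, r ω ∂μ)]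

theorem measurable_pairOff_right (hg : ∀ j, Measurable (g j)) (hq : ∀ j, Measurable (q j))
    (x : ι → Ω) : Measurable (pairOff g q x) := by
  unfold pairOff
  refine Real.measurable_exp.comp (Measurable.iSup fun j => Finset.measurable_sum _ fun i _ => ?_)
  have := hg j
  have := hq j
  fun_prop

theorem abs_pair_sum_le (hg1 : ∀ j ω, |g j ω| ≤ 1 / 2) (hq0 : ∀ j ω, 0 ≤ q j ω)
    (hq1 : ∀ j ω, q j ω ≤ 1) (x : ι → Ω) (j : J) (x' : ι → Ω) :
    |∑ i, ((g j (x' i) - g j (x i)) / 2 - q j (x i) - q j (x' i))| ≤ Fintype.card ι * 3 := by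
  refine (Finset.abs_sum_le_sum_abs _ _).trans ((Finset.sum_le_sum (g := fun _ => (3 : ℝ))
    fun i _ => ?_).trans (by simp))
  have a1 := abs_le.1 (hg1 j (x' i))
  have a2 := abs_le.1 (hg1 j (x i))
  have := hq0 j (x i)
  have := hq0 j (x' i)
  have := hq1 j (x i)
  have := hq1 j (x' i)
  exact abs_le.2 ⟨by linarith, by linarith⟩

theorem abs_pairOff_le (hg1 : ∀ j ω, |g j ω| ≤ 1 / 2) (hq0 : ∀ j ω, 0 ≤ q j ω)
    (hq1 : ∀ j ω, q j ω ≤ 1) (x x' : ι → Ω) :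
    |pairOff g q x x'| ≤ Real.exp (Fintype.card ι * 3) := by
  rw [pairOff, abs_of_pos (Real.exp_pos _)]
  exact exp_ciSup_le fun j => Real.exp_le_exp.2
    ((le_abs_self _).trans (abs_pair_sum_le hg1 hq0 hq1 x j x'))

/-- Jensen in the second sample, conditioned on `A`. Conditioning lowers the mean of `∑ g / 2` by at
most `(n E q - log P(A)) / 2` and keeps that of `∑ q` below `2 n E q - log P(A)`. Adding the two
explains the `5/2` in `devOff` and the `3/2` here. -/
theorem le_integral_pairOff (hg : ∀ j, Measurable (g j)) (hq : ∀ j, Measurable (q j))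
    (hg1 : ∀ j ω, |g j ω| ≤ 1 / 2) (hq0 : ∀ j ω, 0 ≤ q j ω) (hq1 : ∀ j ω, q j ω ≤ 1)
    (hgq : ∀ j ω, g j ω ^ 2 ≤ q j ω) {A : Set (ι → Ω)}
    (hA0 : (Measure.pi fun _ : ι => μ) A ≠ 0) (x : ι → Ω) (j : J) :
    Real.exp (devOff μ g q x j + 3 / 2 * Real.log ((Measure.pi fun _ : ι => μ).real A)) ≤
      ∫ x', pairOff g q x x' ∂(ProbabilityTheory.cond (Measure.pi fun _ : ι => μ) A) := by
  set P := Measure.pi fun _ : ι => μ with hP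
  set ν := ProbabilityTheory.cond P A with hν
  have : IsProbabilityMeasure ν := ProbabilityTheory.cond_isProbabilityMeasure hA0
  set n : ℝ := (Fintype.card ι : ℝ) with hn
  have hq1' : ∀ j ω, |q j ω| ≤ 1 := fun j ω => by rw [abs_of_nonneg (hq0 j ω)]; exact hq1 j ω
  have mG : Measurable fun x : ι → Ω => ∑ i, g j (x i) := by have := hg j; fun_prop
  have mQ : Measurable fun x : ι → Ω => ∑ i, q j (x i) := by have := hq j; fun_prop
  have iG : Integrable (fun x : ι → Ω => ∑ i, g j (x i)) ν :=
    integrable_of_abs_le mG (abs_sum_comp_le (hg1 j))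
  have iQ : Integrable (fun x : ι → Ω => ∑ i, q j (x i)) ν :=
    integrable_of_abs_le mQ (abs_sum_comp_le (hq1' j))
  -- lower bound for the mean of `g` and upper bound for the mean of `q`
  have hm1 : |∫ ω, g j ω ∂μ| ≤ 1 / 2 := by
    have := norm_integral_le_of_norm_le_const (μ := μ) (f := g j) (C := 1 / 2)
      (ae_of_all _ fun x => by rw [Real.norm_eq_abs]; exact hg1 j x)
    simpa using this
  have h1 := integral_cond_pi_sum_le μ hA0 (f := fun ω => ∫ ω', g j ω' ∂μ - g j ω)
    (measurable_const.sub (hg j)) (C := 1) (fun ω => by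
      have h1 := abs_le.1 hm1
      have h2 := abs_le.1 (hg1 j ω)
      exact abs_le.2 ⟨by linarith, by linarith⟩)
    (integral_exp_mean_sub_le μ (hg j) (hq j) (hg1 j) (hq1 j) (hgq j))
  have h2 := integral_cond_pi_sum_le μ hA0 (hq j) (hq1' j)
    (integral_exp_le_of_le_one μ (hq j) (hq0 j) (hq1 j))
  rw [← hP, ← hν] at h1 h2
  simp only [Finset.sum_sub_distrib, Finset.sum_const, Finset.card_univ, nsmul_eq_mul] at h1
  rw [integral_sub (integrable_const _) iG, integral_const] at h1
  simp only [probReal_univ, one_smul] at h1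
  rw [← hn] at h1 h2
  -- Jensen
  set D : (ι → Ω) → ℝ := fun x' => ∑ i, ((g j (x' i) - g j (x i)) / 2 - q j (x i) - q j (x' i))
    with hD
  have hDe : D = fun x' => (∑ i, g j (x' i)) / 2 - ((∑ i, g j (x i)) / 2 + ∑ i, q j (x i))
      - ∑ i, q j (x' i) := by
    funext x'
    simp only [hD, Finset.sum_sub_distrib, sub_div, Finset.sum_div]
    ring
  have hDi : ∫ x', D x' ∂ν = (∫ x', ∑ i, g j (x' i) ∂ν) / 2 -
      ((∑ i, g j (x i)) / 2 + ∑ i, q j (x i)) - ∫ x', ∑ i, q j (x' i) ∂ν := by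
    have i3 : Integrable (fun x' : ι → Ω => (∑ i, g j (x' i)) / 2 -
        ((∑ i, g j (x i)) / 2 + ∑ i, q j (x i))) ν := (iG.div_const 2).sub (integrable_const _)
    rw [hDe, integral_sub i3 iQ, integral_sub (iG.div_const 2) (integrable_const _), integral_div, integral_const]
    simp
  have mD : Measurable D := by rw [hDe]; fun_prop
  have hJ := exp_integral_le (ν := ν) mD (abs_pair_sum_le hg1 hq0 hq1 x j)
  have hle : ∀ x', Real.exp (D x') ≤ pairOff g q x x' := fun x' =>
    Real.exp_le_exp.2 (le_ciSup_finite
      (fun j => ∑ i, ((g j (x' i) - g j (x i)) / 2 - q j (x i) - q j (x' i))) j)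
  have ipair : Integrable (pairOff g q x) ν :=
    integrable_of_abs_le (measurable_pairOff_right hg hq x) (abs_pairOff_le hg1 hq0 hq1 x)
  refine le_trans (Real.exp_le_exp.2 ?_) (hJ.trans (integral_mono_of_nonneg
    (ae_of_all _ fun _ => (Real.exp_pos _).le) ipair (ae_of_all _ hle)))
  rw [hDi, devOff, ← hn]
  linarith

/-- Deviation bound on the event that the empirical exponential moment is small. -/
theorem measure_devOff_level_le (hg : ∀ j, Measurable (g j)) (hq : ∀ j, Measurable (q j))
    (hg1 : ∀ j ω, |g j ω| ≤ 1 / 2) (hq0 : ∀ j ω, 0 ≤ q j ω) (hq1 : ∀ j ω, q j ω ≤ 1)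
    (hgq : ∀ j ω, g j ω ^ 2 ≤ q j ω) (s : ℝ) :
    (Measure.pi fun _ : ι => μ) {x | expOff g q x ≤ Real.exp s ∧
      ∃ j, 11 / 2 * s < devOff μ g q x j} ≤ ENNReal.ofReal (Real.exp (-s)) := by
  set P := Measure.pi fun _ : ι => μ with hP
  set A : Set (ι → Ω) := {x | expOff g q x ≤ Real.exp s} with hA
  have hAm : MeasurableSet A := measurableSet_le (measurable_expOff hg hq) measurable_const
  -- If the event `A` is itself rare there is nothing to prove; otherwise `log P(A) > -s`, so
  -- conditioning on `A` is cheap.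
  rcases le_or_gt (P.real A) (Real.exp (-s)) with hp | hp
  · refine (measure_mono (fun x hx => hx.1)).trans (?_ : P A ≤ _)
    rw [← ENNReal.ofReal_toReal (measure_ne_top P A)]
    exact ENNReal.ofReal_le_ofReal hp
  have hp0 : 0 < P.real A := (Real.exp_pos _).trans hp
  have hA0 : P A ≠ 0 := fun h => by simp [Measure.real, h] at hp0
  have : IsProbabilityMeasure (ProbabilityTheory.cond P A) :=
    ProbabilityTheory.cond_isProbabilityMeasure hA0
  have hlog : -s < Real.log (P.real A) := (Real.lt_log_iff_exp_lt hp0).2 hp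
  set F : (ι → Ω) → ENNReal := fun x => ∫⁻ x' in A, ENNReal.ofReal (pairOff g q x x') ∂P with hF
  have hpm := ENNReal.measurable_ofReal.comp (measurable_pairOff (ι := ι) hg hq)
  have hFm : Measurable F := hpm.lintegral_prod_right'
  -- Removing the normalization by `P(A)` adds another `log P(A)`, so the exponent exceeds `11/2 s -
  -- 5/2 s = 3 s`.
  have hbad : ∀ x, (∃ j, 11 / 2 * s < devOff μ g q x j) → ENNReal.ofReal (Real.exp (3 * s)) ≤ F x := by
    rintro x ⟨j, hj⟩
    have h := le_integral_pairOff μ hg hq hg1 hq0 hq1 hgq hA0 x j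
    rw [← hP, integral_cond_eq, inv_mul_eq_div, le_div_iff₀ hp0] at h
    have hi : Integrable (fun x' => pairOff g q x x') (P.restrict A) := by
      by_contra hcon
      rw [integral_undef hcon] at h
      exact absurd h (not_le.2 (mul_pos (Real.exp_pos _) hp0))
    have hFx : F x = ENNReal.ofReal (∫ x' in A, pairOff g q x x' ∂P) :=
      (ofReal_integral_eq_lintegral_ofReal hi (ae_of_all _ fun _ => (Real.exp_pos _).le)).symm
    rw [hFx]
    refine ENNReal.ofReal_le_ofReal (le_trans ?_ h)
    nth_rw 2 [← Real.exp_log hp0]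
    rw [← Real.exp_add, Real.exp_le_exp]
    linarith
  -- On `A × A` both denominators are at most `e^s`, so the ratio bound loses `e^{2s}`; Markov at
  -- level `e^{3s}` leaves `e^{-s}`.
  have hup : ∫⁻ x in A, F x ∂P ≤ ENNReal.ofReal (Real.exp (2 * s)) := by
    have h := lintegral_pair_ratio_le (ι := ι) μ hg hq
    rw [← hP] at h
    calc ∫⁻ x in A, F x ∂P
        ≤ ∫⁻ x in A, ∫⁻ x' in A, ENNReal.ofReal (Real.exp (2 * s)) * ENNReal.ofReal
            (pairOff g q x x' / (expOff g q x * expOff g q x')) ∂P ∂P := by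
          refine setLIntegral_mono' hAm fun x hx => setLIntegral_mono' hAm fun x' hx' => ?_
          rw [← ENNReal.ofReal_mul (Real.exp_pos _).le]
          refine ENNReal.ofReal_le_ofReal ?_
          have hE := expOff_pos g q x
          have hE' := expOff_pos g q x'
          rw [mul_div_assoc', le_div_iff₀ (mul_pos hE hE'), mul_comm (Real.exp (2 * s))]
          refine mul_le_mul_of_nonneg_left ?_ (Real.exp_pos _).le
          rw [two_mul, Real.exp_add]
          exact mul_le_mul hx hx' hE'.le (Real.exp_pos _).le
      _ ≤ ∫⁻ x, ∫⁻ x', ENNReal.ofReal (Real.exp (2 * s)) * ENNReal.ofReal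
            (pairOff g q x x' / (expOff g q x * expOff g q x')) ∂P ∂P :=
          (setLIntegral_le_lintegral _ _).trans
            (lintegral_mono fun x => setLIntegral_le_lintegral _ _)
      _ = ENNReal.ofReal (Real.exp (2 * s)) * ∫⁻ x, ∫⁻ x', ENNReal.ofReal
            (pairOff g q x x' / (expOff g q x * expOff g q x')) ∂P ∂P := by
          simp only [lintegral_const_mul' _ _ ENNReal.ofReal_ne_top]
      _ ≤ ENNReal.ofReal (Real.exp (2 * s)) * 1 := by gcongr
      _ = _ := mul_one _
  have hmk := mul_meas_ge_le_lintegral (μ := P.restrict A) hFm (ENNReal.ofReal (Real.exp (3 * s)))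
  have hsub : P {x | expOff g q x ≤ Real.exp s ∧ ∃ j, 11 / 2 * s < devOff μ g q x j} ≤
      P.restrict A {x | ENNReal.ofReal (Real.exp (3 * s)) ≤ F x} := by
    rw [Measure.restrict_apply' hAm]
    exact measure_mono fun x hx => ⟨hbad x hx.2, hx.1⟩
  have h5 := (mul_le_mul_right hsub (ENNReal.ofReal (Real.exp (3 * s)))).trans (hmk.trans hup)
  have h6 : ENNReal.ofReal (Real.exp (2 * s)) =
      ENNReal.ofReal (Real.exp (3 * s)) * ENNReal.ofReal (Real.exp (-s)) := by
    rw [← ENNReal.ofReal_mul (Real.exp_pos _).le, ← Real.exp_add]; ring_nf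
  rw [h6] at h5
  exact (ENNReal.mul_le_mul_iff_right (by simpa using Real.exp_pos (3 * s))
    ENNReal.ofReal_ne_top).1 h5

/-- Uniform deviation bound in terms of the empirical exponential moment. -/
theorem measure_devOff_le (hg : ∀ j, Measurable (g j)) (hq : ∀ j, Measurable (q j))
    (hg1 : ∀ j ω, |g j ω| ≤ 1 / 2) (hq0 : ∀ j ω, 0 ≤ q j ω) (hq1 : ∀ j ω, q j ω ≤ 1)
    (hgq : ∀ j ω, g j ω ^ 2 ≤ q j ω) {t : ℝ} (ht : 1 ≤ t) :
    (Measure.pi fun _ : ι => μ) {x | ∃ S, 0 ≤ S ∧ expOff g q x ≤ Real.exp S ∧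
      ∃ j, 6 * (S + t) < devOff μ g q x j} ≤ ENNReal.ofReal (2 * Real.exp (-t)) := by
  have ht0 : 0 < t := by linarith
  -- Since `S` may depend on the sample, it is discretized to multiples of `t`; rounding up turns
  -- `11/2` into `6 (S + t)`. With `t ≥ 1` the probabilities of the levels are dominated by a
  -- geometric series of ratio `1/2`.
  have hsub : {x : ι → Ω | ∃ S, 0 ≤ S ∧ expOff g q x ≤ Real.exp S ∧
      ∃ j, 6 * (S + t) < devOff μ g q x j} ⊆ ⋃ m : ℕ, {x | expOff g q x ≤ Real.exp ((m + 1) * t) ∧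
      ∃ j, 11 / 2 * ((m + 1) * t) < devOff μ g q x j} := by
    rintro x ⟨S, hS, hE, j, hj⟩
    refine Set.mem_iUnion.2 ⟨⌊S / t⌋₊, ?_, j, ?_⟩
    · refine hE.trans (Real.exp_le_exp.2 ?_)
      have := (Nat.lt_floor_add_one (S / t)).le
      rwa [div_le_iff₀ ht0] at this
    · have := Nat.floor_le (div_nonneg hS ht0.le)
      rw [le_div_iff₀ ht0] at this
      nlinarith
  refine (measure_mono hsub).trans ((measure_iUnion_le _).trans ?_)
  have hterm : ∀ m : ℕ, (Measure.pi fun _ : ι => μ) {x | expOff g q x ≤ Real.exp ((m + 1) * t) ∧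
      ∃ j, 11 / 2 * ((m + 1) * t) < devOff μ g q x j} ≤
      ENNReal.ofReal (Real.exp (-t)) * 2⁻¹ ^ m := by
    intro m
    refine (measure_devOff_level_le μ hg hq hg1 hq0 hq1 hgq _).trans ?_
    have h2 : (2⁻¹ : ENNReal) ^ m = ENNReal.ofReal ((1 / 2) ^ m) := by
      rw [ENNReal.ofReal_pow (by norm_num), one_div, ENNReal.ofReal_inv_of_pos (by norm_num)]
      simp
    rw [h2, ← ENNReal.ofReal_mul (Real.exp_pos _).le]
    refine ENNReal.ofReal_le_ofReal ?_
    rw [show -((m + 1) * t) = -t + m * (-t) by ring, Real.exp_add, Real.exp_nat_mul]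
    gcongr
    exact (Real.exp_le_exp.2 (by linarith)).trans exp_neg_one_le_half
  refine (ENNReal.tsum_le_tsum hterm).trans (le_of_eq ?_)
  rw [ENNReal.tsum_mul_left, ENNReal.tsum_geometric_two, mul_comm, ENNReal.ofReal_mul (by norm_num)]
  simp

end Deviation

/-! ### Uniform deviations over separable classes -/

section Classes

variable {ι : Type*} [Fintype ι] {Ω : Type*} [MeasurableSpace Ω] (μ : Measure Ω)
  [IsProbabilityMeasure μ] {X : Type*} [TopologicalSpace X] [FirstCountableTopology X]
  [TopologicalSpace.SeparableSpace X] [Nonempty X]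

theorem continuous_devOff {g q : X → Ω → ℝ} (hg : ∀ p, Measurable (g p))
    (hq : ∀ p, Measurable (q p)) (hg1 : ∀ p ω, |g p ω| ≤ 1 / 2) (hq0 : ∀ p ω, 0 ≤ q p ω)
    (hq1 : ∀ p ω, q p ω ≤ 1) (cg : ∀ ω, Continuous fun p => g p ω)
    (cq : ∀ ω, Continuous fun p => q p ω) (x : ι → Ω) : Continuous (devOff μ g q x) := by
  have h1 : Continuous fun p => ∫ ω, g p ω ∂μ :=
    continuous_of_dominated (fun p => (hg p).aestronglyMeasurable) (bound := fun _ => 1 / 2)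
      (fun p => ae_of_all _ fun ω => by rw [Real.norm_eq_abs]; exact hg1 p ω)
      (integrable_const _) (ae_of_all _ cg)
  have h2 : Continuous fun p => ∫ ω, q p ω ∂μ :=
    continuous_of_dominated (fun p => (hq p).aestronglyMeasurable) (bound := fun _ => 1)
      (fun p => ae_of_all _ fun ω => by
        rw [Real.norm_eq_abs, abs_of_nonneg (hq0 p ω)]; exact hq1 p ω)
      (integrable_const _) (ae_of_all _ cq)
  have h3 : Continuous fun p => ∑ i, g p (x i) := continuous_finsetSum _ fun i _ => cg _
  have h4 : Continuous fun p => ∑ i, q p (x i) := continuous_finsetSum _ fun i _ => cq _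
  unfold devOff
  fun_prop

/-- Uniform deviation bound over a class indexed by a separable space. -/
theorem measure_devOff_class_le {g q : X → Ω → ℝ} (hg : ∀ p, Measurable (g p))
    (hq : ∀ p, Measurable (q p)) (hg1 : ∀ p ω, |g p ω| ≤ 1 / 2) (hq0 : ∀ p ω, 0 ≤ q p ω)
    (hq1 : ∀ p ω, q p ω ≤ 1) (hgq : ∀ p ω, g p ω ^ 2 ≤ q p ω)
    (cg : ∀ ω, Continuous fun p => g p ω) (cq : ∀ ω, Continuous fun p => q p ω)
    {t : ℝ} (ht : 1 ≤ t) :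
    (Measure.pi fun _ : ι => μ) {x | ∃ S, 0 ≤ S ∧
      (∀ (N : ℕ) (u : Fin (N + 1) → X),
        expOff (fun j => g (u j)) (fun j => q (u j)) x ≤ Real.exp S) ∧
      ∃ p, 6 * (S + t) < devOff μ g q x p} ≤ ENNReal.ofReal (2 * Real.exp (-t)) := by
  set d := TopologicalSpace.denseSeq X
  set B : ℕ → Set (ι → Ω) := fun N => {x | ∃ S, 0 ≤ S ∧
      (∀ (N : ℕ) (u : Fin (N + 1) → X),
        expOff (fun j => g (u j)) (fun j => q (u j)) x ≤ Real.exp S) ∧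
      ∃ k : Fin (N + 1), 6 * (S + t) < devOff μ g q x (d k)} with hB
  have hmono : Monotone B := by
    rintro N M hNM x ⟨S, hS, hE, k, hk⟩
    exact ⟨S, hS, hE, ⟨k, by omega⟩, hk⟩
  have hsub : {x : ι → Ω | ∃ S, 0 ≤ S ∧ (∀ (N : ℕ) (u : Fin (N + 1) → X),
        expOff (fun j => g (u j)) (fun j => q (u j)) x ≤ Real.exp S) ∧
      ∃ p, 6 * (S + t) < devOff μ g q x p} ⊆ ⋃ N, B N := by
    rintro x ⟨S, hS, hE, p, hp⟩
    -- Strict exceedance is an open condition, hence already occurs on the dense sequence; the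
    -- initial segments of that sequence give increasing events to which the finite case applies.
    have hopen : IsOpen {p | 6 * (S + t) < devOff μ g q x p} :=
      isOpen_lt continuous_const (continuous_devOff μ hg hq hg1 hq0 hq1 cg cq x)
    obtain ⟨_, hk, ⟨k, rfl⟩⟩ := (TopologicalSpace.denseRange_denseSeq X).inter_open_nonempty
      _ hopen ⟨p, hp⟩
    exact Set.mem_iUnion.2 ⟨k, S, hS, hE, ⟨k, by omega⟩, hk⟩
  refine (measure_mono hsub).trans ?_
  rw [hmono.measure_iUnion]
  refine iSup_le fun N => ?_
  refine le_trans (measure_mono ?_) (measure_devOff_le (ι := ι) μ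
    (g := fun k : Fin (N + 1) => g (d k)) (q := fun k : Fin (N + 1) => q (d k))
    (fun _ => hg _) (fun _ => hq _) (fun _ => hg1 _) (fun _ => hq0 _) (fun _ => hq1 _)
    (fun _ => hgq _) ht)
  rintro x ⟨S, hS, hE, k, hk⟩
  exact ⟨S, hS, hE N _, k, hk⟩

/-- The local averages at radius `σ` of all finite subfamilies are small. -/
def LocallySmall (F : X → Ω → ℝ) (x : ι → Ω) (σ : ℝ) : Prop :=
  ∀ (N : ℕ) (u : Fin (N + 1) → X), signAvg (fun ε : ι → Bool =>
    localSup (fun j i => F (u j) (x i)) σ (fun i => sgn (ε i))) ≤ σ ^ 2 / 160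

theorem expOff_le_of_locallySmall {F : X → Ω → ℝ} {x : ι → Ω} {σ : ℝ} (hσ : 640 ≤ σ)
    (h : LocallySmall F x σ) {N : ℕ} (u : Fin (N + 1) → X) :
    expOff (fun j ω => F (u j) ω / 2560) (fun j ω => F (u j) ω ^ 2 / 102400) x ≤
      Real.exp (σ ^ 2) :=
  signAvg_exp_offset_le (fun j i => F (u j) (x i)) hσ (h N u)

/-- On `[-1, 1]` the square is `2`-Lipschitz, so half of it is a contraction of the identity; the
offsets on both sides are the same. Both signs are needed because the deviation bound is one-sided.
-/
theorem expOff_sq_le {F : X → Ω → ℝ} (hF : ∀ p ω, |F p ω| ≤ 1) (b : Bool) {x : ι → Ω} {N : ℕ}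
    (u : Fin (N + 1) → X) :
    expOff (fun j ω => sgn b * F (u j) ω ^ 2 / 5120) (fun j ω => F (u j) ω ^ 2 / 102400) x ≤
      expOff (fun j ω => F (u j) ω / 2560) (fun j ω => F (u j) ω ^ 2 / 102400) x := by
  have h := signAvg_contraction (fun j i => sgn b * F (u j) (x i) ^ 2 / 5120)
    (fun j i => F (u j) (x i) / 2560) (fun j => -∑ i, F (u j) (x i) ^ 2 / 102400)
    (fun j i => by
      rw [abs_div, abs_div, abs_mul, abs_sgn, one_mul, abs_pow, abs_of_pos (by norm_num : (0:ℝ) < 5120),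
        abs_of_pos (by norm_num : (0:ℝ) < 2560)]
      have := hF (u j) (x i)
      nlinarith [abs_nonneg (F (u j) (x i))])
    (fun j k i => by
      have e1 : sgn b * F (u j) (x i) ^ 2 / 5120 - sgn b * F (u k) (x i) ^ 2 / 5120 =
        sgn b * ((F (u j) (x i) - F (u k) (x i)) * (F (u j) (x i) + F (u k) (x i))) / 5120 := by ring
      have e2 : F (u j) (x i) / 2560 - F (u k) (x i) / 2560 =
        (F (u j) (x i) - F (u k) (x i)) / 2560 := by ring
      rw [e1, e2, abs_div, abs_div, abs_mul, abs_sgn, one_mul, abs_mul,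
        abs_of_pos (by norm_num : (0:ℝ) < 5120), abs_of_pos (by norm_num : (0:ℝ) < 2560)]
      have h2 : |F (u j) (x i) + F (u k) (x i)| ≤ 2 :=
        (abs_add_le _ _).trans (by linarith [hF (u j) (x i), hF (u k) (x i)])
      nlinarith [abs_nonneg (F (u j) (x i) - F (u k) (x i))])
  simp only [← sub_eq_add_neg, ← Finset.sum_sub_distrib] at h
  exact h

/-- The three uniform deviation inequalities for a class of functions bounded by one. -/
def DeviationBound (F : X → Ω → ℝ) (x : ι → Ω) (K : ℝ) : Prop :=
  ∀ p, Fintype.card ι * ∫ ω, F p ω ∂μ - ∑ i, F p (x i) ≤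
      (∑ i, F p (x i) ^ 2) / 20 + (Fintype.card ι * ∫ ω, F p ω ^ 2 ∂μ) / 8 + 30720 * K ∧
    3 / 4 * (Fintype.card ι * ∫ ω, F p ω ^ 2 ∂μ) ≤ 11 / 10 * (∑ i, F p (x i) ^ 2) + 61440 * K ∧
    9 / 10 * (∑ i, F p (x i) ^ 2) ≤ 5 / 4 * (Fintype.card ι * ∫ ω, F p ω ^ 2 ∂μ) + 61440 * K

/-- The deviation bound is applied to `F / 2560` and to `± F² / 5120`, at cost `2 e^{-t}` each.
Multiplying by `5120` and `10240` respectively gives the coefficients of `DeviationBound`. The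
radius `σ` is quantified inside the event, so it may be chosen after seeing the data. -/
theorem measure_not_deviationBound_le {F : X → Ω → ℝ} (hF : ∀ p, Measurable (F p))
    (hF1 : ∀ p ω, |F p ω| ≤ 1) (cF : ∀ ω, Continuous fun p => F p ω) {t : ℝ} (ht : 1 ≤ t) :
    (Measure.pi fun _ : ι => μ) {x | ∃ σ, 640 ≤ σ ∧ LocallySmall F x σ ∧
      ¬ DeviationBound μ F x (σ ^ 2 + t)} ≤ ENNReal.ofReal (6 * Real.exp (-t)) := by
  have hsq : ∀ p ω, F p ω ^ 2 ≤ 1 := fun p ω => by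
    rw [← sq_abs]; nlinarith [hF1 p ω, abs_nonneg (F p ω)]
  have hq : ∀ p, Measurable fun ω => F p ω ^ 2 / 102400 := fun p => by
    have := hF p; fun_prop
  have cq : ∀ ω, Continuous fun p => F p ω ^ 2 / 102400 := fun ω => by
    have := cF ω; fun_prop
  have hlin := measure_devOff_class_le (ι := ι) μ (g := fun p ω => F p ω / 2560)
    (q := fun p ω => F p ω ^ 2 / 102400) (fun p => by have := hF p; fun_prop) hq
    (fun p ω => by
      rw [abs_div, abs_of_pos (by norm_num : (0:ℝ) < 2560)]; linarith [hF1 p ω])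
    (fun p ω => by positivity) (fun p ω => by linarith [hsq p ω])
    (fun p ω => by rw [div_pow]; nlinarith [sq_nonneg (F p ω)])
    (fun ω => by have := cF ω; fun_prop) cq ht
  have hquad : ∀ b, _ := fun b => measure_devOff_class_le (ι := ι) μ
    (g := fun p ω => sgn b * F p ω ^ 2 / 5120)
    (q := fun p ω => F p ω ^ 2 / 102400) (fun p => by have := hF p; fun_prop) hq
    (fun p ω => by
      rw [abs_div, abs_mul, abs_sgn, one_mul, abs_of_pos (by norm_num : (0:ℝ) < 5120),
        abs_of_nonneg (sq_nonneg _)]; linarith [hsq p ω])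
    (fun p ω => by positivity) (fun p ω => by linarith [hsq p ω])
    (fun p ω => by
      rw [div_pow, mul_pow, sgn_sq, one_mul]; nlinarith [sq_nonneg (F p ω), hsq p ω])
    (fun ω => by have := cF ω; fun_prop) cq ht
  have hsplit : ENNReal.ofReal (6 * Real.exp (-t)) = ENNReal.ofReal (2 * Real.exp (-t)) +
      (ENNReal.ofReal (2 * Real.exp (-t)) + ENNReal.ofReal (2 * Real.exp (-t))) := by
    rw [← ENNReal.ofReal_add (by positivity) (by positivity),
      ← ENNReal.ofReal_add (by positivity) (by positivity)]
    ring_nf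
  rw [hsplit]
  refine le_trans (measure_mono ?_) ((measure_union_le _ _).trans (add_le_add hlin
    ((measure_union_le _ _).trans (add_le_add (hquad true) (hquad false)))))
  rintro x ⟨σ, hσ, hL, hD⟩
  have hE := fun (N : ℕ) (u : Fin (N + 1) → X) => expOff_le_of_locallySmall hσ hL u
  by_contra hcon
  simp only [Set.mem_union, not_or] at hcon
  obtain ⟨h1, h2, h3⟩ := hcon
  simp only [Set.mem_ofPred_eq, not_exists, not_and, not_lt] at h1 h2 h3
  refine hD fun p => ?_
  have a1 := h1 _ (sq_nonneg σ) hE p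
  have a2 := h2 _ (sq_nonneg σ) (fun N u => (expOff_sq_le hF1 true u).trans (hE N u)) p
  have a3 := h3 _ (sq_nonneg σ) (fun N u => (expOff_sq_le hF1 false u).trans (hE N u)) p
  simp only [devOff, integral_div, ← Finset.sum_div] at a1 a2 a3
  simp only [sgn, if_true, Bool.false_eq_true, if_false, one_mul, neg_one_mul, integral_neg,
    Finset.sum_neg_distrib] at a2 a3
  refine ⟨?_, ?_, ?_⟩ <;> linarith

end Classes

/-! ### Subsamples selected by an event -/

section Subsample

variable {Ω : Type*} [MeasurableSpace Ω]

theorem pi_restrict_eq_smul_pi_cond {ι : Type*} [Fintype ι] (μ : Measure Ω)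
    [IsProbabilityMeasure μ] {E : Set Ω} (hE0 : μ E ≠ 0) :
    Measure.pi (fun _ : ι => μ.restrict E) =
      μ E ^ Fintype.card ι • Measure.pi (fun _ : ι => ProbabilityTheory.cond μ E) := by
  have hr : ∀ s, μ.restrict E s = μ E * ProbabilityTheory.cond μ E s := by
    intro s
    rw [ProbabilityTheory.cond, Measure.smul_apply, smul_eq_mul, ← mul_assoc,
      ENNReal.mul_inv_cancel hE0 (measure_ne_top _ _), one_mul]
  refine Measure.pi_eq fun s _ => ?_
  rw [Measure.smul_apply, Measure.pi_pi, smul_eq_mul]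
  simp only [hr, Finset.prod_mul_distrib, Finset.prod_const, Finset.card_univ]

open Classical in
/-- An event about the subsample of the observations falling into `E` is at most as likely as for
independent observations from the conditional law. -/
theorem measure_subsample_le {T : ℕ} (μ : Measure Ω) [IsProbabilityMeasure μ] {E : Set Ω}
    (hE : MeasurableSet E) (hE0 : μ E ≠ 0) (Bad : ∀ p : Fin T → Prop, Set ({t // p t} → Ω))
    {β : ENNReal} (h : ∀ p : Fin T → Prop,
      Measure.pi (fun _ : {t // p t} => ProbabilityTheory.cond μ E) (Bad p) ≤ β) :
    Measure.pi (fun _ : Fin T => μ)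
      {D | (fun t : {t // D t ∈ E} => D t) ∈ Bad (fun t => D t ∈ E)} ≤ β := by
  set P := Measure.pi (fun _ : Fin T => μ) with hP
  -- `R s`: the observations in `E` are exactly those indexed by `s`, and the bad event holds for
  -- them. On it the product law factors, and the selected coordinates follow the conditional law.
  set R : Finset (Fin T) → Set (Fin T → Ω) := fun s =>
    (MeasurableEquiv.piEquivPiSubtypeProd (fun _ : Fin T => Ω) (· ∈ s)) ⁻¹'
      ((Bad (· ∈ s) ∩ Set.univ.pi fun _ => E) ×ˢ (Set.univ.pi fun _ => Eᶜ)) with hR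
  have hsub : {D : Fin T → Ω | (fun t : {t // D t ∈ E} => D t) ∈ Bad (fun t => D t ∈ E)} ⊆
      ⋃ s, R s := by
    intro D hD
    refine Set.mem_iUnion.2 ⟨Finset.univ.filter fun t => D t ∈ E, ?_⟩
    have hp : (fun t => D t ∈ E) = (· ∈ Finset.univ.filter fun t => D t ∈ E) := by
      funext t; simp
    refine ⟨⟨?_, ?_⟩, ?_⟩
    · have key : ∀ p : Fin T → Prop, (fun t => D t ∈ E) = p →
          (fun t : {t // p t} => D t) ∈ Bad p := by
        rintro p rfl; exact hD
      exact key _ hp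
    · rintro ⟨t, ht⟩ _
      exact (Finset.mem_filter.1 ht).2
    · rintro ⟨t, ht⟩ _
      simp only [Finset.mem_filter, Finset.mem_univ, true_and] at ht
      exact ht
  have hRs : ∀ s, P (R s) ≤ β * (μ E ^ s.card * μ Eᶜ ^ (Fintype.card (Fin T) - s.card)) := by
    intro s
    have hc : Fintype.card {t // t ∈ s} = s.card := by simp
    have hc' : Fintype.card {t // ¬ t ∈ s} = Fintype.card (Fin T) - s.card := by
      rw [Fintype.card_subtype_compl, hc]
    rw [← hc', ← hc]
    have key : ∀ p : Fin T → Prop, P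
        ((MeasurableEquiv.piEquivPiSubtypeProd (fun _ : Fin T => Ω) p) ⁻¹'
          ((Bad p ∩ Set.univ.pi fun _ => E) ×ˢ (Set.univ.pi fun _ => Eᶜ))) ≤
        β * (μ E ^ Fintype.card {t // p t} * μ Eᶜ ^ Fintype.card {t // ¬ p t}) := by
      intro p
      have hmp := measurePreserving_piEquivPiSubtypeProd (fun _ : Fin T => μ) p
      rw [hP, hmp.measure_preimage_equiv, Measure.prod_prod, Measure.pi_pi,
        ← Measure.restrict_apply' (MeasurableSet.univ_pi fun _ => hE), Measure.restrict_pi_pi,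
        pi_restrict_eq_smul_pi_cond μ hE0, Measure.smul_apply, smul_eq_mul, Finset.prod_const,
        Finset.card_univ]
      calc _ ≤ μ E ^ Fintype.card {t // p t} * β * μ Eᶜ ^ Fintype.card {t // ¬ p t} := by
            gcongr; exact h _
        _ = _ := by ring
    convert key (· ∈ s) using 3 <;> congr!
  refine (measure_mono hsub).trans ((measure_iUnion_le _).trans ?_)
  rw [tsum_fintype]
  refine (Finset.sum_le_sum fun s _ => hRs s).trans ?_
  -- By the binomial theorem the weights of all index sets add up to `(μ E + μ Eᶜ)^T = 1`.
  rw [← Finset.mul_sum, Fintype.sum_pow_mul_eq_add_pow, prob_add_prob_compl hE, one_pow, mul_one]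

end Subsample

/-! ### From critical radii to local smallness -/

section CriticalRadius

variable {ι : Type*} [Fintype ι] {Ω : Type*} {X : Type*}

theorem locRademacher_eq_signAvg (x : ι → Ω) (G : Set (Ω → ℝ)) (η : ℝ) :
    locRademacher x G η = signAvg (fun ε : ι → Bool => sSup {r | ∃ f ∈ G,
      √(empMean x (fun ω => f ω ^ 2)) ≤ η ∧
        r = (∑ i, sgn (ε i) * f (x i)) / Fintype.card ι}) := rfl

theorem bddAbove_locRademacher {x : ι → Ω} {G : Set (Ω → ℝ)} {B : ℝ}
    (hG : ∀ f ∈ G, ∀ i, |f (x i)| ≤ B) (η : ℝ) (ε : ι → Bool) :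
    BddAbove {r | ∃ f ∈ G, √(empMean x (fun ω => f ω ^ 2)) ≤ η ∧
        r = (∑ i, sgn (ε i) * f (x i)) / Fintype.card ι} := by
  refine ⟨(∑ _i : ι, B) / Fintype.card ι, ?_⟩
  rintro r ⟨f, hf, -, rfl⟩
  refine div_le_div_of_nonneg_right (Finset.sum_le_sum fun i _ => ?_) (Nat.cast_nonneg _)
  refine (le_abs_self _).trans ?_
  rw [abs_mul, abs_sgn, one_mul]
  exact hG f hf i

/-- Star-shapedness: scaling a member of norm at most `σ = √n r` by `κ = (ρ / B) / r ≤ 1` brings it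
into the ball of the critical radius, so the local average at `σ` is at most `n / (κ B)` times that
at `ρ`. The result is `n (ρ / B) r`, which is at most `σ² / 160` as soon as `r ≥ 160 ρ / B`. -/
theorem locallySmall_of_isCriticalRadius [Nonempty ι] {F : X → Ω → ℝ} {G : Set (Ω → ℝ)}
    {x : ι → Ω} {B ρ r : ℝ} (hB : 0 < B) (hcr : IsCriticalRadius x G B ρ)
    (hG : ∀ f ∈ G, ∀ i, |f (x i)| ≤ B)
    (hstar : ∀ p, ∀ s, 0 ≤ s → s ≤ 1 → ∃ f ∈ G, ∀ i, f (x i) = s * (B * F p (x i)))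
    (hr : 160 * (ρ / B) ≤ r) : LocallySmall F x (√(Fintype.card ι) * r) := by
  obtain ⟨hρ, hrad⟩ := hcr
  set n : ℝ := (Fintype.card ι : ℝ) with hn
  have hn0 : 0 < n := by rw [hn]; exact_mod_cast Fintype.card_pos
  have hρB : 0 < ρ / B := div_pos hρ hB
  have hr0 : 0 < r := by linarith
  set κ := ρ / B / r with hκ
  have hκ0 : 0 < κ := div_pos hρB hr0
  have hκ1 : κ ≤ 1 := by rw [hκ, div_le_one hr0]; linarith
  have hκr : κ * r = ρ / B := by rw [hκ]; field_simp
  have hsn : √n * √n = n := Real.mul_self_sqrt hn0.le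
  have hsn0 : 0 < √n := Real.sqrt_pos.2 hn0
  intro N u
  set σ := √n * r with hσ
  set v : Fin (N + 1) → ι → ℝ := fun j i => F (u j) (x i) with hv
  set S : (ι → Bool) → ℝ := fun ε => sSup {r | ∃ f ∈ G, √(empMean x (fun ω => f ω ^ 2)) ≤ ρ ∧
        r = (∑ i, sgn (ε i) * f (x i)) / Fintype.card ι} with hS
  have hmem : ∀ (ε : ι → Bool) (p : X) (s : ℝ), 0 ≤ s → s ≤ 1 →
      s * (B * √(∑ i, F p (x i) ^ 2)) ≤ √n * ρ →
      s * B * (∑ i, sgn (ε i) * F p (x i)) / n ≤ S ε := by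
    intro ε p s hs0 hs1 hs
    obtain ⟨f, hf, hfx⟩ := hstar p s hs0 hs1
    refine le_csSup (bddAbove_locRademacher hG ρ ε) ⟨f, hf, ?_, ?_⟩
    · have : empMean x (fun ω => f ω ^ 2) = (s * B) ^ 2 * (∑ i, F p (x i) ^ 2) / n := by
        simp only [empMean, hfx, ← hn, Finset.mul_sum]
        congr 1
        exact Finset.sum_congr rfl fun i _ => by ring
      rw [this, Real.sqrt_div' _ hn0.le, Real.sqrt_mul (sq_nonneg _),
        Real.sqrt_sq (by positivity), div_le_iff₀ hsn0]
      linarith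
    · simp only [hfx, ← hn, Finset.mul_sum]
      congr 1
      exact Finset.sum_congr rfl fun i _ => by ring
  have hS0 : ∀ ε, 0 ≤ S ε := by
    intro ε
    have := hmem ε (u 0) 0 le_rfl zero_le_one (by simp; positivity)
    simpa using this
  have hpt : ∀ ε : ι → Bool, localSup v σ (fun i => sgn (ε i)) ≤ n / (κ * B) * S ε := by
    intro ε
    have hnn : 0 ≤ n / (κ * B) * S ε := mul_nonneg (by positivity) (hS0 ε)
    refine Real.iSup_le (fun j => max_le hnn ?_) hnn
    set V := √(∑ i, v j i ^ 2) with hV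
    set c := min 1 (σ / V) with hc
    have hc0 : 0 ≤ c := le_min zero_le_one (by positivity)
    have hcV : c * V ≤ σ := by
      rcases (Real.sqrt_nonneg (∑ i, v j i ^ 2)).eq_or_lt with h | h
      · rw [hV, ← h]; simp only [mul_zero]; positivity
      · calc _ ≤ (σ / V) * V := by gcongr; exact min_le_right _ _
          _ = σ := by rw [← hV] at h; field_simp
    have h := hmem ε (u j) (κ * c) (by positivity) (mul_le_one₀ hκ1 hc0 (min_le_left _ _)) (by
      calc κ * c * (B * V) = κ * B * (c * V) := by ring
        _ ≤ κ * B * σ := by gcongr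
        _ = √n * (B * (κ * r)) := by rw [hσ]; ring
        _ = √n * ρ := by rw [hκr]; field_simp
        _ ≤ _ := le_rfl)
    calc c * ∑ i, sgn (ε i) * v j i
        = n / (κ * B) * (κ * c * B * (∑ i, sgn (ε i) * F (u j) (x i)) / n) := by
          simp only [hv]; field_simp
      _ ≤ _ := by gcongr
  refine (signAvg_mono hpt).trans ?_
  rw [signAvg_const_mul]
  rw [locRademacher_eq_signAvg] at hrad
  calc n / (κ * B) * signAvg S ≤ n / (κ * B) * (ρ ^ 2 / B) := by gcongr
    _ = n * (ρ / B) ^ 2 / κ := by field_simp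
    _ = n * (ρ / B) * r := by rw [hκ]; field_simp
    _ ≤ n * (r / 160) * r :=
        mul_le_mul_of_nonneg_right (mul_le_mul_of_nonneg_left (by linarith) hn0.le) hr0.le
    _ = (√n * √n) * r ^ 2 / 160 := by rw [hsn]; ring
    _ = σ ^ 2 / 160 := by rw [hσ]; ring

end CriticalRadius

/-! ### Parametrization of the product and dual classes -/

section Params

variable {Om S O A Op : Type*} [MeasurableSpace Om] [MeasurableSpace S] [MeasurableSpace O]
  [MeasurableSpace A] [MeasurableSpace Op] {c : Constants}

theorem measurable_preObs : Measurable (preObs : Trial Om S O A Op → Om) := by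
  unfold preObs; fun_prop
theorem measurable_state : Measurable (state : Trial Om S O A Op → S) := by
  unfold state; fun_prop
theorem measurable_obs : Measurable (obs : Trial Om S O A Op → O) := by unfold obs; fun_prop
theorem measurable_act : Measurable (act : Trial Om S O A Op → A) := by unfold act; fun_prop
theorem measurable_rew : Measurable (rew : Trial Om S O A Op → ℝ) := by unfold rew; fun_prop
theorem measurable_nextObs : Measurable (nextObs : Trial Om S O A Op → Op) := by
  unfold nextObs; fun_prop
theorem measurable_seenObs : Measurable (seenObs : Trial Om S O A Op → Bool) := by
  unfold seenObs; fun_prop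
theorem measurable_seenPreObs : Measurable (seenPreObs : Trial Om S O A Op → Bool) := by
  unfold seenPreObs; fun_prop
theorem measurable_seenNextObs : Measurable (seenNextObs : Trial Om S O A Op → Bool) := by
  unfold seenNextObs; fun_prop

attribute [fun_prop] measurable_preObs measurable_state measurable_obs measurable_act measurable_rew
  measurable_nextObs measurable_seenObs measurable_seenPreObs measurable_seenNextObs

theorem measurableSet_pattern (k : Fin 4) : MeasurableSet (pattern k : Set (Trial Om S O A Op)) := by
  have h1 : MeasurableSet {t : Trial Om S O A Op | seenObs t = true} :=
    measurable_seenObs (measurableSet_singleton true)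
  have h2 : MeasurableSet {t : Trial Om S O A Op | seenPreObs t = true} :=
    measurable_seenPreObs (measurableSet_singleton true)
  have h3 : MeasurableSet {t : Trial Om S O A Op | seenNextObs t = true} :=
    measurable_seenNextObs (measurableSet_singleton true)
  fin_cases k
  · exact h2.inter h3
  · exact h1.inter (h2.inter h3)
  · exact h1.inter h2
  · exact h2

/-- Dimension of the `k`-th dual class. -/
def dualDim (c : Constants) : Fin 4 → ℕ
  | 0 => c.d₁
  | 1 => c.d₂
  | 2 => c.d₃
  | 3 => c.m₄

/-- Feature map of the `k`-th dual class. -/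
def dualFeat (Φ : Features c Om O A Op) (k : Fin 4) (t : Trial Om S O A Op) :
    EuclideanSpace ℝ (Fin (dualDim c k)) :=
  match k with
  | 0 => Φ.ψ₁ (act t, preObs t, nextObs t)
  | 1 => Φ.ψ₂ (act t, obs t, preObs t, nextObs t)
  | 2 => Φ.ψ₃ (act t, obs t, preObs t)
  | 3 => Φ.ψ₄ (preObs t)

theorem dualClass_eq (Φ : Features c Om O A Op) (k : Fin 4) :
    dualClass (S := S) Φ k = linClass (dualFeat Φ k) (c.D k) := by
  fin_cases k <;> rfl

theorem norm_dualFeat_le (Φ : Features c Om O A Op) (k : Fin 4) (t : Trial Om S O A Op) :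
    ‖dualFeat Φ k t‖ ≤ 1 := by
  fin_cases k
  · exact Φ.norm_ψ₁ _
  · exact Φ.norm_ψ₂ _
  · exact Φ.norm_ψ₃ _
  · exact Φ.norm_ψ₄ _

theorem measurable_dualFeat (Φ : Features c Om O A Op) (k : Fin 4) :
    Measurable (dualFeat (S := S) Φ k) := by
  fin_cases k
  · exact Φ.meas_ψ₁.comp (by fun_prop)
  · exact Φ.meas_ψ₂.comp (by fun_prop)
  · exact Φ.meas_ψ₃.comp (by fun_prop)
  · exact Φ.meas_ψ₄.comp (by fun_prop)

theorem abs_inner_le {d : ℕ} {w v : EuclideanSpace ℝ (Fin d)} {C : ℝ} (hw : ‖w‖ ≤ C)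
    (hv : ‖v‖ ≤ 1) : |inner ℝ w v| ≤ C := by
  have := abs_real_inner_le_norm w v
  nlinarith [norm_nonneg w, norm_nonneg v]

variable [Fintype A]

/-- Softmax probabilities. -/
def softProb (Φ : Features c Om O A Op) (w : EuclideanSpace ℝ (Fin c.m₀)) (om : Om) (o : O)
    (a : A) : ℝ :=
  Real.exp (inner ℝ w (Φ.φ₀ (a, o, om))) / ∑ a' : A, Real.exp (inner ℝ w (Φ.φ₀ (a', o, om)))

/-- `w` is a softmax parameter of the policy `π`. -/
def IsSoftmaxParam (Φ : Features c Om O A Op) (π : Kernel (Om × O) A)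
    (w : EuclideanSpace ℝ (Fin c.m₀)) : Prop :=
  ‖w‖ ≤ c.C₀ ∧ ∀ om o a, (π (om, o)).real {a} = softProb Φ w om o a

theorem exists_isSoftmaxParam {Φ : Features c Om O A Op} {π : Kernel (Om × O) A}
    (h : π ∈ softmaxClass Φ) : ∃ w, IsSoftmaxParam Φ π w := by
  obtain ⟨w, hw, h⟩ := h
  refine ⟨w, hw, fun om o a => ?_⟩
  rw [Measure.real, h, ENNReal.toReal_ofReal (by positivity)]
  rfl

/-- The tuple of linear functions with given coefficient vectors. -/
def linBridge (Φ : Features c Om O A Op) (w₁ : EuclideanSpace ℝ (Fin c.m₁))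
    (w₂ : EuclideanSpace ℝ (Fin c.m₂)) (w₃ : EuclideanSpace ℝ (Fin c.m₃))
    (w₄ : EuclideanSpace ℝ (Fin c.m₄)) : Bridge Om O A Op :=
  ⟨fun x => inner ℝ w₁ (Φ.φ₁ x), fun x => inner ℝ w₂ (Φ.φ₂ x), fun x => inner ℝ w₃ (Φ.φ₃ x),
    fun x => inner ℝ w₄ (Φ.ψ₄ x)⟩

theorem mem_hypClass_iff {Φ : Features c Om O A Op} {h : Bridge Om O A Op} :
    h ∈ hypClass Φ ↔ ∃ w₁ w₂ w₃ w₄, ‖w₁‖ ≤ c.C₁ ∧ ‖w₂‖ ≤ c.C₂ ∧ ‖w₃‖ ≤ c.C₃ ∧ ‖w₄‖ ≤ c.C₄ ∧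
      h = linBridge Φ w₁ w₂ w₃ w₄ := by
  constructor
  · rintro ⟨⟨w₁, h₁, e₁⟩, ⟨w₂, h₂, e₂⟩, ⟨w₃, h₃, e₃⟩, ⟨w₄, h₄, e₄⟩⟩
    refine ⟨w₁, w₂, w₃, w₄, h₁, h₂, h₃, h₄, ?_⟩
    cases h
    simp only at e₁ e₂ e₃ e₄
    rw [linBridge, e₁, e₂, e₃, e₄]
  · rintro ⟨w₁, w₂, w₃, w₄, h₁, h₂, h₃, h₄, rfl⟩
    exact ⟨⟨w₁, h₁, rfl⟩, ⟨w₂, h₂, rfl⟩, ⟨w₃, h₃, rfl⟩, ⟨w₄, h₄, rfl⟩⟩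

/-- The integrand of the `k`-th moment equation as a function of the coefficient vectors. -/
def alphaLin (Φ : Features c Om O A Op) (w₀ : EuclideanSpace ℝ (Fin c.m₀))
    (w₁ : EuclideanSpace ℝ (Fin c.m₁)) (w₂ : EuclideanSpace ℝ (Fin c.m₂))
    (w₃ : EuclideanSpace ℝ (Fin c.m₃)) (w₄ : EuclideanSpace ℝ (Fin c.m₄)) (k : Fin 4)
    (t : Trial Om S O A Op) : ℝ :=
  match k with
  | 0 => inner ℝ w₁ (Φ.φ₁ (rew t, act t, preObs t, nextObs t))
  | 1 => inner ℝ w₂ (Φ.φ₂ (act t, obs t, preObs t))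
          - inner ℝ w₁ (Φ.φ₁ (rew t, act t, preObs t, nextObs t))
          - rew t * softProb Φ w₀ (preObs t) (obs t) (act t)
  | 2 => inner ℝ w₃ (Φ.φ₃ (rew t, act t, preObs t))
          - ∑ a : A, inner ℝ w₂ (Φ.φ₂ (a, obs t, preObs t))
  | 3 => inner ℝ w₄ (Φ.ψ₄ (preObs t)) - inner ℝ w₃ (Φ.φ₃ (rew t, act t, preObs t))

theorem alpha_linBridge {Φ : Features c Om O A Op} {π : Kernel (Om × O) A}
    {w₀ : EuclideanSpace ℝ (Fin c.m₀)} (h : IsSoftmaxParam Φ π w₀)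
    (w₁ : EuclideanSpace ℝ (Fin c.m₁)) (w₂ : EuclideanSpace ℝ (Fin c.m₂))
    (w₃ : EuclideanSpace ℝ (Fin c.m₃)) (w₄ : EuclideanSpace ℝ (Fin c.m₄)) (k : Fin 4)
    (t : Trial Om S O A Op) :
    alpha π (linBridge Φ w₁ w₂ w₃ w₄) k t = alphaLin Φ w₀ w₁ w₂ w₃ w₄ k t := by
  fin_cases k
  · rfl
  · simp only [alpha, alphaLin, linBridge, h.2]
  · rfl
  · rfl

theorem softProb_nonneg (Φ : Features c Om O A Op) (w : EuclideanSpace ℝ (Fin c.m₀)) (om : Om)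
    (o : O) (a : A) : 0 ≤ softProb Φ w om o a := by unfold softProb; positivity

theorem softProb_le_one (Φ : Features c Om O A Op) (w : EuclideanSpace ℝ (Fin c.m₀)) (om : Om)
    (o : O) (a : A) : softProb Φ w om o a ≤ 1 := by
  have : Nonempty A := ⟨a⟩
  rw [softProb, div_le_one (by positivity)]
  exact Finset.single_le_sum (f := fun a' => Real.exp (inner ℝ w (Φ.φ₀ (a', o, om))))
    (fun _ _ => (Real.exp_pos _).le) (Finset.mem_univ a)

variable [MeasurableSingletonClass A]

theorem measurable_softProb (Φ : Features c Om O A Op) (w : EuclideanSpace ℝ (Fin c.m₀)) :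
    Measurable fun x : (Om × O) × A => softProb Φ w x.1.1 x.1.2 x.2 := by
  unfold softProb
  have h := Φ.meas_φ₀
  refine Measurable.div ?_ ?_
  · exact Real.measurable_exp.comp (measurable_const.inner (h.comp (by fun_prop)))
  · exact Finset.measurable_sum _ fun a _ =>
      Real.measurable_exp.comp (measurable_const.inner (h.comp (by fun_prop)))

theorem measurable_alphaLin (Φ : Features c Om O A Op) (w₀ : EuclideanSpace ℝ (Fin c.m₀))
    (w₁ : EuclideanSpace ℝ (Fin c.m₁)) (w₂ : EuclideanSpace ℝ (Fin c.m₂))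
    (w₃ : EuclideanSpace ℝ (Fin c.m₃)) (w₄ : EuclideanSpace ℝ (Fin c.m₄)) (k : Fin 4) :
    Measurable (alphaLin (S := S) Φ w₀ w₁ w₂ w₃ w₄ k) := by
  have m1 : Measurable fun t : Trial Om S O A Op =>
      inner ℝ w₁ (Φ.φ₁ (rew t, act t, preObs t, nextObs t)) :=
    measurable_const.inner (Φ.meas_φ₁.comp (by fun_prop))
  have m2 : ∀ a : A, Measurable fun t : Trial Om S O A Op =>
      inner ℝ w₂ (Φ.φ₂ (a, obs t, preObs t)) := fun a =>
    measurable_const.inner (Φ.meas_φ₂.comp (by fun_prop))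
  have m2' : Measurable fun t : Trial Om S O A Op =>
      inner ℝ w₂ (Φ.φ₂ (act t, obs t, preObs t)) :=
    measurable_const.inner (Φ.meas_φ₂.comp (by fun_prop))
  have m3 : Measurable fun t : Trial Om S O A Op =>
      inner ℝ w₃ (Φ.φ₃ (rew t, act t, preObs t)) :=
    measurable_const.inner (Φ.meas_φ₃.comp (by fun_prop))
  have m4 : Measurable fun t : Trial Om S O A Op => inner ℝ w₄ (Φ.ψ₄ (preObs t)) :=
    measurable_const.inner (Φ.meas_ψ₄.comp (by fun_prop))
  have mp : Measurable fun t : Trial Om S O A Op =>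
      softProb Φ w₀ (preObs t) (obs t) (act t) :=
    (measurable_softProb Φ w₀).comp
      (f := fun t : Trial Om S O A Op => ((preObs t, obs t), act t)) (by fun_prop)
  fin_cases k
  · exact m1
  · exact (m2'.sub m1).sub (measurable_rew.mul mp)
  · exact m3.sub (Finset.measurable_sum _ fun a _ => m2 a)
  · exact m4.sub m3

/-- Parameters of the product class: softmax parameter, four coefficient vectors of the bridge
functions, and the coefficient vector of the dual function. -/
abbrev ProdParam (c : Constants) (k : Fin 4) : Type :=
  EuclideanSpace ℝ (Fin c.m₀) × EuclideanSpace ℝ (Fin c.m₁) × EuclideanSpace ℝ (Fin c.m₂) ×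
    EuclideanSpace ℝ (Fin c.m₃) × EuclideanSpace ℝ (Fin c.m₄) × EuclideanSpace ℝ (Fin (dualDim c k))

/-- The product function with given parameters. -/
def prodLin (Φ : Features c Om O A Op) (k : Fin 4) (p : ProdParam c k) (t : Trial Om S O A Op) : ℝ :=
  alphaLin Φ p.1 p.2.1 p.2.2.1 p.2.2.2.1 p.2.2.2.2.1 k t *
    inner ℝ p.2.2.2.2.2 (dualFeat Φ k t)

/-- The parameters of the members of the product class. -/
def prodParamSet (Φ : Features c Om O A Op) (Pol : Set (Kernel (Om × O) A)) (k : Fin 4) :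
    Set (ProdParam c k) :=
  {p | (∃ π ∈ Pol, IsSoftmaxParam Φ π p.1) ∧ ‖p.2.1‖ ≤ c.C₁ ∧ ‖p.2.2.1‖ ≤ c.C₂ ∧
    ‖p.2.2.2.1‖ ≤ c.C₃ ∧ ‖p.2.2.2.2.1‖ ≤ c.C₄ ∧ ‖p.2.2.2.2.2‖ ≤ c.D k}

theorem measurable_prodLin (Φ : Features c Om O A Op) (k : Fin 4) (p : ProdParam c k) :
    Measurable (prodLin (S := S) Φ k p) :=
  (measurable_alphaLin Φ _ _ _ _ _ k).mul (measurable_const.inner (measurable_dualFeat Φ k))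

/-- Together with separability of the parameter space, this puts the product class within reach of
the uniform deviation bound, for an arbitrary set of softmax policies. -/
theorem continuous_prodLin (Φ : Features c Om O A Op) (k : Fin 4) (t : Trial Om S O A Op) :
    Continuous fun p : ProdParam c k => prodLin Φ k p t := by
  have : Nonempty A := ⟨act t⟩
  refine Continuous.mul ?_ (by fun_prop)
  fin_cases k
  · simp only [alphaLin]; fun_prop
  · simp only [alphaLin, softProb]
    refine Continuous.sub (by fun_prop) (continuous_const.mul (Continuous.div (by fun_prop)
      (by fun_prop) fun p => ?_))
    positivity
  · simp only [alphaLin]; fun_prop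
  · simp only [alphaLin]; fun_prop

theorem mem_prodClass_iff {Φ : Features c Om O A Op} {Pol : Set (Kernel (Om × O) A)}
    (hPol : Pol ⊆ softmaxClass Φ) {k : Fin 4} {f : Trial Om S O A Op → ℝ} :
    f ∈ prodClass Φ Pol k ↔ ∃ p ∈ prodParamSet Φ Pol k, f = prodLin Φ k p := by
  constructor
  · rintro ⟨π, hπ, h, hh, θ, hθ, rfl⟩
    obtain ⟨w₀, hw₀⟩ := exists_isSoftmaxParam (hPol hπ)
    obtain ⟨w₁, w₂, w₃, w₄, h₁, h₂, h₃, h₄, rfl⟩ := mem_hypClass_iff.1 hh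
    rw [dualClass_eq] at hθ
    obtain ⟨β, hβ, rfl⟩ := hθ
    refine ⟨(w₀, w₁, w₂, w₃, w₄, β), ⟨⟨π, hπ, hw₀⟩, h₁, h₂, h₃, h₄, hβ⟩, ?_⟩
    funext t
    rw [prodLin, alpha_linBridge hw₀]
  · rintro ⟨⟨w₀, w₁, w₂, w₃, w₄, β⟩, ⟨⟨π, hπ, hw₀⟩, h₁, h₂, h₃, h₄, hβ⟩, rfl⟩
    refine ⟨π, hπ, _, mem_hypClass_iff.2 ⟨w₁, w₂, w₃, w₄, h₁, h₂, h₃, h₄, rfl⟩,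
      fun t => inner ℝ β (dualFeat Φ k t), ?_, ?_⟩
    · rw [dualClass_eq]; exact ⟨β, hβ, rfl⟩
    · funext t
      rw [prodLin, alpha_linBridge hw₀]

end Params

/-! ### Uniform deviations on i.i.d. data in terms of critical radii -/

section UniformDeviation

variable {Om S O A Op : Type*} [MeasurableSpace Om] [MeasurableSpace S] [MeasurableSpace O]
  [Fintype A] [MeasurableSpace A] [MeasurableSingletonClass A] [MeasurableSpace Op] {c : Constants}
  {ι : Type*} [Fintype ι]

/-- Deviations of the product class and of the squares of the dual class, of order `η ^ 2`. -/
def UniformDev (ν : Measure (Trial Om S O A Op)) (Φ : Features c Om O A Op)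
    (Pol : Set (Kernel (Om × O) A)) (k : Fin 4) (x : ι → Trial Om S O A Op) (η : ℝ) : Prop :=
  (∀ π ∈ Pol, ∀ h ∈ hypClass Φ, ∀ θ ∈ dualClass (S := S) Φ k,
    |empMean x (fun t => alpha π h k t * θ t) - ∫ t, alpha π h k t * θ t ∂ν| ≤
      (empMean x (fun t => θ t ^ 2) + ∫ t, θ t ^ 2 ∂ν) / 16 + η ^ 2 / 16) ∧
  ∀ θ ∈ dualClass (S := S) Φ k, ∫ t, θ t ^ 2 ∂ν ≤ 2 * empMean x (fun t => θ t ^ 2) + η ^ 2 / 16 ∧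
    empMean x (fun t => θ t ^ 2) ≤ 2 * ∫ t, θ t ^ 2 ∂ν + η ^ 2 / 16

/-- The normalized product class, set to zero where the reward is out of range. -/
def normProd (Φ : Features c Om O A Op) (Pol : Set (Kernel (Om × O) A)) (k : Fin 4) (B : ℝ)
    (p : prodParamSet Φ Pol k) (t : Trial Om S O A Op) : ℝ :=
  if |rew t| ≤ c.LY then prodLin Φ k p.1 t / B else 0

/-- The normalized dual class. -/
def normDual (S : Type*) (Φ : Features c Om O A Op) (k : Fin 4) (B : ℝ)
    (β : {β : EuclideanSpace ℝ (Fin (dualDim c k)) // ‖β‖ ≤ c.D k}) (t : Trial Om S O A Op) : ℝ :=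
  inner ℝ β.1 (dualFeat Φ k t) / B

theorem one_le_classBound (c : Constants) (L : ℝ) (k : Fin 4) : 1 ≤ classBound c L k :=
  one_le_mul_of_one_le_of_one_le (le_max_left _ _) (le_max_left _ _)

theorem abs_prodLin_le {Φ : Features c Om O A Op} {Pol : Set (Kernel (Om × O) A)} {L : ℝ}
    (hL : AlphaBounded S Φ Pol L) {k : Fin 4} {p : ProdParam c k} (hp : p ∈ prodParamSet Φ Pol k)
    {t : Trial Om S O A Op} (ht : |rew t| ≤ c.LY) :
    |alphaLin Φ p.1 p.2.1 p.2.2.1 p.2.2.2.1 p.2.2.2.2.1 k t| ≤ L ∧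
      |prodLin Φ k p t| ≤ classBound c L k := by
  obtain ⟨⟨π, hπ, hw₀⟩, h₁, h₂, h₃, h₄, hβ⟩ := hp
  have h1 := hL π hπ _ (mem_hypClass_iff.2 ⟨_, _, _, _, h₁, h₂, h₃, h₄, rfl⟩) k t ht
  rw [alpha_linBridge hw₀] at h1
  refine ⟨h1, ?_⟩
  rw [prodLin, abs_mul]
  exact mul_le_mul (h1.trans (le_max_right _ _))
    ((abs_inner_le hβ (norm_dualFeat_le Φ k t)).trans (le_max_right _ _)) (abs_nonneg _)
    (le_trans zero_le_one (le_max_left _ _))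

theorem abs_normProd_le {Φ : Features c Om O A Op} {Pol : Set (Kernel (Om × O) A)} {L : ℝ}
    (hL : AlphaBounded S Φ Pol L) (k : Fin 4) (p : prodParamSet Φ Pol k)
    (t : Trial Om S O A Op) : |normProd Φ Pol k (classBound c L k) p t| ≤ 1 := by
  have hB := one_le_classBound c L k
  unfold normProd
  split_ifs with h
  · rw [abs_div, abs_of_pos (by linarith : 0 < classBound c L k), div_le_one (by linarith)]
    exact (abs_prodLin_le hL p.2 h).2
  · simp

theorem abs_normDual_le (Φ : Features c Om O A Op) (L : ℝ) (k : Fin 4)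
    (β : {β : EuclideanSpace ℝ (Fin (dualDim c k)) // ‖β‖ ≤ c.D k}) (t : Trial Om S O A Op) :
    |normDual S Φ k (classBound c L k) β t| ≤ 1 := by
  have hB := one_le_classBound c L k
  rw [normDual, abs_div, abs_of_pos (by linarith : 0 < classBound c L k), div_le_one (by linarith)]
  refine (abs_inner_le β.2 (norm_dualFeat_le Φ k t)).trans ((le_max_right 1 _).trans ?_)
  exact le_mul_of_one_le_left (le_trans zero_le_one (le_max_left _ _)) (le_max_left _ _)

theorem measurable_normProd (Φ : Features c Om O A Op) (Pol : Set (Kernel (Om × O) A)) (k : Fin 4)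
    (B : ℝ) (p : prodParamSet Φ Pol k) : Measurable (normProd (S := S) Φ Pol k B p) :=
  Measurable.ite (measurableSet_le (by fun_prop) measurable_const)
    ((measurable_prodLin Φ k p.1).div_const B) measurable_const

theorem measurable_normDual (Φ : Features c Om O A Op) (k : Fin 4) (B : ℝ)
    (β : {β : EuclideanSpace ℝ (Fin (dualDim c k)) // ‖β‖ ≤ c.D k}) :
    Measurable (normDual S Φ k B β) :=
  (measurable_const.inner (measurable_dualFeat Φ k)).div_const B

theorem continuous_normProd (Φ : Features c Om O A Op) (Pol : Set (Kernel (Om × O) A)) (k : Fin 4)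
    (B : ℝ) (t : Trial Om S O A Op) : Continuous fun p => normProd Φ Pol k B p t := by
  unfold normProd
  split_ifs
  · exact ((continuous_prodLin Φ k t).comp continuous_subtype_val).div_const B
  · exact continuous_const

theorem continuous_normDual (Φ : Features c Om O A Op) (k : Fin 4) (B : ℝ)
    (t : Trial Om S O A Op) : Continuous fun β => normDual S Φ k B β t := by
  unfold normDual; fun_prop

/-- The localization radius attached to a critical radius. -/
def locRadius (n B ρ t : ℝ) : ℝ := √n * (640 * max (ρ / B) √(t / n))

/-- The maximum in `locRadius` secures both the floor `640` (as `t ≥ 1`) and `640 ≥ 160` times the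
critical radius. The constant `2000000` works because `(640² + 1) (3/2)² ≤ 2000000`, where `3/2`
absorbs `√2` from `t = 2 log (1/ξ)`. -/
theorem locRadius_bounds {n B ρ ξ η : ℝ} (hn : 0 < n) (hB : 1 ≤ B) (hρ : 0 < ρ)
    (hξ : 1 ≤ 2 * Real.log (1 / ξ)) (hη : 2000000 * (ρ + B * √(Real.log (1 / ξ) / n)) ≤ η) :
    640 ≤ locRadius n B ρ (2 * Real.log (1 / ξ)) ∧
    B ^ 2 * (locRadius n B ρ (2 * Real.log (1 / ξ)) ^ 2 + 2 * Real.log (1 / ξ)) ≤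
      n * (η ^ 2 / 2000000) := by
  set l := Real.log (1 / ξ)
  set m := max (ρ / B) √(2 * l / n) with hm
  have hl : 0 < l := by linarith
  have hsn := Real.sq_sqrt hn.le
  have hs2 := Real.sq_sqrt (by positivity : 0 ≤ 2 * l / n)
  have hsm : √(2 * l / n) ≤ m := le_max_right _ _
  have hm0 : 0 ≤ m := le_trans (Real.sqrt_nonneg _) hsm
  have hnm : 2 * l ≤ n * m ^ 2 := by
    have := pow_le_pow_left₀ (Real.sqrt_nonneg _) hsm 2
    rw [hs2, div_le_iff₀ hn] at this
    linarith
  have hr2 : locRadius n B ρ (2 * l) ^ 2 = 640 ^ 2 * (n * m ^ 2) := by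
    rw [locRadius, ← hm, mul_pow, hsn]; ring
  constructor
  · have h0 : 0 ≤ locRadius n B ρ (2 * l) := by rw [locRadius, ← hm]; positivity
    refine le_of_sq_le_sq ?_ h0
    rw [hr2]; nlinarith
  · set δ := ρ + B * √(l / n) with hδ
    have hBm : B * m ≤ 3 / 2 * δ := by
      have h1 : √(2 * l / n) ≤ 3 / 2 * √(l / n) := by
        rw [mul_div_assoc, Real.sqrt_mul (by norm_num)]
        gcongr
        rw [Real.sqrt_le_left (by norm_num)]; norm_num
      have h0 : 0 ≤ √(l / n) := Real.sqrt_nonneg _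
      rw [hm, mul_max_of_nonneg _ _ (by linarith)]
      refine max_le ?_ ?_
      · rw [mul_div_cancel₀ _ (by linarith)]; nlinarith
      · nlinarith
    have hδ0 : 0 < δ := by positivity
    have hη2 : (2000000 * δ) ^ 2 ≤ η ^ 2 := pow_le_pow_left₀ (by positivity) hη 2
    have hBm2 : (B * m) ^ 2 ≤ (3 / 2 * δ) ^ 2 := pow_le_pow_left₀ (by positivity) hBm 2
    rw [hr2]
    calc B ^ 2 * (640 ^ 2 * (n * m ^ 2) + 2 * l) ≤ B ^ 2 * (640 ^ 2 * (n * m ^ 2) + n * m ^ 2) := by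
          gcongr
      _ = n * ((640 ^ 2 + 1) * (B * m) ^ 2) := by ring
      _ ≤ n * (η ^ 2 / 2000000) := by
          gcongr; nlinarith

set_option maxHeartbeats 1000000 in
theorem uniformDev_of_deviationBound [Nonempty ι] {ν : Measure (Trial Om S O A Op)}
    [IsProbabilityMeasure ν] (hν : ∀ᵐ t ∂ν, |rew t| ≤ c.LY) {Φ : Features c Om O A Op}
    {Pol : Set (Kernel (Om × O) A)} (hPol : Pol ⊆ softmaxClass Φ) {L : ℝ}
    (hL : AlphaBounded S Φ Pol L) (k : Fin 4) {x : ι → Trial Om S O A Op}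
    (hx : ∀ i, |rew (x i)| ≤ c.LY) {K η : ℝ}
    (hK : classBound c L k ^ 2 * K ≤ Fintype.card ι * (η ^ 2 / 2000000))
    (h1 : DeviationBound ν (normProd Φ Pol k (classBound c L k)) x K)
    (h2 : DeviationBound ν (normDual S Φ k (classBound c L k)) x K) :
    UniformDev ν Φ Pol k x η := by
  set B := classBound c L k with hBdef
  have hB : 1 ≤ B := one_le_classBound c L k
  set n : ℝ := (Fintype.card ι : ℝ) with hn
  have hn0 : 0 < n := by rw [hn]; exact_mod_cast Fintype.card_pos
  have hdual : ∀ β : EuclideanSpace ℝ (Fin (dualDim c k)), ‖β‖ ≤ c.D k →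
      3 / 4 * ∫ t, inner ℝ β (dualFeat Φ k t) ^ 2 ∂ν ≤
        11 / 10 * empMean x (fun t => inner ℝ β (dualFeat Φ k t) ^ 2) + 61440 * (η ^ 2 / 2000000) ∧
      9 / 10 * empMean x (fun t => inner ℝ β (dualFeat Φ k t) ^ 2) ≤
        5 / 4 * ∫ t, inner ℝ β (dualFeat Φ k t) ^ 2 ∂ν + 61440 * (η ^ 2 / 2000000) := by
    intro β hβ
    obtain ⟨-, h3, h4⟩ := h2 ⟨β, hβ⟩
    simp only [normDual, div_pow, integral_div, ← Finset.sum_div, ← hn] at h3 h4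
    have eE : ∑ i, inner ℝ β (dualFeat Φ k (x i)) ^ 2 =
        n * empMean x (fun t => inner ℝ β (dualFeat Φ k t) ^ 2) := by
      simp only [empMean, ← hn]; field_simp
    rw [eE] at h3 h4
    set e := empMean x (fun t => inner ℝ β (dualFeat Φ k t) ^ 2)
    set I := ∫ t, inner ℝ β (dualFeat Φ k t) ^ 2 ∂ν
    have hB2 : 0 < B ^ 2 := by positivity
    have h3' := mul_le_mul_of_nonneg_left h3 hB2.le
    have h4' := mul_le_mul_of_nonneg_left h4 hB2.le
    have e1 : B ^ 2 * (3 / 4 * (n * (I / B ^ 2))) = n * (3 / 4 * I) := by field_simp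
    have e2 : B ^ 2 * (11 / 10 * (n * e / B ^ 2) + 61440 * K) =
      n * (11 / 10 * e) + 61440 * (B ^ 2 * K) := by field_simp
    have e3 : B ^ 2 * (9 / 10 * (n * e / B ^ 2)) = n * (9 / 10 * e) := by field_simp
    have e4 : B ^ 2 * (5 / 4 * (n * (I / B ^ 2)) + 61440 * K) =
      n * (5 / 4 * I) + 61440 * (B ^ 2 * K) := by field_simp
    rw [e1, e2] at h3'
    rw [e3, e4] at h4'
    constructor
    · refine le_of_mul_le_mul_left ?_ hn0
      linarith
    · refine le_of_mul_le_mul_left ?_ hn0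
      linarith
  have hη0 : 0 ≤ η ^ 2 := sq_nonneg η
  -- the one-sided bound for the product class
  have hone : ∀ π ∈ Pol, ∀ h ∈ hypClass Φ, ∀ β : EuclideanSpace ℝ (Fin (dualDim c k)),
      ‖β‖ ≤ c.D k →
      ∫ t, alpha π h k t * inner ℝ β (dualFeat Φ k t) ∂ν -
        empMean x (fun t => alpha π h k t * inner ℝ β (dualFeat Φ k t)) ≤
      (empMean x (fun t => inner ℝ β (dualFeat Φ k t) ^ 2) +
        ∫ t, inner ℝ β (dualFeat Φ k t) ^ 2 ∂ν) / 16 + η ^ 2 / 16 := by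
    intro π hπ h hh β hβ
    obtain ⟨w₀, hw₀⟩ := exists_isSoftmaxParam (hPol hπ)
    obtain ⟨w₁, w₂, w₃, w₄, a₁, a₂, a₃, a₄, rfl⟩ := mem_hypClass_iff.1 hh
    set m := max 1 L with hm
    have hm1 : 1 ≤ m := le_max_left _ _
    have hmB : m ≤ B := le_mul_of_one_le_right (by linarith) (le_max_left _ _)
    -- Shrinking the dual function by `1 / (2 m)`, with `m` dominating `|α|`, makes the square of
    -- the normalized product at most `θ² / (4 B²)`. After multiplying back by `2 m B`, the
    -- quadratic terms are `E / 40 + I / 16`, free of `L`.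
    set s := 1 / (2 * m) with hs
    have hs0 : 0 < s := by positivity
    have hs1 : s ≤ 1 := by rw [hs, div_le_one (by positivity)]; linarith
    have hsβ : ‖s • β‖ ≤ c.D k := by
      rw [norm_smul, Real.norm_eq_abs, abs_of_pos hs0]
      nlinarith [norm_nonneg β]
    have hmem : (w₀, w₁, w₂, w₃, w₄, s • β) ∈ prodParamSet Φ Pol k :=
      ⟨⟨π, hπ, hw₀⟩, a₁, a₂, a₃, a₄, hsβ⟩
    set α : Trial Om S O A Op → ℝ := fun t => alpha π (linBridge Φ w₁ w₂ w₃ w₄) k t with hα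
    set θ : Trial Om S O A Op → ℝ := fun t => inner ℝ β (dualFeat Φ k t) with hθ
    have hval : ∀ t : Trial Om S O A Op, |rew t| ≤ c.LY →
        normProd Φ Pol k B ⟨_, hmem⟩ t = s / B * (α t * θ t) := by
      intro t ht
      rw [normProd, if_pos ht, prodLin, ← alpha_linBridge hw₀, inner_smul_left]
      simp only [conj_trivial, hα, hθ]
      ring
    have hαL : ∀ t : Trial Om S O A Op, |rew t| ≤ c.LY → α t ^ 2 ≤ m ^ 2 := by
      intro t ht
      rw [← sq_abs]
      exact pow_le_pow_left₀ (abs_nonneg _) ((hL π hπ _ hh k t ht).trans (le_max_right _ _)) 2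
    have hI1 : ∫ t, normProd Φ Pol k B ⟨_, hmem⟩ t ∂ν = s / B * ∫ t, α t * θ t ∂ν := by
      rw [← integral_const_mul]
      exact integral_congr_ae (hν.mono fun t ht => hval t ht)
    have hθm : Measurable θ := measurable_const.inner (measurable_dualFeat Φ k)
    have hθb : ∀ t, |θ t| ≤ c.D k := fun t => abs_inner_le hβ (norm_dualFeat_le Φ k t)
    have hθi : Integrable (fun t => θ t ^ 2) ν :=
      integrable_of_abs_le (C := c.D k ^ 2) (by fun_prop) fun t => by
        rw [abs_pow]; exact pow_le_pow_left₀ (abs_nonneg _) (hθb t) 2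
    have hsm : (s / B) ^ 2 * m ^ 2 = 1 / (4 * B ^ 2) := by
      rw [hs]; field_simp; norm_num
    have hsq : ∀ t : Trial Om S O A Op, |rew t| ≤ c.LY →
        normProd Φ Pol k B ⟨_, hmem⟩ t ^ 2 ≤ 1 / (4 * B ^ 2) * θ t ^ 2 := by
      intro t ht
      rw [hval t ht, ← hsm]
      calc (s / B * (α t * θ t)) ^ 2 = (s / B) ^ 2 * (α t ^ 2 * θ t ^ 2) := by ring
        _ ≤ (s / B) ^ 2 * (m ^ 2 * θ t ^ 2) := mul_le_mul_of_nonneg_left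
            (mul_le_mul_of_nonneg_right (hαL t ht) (sq_nonneg _)) (sq_nonneg _)
        _ = _ := by ring
    have hI2 : ∫ t, normProd Φ Pol k B ⟨_, hmem⟩ t ^ 2 ∂ν ≤ 1 / (4 * B ^ 2) * ∫ t, θ t ^ 2 ∂ν := by
      rw [← integral_const_mul]
      exact integral_mono_of_nonneg (ae_of_all _ fun _ => sq_nonneg _) (hθi.const_mul _)
        (hν.mono fun t ht => hsq t ht)
    have hS1 : ∑ i, normProd Φ Pol k B ⟨_, hmem⟩ (x i) =
        s / B * (n * empMean x (fun t => α t * θ t)) := by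
      have : n * empMean x (fun t => α t * θ t) = ∑ i, α (x i) * θ (x i) := by
        simp only [empMean, ← hn]; field_simp
      rw [this, Finset.mul_sum]
      exact Finset.sum_congr rfl fun i _ => hval _ (hx i)
    have hS2 : ∑ i, normProd Φ Pol k B ⟨_, hmem⟩ (x i) ^ 2 ≤
        1 / (4 * B ^ 2) * (n * empMean x (fun t => θ t ^ 2)) := by
      have : n * empMean x (fun t => θ t ^ 2) = ∑ i, θ (x i) ^ 2 := by
        simp only [empMean, ← hn]; field_simp
      rw [this, Finset.mul_sum]
      exact Finset.sum_le_sum fun i _ => hsq _ (hx i)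
    have hdev := (h1 ⟨_, hmem⟩).1
    rw [hI1, hS1, ← hn] at hdev
    set E := empMean x (fun t => θ t ^ 2) with hE
    set I := ∫ t, θ t ^ 2 ∂ν with hI
    have hE0 : 0 ≤ E := div_nonneg (Finset.sum_nonneg fun _ _ => sq_nonneg _) (Nat.cast_nonneg _)
    have hI0 : 0 ≤ I := integral_nonneg fun _ => sq_nonneg _
    set Δ := ∫ t, α t * θ t ∂ν - empMean x (fun t => α t * θ t) with hΔ
    have hd2 : s / B * (n * Δ) ≤ 1 / (4 * B ^ 2) * (n * E) / 20 +
        n * (1 / (4 * B ^ 2) * I) / 8 + 30720 * K := by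
      have hnI := mul_le_mul_of_nonneg_left hI2 hn0.le
      have : s / B * (n * Δ) = n * (s / B * ∫ t, α t * θ t ∂ν) -
        s / B * (n * empMean x (fun t => α t * θ t)) := by rw [hΔ]; ring
      rw [this]
      linarith
    have hd3 := mul_le_mul_of_nonneg_left hd2 (by positivity : 0 ≤ 2 * m * B)
    have hsB : 2 * m * B * (s / B * (n * Δ)) = n * Δ := by rw [hs]; field_simp
    rw [hsB] at hd3
    have hmB1 : m / B ≤ 1 := (div_le_one (by linarith)).2 hmB
    have e5 : 2 * m * B * (1 / (4 * B ^ 2) * (n * E) / 20 +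
        n * (1 / (4 * B ^ 2) * I) / 8 + 30720 * K) =
        n * (m / B * (E / 40 + I / 16)) + 61440 * (m * B * K) := by field_simp; ring
    rw [e5] at hd3
    have hKm : m * B * K ≤ n * (η ^ 2 / 2000000) := by
      rcases le_or_gt 0 K with hK0 | hK0
      · refine le_trans ?_ hK
        have : m * B ≤ B ^ 2 := by nlinarith
        exact mul_le_mul_of_nonneg_right this hK0
      · have : m * B * K ≤ 0 := mul_nonpos_of_nonneg_of_nonpos (by positivity) hK0.le
        have : 0 ≤ n * (η ^ 2 / 2000000) := by positivity
        linarith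
    have h6 : m / B * (E / 40 + I / 16) ≤ E / 40 + I / 16 :=
      mul_le_of_le_one_left (by positivity) hmB1
    refine le_of_mul_le_mul_left ?_ hn0
    have h7 := mul_le_mul_of_nonneg_left h6 hn0.le
    have h8 : n * (E / 40 + I / 16) + 61440 * (n * (η ^ 2 / 2000000)) ≤
        n * ((E + I) / 16 + η ^ 2 / 16) := by
      rw [show n * (E / 40 + I / 16) + 61440 * (n * (η ^ 2 / 2000000)) =
        n * (E / 40 + I / 16 + 61440 * (η ^ 2 / 2000000)) by ring]
      exact mul_le_mul_of_nonneg_left (by linarith) hn0.le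
    linarith
  refine ⟨fun π hπ h hh θ hθ => ?_, fun θ hθ => ?_⟩
  · rw [dualClass_eq] at hθ
    obtain ⟨β, hβ, rfl⟩ := hθ
    have h3 := hone π hπ h hh β hβ
    -- The opposite inequality comes from symmetry of the dual ball.
    have h4 := hone π hπ h hh (-β) (by rwa [norm_neg])
    simp only [inner_neg_left, mul_neg, integral_neg, neg_sq] at h4
    have : empMean x (fun t => -(alpha π h k t * inner ℝ β (dualFeat Φ k t))) =
        -empMean x (fun t => alpha π h k t * inner ℝ β (dualFeat Φ k t)) := by
      simp only [empMean, Finset.sum_neg_distrib, neg_div]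
    rw [this] at h4
    rw [abs_le]
    constructor <;> linarith
  · rw [dualClass_eq] at hθ
    obtain ⟨β, hβ, rfl⟩ := hθ
    obtain ⟨h3, h4⟩ := hdual β hβ
    have hE0 : 0 ≤ empMean x (fun t => inner ℝ β (dualFeat Φ k t) ^ 2) :=
      div_nonneg (Finset.sum_nonneg fun _ _ => sq_nonneg _) (Nat.cast_nonneg _)
    have hI0 : 0 ≤ ∫ t, inner ℝ β (dualFeat Φ k t) ^ 2 ∂ν := integral_nonneg fun _ => sq_nonneg _
    constructor <;> nlinarith

/-- On independent data, with high probability the deviations are of order `η ^ 2` for every `η`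
dominating a critical radius. -/
theorem measure_not_uniformDev_le {ν : Measure (Trial Om S O A Op)}
    [IsProbabilityMeasure ν] (hν : ∀ᵐ t ∂ν, |rew t| ≤ c.LY) {Φ : Features c Om O A Op}
    {Pol : Set (Kernel (Om × O) A)} (hPol : Pol ⊆ softmaxClass Φ) {L : ℝ}
    (hL : AlphaBounded S Φ Pol L) (k : Fin 4) (hD : 0 ≤ c.D k) (hne : Pol.Nonempty)
    (hC : 0 ≤ c.C₁ ∧ 0 ≤ c.C₂ ∧ 0 ≤ c.C₃ ∧ 0 ≤ c.C₄) {ξ : ℝ} (hξ : 1 ≤ 2 * Real.log (1 / ξ)) :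
    (Measure.pi fun _ : ι => ν) {x | Nonempty ι ∧ ¬ ∀ η, (∃ ρ,
      IsCriticalRadius x (prodClass Φ Pol k) (classBound c L k) ρ ∧
      IsCriticalRadius x (dualClass Φ k) (classBound c L k) ρ ∧
      2000000 * (ρ + classBound c L k * √(Real.log (1 / ξ) / Fintype.card ι)) ≤ η) →
      UniformDev ν Φ Pol k x η} ≤
    ENNReal.ofReal (12 * Real.exp (-(2 * Real.log (1 / ξ)))) := by
  set B := classBound c L k with hBdef
  have hB : 1 ≤ B := one_le_classBound c L k
  have hB0 : 0 < B := by linarith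
  have : Nonempty (prodParamSet Φ Pol k) := by
    obtain ⟨π, hπ⟩ := hne
    obtain ⟨w₀, hw₀⟩ := exists_isSoftmaxParam (hPol hπ)
    exact ⟨(w₀, 0, 0, 0, 0, 0), ⟨π, hπ, hw₀⟩, by simpa using hC.1, by simpa using hC.2.1,
      by simpa using hC.2.2.1, by simpa using hC.2.2.2, by simpa using hD⟩
  have : Nonempty {β : EuclideanSpace ℝ (Fin (dualDim c k)) // ‖β‖ ≤ c.D k} :=
    ⟨0, by simpa using hD⟩
  have hbad1 := measure_not_deviationBound_le (ι := ι) ν (F := normProd (S := S) Φ Pol k B)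
    (measurable_normProd Φ Pol k B) (abs_normProd_le hL k) (continuous_normProd Φ Pol k B) hξ
  have hbad2 := measure_not_deviationBound_le (ι := ι) ν (F := normDual S Φ k B)
    (measurable_normDual Φ k B) (abs_normDual_le Φ L k) (continuous_normDual Φ k B) hξ
  have hrew : (Measure.pi fun _ : ι => ν) {x | ∃ i, ¬ |rew (x i)| ≤ c.LY} = 0 := by
    have h := ae_all_iff.2 fun i : ι =>
      (Measure.quasiMeasurePreserving_eval (fun _ : ι => ν) i).ae hν
    rw [ae_iff] at h
    simpa using h
  have hsplit : ENNReal.ofReal (12 * Real.exp (-(2 * Real.log (1 / ξ)))) =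
      0 + (ENNReal.ofReal (6 * Real.exp (-(2 * Real.log (1 / ξ)))) +
        ENNReal.ofReal (6 * Real.exp (-(2 * Real.log (1 / ξ))))) := by
    rw [zero_add, ← ENNReal.ofReal_add (by positivity) (by positivity)]
    ring_nf
  rw [hsplit]
  refine le_trans (measure_mono ?_) ((measure_union_le _ _).trans (add_le_add hrew.le
    ((measure_union_le _ _).trans (add_le_add hbad1 hbad2))))
  rintro x ⟨hι, hx⟩
  by_contra hcon
  simp only [Set.mem_union, not_or, Set.mem_ofPred_eq, not_exists, not_not, not_and] at hcon
  obtain ⟨hr, h1, h2⟩ := hcon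
  refine hx fun η hη => ?_
  obtain ⟨ρ, hQ, hT, hle⟩ := hη
  have hn0 : (0 : ℝ) < Fintype.card ι := by exact_mod_cast Fintype.card_pos
  obtain ⟨hσ, hK⟩ := locRadius_bounds hn0 hB hQ.1 hξ hle
  have h160 : 160 * (ρ / B) ≤ 640 * max (ρ / B) √(2 * Real.log (1 / ξ) / Fintype.card ι) := by
    have : 0 < ρ / B := div_pos hQ.1 hB0
    have := le_max_left (ρ / B) √(2 * Real.log (1 / ξ) / Fintype.card ι)
    linarith
  have hrj : ∀ i, |rew (x i)| ≤ c.LY := hr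
  refine uniformDev_of_deviationBound hν hPol hL k hrj hK
    (h1 _ hσ (locallySmall_of_isCriticalRadius hB0 hQ ?_ ?_ h160))
    (h2 _ hσ (locallySmall_of_isCriticalRadius hB0 hT ?_ ?_ h160))
  · intro f hf i
    obtain ⟨p, hp, rfl⟩ := (mem_prodClass_iff hPol).1 hf
    exact (abs_prodLin_le hL hp (hrj i)).2
  -- The product class is star-shaped because scaling the dual coefficient alone scales the product.
  · rintro ⟨p, hp⟩ s hs0 hs1
    refine ⟨prodLin Φ k (p.1, p.2.1, p.2.2.1, p.2.2.2.1, p.2.2.2.2.1, s • p.2.2.2.2.2),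
      (mem_prodClass_iff hPol).2
        ⟨(p.1, p.2.1, p.2.2.1, p.2.2.2.1, p.2.2.2.2.1, s • p.2.2.2.2.2), ⟨hp.1, hp.2.1, hp.2.2.1, hp.2.2.2.1, hp.2.2.2.2.1, ?_⟩, rfl⟩, ?_⟩
    · have := hp.2.2.2.2.2
      simp only [norm_smul, Real.norm_eq_abs, abs_of_nonneg hs0]
      nlinarith [norm_nonneg p.2.2.2.2.2]
    · intro i
      simp only [normProd, if_pos (hrj i), prodLin, inner_smul_left, conj_trivial]
      field_simp
  · intro f hf i
    rw [dualClass_eq] at hf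
    obtain ⟨β, hβ, rfl⟩ := hf
    refine (abs_inner_le hβ (norm_dualFeat_le Φ k _)).trans ((le_max_right 1 _).trans ?_)
    exact le_mul_of_one_le_left (le_trans zero_le_one (le_max_left _ _)) (le_max_left _ _)
  · rintro ⟨β, hβ⟩ s hs0 hs1
    refine ⟨fun t => inner ℝ (s • β) (dualFeat Φ k t), ?_, fun i => ?_⟩
    · rw [dualClass_eq]
      refine ⟨s • β, ?_, rfl⟩
      rw [norm_smul, Real.norm_eq_abs, abs_of_nonneg hs0]
      nlinarith [norm_nonneg β]
    · simp only [normDual, inner_smul_left, conj_trivial]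
      field_simp

end UniformDeviation

/-! ### Uniform deviations on the four subsamples -/

section DataConcentration

theorem ae_compProd_of_ae_fst {α β : Type*} [MeasurableSpace α] [MeasurableSpace β] {μ : Measure α}
    [SFinite μ] {κ : Kernel α β} [IsMarkovKernel κ] {p : α → Prop} (h : ∀ᵐ x ∂μ, p x) :
    ∀ᵐ x ∂(μ ⊗ₘ κ), p x.1 := by
  have h' : ∀ᵐ x ∂(μ ⊗ₘ κ).fst, p x := by rwa [Measure.fst_compProd]
  exact ae_of_ae_map measurable_fst.aemeasurable h'

variable {Om S O A Op : Type*} [MeasurableSpace Om] [MeasurableSpace S] [MeasurableSpace O]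
  [MeasurableSpace A] [MeasurableSpace Op] {c : Constants}

theorem ae_abs_rew_le {M : Model Om S O A Op} {C : ℝ} (h : RewardBounded M C) :
    ∀ᵐ t ∂obLaw M, |rew t| ≤ C := by
  unfold obLaw
  refine ae_compProd_of_ae_fst (p := fun x : ((((((((Om × S) × O) × A) × ℝ) × S) × Op) × A) × Bool) × Bool =>
    |x.1.1.1.1.1.2| ≤ C) ?_
  refine ae_compProd_of_ae_fst (p := fun x : (((((((Om × S) × O) × A) × ℝ) × S) × Op) × A) × Bool =>
    |x.1.1.1.1.2| ≤ C) ?_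
  refine ae_compProd_of_ae_fst (p := fun x : ((((((Om × S) × O) × A) × ℝ) × S) × Op) × A =>
    |x.1.1.1.2| ≤ C) ?_
  refine ae_compProd_of_ae_fst (p := fun x : (((((Om × S) × O) × A) × ℝ) × S) × Op =>
    |x.1.1.2| ≤ C) ?_
  refine ae_compProd_of_ae_fst (p := fun x : ((((Om × S) × O) × A) × ℝ) × S =>
    |x.1.2| ≤ C) ?_
  refine ae_compProd_of_ae_fst (p := fun x : (((Om × S) × O) × A) × ℝ =>
    |x.2| ≤ C) ?_
  refine Measure.ae_compProd_of_ae_ae (measurableSet_le (by fun_prop) measurable_const) ?_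
  exact ae_of_all _ fun x => h _

theorem ae_abs_rew_le_condLaw {M : Model Om S O A Op} {C : ℝ} (h : RewardBounded M C) (k : Fin 4) :
    ∀ᵐ t ∂condLaw M k, |rew t| ≤ C :=
  cond_absolutelyContinuous.ae_le (ae_abs_rew_le h)

theorem pattern_one_subset (k : Fin 4) :
    (pattern 1 : Set (Trial Om S O A Op)) ⊆ pattern k := by
  intro t ht
  have ht' := ht
  obtain ⟨h1, h2, h3⟩ : seenObs t = true ∧ seenPreObs t = true ∧ seenNextObs t = true := ht
  fin_cases k
  · exact ⟨h2, h3⟩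
  · exact ht'
  · exact ⟨h1, h2⟩
  · exact h2

theorem size_one_le {T : ℕ} (D : Fin T → Trial Om S O A Op) (k : Fin 4) : size D 1 ≤ size D k :=
  Fintype.card_subtype_mono _ _ (fun _ h => pattern_one_subset k h)

theorem nonempty_of_size_pos {T : ℕ} {D : Fin T → Trial Om S O A Op} (h : 0 < size D 1)
    (k : Fin 4) : Nonempty {t : Fin T // D t ∈ pattern k} :=
  Fintype.card_pos_iff.1 (h.trans_le (size_one_le D k))

theorem ae_size_one_eq_zero {M : Model Om S O A Op} (h : obLaw M (pattern 1) = 0) (T : ℕ) :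
    ∀ᵐ D ∂(Measure.pi fun _ : Fin T => obLaw M), size D 1 = 0 := by
  have h1 : ∀ᵐ t ∂obLaw M, t ∉ pattern 1 := by
    rw [ae_iff]; simpa using h
  have h2 := ae_all_iff.2 fun i : Fin T =>
    (Measure.quasiMeasurePreserving_eval (fun _ : Fin T => obLaw M) i).ae h1
  filter_upwards [h2] with D hD
  rw [size, Fintype.card_eq_zero_iff]
  exact ⟨fun t => hD t.1 t.2⟩

variable [Fintype A] [MeasurableSingletonClass A]

/-- With high probability the deviations on all four subsamples are controlled by the critical
radii. -/
theorem measure_not_forall_uniformDev_le {M : Model Om S O A Op} (hR : RewardBounded M c.LY)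
    {Φ : Features c Om O A Op} {Pol : Set (Kernel (Om × O) A)} (hPol : Pol ⊆ softmaxClass Φ)
    {L : ℝ} (hL : AlphaBounded S Φ Pol L) (hD : ∀ k, 0 ≤ c.D k) (hne : Pol.Nonempty)
    (hC : 0 ≤ c.C₁ ∧ 0 ≤ c.C₂ ∧ 0 ≤ c.C₃ ∧ 0 ≤ c.C₄) {ξ : ℝ} (hξ0 : 0 < ξ) (T : ℕ) :
    (Measure.pi fun _ : Fin T => obLaw M) {D | 0 < size D 1 ∧ ¬ ∀ η,
      BoundsCriticalRadii 2000000 ξ L Φ Pol D η →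
        ∀ k, UniformDev (condLaw M k) Φ Pol k (subData D k) (η k)} ≤ ENNReal.ofReal (8 * ξ) := by
  classical
  -- For `ξ ≥ 1/8` the bound `8 ξ` exceeds one. Below, `t = 2 log (1/ξ) ≥ 1` is available.
  rcases le_or_gt (1 / 8) ξ with h8 | h8
  · refine prob_le_one.trans ?_
    rw [ENNReal.one_le_ofReal]; linarith
  -- If complete trials have probability zero, almost surely none is observed. Otherwise every
  -- pattern, being implied by completeness, has positive probability.
  by_cases hp : obLaw M (pattern 1) = 0
  · refine le_of_eq_of_le (measure_mono_null (fun D hD => ?_)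
      (ae_iff.1 (ae_size_one_eq_zero hp T))) zero_le
    exact hD.1.ne'
  have hpk : ∀ k, obLaw M (pattern k) ≠ 0 := fun k h =>
    hp (measure_mono_null (pattern_one_subset k) h)
  have hξ : 1 ≤ 2 * Real.log (1 / ξ) := by
    have h2 : Real.log 2 ≤ Real.log (1 / ξ) := by
      refine Real.log_le_log (by norm_num) ?_
      rw [le_div_iff₀ hξ0]; linarith
    have := Real.log_two_gt_d9
    linarith
  have hexp : Real.exp (-(2 * Real.log (1 / ξ))) = ξ ^ 2 := by
    rw [show -(2 * Real.log (1 / ξ)) = Real.log ξ + Real.log ξ by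
      rw [one_div, Real.log_inv]; ring, Real.exp_add, Real.exp_log hξ0, sq]
  have key : ∀ k : Fin 4, (Measure.pi fun _ : Fin T => obLaw M)
      {D | Nonempty {t : Fin T // D t ∈ pattern k} ∧ ¬ ∀ η, (∃ ρ,
        IsCriticalRadius (subData D k) (prodClass Φ Pol k) (classBound c L k) ρ ∧
        IsCriticalRadius (subData D k) (dualClass Φ k) (classBound c L k) ρ ∧
        2000000 * (ρ + classBound c L k * √(Real.log (1 / ξ) / size D k)) ≤ η) →
        UniformDev (condLaw M k) Φ Pol k (subData D k) η} ≤ ENNReal.ofReal (12 * ξ ^ 2) := by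
    intro k
    have : IsProbabilityMeasure (condLaw M k) := cond_isProbabilityMeasure (hpk k)
    have := measure_subsample_le (T := T) (obLaw M) (measurableSet_pattern k) (hpk k)
      (fun p => {x | Nonempty {t // p t} ∧ ¬ ∀ η, (∃ ρ,
        IsCriticalRadius x (prodClass Φ Pol k) (classBound c L k) ρ ∧
        IsCriticalRadius x (dualClass Φ k) (classBound c L k) ρ ∧
        2000000 * (ρ + classBound c L k * √(Real.log (1 / ξ) / Fintype.card {t // p t})) ≤ η) →
        UniformDev (condLaw M k) Φ Pol k x η})
      (fun p => measure_not_uniformDev_le (ae_abs_rew_le_condLaw hR k) hPol hL k (hD k) hne hC hξ)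
    rw [hexp] at this
    exact this
  -- The level `ξ²` rather than `ξ` pays for the constants: `48 ξ² ≤ 8 ξ` when `ξ < 1/8`.
  have hsum : ∑ _k : Fin 4, ENNReal.ofReal (12 * ξ ^ 2) ≤ ENNReal.ofReal (8 * ξ) := by
    rw [← ENNReal.ofReal_sum_of_nonneg (fun _ _ => by positivity)]
    refine ENNReal.ofReal_le_ofReal ?_
    simp only [Finset.sum_const, Finset.card_univ, Fintype.card_fin, nsmul_eq_mul]
    push_cast
    nlinarith
  refine le_trans (measure_mono ?_) ((measure_iUnion_fintype_le _ _).trans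
    ((Finset.sum_le_sum fun k _ => key k).trans hsum))
  rintro D ⟨hs, hD⟩
  push Not at hD
  obtain ⟨η, hη, k, hk⟩ := hD
  refine Set.mem_iUnion.2 ⟨k, nonempty_of_size_pos hs k, fun hcon => hk (hcon _ (hη k))⟩

end DataConcentration

/-! ### Integrating out the missingness indicators -/

section BaseLaw

variable {Om S O A Op : Type*} [MeasurableSpace Om] [MeasurableSpace S] [MeasurableSpace O]
  [MeasurableSpace A] [MeasurableSpace Op] {c : Constants}

/-- The variables of a trial other than the missingness indicators. -/
abbrev Base (Om S O A Op : Type*) : Type _ := (((((((Om × S) × O) × A) × ℝ) × S) × Op) × A)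

/-- The law of the variables of a trial other than the missingness indicators. -/
def baseLaw (M : Model Om S O A Op) : Measure (Base Om S O A Op) :=
  M.pOm ⊗ₘ M.kS
    ⊗ₘ M.kO.comap (fun x : Om × S => x.2) (by fun_prop)
    ⊗ₘ M.piOb.comap (fun x : (Om × S) × O => x.1.2) (by fun_prop)
    ⊗ₘ M.kY.comap (fun x : ((Om × S) × O) × A => (x.1.1.2, x.1.2, x.2)) (by fun_prop)
    ⊗ₘ M.kSnext.comap (fun x : (((Om × S) × O) × A) × ℝ => (x.1.1.1.2, x.1.2)) (by fun_prop)
    ⊗ₘ M.kOp.comap (fun x : ((((Om × S) × O) × A) × ℝ) × S => x.2) (by fun_prop)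
    ⊗ₘ M.piOb.comap (fun x : (((((Om × S) × O) × A) × ℝ) × S) × Op => x.1.2) (by fun_prop)

instance (M : Model Om S O A Op) : IsProbabilityMeasure (baseLaw M) := by
  unfold baseLaw; infer_instance

/-- Forget the missingness indicators. -/
def base (t : Trial Om S O A Op) : Base Om S O A Op := t.1.1.1

/-- The trial with all values recorded. -/
def complete (b : Base Om S O A Op) : Trial Om S O A Op := (((b, true), true), true)

@[fun_prop]
theorem measurable_base : Measurable (base : Trial Om S O A Op → Base Om S O A Op) := by
  unfold base; fun_prop

@[fun_prop]
theorem measurable_complete : Measurable (complete : Base Om S O A Op → Trial Om S O A Op) := by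
  unfold complete; fun_prop

theorem measurable_comp_complete {f : Trial Om S O A Op → ℝ} (hf : Measurable f) :
    Measurable fun b => f (complete b) := hf.comp measurable_complete

/-- The event that the missingness indicators lie in the given sets. -/
def visEvent (E₁ E₂ E₃ : Set Bool) : Set (Trial Om S O A Op) :=
  {t | seenObs t ∈ E₁ ∧ seenPreObs t ∈ E₂ ∧ seenNextObs t ∈ E₃}

/-- The conditional probability of `visEvent` given the other variables. -/
def visWeight (M : Model Om S O A Op) (E₁ E₂ E₃ : Set Bool) (b : Base Om S O A Op) : ENNReal :=
  M.rO (b.1.1.1.1.1.2, b.1.1.1.1.2) E₁ * M.rOm b.1.1.1.1.1.1.1 E₂ * M.rOp (b.1.2, b.2) E₃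

theorem measurable_visWeight (M : Model Om S O A Op) (E₁ E₂ E₃ : Set Bool) :
    Measurable (visWeight M E₁ E₂ E₃) := by
  have h1 := M.rO.measurable_coe (MeasurableSet.of_discrete (s := E₁))
  have h2 := M.rOm.measurable_coe (MeasurableSet.of_discrete (s := E₂))
  have h3 := M.rOp.measurable_coe (MeasurableSet.of_discrete (s := E₃))
  unfold visWeight
  fun_prop

theorem visWeight_le_one (M : Model Om S O A Op) (E₁ E₂ E₃ : Set Bool) (b : Base Om S O A Op) :
    visWeight M E₁ E₂ E₃ b ≤ 1 :=
  mul_le_one' (mul_le_one' prob_le_one prob_le_one) prob_le_one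

/-- Given all other variables the three indicators are independent, so conditioning on a pattern
only reweights the law of the remaining variables. All later computations take place under this
single law. -/
theorem map_base_restrict (M : Model Om S O A Op) (E₁ E₂ E₃ : Set Bool) :
    ((obLaw M).restrict (visEvent E₁ E₂ E₃)).map base =
      (baseLaw M).withDensity (visWeight M E₁ E₂ E₃) := by
  have h1 := M.rO.measurable_coe (MeasurableSet.of_discrete (s := E₁))
  have h2 := M.rOm.measurable_coe (MeasurableSet.of_discrete (s := E₂))
  have h3 := M.rOp.measurable_coe (MeasurableSet.of_discrete (s := E₃))
  ext s hs
  rw [Measure.map_apply (by fun_prop) hs, Measure.restrict_apply (measurable_base hs),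
    withDensity_apply _ hs]
  have : base ⁻¹' s ∩ visEvent E₁ E₂ E₃ =
      (((s ×ˢ E₁) ×ˢ E₂) ×ˢ E₃ : Set (Trial Om S O A Op)) := by
    ext t
    simp only [visEvent, base, seenObs, seenPreObs, seenNextObs, Set.mem_inter_iff,
      Set.mem_preimage, Set.mem_prod, Set.mem_ofPred_eq]
    tauto
  rw [this]
  change (baseLaw M ⊗ₘ _ ⊗ₘ _ ⊗ₘ _) _ = _
  rw [Measure.compProd_apply_prod ((hs.prod .of_discrete).prod .of_discrete) .of_discrete,
    Measure.setLIntegral_compProd _ (hs.prod .of_discrete) .of_discrete]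
  · simp only [Kernel.comap_apply, setLIntegral_const]
    rw [Measure.setLIntegral_compProd _ hs .of_discrete]
    · simp only [Kernel.comap_apply, setLIntegral_const]
      refine lintegral_congr fun b => ?_
      simp only [visWeight]
      ring
    · fun_prop
  · simp only [Kernel.comap_apply]
    fun_prop

/-- The indicators whose being recorded is required by the `k`-th pattern. -/
def patternSets : Fin 4 → Set Bool × Set Bool × Set Bool
  | 0 => (Set.univ, {true}, {true})
  | 1 => ({true}, {true}, {true})
  | 2 => ({true}, {true}, Set.univ)
  | 3 => (Set.univ, {true}, Set.univ)

theorem pattern_eq_visEvent (k : Fin 4) : (pattern k : Set (Trial Om S O A Op)) =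
    visEvent (patternSets k).1 (patternSets k).2.1 (patternSets k).2.2 := by
  fin_cases k <;> ext t <;> simp [pattern, patternSets, visEvent]

/-- The density of the conditional law given the `k`-th pattern. -/
def dens (M : Model Om S O A Op) (k : Fin 4) (b : Base Om S O A Op) : ENNReal :=
  (obLaw M (pattern k))⁻¹ * visWeight M (patternSets k).1 (patternSets k).2.1 (patternSets k).2.2 b

theorem measurable_dens (M : Model Om S O A Op) (k : Fin 4) : Measurable (dens M k) :=
  (measurable_visWeight M _ _ _).const_mul _

theorem dens_lt_top {M : Model Om S O A Op} {k : Fin 4} (hk : obLaw M (pattern k) ≠ 0)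
    (b : Base Om S O A Op) : dens M k b < ⊤ :=
  ENNReal.mul_lt_top (ENNReal.inv_lt_top.2 (pos_iff_ne_zero.2 hk))
    ((visWeight_le_one M _ _ _ b).trans_lt ENNReal.one_lt_top)

theorem map_base_condLaw (M : Model Om S O A Op) (k : Fin 4) :
    (condLaw M k).map base = (baseLaw M).withDensity (dens M k) := by
  have h : dens M k = (obLaw M (pattern k))⁻¹ • visWeight M (patternSets k).1 (patternSets k).2.1
    (patternSets k).2.2 := rfl
  rw [condLaw, ProbabilityTheory.cond, Measure.map_smul, h,
    withDensity_smul _ (measurable_visWeight M _ _ _), ← map_base_restrict, ← pattern_eq_visEvent]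

theorem map_condLaw {M : Model Om S O A Op} (k : Fin 4) {X : Type*} [MeasurableSpace X]
    {f : Base Om S O A Op → X} (hf : Measurable f) :
    (condLaw M k).map (fun t => f (base t)) = ((baseLaw M).withDensity (dens M k)).map f := by
  rw [← map_base_condLaw, Measure.map_map hf measurable_base]
  rfl

/-- A function of a trial that does not depend on the missingness indicators. -/
def IgnoresMissingness {X : Type*} (f : Trial Om S O A Op → X) : Prop :=
  ∀ t, f (complete (base t)) = f t

theorem integral_restrict_visEvent (M : Model Om S O A Op) (E₁ E₂ E₃ : Set Bool)
    {f : Trial Om S O A Op → ℝ} (hf : IgnoresMissingness f) (hm : Measurable f) :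
    ∫ t, f t ∂((obLaw M).restrict (visEvent E₁ E₂ E₃)) =
      ∫ b, (visWeight M E₁ E₂ E₃ b).toReal * f (complete b) ∂baseLaw M := by
  have h1 : ∫ t, f t ∂((obLaw M).restrict (visEvent E₁ E₂ E₃)) =
      ∫ t, (fun b => f (complete b)) (base t) ∂((obLaw M).restrict (visEvent E₁ E₂ E₃)) :=
    integral_congr_ae (ae_of_all _ fun t => (hf t).symm)
  rw [h1, ← integral_map measurable_base.aemeasurable
    (measurable_comp_complete hm).aestronglyMeasurable, map_base_restrict,
    integral_withDensity_eq_integral_toReal_smul (measurable_visWeight M _ _ _)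
      (ae_of_all _ fun b => (visWeight_le_one M _ _ _ b).trans_lt ENNReal.one_lt_top)]
  rfl

theorem integrable_restrict_visEvent_iff (M : Model Om S O A Op) (E₁ E₂ E₃ : Set Bool)
    {f : Trial Om S O A Op → ℝ} (hf : IgnoresMissingness f) (hm : Measurable f) :
    Integrable f ((obLaw M).restrict (visEvent E₁ E₂ E₃)) ↔
      Integrable (fun b => (visWeight M E₁ E₂ E₃ b).toReal * f (complete b)) (baseLaw M) := by
  have h1 : Integrable f ((obLaw M).restrict (visEvent E₁ E₂ E₃)) ↔
      Integrable ((fun b => f (complete b)) ∘ base) ((obLaw M).restrict (visEvent E₁ E₂ E₃)) :=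
    integrable_congr (ae_of_all _ fun t => (hf t).symm)
  rw [h1, ← integrable_map_measure (measurable_comp_complete hm).aestronglyMeasurable
    measurable_base.aemeasurable, map_base_restrict,
    integrable_withDensity_iff_integrable_smul' (measurable_visWeight M _ _ _)
      (ae_of_all _ fun b => (visWeight_le_one M _ _ _ b).trans_lt ENNReal.one_lt_top)]
  rfl

theorem integral_condLaw {M : Model Om S O A Op} {k : Fin 4} (hk : obLaw M (pattern k) ≠ 0)
    {f : Trial Om S O A Op → ℝ} (hf : IgnoresMissingness f) (hm : Measurable f) :
    ∫ t, f t ∂condLaw M k = ∫ b, (dens M k b).toReal * f (complete b) ∂baseLaw M := by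
  have h1 : ∫ t, f t ∂condLaw M k = ∫ t, (fun b => f (complete b)) (base t) ∂condLaw M k :=
    integral_congr_ae (ae_of_all _ fun t => (hf t).symm)
  rw [h1, ← integral_map measurable_base.aemeasurable
    (measurable_comp_complete hm).aestronglyMeasurable, map_base_condLaw,
    integral_withDensity_eq_integral_toReal_smul (measurable_dens M k)
      (ae_of_all _ fun b => dens_lt_top hk b)]
  rfl

theorem integrable_condLaw_iff {M : Model Om S O A Op} {k : Fin 4}
    (hk : obLaw M (pattern k) ≠ 0) {f : Trial Om S O A Op → ℝ} (hf : IgnoresMissingness f)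
    (hm : Measurable f) : Integrable f (condLaw M k) ↔
      Integrable (fun b => (dens M k b).toReal * f (complete b)) (baseLaw M) := by
  have h1 : Integrable f (condLaw M k) ↔
      Integrable ((fun b => f (complete b)) ∘ base) (condLaw M k) :=
    integrable_congr (ae_of_all _ fun t => (hf t).symm)
  rw [h1, ← integrable_map_measure (measurable_comp_complete hm).aestronglyMeasurable
    measurable_base.aemeasurable, map_base_condLaw,
    integrable_withDensity_iff_integrable_smul' (measurable_dens M k)
      (ae_of_all _ fun b => dens_lt_top hk b)]
  rfl

end BaseLaw

/-! ### Linear conditional moments in integrated form -/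

section Dual

/-- Tower property in integrated form. -/
theorem integral_mul_eq_of_condExp_eq {Ω : Type*} {m : MeasurableSpace Ω} [mΩ : MeasurableSpace Ω]
    {ν : Measure Ω} [IsFiniteMeasure ν] (hm : m ≤ mΩ) {f g v : Ω → ℝ}
    (h : ν[f|m] =ᵐ[ν] g) (hv : Measurable[m] v) (hf : Integrable f ν)
    (hfv : Integrable (fun ω => f ω * v ω) ν) : ∫ ω, f ω * v ω ∂ν = ∫ ω, g ω * v ω ∂ν := by
  have h1 : ν[fun ω => f ω * v ω|m] =ᵐ[ν] fun ω => ν[f|m] ω * v ω :=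
    condExp_mul_of_stronglyMeasurable_right hv.stronglyMeasurable hfv hf
  rw [← integral_condExp hm, integral_congr_ae h1]
  refine integral_congr_ae ?_
  filter_upwards [h] with ω hω
  rw [hω]

/-- The transpose of `W` applied to `w`. -/
def transposeMul {p q : ℕ} (W : Matrix (Fin p) (Fin q) ℝ) (w : EuclideanSpace ℝ (Fin p)) :
    EuclideanSpace ℝ (Fin q) := WithLp.toLp 2 fun j => ∑ i, w i * W i j

theorem norm_transposeMul_le {p q : ℕ} (W : Matrix (Fin p) (Fin q) ℝ)
    (w : EuclideanSpace ℝ (Fin p)) : ‖transposeMul W w‖ ≤ ‖w‖ * frob W := by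
  rw [EuclideanSpace.norm_eq, EuclideanSpace.norm_eq, frob,
    ← Real.sqrt_mul (Finset.sum_nonneg fun _ _ => sq_nonneg _)]
  refine Real.sqrt_le_sqrt ?_
  simp only [Real.norm_eq_abs, sq_abs, transposeMul]
  rw [Finset.sum_comm (f := fun i j => W i j ^ 2), Finset.mul_sum]
  exact Finset.sum_le_sum fun j _ => Finset.sum_mul_sq_le_sq_mul_sq _ _ _

theorem inner_transposeMul {p q : ℕ} (W : Matrix (Fin p) (Fin q) ℝ)
    (w : EuclideanSpace ℝ (Fin p)) (g : EuclideanSpace ℝ (Fin q)) :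
    inner ℝ (transposeMul W w) g = ∑ i, w i * ∑ j, W i j * g j := by
  simp only [transposeMul, PiLp.inner_apply, RCLike.inner_apply, conj_trivial, Finset.mul_sum]
  rw [Finset.sum_comm]
  refine Finset.sum_congr rfl fun i _ => Finset.sum_congr rfl fun j _ => ?_
  ring

/-- The multiplier `v` is only integrable, not bounded: it will be one of the weights times a
recording probability. -/
theorem CondExpEqLin.integral_inner_mul {Ω : Type*} {m : MeasurableSpace Ω} [mΩ : MeasurableSpace Ω]
    {p q : ℕ} {ν : Measure Ω} [IsFiniteMeasure ν] (hm : m ≤ mΩ)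
    {f : Ω → EuclideanSpace ℝ (Fin p)} {W : Matrix (Fin p) (Fin q) ℝ}
    {g : Ω → EuclideanSpace ℝ (Fin q)} (h : CondExpEqLin ν m f W g) (hfm : Measurable f)
    (hf1 : ∀ ω, ‖f ω‖ ≤ 1) (hgm : Measurable g) (hg1 : ∀ ω, ‖g ω‖ ≤ 1) {v : Ω → ℝ}
    (hv : Measurable[m] v) (hvi : Integrable v ν) (w : EuclideanSpace ℝ (Fin p)) :
    ∫ ω, inner ℝ w (f ω) * v ω ∂ν = ∫ ω, inner ℝ (transposeMul W w) (g ω) * v ω ∂ν := by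
  have hfi : ∀ i ω, ‖f ω i‖ ≤ 1 := fun i ω => (PiLp.norm_apply_le (f ω) i).trans (hf1 ω)
  have hgi : ∀ i ω, ‖g ω i‖ ≤ 1 := fun i ω => (PiLp.norm_apply_le (g ω) i).trans (hg1 ω)
  have hfmi : ∀ i, Measurable fun ω => f ω i := fun i => by fun_prop
  have hgmi : ∀ i, Measurable fun ω => g ω i := fun i => by fun_prop
  have hint : ∀ i, Integrable (fun ω => f ω i * v ω) ν := fun i =>
    hvi.bdd_mul (hfmi i).aestronglyMeasurable (ae_of_all _ (hfi i))
  have hint2 : ∀ j, Integrable (fun ω => g ω j * v ω) ν := fun j =>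
    hvi.bdd_mul (hgmi j).aestronglyMeasurable (ae_of_all _ (hgi j))
  have h1 : ∀ i, ∫ ω, f ω i * v ω ∂ν = ∫ ω, (∑ j, W i j * g ω j) * v ω ∂ν := fun i =>
    integral_mul_eq_of_condExp_eq hm (h i) hv
      (Integrable.of_bound (hfmi i).aestronglyMeasurable 1 (ae_of_all _ (hfi i))) (hint i)
  have e1 : ∀ ω, inner ℝ w (f ω) * v ω = ∑ i, w i * (f ω i * v ω) := by
    intro ω
    simp only [PiLp.inner_apply, RCLike.inner_apply, conj_trivial, Finset.sum_mul]
    exact Finset.sum_congr rfl fun i _ => by ring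
  have e2 : ∀ ω, inner ℝ (transposeMul W w) (g ω) * v ω =
      ∑ i, w i * ((∑ j, W i j * g ω j) * v ω) := by
    intro ω
    rw [inner_transposeMul, Finset.sum_mul]
    exact Finset.sum_congr rfl fun i _ => by ring
  have hint3 : ∀ i, Integrable (fun ω => (∑ j, W i j * g ω j) * v ω) ν := by
    intro i
    have : (fun ω => (∑ j, W i j * g ω j) * v ω) = fun ω => ∑ j, W i j * (g ω j * v ω) := by
      funext ω
      rw [Finset.sum_mul]
      exact Finset.sum_congr rfl fun j _ => by ring
    rw [this]
    exact integrable_finsetSum _ fun j _ => (hint2 j).const_mul _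
  simp only [e1, e2]
  rw [integral_finsetSum _ fun i _ => (hint i).const_mul _,
    integral_finsetSum _ fun i _ => (hint3 i).const_mul _]
  refine Finset.sum_congr rfl fun i _ => ?_
  rw [integral_const_mul, integral_const_mul, h1]

end Dual

/-! ### Conditional moments under the missingness patterns -/

section MomentTransfer

theorem measurable_comap_comp {Ω X Y : Type*} [mX : MeasurableSpace X] [MeasurableSpace Y]
    {Z : Ω → X} {f : X → Y} (hf : Measurable f) :
    Measurable[mX.comap Z] fun ω => f (Z ω) := hf.comp (comap_measurable Z)

variable {Om S O A Op : Type*} [MeasurableSpace Om] [MeasurableSpace S] [MeasurableSpace O]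
  [MeasurableSpace A] [MeasurableSpace Op] {c : Constants}

theorem sigmaZ_le (k : Fin 4) :
    sigmaZ k ≤ (inferInstance : MeasurableSpace (Trial Om S O A Op)) := by
  fin_cases k
  · exact Measurable.comap_le (by fun_prop)
  · exact Measurable.comap_le (by fun_prop)
  · exact Measurable.comap_le (by fun_prop)
  · exact Measurable.comap_le (by fun_prop)

/-- The observational law given the next-step part of the `k`-th pattern. -/
def refLaw (M : Model Om S O A Op) (k : Fin 4) : Measure (Trial Om S O A Op) :=
  ProbabilityTheory.cond (obLaw M) (visEvent Set.univ Set.univ (patternSets k).2.2)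

theorem visEvent_univ_univ_true :
    (visEvent Set.univ Set.univ {true} : Set (Trial Om S O A Op)) = {t | seenNextObs t = true} := by
  ext t; simp [visEvent]

theorem visEvent_univ : (visEvent Set.univ Set.univ Set.univ : Set (Trial Om S O A Op)) =
    Set.univ := by
  ext t; simp [visEvent]

theorem refLaw_eq_obLaw (M : Model Om S O A Op) {k : Fin 4} (h : (patternSets k).2.2 = Set.univ) :
    refLaw M k = obLaw M := by
  rw [refLaw, h, visEvent_univ, cond_univ]

theorem refLaw_eq_cond (M : Model Om S O A Op) {k : Fin 4} (h : (patternSets k).2.2 = {true}) :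
    refLaw M k = ProbabilityTheory.cond (obLaw M) {t | seenNextObs t = true} := by
  rw [refLaw, h, visEvent_univ_univ_true]

/-- Conditional probability of the part of the `k`-th pattern about the current step. -/
def curWeight (M : Model Om S O A Op) (k : Fin 4) (t : Trial Om S O A Op) : ℝ :=
  match k with
  | 0 => (M.rOm (preObs t)).real {true}
  | 1 => (M.rO (obs t, act t)).real {true} * (M.rOm (preObs t)).real {true}
  | 2 => (M.rO (obs t, act t)).real {true} * (M.rOm (preObs t)).real {true}
  | 3 => (M.rOm (preObs t)).real {true}

theorem ignoresMissingness_curWeight (M : Model Om S O A Op) (k : Fin 4) :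
    IgnoresMissingness (curWeight M k) := by
  intro t; fin_cases k <;> rfl

/-- The current-step recording probability depends only on variables in `Z_k`. This is why the
linearity assumptions, stated without conditioning on the current-step indicators, remain valid
under the full pattern. -/
theorem measurable_curWeight (M : Model Om S O A Op) (k : Fin 4) :
    Measurable[sigmaZ k] (curWeight M k) := by
  have h1 : Measurable fun x : O × A => (M.rO x).real {true} :=
    (M.rO.measurable_coe (measurableSet_singleton _)).ennreal_toReal
  have h2 : Measurable fun x : Om => (M.rOm x).real {true} :=
    (M.rOm.measurable_coe (measurableSet_singleton _)).ennreal_toReal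
  match k with
  | 0 =>
    exact measurable_comap_comp (Z := fun t => (act t, preObs t, nextObs t))
      (h2.comp (by fun_prop : Measurable fun z : A × Om × Op => z.2.1))
  | 1 =>
    exact measurable_comap_comp (Z := fun t => (act t, obs t, preObs t, nextObs t))
      ((h1.comp (by fun_prop : Measurable fun z : A × O × Om × Op => (z.2.1, z.1))).mul
      (h2.comp (by fun_prop : Measurable fun z : A × O × Om × Op => z.2.2.1)))
  | 2 =>
    exact measurable_comap_comp (Z := fun t => (act t, obs t, preObs t))
      ((h1.comp (by fun_prop : Measurable fun z : A × O × Om => (z.2.1, z.1))).mul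
      (h2.comp (by fun_prop : Measurable fun z : A × O × Om => z.2.2)))
  | 3 =>
    exact measurable_comap_comp (Z := fun t => preObs t) h2

theorem toReal_visWeight_pattern (M : Model Om S O A Op) (k : Fin 4) (b : Base Om S O A Op) :
    (visWeight M (patternSets k).1 (patternSets k).2.1 (patternSets k).2.2 b).toReal =
      (visWeight M Set.univ Set.univ (patternSets k).2.2 b).toReal * curWeight M k (complete b) := by
  fin_cases k <;>
    simp only [visWeight, patternSets, ENNReal.toReal_mul, measure_univ, ENNReal.toReal_one,
      curWeight, Measure.real, one_mul, mul_one] <;> simp [complete, obs, act, preObs, mul_comm]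

theorem IgnoresMissingness.mul {f g : Trial Om S O A Op → ℝ} (hf : IgnoresMissingness f)
    (hg : IgnoresMissingness g) : IgnoresMissingness fun t => f t * g t := fun t => by
  simp only [hf t, hg t]

/-- The density of the pattern factors into its next-step part, which defines `refLaw`, and
`curWeight`; normalizing constants account for the rest. -/
theorem integral_condLaw_eq_refLaw {M : Model Om S O A Op} {k : Fin 4}
    (hk : obLaw M (pattern k) ≠ 0) {f : Trial Om S O A Op → ℝ} (hf : IgnoresMissingness f)
    (hm : Measurable f) : ∫ t, f t ∂condLaw M k = ((obLaw M).real (pattern k))⁻¹ *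
      ((obLaw M).real (visEvent Set.univ Set.univ (patternSets k).2.2) *
        ∫ t, f t * curWeight M k t ∂refLaw M k) := by
  have hsub : (pattern k : Set (Trial Om S O A Op)) ⊆
      visEvent Set.univ Set.univ (patternSets k).2.2 := by
    rw [pattern_eq_visEvent]
    exact fun t ht => ⟨trivial, trivial, ht.2.2⟩
  have hr : (obLaw M).real (visEvent Set.univ Set.univ (patternSets k).2.2) ≠ 0 := by
    rw [Measure.real, ENNReal.toReal_ne_zero]
    exact ⟨fun h => hk (measure_mono_null hsub h), measure_ne_top _ _⟩
  rw [condLaw, refLaw, integral_cond_eq, integral_cond_eq, mul_inv_cancel_left₀ hr,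
    pattern_eq_visEvent, integral_restrict_visEvent M _ _ _ hf hm,
    integral_restrict_visEvent M _ _ _ (hf.mul (ignoresMissingness_curWeight M k))
      (hm.mul ((measurable_curWeight M k).mono (sigmaZ_le k) le_rfl))]
  congr 1
  refine integral_congr_ae (ae_of_all _ fun b => ?_)
  simp only [toReal_visWeight_pattern]
  ring

theorem integrable_refLaw {M : Model Om S O A Op} {k : Fin 4}
    (hk : obLaw M (pattern k) ≠ 0) {f : Trial Om S O A Op → ℝ} (hf : IgnoresMissingness f)
    (hm : Measurable f) (hi : Integrable f (condLaw M k)) :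
    Integrable (fun t => f t * curWeight M k t) (refLaw M k) := by
  have h1 : Integrable f ((obLaw M).restrict (pattern k)) :=
    (integrable_smul_measure (ENNReal.inv_ne_zero.2 (measure_ne_top _ _))
      (ENNReal.inv_ne_top.2 hk)).1 hi
  rw [pattern_eq_visEvent, integrable_restrict_visEvent_iff M _ _ _ hf hm] at h1
  have h2 : Integrable (fun t => f t * curWeight M k t)
      ((obLaw M).restrict (visEvent Set.univ Set.univ (patternSets k).2.2)) := by
    rw [integrable_restrict_visEvent_iff M _ _ _ (hf.mul (ignoresMissingness_curWeight M k))
      (hm.mul ((measurable_curWeight M k).mono (sigmaZ_le k) le_rfl))]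
    refine h1.congr (ae_of_all _ fun b => ?_)
    simp only [toReal_visWeight_pattern]
    ring
  have hsub : (pattern k : Set (Trial Om S O A Op)) ⊆
      visEvent Set.univ Set.univ (patternSets k).2.2 := by
    rw [pattern_eq_visEvent]
    exact fun t ht => ⟨trivial, trivial, ht.2.2⟩
  exact h2.smul_measure (ENNReal.inv_ne_top.2 fun h => hk (measure_mono_null hsub h))

/-- Pass to the reference law, where the recording probability becomes part of the `Z_k`-measurable
multiplier, apply linearity there, and return. -/
theorem integral_inner_mul_condLaw {M : Model Om S O A Op} {k : Fin 4}
    (hk : obLaw M (pattern k) ≠ 0) {p q : ℕ} {F : Trial Om S O A Op → EuclideanSpace ℝ (Fin p)}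
    {W : Matrix (Fin p) (Fin q) ℝ} {G : Trial Om S O A Op → EuclideanSpace ℝ (Fin q)}
    (h : CondExpEqLin (refLaw M k) (sigmaZ k) F W G) (hF : IgnoresMissingness F)
    (hFm : Measurable F) (hF1 : ∀ t, ‖F t‖ ≤ 1) (hG : IgnoresMissingness G) (hGm : Measurable G)
    (hG1 : ∀ t, ‖G t‖ ≤ 1) {u : Trial Om S O A Op → ℝ} (hu : Measurable[sigmaZ k] u)
    (hu' : IgnoresMissingness u) (hui : Integrable u (condLaw M k))
    (w : EuclideanSpace ℝ (Fin p)) :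
    ∫ t, inner ℝ w (F t) * u t ∂condLaw M k =
      ∫ t, inner ℝ (transposeMul W w) (G t) * u t ∂condLaw M k := by
  have : IsFiniteMeasure (refLaw M k) := by unfold refLaw; infer_instance
  have hum : Measurable u := hu.mono (sigmaZ_le k) le_rfl
  have hF' : IgnoresMissingness fun t => inner ℝ w (F t) := fun t => by simp only [hF t]
  have hG' : IgnoresMissingness fun t => inner ℝ (transposeMul W w) (G t) := fun t => by
    simp only [hG t]
  rw [integral_condLaw_eq_refLaw hk (hF'.mul hu') ((measurable_const.inner hFm).mul hum),
    integral_condLaw_eq_refLaw hk (hG'.mul hu') ((measurable_const.inner hGm).mul hum)]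
  simp only [mul_assoc]
  have := h.integral_inner_mul (sigmaZ_le k) hFm hF1 hGm hG1
    (v := fun t => u t * curWeight M k t) (hu.mul (measurable_curWeight M k))
    (integrable_refLaw hk hu' hum hui) w
  rw [this]

variable [Fintype A] [MeasurableSingletonClass A]

theorem measurable_alpha {Φ : Features c Om O A Op} {Pol : Set (Kernel (Om × O) A)}
    (hPol : Pol ⊆ softmaxClass Φ) {π : Kernel (Om × O) A} (hπ : π ∈ Pol) {h : Bridge Om O A Op}
    (hh : h ∈ hypClass Φ) (k : Fin 4) : Measurable (alpha (S := S) π h k) := by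
  obtain ⟨w₀, hw₀⟩ := exists_isSoftmaxParam (hPol hπ)
  obtain ⟨w₁, w₂, w₃, w₄, -, -, -, -, rfl⟩ := mem_hypClass_iff.1 hh
  rw [funext fun t => alpha_linBridge hw₀ w₁ w₂ w₃ w₄ k t]
  exact measurable_alphaLin Φ w₀ w₁ w₂ w₃ w₄ k

theorem integrable_alpha_mul {M : Model Om S O A Op} (hR : RewardBounded M c.LY)
    {Φ : Features c Om O A Op} {Pol : Set (Kernel (Om × O) A)} (hPol : Pol ⊆ softmaxClass Φ)
    {L : ℝ} (hL : AlphaBounded S Φ Pol L) {π : Kernel (Om × O) A} (hπ : π ∈ Pol)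
    {h : Bridge Om O A Op} (hh : h ∈ hypClass Φ) {k : Fin 4} {u : Trial Om S O A Op → ℝ}
    (hui : Integrable u (condLaw M k)) :
    Integrable (fun t => alpha π h k t * u t) (condLaw M k) :=
  hui.bdd_mul (measurable_alpha hPol hπ hh k).aestronglyMeasurable
    ((ae_abs_rew_le_condLaw hR k).mono fun t ht => hL π hπ h hh k t ht)

theorem integrable_inner_mul {Ω : Type*} [MeasurableSpace Ω] {ν : Measure Ω} {p : ℕ}
    {F : Ω → EuclideanSpace ℝ (Fin p)} (hFm : Measurable F) (hF1 : ∀ t, ‖F t‖ ≤ 1) {u : Ω → ℝ}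
    (hu : Integrable u ν) (w : EuclideanSpace ℝ (Fin p)) :
    Integrable (fun t => inner ℝ w (F t) * u t) ν :=
  hu.bdd_mul (measurable_const.inner hFm).aestronglyMeasurable
    (ae_of_all _ fun t => abs_inner_le (le_refl ‖w‖) (hF1 t))

/-- Every policy of the class has a tuple of bridge functions in the hypothesis class with vanishing
moments; the moments of any other tuple are represented by elements of the dual classes. -/
theorem exists_bridge_moments {M : Model Om S O A Op} (hR : RewardBounded M c.LY)
    {Φ : Features c Om O A Op} {Pol : Set (Kernel (Om × O) A)} (hPol : Pol ⊆ softmaxClass Φ)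
    {L : ℝ} (hL : AlphaBounded S Φ Pol L) (hrad : RadiiOK Φ) (hlin : LinearBridgeExists M Φ Pol)
    (hdual : DualLinear M Φ) (hk : ∀ k, obLaw M (pattern k) ≠ 0) {π : Kernel (Om × O) A}
    (hπ : π ∈ Pol) : ∃ h₀ ∈ hypClass Φ,
      (∀ k (u : Trial Om S O A Op → ℝ), Measurable[sigmaZ k] u → IgnoresMissingness u →
        Integrable u (condLaw M k) → ∫ t, alpha π h₀ k t * u t ∂condLaw M k = 0) ∧
      ∀ h ∈ hypClass Φ, ∀ k, ∃ β : EuclideanSpace ℝ (Fin (dualDim c k)), ‖β‖ ≤ c.D k ∧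
        ∀ u : Trial Om S O A Op → ℝ, Measurable[sigmaZ k] u → IgnoresMissingness u →
          Integrable u (condLaw M k) → ∫ t, alpha π h k t * u t ∂condLaw M k =
            ∫ t, inner ℝ β (dualFeat Φ k t) * u t ∂condLaw M k := by
  have hfin : ∀ k, IsProbabilityMeasure (condLaw M k) := fun k => cond_isProbabilityMeasure (hk k)
  obtain ⟨hC1, hC2, hC3, hC4, hD0, hD1, hD2, hD3⟩ := hrad
  obtain ⟨hd1, hd2, hd3, hd4, hd5, hd6⟩ := hdual
  rw [← refLaw_eq_cond M (k := 0) rfl] at hd1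
  rw [← refLaw_eq_cond M (k := 1) rfl] at hd2 hd3
  rw [← refLaw_eq_obLaw M (k := 2) rfl] at hd5
  rw [← refLaw_eq_obLaw M (k := 3) rfl] at hd6
  have hf : ∀ {p q : ℕ} (W : Matrix (Fin p) (Fin q) ℝ), 0 ≤ frob W := fun W => Real.sqrt_nonneg _
  have mφ1 : Measurable fun t : Trial Om S O A Op => Φ.φ₁ (rew t, act t, preObs t, nextObs t) :=
    Φ.meas_φ₁.comp (by fun_prop)
  have mφ2 : Measurable fun t : Trial Om S O A Op => Φ.φ₂ (act t, obs t, preObs t) :=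
    Φ.meas_φ₂.comp (by fun_prop)
  have mφ3 : Measurable fun t : Trial Om S O A Op => Φ.φ₃ (rew t, act t, preObs t) :=
    Φ.meas_φ₃.comp (by fun_prop)
  have mψ0 : Measurable fun t : Trial Om S O A Op => Φ.ψ₁ (act t, preObs t, nextObs t) :=
    Φ.meas_ψ₁.comp (by fun_prop)
  have mψ1 : Measurable fun t : Trial Om S O A Op => Φ.ψ₂ (act t, obs t, preObs t, nextObs t) :=
    Φ.meas_ψ₂.comp (by fun_prop)
  have mψ2 : Measurable fun t : Trial Om S O A Op => Φ.ψ₃ (act t, obs t, preObs t) :=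
    Φ.meas_ψ₃.comp (by fun_prop)
  have mψ3 : Measurable fun t : Trial Om S O A Op => Φ.ψ₄ (preObs t) :=
    Φ.meas_ψ₄.comp (by fun_prop)
  have T1 := fun {u} hu hu' hui w => integral_inner_mul_condLaw (hk 0) hd1 (fun _ => rfl) mφ1
    (fun t => Φ.norm_φ₁ _) (fun _ => rfl) mψ0 (fun t => Φ.norm_ψ₁ _)
    (u := u) hu hu' hui w
  have T2 := fun {u} hu hu' hui w => integral_inner_mul_condLaw (hk 1) hd2 (fun _ => rfl) mφ1
    (fun t => Φ.norm_φ₁ _) (fun _ => rfl) mψ1 (fun t => Φ.norm_ψ₂ _)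
    (u := u) hu hu' hui w
  have T3 := fun {u} hu hu' hui w => integral_inner_mul_condLaw (hk 1) hd3 (fun _ => rfl) mφ2
    (fun t => Φ.norm_φ₂ _) (fun _ => rfl) mψ1 (fun t => Φ.norm_ψ₂ _)
    (u := u) hu hu' hui w
  have T5 := fun {u} hu hu' hui w => integral_inner_mul_condLaw (hk 2) hd5 (fun _ => rfl) mφ3
    (fun t => Φ.norm_φ₃ _) (fun _ => rfl) mψ2 (fun t => Φ.norm_ψ₃ _)
    (u := u) hu hu' hui w
  have T6 := fun {u} hu hu' hui w => integral_inner_mul_condLaw (hk 3) hd6 (fun _ => rfl) mφ3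
    (fun t => Φ.norm_φ₃ _) (fun _ => rfl) mψ3 (fun t => Φ.norm_ψ₄ _)
    (u := u) hu hu' hui w
  obtain ⟨⟨g₁, g₂, g₃, g₄⟩, hsol, -, ⟨v₁, hv₁, e₁⟩, ⟨v₂, hv₂, e₂⟩, ⟨v₃, hv₃, e₃⟩⟩ := hlin π hπ
  simp only at e₁ e₂ e₃
  subst e₁ e₂ e₃
  -- The last component of the given solution need not lie in the class. It is replaced by the
  -- linear form `E[h₃ | Z_4]`; the first three equations do not involve it, and the choice of `C₄`
  -- is exactly what makes it admissible.
  have hh₀ : linBridge Φ v₁ v₂ v₃ (transposeMul Φ.W₆ v₃) ∈ hypClass Φ := by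
    refine mem_hypClass_iff.2 ⟨v₁, v₂, v₃, _, hv₁, hv₂, hv₃, ?_, rfl⟩
    rw [hC4]
    exact (norm_transposeMul_le _ _).trans (mul_le_mul_of_nonneg_right hv₃ (hf _))
  have hzero : ∀ k (u : Trial Om S O A Op → ℝ), Measurable[sigmaZ k] u → IgnoresMissingness u →
        Integrable u (condLaw M k) → ∫ t, alpha π (linBridge Φ v₁ v₂ v₃ (transposeMul Φ.W₆ v₃)) k t
          * u t ∂condLaw M k = 0 := by
    intro k u hu hu' hui
    have key : ∀ j, (j = 0 ∨ j = 1 ∨ j = 2) → (alpha (S := S) π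
        (linBridge Φ v₁ v₂ v₃ (transposeMul Φ.W₆ v₃)) j) = alpha π
        ⟨fun x => inner ℝ v₁ (Φ.φ₁ x), fun x => inner ℝ v₂ (Φ.φ₂ x),
          fun x => inner ℝ v₃ (Φ.φ₃ x), g₄⟩ j := by
      rintro j (rfl | rfl | rfl) <;> rfl
    by_cases h3 : k = 3
    · subst h3
      have hi1 := integrable_inner_mul mψ3 (fun t => Φ.norm_ψ₄ _) hui
        (transposeMul Φ.W₆ v₃)
      have hi2 := integrable_inner_mul mφ3 (fun t => Φ.norm_φ₃ _) hui v₃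
      have : ∀ t, alpha π (linBridge Φ v₁ v₂ v₃ (transposeMul Φ.W₆ v₃)) 3 t * u t =
          inner ℝ (transposeMul Φ.W₆ v₃) (Φ.ψ₄ (preObs t)) * u t -
            inner ℝ v₃ (Φ.φ₃ (rew t, act t, preObs t)) * u t := fun t => sub_mul _ _ _
      simp only [this]
      rw [integral_sub hi1 hi2, T6 hu hu' hui]
      exact sub_self _
    · have hk3 : k = 0 ∨ k = 1 ∨ k = 2 := by
        fin_cases k <;> simp_all
      have hi := integrable_alpha_mul hR hPol hL hπ hh₀ (k := k) hui
      rw [key k hk3] at hi ⊢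
      have := integral_mul_eq_of_condExp_eq (sigmaZ_le k) (hsol k).2 hu (hsol k).1 hi
      rw [this]
      simp
  refine ⟨_, hh₀, hzero, fun h hh k => ?_⟩
  obtain ⟨w₁, w₂, w₃, w₄, a₁, a₂, a₃, a₄, rfl⟩ := mem_hypClass_iff.1 hh
  have r0 : ∃ β : EuclideanSpace ℝ (Fin c.d₁), ‖β‖ ≤ c.D 0 ∧
      ∀ u : Trial Om S O A Op → ℝ, Measurable[sigmaZ 0] u → IgnoresMissingness u →
        Integrable u (condLaw M 0) →
        ∫ t, alpha π (linBridge Φ w₁ w₂ w₃ w₄) 0 t * u t ∂condLaw M 0 =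
          ∫ t, inner ℝ β (Φ.ψ₁ (act t, preObs t, nextObs t)) * u t ∂condLaw M 0 := by
    refine ⟨transposeMul Φ.W₁ w₁, (norm_transposeMul_le _ _).trans ?_, fun u hu hu' hui =>
      T1 hu hu' hui w₁⟩
    have := mul_le_mul_of_nonneg_right a₁ (hf Φ.W₁)
    have := mul_nonneg hC1 (hf Φ.W₁)
    linarith
  have r1 : ∃ β : EuclideanSpace ℝ (Fin c.d₂), ‖β‖ ≤ c.D 1 ∧
      ∀ u : Trial Om S O A Op → ℝ, Measurable[sigmaZ 1] u → IgnoresMissingness u →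
        Integrable u (condLaw M 1) →
        ∫ t, alpha π (linBridge Φ w₁ w₂ w₃ w₄) 1 t * u t ∂condLaw M 1 =
          ∫ t, inner ℝ β (Φ.ψ₂ (act t, obs t, preObs t, nextObs t)) * u t ∂condLaw M 1 := by
    -- The term `Y π` is not linear in the features. Subtracting the vanishing moment of the
    -- solution removes it and leaves differences of coefficient vectors, of norm up to twice the
    -- radii.
    refine ⟨transposeMul Φ.W₃ (w₂ - v₂) - transposeMul Φ.W₂ (w₁ - v₁),
      (norm_sub_le _ _).trans ?_, fun u hu hu' hui => ?_⟩
    · have h1 := norm_transposeMul_le Φ.W₃ (w₂ - v₂)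
      have h2 := norm_transposeMul_le Φ.W₂ (w₁ - v₁)
      have h3 := mul_le_mul_of_nonneg_right ((norm_sub_le w₂ v₂).trans (add_le_add a₂ hv₂))
        (hf Φ.W₃)
      have h4 := mul_le_mul_of_nonneg_right ((norm_sub_le w₁ v₁).trans (add_le_add a₁ hv₁))
        (hf Φ.W₂)
      linarith
    · have hi0 := integrable_alpha_mul hR hPol hL hπ hh₀ (k := 1) hui
      have hi1 := integrable_inner_mul mφ1 (fun t => Φ.norm_φ₁ _) hui (w₁ - v₁)
      have hi2 := integrable_inner_mul mφ2 (fun t => Φ.norm_φ₂ _) hui (w₂ - v₂)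
      have e : ∀ t, alpha π (linBridge Φ w₁ w₂ w₃ w₄) 1 t * u t =
          alpha π (linBridge Φ v₁ v₂ v₃ (transposeMul Φ.W₆ v₃)) 1 t * u t +
          (inner ℝ (w₂ - v₂) (Φ.φ₂ (act t, obs t, preObs t)) * u t -
          inner ℝ (w₁ - v₁) (Φ.φ₁ (rew t, act t, preObs t, nextObs t)) * u t) := by
        intro t
        simp only [alpha, linBridge, inner_sub_left]
        ring
      have hi3 := integrable_inner_mul mψ1 (fun t => Φ.norm_ψ₂ _) hui
        (transposeMul Φ.W₃ (w₂ - v₂))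
      have hi4 := integrable_inner_mul mψ1 (fun t => Φ.norm_ψ₂ _) hui
        (transposeMul Φ.W₂ (w₁ - v₁))
      simp only [e]
      have hi5 : Integrable (fun t => inner ℝ (w₂ - v₂) (Φ.φ₂ (act t, obs t, preObs t)) * u t -
          inner ℝ (w₁ - v₁) (Φ.φ₁ (rew t, act t, preObs t, nextObs t)) * u t) (condLaw M 1) :=
        hi2.sub hi1
      rw [integral_add hi0 hi5, hzero 1 u hu hu' hui, integral_sub hi2 hi1,
        T2 hu hu' hui, T3 hu hu' hui, zero_add, ← integral_sub]
      · simp only [inner_sub_left, sub_mul]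
      · exact hi3
      · exact hi4
  have r2 : ∃ β : EuclideanSpace ℝ (Fin c.d₃), ‖β‖ ≤ c.D 2 ∧
      ∀ u : Trial Om S O A Op → ℝ, Measurable[sigmaZ 2] u → IgnoresMissingness u →
        Integrable u (condLaw M 2) →
        ∫ t, alpha π (linBridge Φ w₁ w₂ w₃ w₄) 2 t * u t ∂condLaw M 2 =
          ∫ t, inner ℝ β (Φ.ψ₃ (act t, obs t, preObs t)) * u t ∂condLaw M 2 := by
    refine ⟨transposeMul Φ.W₅ w₃ - transposeMul Φ.W₄ w₂, (norm_sub_le _ _).trans ?_,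
      fun u hu hu' hui => ?_⟩
    · have h1 := norm_transposeMul_le Φ.W₅ w₃
      have h2 := norm_transposeMul_le Φ.W₄ w₂
      have h3 := mul_le_mul_of_nonneg_right a₃ (hf Φ.W₅)
      have h4 := mul_le_mul_of_nonneg_right a₂ (hf Φ.W₄)
      have := mul_nonneg hC3 (hf Φ.W₅)
      have := mul_nonneg hC2 (hf Φ.W₄)
      linarith
    · have hi1 := integrable_inner_mul mφ3 (fun t => Φ.norm_φ₃ _) hui w₃
      have hi3 := integrable_inner_mul mψ2 (fun t => Φ.norm_ψ₃ _) hui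
        (transposeMul Φ.W₅ w₃)
      have hi4 := integrable_inner_mul mψ2 (fun t => Φ.norm_ψ₃ _) hui
        (transposeMul Φ.W₄ w₂)
      have e : ∀ t, alpha π (linBridge Φ w₁ w₂ w₃ w₄) 2 t * u t =
          inner ℝ w₃ (Φ.φ₃ (rew t, act t, preObs t)) * u t -
            inner ℝ (transposeMul Φ.W₄ w₂) (Φ.ψ₃ (act t, obs t, preObs t)) * u t := by
        intro t
        have e1 : ∑ a : A, inner ℝ w₂ (Φ.φ₂ (a, obs t, preObs t)) =
            inner ℝ (transposeMul Φ.W₄ w₂) (Φ.ψ₃ (act t, obs t, preObs t)) := by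
          rw [← inner_sum, inner_transposeMul, PiLp.inner_apply]
          refine Finset.sum_congr rfl fun i _ => ?_
          rw [hd4 (act t) (obs t) (preObs t) i]
          simp [mul_comm]
        rw [← e1]
        exact sub_mul _ _ _
      simp only [e]
      rw [integral_sub hi1 hi4, T5 hu hu' hui, ← integral_sub hi3 hi4]
      simp only [inner_sub_left, sub_mul]
  have r3 : ∃ β : EuclideanSpace ℝ (Fin c.m₄), ‖β‖ ≤ c.D 3 ∧
      ∀ u : Trial Om S O A Op → ℝ, Measurable[sigmaZ 3] u → IgnoresMissingness u →
        Integrable u (condLaw M 3) →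
        ∫ t, alpha π (linBridge Φ w₁ w₂ w₃ w₄) 3 t * u t ∂condLaw M 3 =
          ∫ t, inner ℝ β (Φ.ψ₄ (preObs t)) * u t ∂condLaw M 3 := by
    refine ⟨w₄ - transposeMul Φ.W₆ w₃, (norm_sub_le _ _).trans ?_, fun u hu hu' hui => ?_⟩
    · have h1 := norm_transposeMul_le Φ.W₆ w₃
      have h3 := mul_le_mul_of_nonneg_right a₃ (hf Φ.W₆)
      have := mul_nonneg hC3 (hf Φ.W₆)
      linarith
    · have hi1 := integrable_inner_mul mφ3 (fun t => Φ.norm_φ₃ _) hui w₃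
      have hi3 := integrable_inner_mul mψ3 (fun t => Φ.norm_ψ₄ _) hui w₄
      have hi4 := integrable_inner_mul mψ3 (fun t => Φ.norm_ψ₄ _) hui
        (transposeMul Φ.W₆ w₃)
      have e : ∀ t, alpha π (linBridge Φ w₁ w₂ w₃ w₄) 3 t * u t =
          inner ℝ w₄ (Φ.ψ₄ (preObs t)) * u t -
            inner ℝ w₃ (Φ.φ₃ (rew t, act t, preObs t)) * u t := fun t => sub_mul _ _ _
      simp only [e]
      rw [integral_sub hi3 hi1, T6 hu hu' hui]
      simp only [inner_sub_left, sub_mul]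
      exact (integral_sub hi3 hi4).symm
  fin_cases k
  · exact r0
  · exact r1
  · exact r2
  · exact r3

end MomentTransfer

/-! ### Densities of the patterns and of the interventional laws -/

section DensityRatios

theorem map_withDensity_comp {α β : Type*} [MeasurableSpace α] [MeasurableSpace β] (μ : Measure α)
    {f : α → β} (hf : Measurable f) {d : β → ENNReal} (hd : Measurable d) :
    (μ.withDensity fun x => d (f x)).map f = (μ.map f).withDensity d := by
  ext s hs
  rw [Measure.map_apply hf hs, withDensity_apply _ (hf hs), withDensity_apply _ hs,
    setLIntegral_map hs hd hf]

theorem withDensity_compProd_left {α β : Type*} [MeasurableSpace α] [MeasurableSpace β]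
    (μ : Measure α) [SFinite μ] (κ : Kernel α β) [IsMarkovKernel κ] {d : α → ENNReal}
    (hd : Measurable d) [SFinite (μ.withDensity d)] :
    (μ.withDensity d) ⊗ₘ κ = (μ ⊗ₘ κ).withDensity fun x => d x.1 := by
  refine Measure.ext_of_lintegral _ fun f hf => ?_
  rw [Measure.lintegral_compProd hf, lintegral_withDensity_eq_lintegral_mul _ hd (by fun_prop),
    lintegral_withDensity_eq_lintegral_mul _ (by fun_prop) hf,
    Measure.lintegral_compProd (by fun_prop)]
  refine lintegral_congr fun x => ?_
  simp only [Pi.mul_apply]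
  rw [lintegral_const_mul _ (by fun_prop)]

theorem map_fst_compProd {α β γ : Type*} [MeasurableSpace α] [MeasurableSpace β]
    [MeasurableSpace γ] (μ : Measure α) [SFinite μ] (κ : Kernel α β) [IsMarkovKernel κ]
    {f : α → γ} (hf : Measurable f) : (μ ⊗ₘ κ).map (fun x => f x.1) = μ.map f := by
  conv_rhs => rw [← Measure.fst_compProd μ κ, Measure.fst, Measure.map_map hf measurable_fst]
  rfl

variable {Om S O A Op : Type*} [MeasurableSpace Om] [MeasurableSpace S] [MeasurableSpace O]
  [MeasurableSpace A] [MeasurableSpace Op]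

/-- The law of pre-observation, state and observation. -/
def obsLaw (M : Model Om S O A Op) : Measure ((Om × S) × O) :=
  M.pOm ⊗ₘ M.kS ⊗ₘ M.kO.comap (fun x : Om × S => x.2) (by fun_prop)

/-- The law of pre-observation, state, observation and action. -/
def actLaw (M : Model Om S O A Op) : Measure (((Om × S) × O) × A) :=
  obsLaw M ⊗ₘ M.piOb.comap (fun x : (Om × S) × O => x.1.2) (by fun_prop)

instance (M : Model Om S O A Op) : IsProbabilityMeasure (obsLaw M) := by
  unfold obsLaw; infer_instance

theorem map_baseLaw_act (M : Model Om S O A Op) {X : Type*} [MeasurableSpace X]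
    {f : ((Om × S) × O) × A → X} (hf : Measurable f) :
    (baseLaw M).map (fun b => f b.1.1.1.1) = (actLaw M).map f := by
  have h1 : Measurable fun b : ((((Om × S) × O) × A) × ℝ) => f b.1 := by fun_prop
  have h2 : Measurable fun b : (((((Om × S) × O) × A) × ℝ) × S) => f b.1.1 := by fun_prop
  have h3 : Measurable fun b : ((((((Om × S) × O) × A) × ℝ) × S) × Op) => f b.1.1.1 := by fun_prop
  unfold baseLaw
  rw [map_fst_compProd _ _ h3, map_fst_compProd _ _ h2, map_fst_compProd _ _ h1,
    map_fst_compProd _ _ hf]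
  rfl

theorem map_baseLaw_obs (M : Model Om S O A Op) {X : Type*} [MeasurableSpace X]
    {f : (Om × S) × O → X} (hf : Measurable f) :
    (baseLaw M).map (fun b => f b.1.1.1.1.1) = (obsLaw M).map f := by
  rw [map_baseLaw_act M (f := fun x => f x.1) (by fun_prop), actLaw, map_fst_compProd _ _ hf]

theorem map_baseLaw_preObs (M : Model Om S O A Op) :
    (baseLaw M).map (fun b => preObs (complete b)) = M.pOm := by
  have h := map_baseLaw_obs M (f := fun x => x.1.1) (by fun_prop)
  refine Eq.trans h ?_
  rw [obsLaw, map_fst_compProd _ _ measurable_fst]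
  exact Measure.fst_compProd _ _

/-- Action, observation and pre-observation. -/
def aoOm (b : Base Om S O A Op) : A × O × Om :=
  (act (complete b), obs (complete b), preObs (complete b))

@[fun_prop]
theorem measurable_aoOm : Measurable (aoOm : Base Om S O A Op → A × O × Om) := by
  unfold aoOm; fun_prop

/-- Action and observation are conditionally independent given the state, so the order in which they
are drawn is immaterial. -/
theorem map_actLaw_eq (M : Model Om S O A Op) :
    (actLaw M).map (fun x => (x.2, x.1.2, x.1.1.1)) =
      (M.pOm ⊗ₘ ((M.piOb ×ₖ M.kO) ∘ₖ M.kS)).map (fun x => (x.2.1, x.2.2, x.1)) := by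
  refine Measure.ext_of_lintegral _ fun f hf => ?_
  rw [lintegral_map hf (by fun_prop), lintegral_map hf (by fun_prop), actLaw, obsLaw,
    Measure.lintegral_compProd (by fun_prop), Measure.lintegral_compProd (by fun_prop),
    Measure.lintegral_compProd (by fun_prop), Measure.lintegral_compProd (by fun_prop)]
  refine lintegral_congr fun om => ?_
  rw [Kernel.lintegral_comp _ _ _ (by fun_prop)]
  refine lintegral_congr fun s => ?_
  rw [Kernel.prod_apply, lintegral_prod_symm _ (by fun_prop)]
  simp only [Kernel.comap_apply]

/-- `dens M 3` as a function of the pre-observation. -/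
def densOm (M : Model Om S O A Op) (om : Om) : ENNReal :=
  (obLaw M (pattern 3))⁻¹ * M.rOm om {true}

theorem measurable_densOm (M : Model Om S O A Op) : Measurable (densOm M) :=
  (M.rOm.measurable_coe (measurableSet_singleton _)).const_mul _

theorem dens_three (M : Model Om S O A Op) (b : Base Om S O A Op) :
    dens M 3 b = densOm M (preObs (complete b)) := by
  simp only [dens, densOm, visWeight, patternSets, preObs, complete, measure_univ, one_mul, mul_one]

theorem lawOm_eq (M : Model Om S O A Op) : lawOm M = M.pOm.withDensity (densOm M) := by
  rw [← map_baseLaw_preObs M, ← map_withDensity_comp _ (by fun_prop) (measurable_densOm M), lawOm]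
  have h := map_condLaw (M := M) 3 (f := fun b => preObs (complete b)) (by fun_prop)
  refine Eq.trans h ?_
  congr 2
  exact funext fun b => dens_three M b

/-- The density of the interventional law of the pre-observation. -/
def shiftOm (M : Model Om S O A Op) (om : Om) : ENNReal :=
  densOm M om * M.pTilde.rnDeriv (lawOm M) om

theorem measurable_shiftOm (M : Model Om S O A Op) : Measurable (shiftOm M) :=
  (measurable_densOm M).mul (Measure.measurable_rnDeriv _ _)

instance (M : Model Om S O A Op) (k : Fin 4) : IsFiniteMeasure (condLaw M k) := by
  unfold condLaw; infer_instance

instance (M : Model Om S O A Op) (k : Fin 4) : IsFiniteMeasure (lawAOOm M k) := by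
  unfold lawAOOm; infer_instance

instance (M : Model Om S O A Op) : IsFiniteMeasure (lawOm M) := by
  unfold lawOm; infer_instance

instance (M : Model Om S O A Op) : IsProbabilityMeasure (shiftNum₃ M) := by
  unfold shiftNum₃
  exact Measure.isProbabilityMeasure_map (by fun_prop)

theorem withDensity_shiftOm {M : Model Om S O A Op} (h : M.pTilde ≪ lawOm M) :
    M.pOm.withDensity (shiftOm M) = M.pTilde := by
  conv_rhs => rw [← Measure.withDensity_rnDeriv_eq _ _ h, lawOm_eq]
  rw [← withDensity_mul _ (measurable_densOm M) (Measure.measurable_rnDeriv _ _)]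
  rw [← lawOm_eq]
  rfl

/-- The density involves only the root of the causal graph, so it passes through the subsequent
kernels. -/
theorem obsLaw_withDensity_shiftOm {M : Model Om S O A Op} (h : M.pTilde ≪ lawOm M) :
    (obsLaw M).withDensity (fun x => shiftOm M x.1.1) =
      M.pTilde ⊗ₘ M.kS ⊗ₘ M.kO.comap (fun x : Om × S => x.2) (by fun_prop) := by
  have hm := measurable_shiftOm M
  have h1 := withDensity_shiftOm h
  have : SFinite (M.pOm.withDensity (shiftOm M)) := by rw [h1]; infer_instance
  have h2 := withDensity_compProd_left M.pOm M.kS hm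
  rw [h1] at h2
  have : SFinite ((M.pOm ⊗ₘ M.kS).withDensity fun x => shiftOm M x.1) := by
    rw [← h2]; infer_instance
  rw [h2, withDensity_compProd_left _ _ (by fun_prop)]
  rfl

/-- `dens M 2` as a function of action, observation and pre-observation. -/
def densAOOm (M : Model Om S O A Op) (x : A × O × Om) : ENNReal :=
  (obLaw M (pattern 2))⁻¹ * (M.rO (x.2.1, x.1) {true} * M.rOm x.2.2 {true})

theorem measurable_densAOOm (M : Model Om S O A Op) : Measurable (densAOOm M) := by
  have h1 := M.rO.measurable_coe (measurableSet_singleton true)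
  have h2 := M.rOm.measurable_coe (measurableSet_singleton true)
  unfold densAOOm
  fun_prop

theorem dens_two (M : Model Om S O A Op) (b : Base Om S O A Op) :
    dens M 2 b = densAOOm M (aoOm b) := by
  simp only [dens, densAOOm, visWeight, patternSets, preObs, obs, act, complete, aoOm, measure_univ,
    mul_one]

theorem lawAOOm_eq_map (M : Model Om S O A Op) (k : Fin 4) :
    lawAOOm M k = ((baseLaw M).withDensity (dens M k)).map aoOm :=
  map_condLaw k measurable_aoOm

/-- Both sides are densities of `shiftNum₃` with respect to the observational law of `(A,O,O⁻)`: the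
left by definition of the derivative, the right because only the law of `O⁻` was changed. Densities
are almost everywhere unique. -/
theorem dens_three_mul_eq {M : Model Om S O A Op} (h : RatiosExist M) :
    ∀ᵐ b ∂baseLaw M, dens M 2 b * (shiftNum₃ M).rnDeriv (lawAOOm M 2) (aoOm b) =
      shiftOm M (preObs (complete b)) := by
  have hm := measurable_shiftOm M
  have hB : (baseLaw M).map aoOm =
      (M.pOm ⊗ₘ ((M.piOb ×ₖ M.kO) ∘ₖ M.kS)).map (fun x => (x.2.1, x.2.2, x.1)) := by
    rw [← map_actLaw_eq, ← map_baseLaw_act M (by fun_prop)]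
    rfl
  have e1 : shiftNum₃ M = ((baseLaw M).map aoOm).withDensity
      (densAOOm M * (shiftNum₃ M).rnDeriv (lawAOOm M 2)) := by
    have h2 : lawAOOm M 2 = ((baseLaw M).map aoOm).withDensity (densAOOm M) := by
      rw [lawAOOm_eq_map, ← map_withDensity_comp _ measurable_aoOm (measurable_densAOOm M)]
      congr 2
      exact funext fun b => dens_two M b
    rw [withDensity_mul _ (measurable_densAOOm M) (Measure.measurable_rnDeriv _ _), ← h2,
      Measure.withDensity_rnDeriv_eq _ _ h.2.1]
  have e2 : shiftNum₃ M = ((baseLaw M).map aoOm).withDensity (fun x => shiftOm M x.2.2) := by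
    have h1 := withDensity_shiftOm h.2.2
    have : SFinite (M.pOm.withDensity (shiftOm M)) := by rw [h1]; infer_instance
    rw [shiftNum₃, ← h1, withDensity_compProd_left _ _ hm, hB,
      ← map_withDensity_comp _ (by fun_prop) (by fun_prop)]
  have hfin : ∫⁻ x, (densAOOm M * (shiftNum₃ M).rnDeriv (lawAOOm M 2)) x
      ∂((baseLaw M).map aoOm) ≠ ⊤ := by
    rw [← setLIntegral_univ, ← withDensity_apply _ .univ, ← e1]
    exact measure_ne_top _ _
  have h3 := (withDensity_eq_iff ((measurable_densAOOm M).mul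
    (Measure.measurable_rnDeriv _ _)).aemeasurable (by fun_prop) hfin).1 (e1.symm.trans e2)
  filter_upwards [ae_of_ae_map measurable_aoOm.aemeasurable h3] with b hb
  rw [dens_two]
  exact hb

/-- Recording of `O` depends on `(O,A)` alone, so the densities of the first two patterns differ by
a function `q` of `(A,O,O⁻)`. The derivative inverts `q` almost everywhere under the first pattern.
-/
theorem dens_one_mul_eq {M : Model Om S O A Op} (h : RatiosExist M)
    (hk : ∀ k, obLaw M (pattern k) ≠ 0) :
    ∀ᵐ b ∂baseLaw M, dens M 1 b * (lawAOOm M 0).rnDeriv (lawAOOm M 1) (aoOm b) = dens M 0 b := by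
  set q : A × O × Om → ENNReal := fun x =>
    (obLaw M (pattern 1))⁻¹ * obLaw M (pattern 0) * M.rO (x.2.1, x.1) {true} with hq
  have hr := M.rO.measurable_coe (measurableSet_singleton true)
  have hqm : Measurable q := by fun_prop
  have hd : ∀ b, dens M 1 b = dens M 0 b * q (aoOm b) := by
    intro b
    have hc : (obLaw M (pattern 0))⁻¹ * obLaw M (pattern 0) = 1 :=
      ENNReal.inv_mul_cancel (hk 0) (measure_ne_top _ _)
    simp only [dens, visWeight, patternSets, hq, aoOm, act, obs, complete, measure_univ, one_mul]
    calc _ = ((obLaw M (pattern 0))⁻¹ * obLaw M (pattern 0)) * ((obLaw M (pattern 1))⁻¹ *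
        (M.rO (b.1.1.1.1.1.2, b.1.1.1.1.2) {true} * M.rOm b.1.1.1.1.1.1.1 {true} *
          M.rOp (b.1.2, b.2) {true})) := by rw [hc, one_mul]
      _ = _ := by ring
  set R := (lawAOOm M 0).rnDeriv (lawAOOm M 1) with hR
  have hRm : Measurable R := Measure.measurable_rnDeriv _ _
  have e1 : lawAOOm M 1 = (lawAOOm M 0).withDensity q := by
    rw [lawAOOm_eq_map, lawAOOm_eq_map, ← map_withDensity_comp _ measurable_aoOm hqm,
      ← withDensity_mul _ (measurable_dens M 0) (by fun_prop)]
    congr 2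
    exact funext hd
  have e2 : (lawAOOm M 0).withDensity (q * R) = (lawAOOm M 0).withDensity 1 := by
    rw [withDensity_mul _ hqm hRm, ← e1, hR, Measure.withDensity_rnDeriv_eq _ _ h.1,
      withDensity_one]
  have hfin : ∫⁻ x, (q * R) x ∂(lawAOOm M 0) ≠ ⊤ := by
    rw [← setLIntegral_univ, ← withDensity_apply _ .univ, e2, withDensity_one]
    exact measure_ne_top _ _
  have h3 := (withDensity_eq_iff (hqm.mul hRm).aemeasurable measurable_one.aemeasurable hfin).1 e2
  rw [lawAOOm_eq_map] at h3
  have h4 := ae_of_ae_map measurable_aoOm.aemeasurable h3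
  rw [ae_withDensity_iff (measurable_dens M 0)] at h4
  filter_upwards [h4] with b hb
  rw [hd]
  by_cases h0 : dens M 0 b = 0
  · rw [h0]; simp
  · have := hb h0
    simp only [Pi.mul_apply, Pi.one_apply] at this
    rw [mul_assoc, this, mul_one]

end DensityRatios

/-! ### Independence of observation and reward from the next step -/

section ConditionalIndependence

variable {Om S O A Op : Type*} [MeasurableSpace Om] [MeasurableSpace S] [MeasurableSpace O]
  [MeasurableSpace A] [MeasurableSpace Op]

/-- The law of observation and reward given pre-observation, state and action. -/
def obsRewKernel (M : Model Om S O A Op) : Kernel ((Om × S) × A) (O × ℝ) :=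
  (M.kO.comap (fun x : (Om × S) × A => x.1.2) (by fun_prop)) ⊗ₖ
    (M.kY.comap (fun z : ((Om × S) × A) × O => (z.1.1.2, z.2, z.1.2)) (by fun_prop))

/-- The law of next observation and next action given pre-observation, state and action. -/
def nextKernel (M : Model Om S O A Op) : Kernel ((Om × S) × A) (Op × A) :=
  ((M.kOp ⊗ₖ M.piOb.comap (fun x : S × Op => x.1) (by fun_prop)) ∘ₖ M.kSnext).comap
    (fun x : (Om × S) × A => (x.1.2, x.2)) (by fun_prop)

instance (M : Model Om S O A Op) : IsMarkovKernel (obsRewKernel M) := by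
  unfold obsRewKernel; infer_instance

instance (M : Model Om S O A Op) : IsMarkovKernel (nextKernel M) := by
  unfold nextKernel; infer_instance

/-- Pre-observation, state, action, and the variables of the next step. -/
def causeVars (b : Base Om S O A Op) : ((Om × S) × A) × (Op × A) :=
  ((b.1.1.1.1.1.1, b.1.1.1.1.2), (b.1.2, b.2))

/-- Observation and reward. -/
def effectVars (b : Base Om S O A Op) : O × ℝ := (b.1.1.1.1.1.2, b.1.1.1.2)

@[fun_prop]
theorem measurable_causeVars :
    Measurable (causeVars : Base Om S O A Op → ((Om × S) × A) × (Op × A)) := by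
  unfold causeVars; fun_prop

@[fun_prop]
theorem measurable_effectVars : Measurable (effectVars : Base Om S O A Op → O × ℝ) := by
  unfold effectVars; fun_prop

/-- The next step depends on the past only through `(S,A)`, so its integral factors out first; then
the integrals over `O` and `A` are exchanged, which is possible because both are drawn from the
state. -/
theorem lintegral_baseLaw_mul (M : Model Om S O A Op)
    {V : ((Om × S) × A) × (Op × A) → ENNReal} (hV : Measurable V)
    {H : ((Om × S) × A) × (O × ℝ) → ENNReal} (hH : Measurable H) (hH' : ∀ x, H x ≠ ⊤) :
    ∫⁻ b, V (causeVars b) * H ((causeVars b).1, effectVars b) ∂baseLaw M =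
      ∫⁻ x, ∫⁻ a, (∫⁻ z, V ((x, a), z) ∂nextKernel M (x, a)) *
        (∫⁻ z, H ((x, a), z) ∂obsRewKernel M (x, a)) ∂M.piOb x.2 ∂(M.pOm ⊗ₘ M.kS) := by
  obtain ⟨Vb, hVb, hVb'⟩ : ∃ Vb : (Om × S) × A → ENNReal, Measurable Vb ∧
      ∀ x, Vb x = ∫⁻ z, V (x, z) ∂nextKernel M x := ⟨_, by fun_prop, fun _ => rfl⟩
  have hHy : Measurable fun p : ((Om × S) × A) × O => ∫⁻ y, H (p.1, (p.2, y))
      ∂(M.kY.comap (fun z : ((Om × S) × A) × O => (z.1.1.2, z.2, z.1.2)) (by fun_prop)) p := by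
    fun_prop
  have h1 : ∀ x : (((Om × S) × O) × A) × ℝ,
      ∫⁻ s', ∫⁻ op, ∫⁻ a', V (((x.1.1.1, x.1.2), (op, a'))) *
        H ((x.1.1.1, x.1.2), (x.1.1.2, x.2)) ∂M.piOb s' ∂M.kOp s' ∂M.kSnext (x.1.1.1.2, x.1.2) =
      Vb (x.1.1.1, x.1.2) * H ((x.1.1.1, x.1.2), (x.1.1.2, x.2)) := by
    intro x
    simp only [lintegral_mul_const' _ _ (hH' _)]
    congr 1
    rw [hVb', nextKernel, Kernel.comap_apply, Kernel.lintegral_comp _ _ _ (by fun_prop)]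
    refine lintegral_congr fun s' => ?_
    rw [Kernel.lintegral_compProd _ _ _ (by fun_prop)]
    rfl
  unfold baseLaw
  rw [Measure.lintegral_compProd (by fun_prop), Measure.lintegral_compProd (by fun_prop),
    Measure.lintegral_compProd (by fun_prop)]
  refine (lintegral_congr fun x => h1 x).trans ?_
  rw [Measure.lintegral_compProd (by fun_prop), Measure.lintegral_compProd (by fun_prop),
    Measure.lintegral_compProd (by fun_prop)]
  refine lintegral_congr fun x => ?_
  simp only [Kernel.comap_apply]
  rw [lintegral_lintegral_swap]
  · refine lintegral_congr fun a => ?_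
    rw [← hVb', obsRewKernel, Kernel.lintegral_compProd _ _ _ (by fun_prop), ← lintegral_const_mul]
    · refine lintegral_congr fun o => ?_
      rw [lintegral_const_mul _ (by fun_prop)]
      rfl
    · exact hHy.comp (by fun_prop : Measurable fun o : O => ((x, a), o))
  · refine Measurable.aemeasurable ?_
    have : Measurable fun p : ((Om × S) × O) × A => ∫⁻ y,
        Vb (p.1.1, p.2) * H ((p.1.1, p.2), (p.1.2, y))
          ∂(M.kY.comap (fun x : ((Om × S) × O) × A => (x.1.1.2, x.1.2, x.2)) (by fun_prop)) p := by
      fun_prop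
    exact this.comp (by fun_prop : Measurable fun q : O × A => ((x, q.1), q.2))

/-- Observation and reward are independent of the variables of the next step given
pre-observation, state and action. -/
theorem map_causeVars_effectVars (M : Model Om S O A Op) :
    (baseLaw M).map (fun b => (causeVars b, effectVars b)) = ((baseLaw M).map causeVars) ⊗ₘ
      (obsRewKernel M).comap (fun x : ((Om × S) × A) × (Op × A) => x.1) (by fun_prop) := by
  have : IsProbabilityMeasure ((baseLaw M).map (fun b => (causeVars b, effectVars b))) :=
    Measure.isProbabilityMeasure_map (by fun_prop)
  refine Measure.ext_prod fun {s t} hs ht => ?_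
  have ht' := (obsRewKernel M).measurable_coe ht
  rw [Measure.compProd_apply_prod hs ht, Measure.map_apply (by fun_prop) (hs.prod ht),
    setLIntegral_map hs (Kernel.measurable_coe _ ht) (by fun_prop)]
  have e1 : baseLaw M ((fun b => (causeVars b, effectVars b)) ⁻¹' s ×ˢ t) =
      ∫⁻ b, s.indicator 1 (causeVars b) *
        (fun x : ((Om × S) × A) × (O × ℝ) => t.indicator (1 : O × ℝ → ENNReal) x.2)
          ((causeVars b).1, effectVars b) ∂baseLaw M := by
    rw [← lintegral_indicator_one ((by fun_prop : Measurable fun b : Base Om S O A Op =>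
      (causeVars b, effectVars b)) (hs.prod ht))]
    refine lintegral_congr fun b => ?_
    by_cases h1 : causeVars b ∈ s <;> by_cases h2 : effectVars b ∈ t <;>
      simp [h1, h2, Set.indicator]
  have e2 : ∫⁻ b in causeVars ⁻¹' s, ((obsRewKernel M).comap
      (fun x : ((Om × S) × A) × (Op × A) => x.1) (by fun_prop)) (causeVars b) t ∂baseLaw M =
      ∫⁻ b, s.indicator 1 (causeVars b) *
        (fun x : ((Om × S) × A) × (O × ℝ) => obsRewKernel M x.1 t)
          ((causeVars b).1, effectVars b) ∂baseLaw M := by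
    rw [← lintegral_indicator (measurable_causeVars hs)]
    refine lintegral_congr fun b => ?_
    by_cases h1 : causeVars b ∈ s <;> simp [h1, Set.indicator]
  have m1 : Measurable fun x : ((Om × S) × A) × (O × ℝ) =>
      t.indicator (1 : O × ℝ → ENNReal) x.2 := (measurable_one.indicator ht).comp measurable_snd
  have m2 : Measurable fun x : ((Om × S) × A) × (O × ℝ) => obsRewKernel M x.1 t :=
    ht'.comp measurable_fst
  rw [e1, e2, lintegral_baseLaw_mul M (measurable_one.indicator hs) m1,
    lintegral_baseLaw_mul M (measurable_one.indicator hs) m2]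
  · refine lintegral_congr fun x => lintegral_congr fun a => ?_
    dsimp only
    rw [lintegral_const, measure_univ, mul_one, lintegral_indicator_one ht]
  · exact fun x => measure_ne_top _ _
  · intro x
    by_cases h2 : x.2 ∈ t <;> simp [h2, Set.indicator]

/-- `V` will contain the unbounded shift function, so only integrability is asked of it, while `H`
is bounded. -/
theorem integral_baseLaw_mul (M : Model Om S O A Op) {V : ((Om × S) × A) × (Op × A) → ℝ}
    (hV : Measurable V) (hVi : Integrable (fun b => V (causeVars b)) (baseLaw M))
    {H : ((Om × S) × A) × (O × ℝ) → ℝ} (hH : Measurable H) {C : ℝ} (hC : ∀ x, |H x| ≤ C) :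
    ∫ b, V (causeVars b) * H ((causeVars b).1, effectVars b) ∂baseLaw M =
      ∫ b, V (causeVars b) * ∫ z, H ((causeVars b).1, z) ∂obsRewKernel M (causeVars b).1
        ∂baseLaw M := by
  have hi : Integrable (fun p : (((Om × S) × A) × (Op × A)) × (O × ℝ) => V p.1 * H (p.1.1, p.2))
      (((baseLaw M).map causeVars) ⊗ₘ
      (obsRewKernel M).comap (fun x : ((Om × S) × A) × (Op × A) => x.1) (by fun_prop)) := by
    rw [← map_causeVars_effectVars, integrable_map_measure (by fun_prop) (by fun_prop)]
    exact hVi.mul_bdd (c := C) (hH.comp (by fun_prop : Measurable fun b : Base Om S O A Op =>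
      ((causeVars b).1, effectVars b))).aestronglyMeasurable (ae_of_all _ fun b => hC _)
  have h1 : ∫ b, V (causeVars b) * H ((causeVars b).1, effectVars b) ∂baseLaw M =
      ∫ p, V p.1 * H (p.1.1, p.2) ∂((baseLaw M).map (fun b => (causeVars b, effectVars b))) := by
    rw [integral_map (by fun_prop) (by fun_prop)]
  rw [h1, map_causeVars_effectVars, Measure.integral_compProd hi]
  simp only [integral_const_mul, Kernel.comap_apply]
  have hK : Measurable fun x => ∫ z, H (x, z) ∂obsRewKernel M x :=
    (hH.stronglyMeasurable.integral_kernel_prod_right' (κ := obsRewKernel M)).measurable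
  rw [integral_map (by fun_prop)]
  exact (hV.mul (hK.comp measurable_fst)).aestronglyMeasurable

end ConditionalIndependence

/-! ### Change of measure by the shift function -/

section ShiftIdentity

variable {Om S O A Op : Type*} [MeasurableSpace Om] [MeasurableSpace S] [MeasurableSpace O]
  [MeasurableSpace A] [MeasurableSpace Op]

theorem abs_integral_le_of_abs_le {α : Type*} [MeasurableSpace α] {ν : Measure α}
    [IsProbabilityMeasure ν] {f : α → ℝ} {C : ℝ} (h : ∀ x, |f x| ≤ C) : |∫ x, f x ∂ν| ≤ C := by
  have := norm_integral_le_of_norm_le_const (μ := ν) (f := f) (ae_of_all _ fun x =>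
    (Real.norm_eq_abs _).trans_le (h x))
  simpa using this

theorem measurable_integral_kernel {α β : Type*} [MeasurableSpace α] [MeasurableSpace β]
    (κ : Kernel α β) [IsMarkovKernel κ] {f : α × β → ℝ} (hf : Measurable f) :
    Measurable fun x => ∫ y, f (x, y) ∂κ x :=
  (hf.stronglyMeasurable.integral_kernel_prod_right' (κ := κ)).measurable

instance (M : Model Om S O A Op) : IsFiniteMeasure (shiftDen₁ M) := by
  unfold shiftDen₁; infer_instance

variable [Fintype A] [MeasurableSingletonClass A]

instance (M : Model Om S O A Op) : IsFiniteMeasure (shiftNum₁ M) := by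
  unfold shiftNum₁; infer_instance

theorem integral_shiftNum₁ (M : Model Om S O A Op) {K : (Om × S) × A → ℝ} (hK : Measurable K)
    {C : ℝ} (hC : ∀ x, |K x| ≤ C) :
    ∫ x, K x ∂shiftNum₁ M = ∫ x, ∑ a, K (x, a) ∂(M.pTilde ⊗ₘ M.kS) := by
  have hi : Integrable K (shiftNum₁ M) := integrable_of_abs_le hK hC
  rw [shiftNum₁] at hi ⊢
  rw [integral_prod _ hi]
  exact integral_congr_ae (ae_of_all _ fun x => integral_count _)

/-- The first pattern does not involve the recording of `O`, so its density times `b` is a function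
`V` of `(O⁻,S,A,O⁺,A⁺)`. Conditional independence replaces `H` by its mean given `(O⁻,S,A)`; against
a function of these, `b` may be replaced by its conditional expectation, a density ratio, which
changes the law to `shiftNum₁`. -/
theorem integral_shift_mul {M : Model Om S O A Op} (hk : ∀ k, obLaw M (pattern k) ≠ 0)
    {b : Om × A × Op → ℝ} (hb : IsShift M b) {H : ((Om × S) × A) × (O × ℝ) → ℝ}
    (hH : Measurable H) {C : ℝ} (hC : ∀ x, |H x| ≤ C) :
    ∫ w, (dens M 0 w).toReal * (b ((causeVars w).1.1.1, (causeVars w).1.2, (causeVars w).2.1) *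
      H ((causeVars w).1, effectVars w)) ∂baseLaw M =
      ∫ x, ∑ a, ∫ z, H ((x, a), z) ∂obsRewKernel M (x, a) ∂(M.pTilde ⊗ₘ M.kS) := by
  obtain ⟨hbm, hac, hbi, hce⟩ := hb
  set V : ((Om × S) × A) × (Op × A) → ℝ := fun r =>
    ((obLaw M (pattern 0))⁻¹ * (M.rOm r.1.1.1 {true} * M.rOp r.2 {true})).toReal *
      b (r.1.1.1, r.1.2, r.2.1) with hV
  have hr1 := M.rOm.measurable_coe (measurableSet_singleton true)
  have hr2 := M.rOp.measurable_coe (measurableSet_singleton true)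
  have hVm : Measurable V := by fun_prop
  have hVe : ∀ w, V (causeVars w) =
      (dens M 0 w).toReal * b ((causeVars w).1.1.1, (causeVars w).1.2, (causeVars w).2.1) := by
    intro w
    simp only [hV, dens, visWeight, patternSets, measure_univ, one_mul]
    rfl
  have hVi : Integrable (fun w => V (causeVars w)) (baseLaw M) := by
    rw [funext hVe]
    exact (integrable_condLaw_iff (hk 0) (fun _ => rfl) (by fun_prop)).1 hbi
  have hKm : Measurable fun x => ∫ z, H (x, z) ∂obsRewKernel M x :=
    measurable_integral_kernel _ hH
  set K : (Om × S) × A → ℝ := fun x => ∫ z, H (x, z) ∂obsRewKernel M x with hK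
  have hKb : ∀ x, |K x| ≤ C := fun x => abs_integral_le_of_abs_le fun z => hC _
  have s1 := integral_baseLaw_mul M hVm hVi hH hC
  have s2 : ∫ w, V (causeVars w) * K (causeVars w).1 ∂baseLaw M =
      ∫ t, b (preObs t, act t, nextObs t) * K ((preObs t, state t), act t) ∂condLaw M 0 := by
    rw [integral_condLaw (hk 0) (fun _ => rfl) (by fun_prop)]
    refine integral_congr_ae (ae_of_all _ fun w => ?_)
    simp only [hVe, mul_assoc]
    rfl
  have s3 : ∫ t, b (preObs t, act t, nextObs t) * K ((preObs t, state t), act t) ∂condLaw M 0 =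
      ∫ t, ((shiftNum₁ M).rnDeriv (shiftDen₁ M) ((preObs t, state t), act t)).toReal *
        K ((preObs t, state t), act t) ∂condLaw M 0 := by
    refine integral_mul_eq_of_condExp_eq (Measurable.comap_le (by fun_prop)) hce
      (measurable_comap_comp (Z := fun t => ((preObs t, state t), act t)) hKm) hbi ?_
    exact hbi.mul_bdd (c := C)
      (hKm.comp (by fun_prop : Measurable fun t : Trial Om S O A Op =>
        ((preObs t, state t), act t))).aestronglyMeasurable (ae_of_all _ fun t => hKb _)
  have s4 : ∫ t, ((shiftNum₁ M).rnDeriv (shiftDen₁ M) ((preObs t, state t), act t)).toReal *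
        K ((preObs t, state t), act t) ∂condLaw M 0 =
      ∫ x, ((shiftNum₁ M).rnDeriv (shiftDen₁ M) x).toReal • K x ∂shiftDen₁ M := by
    rw [shiftDen₁, integral_map (by fun_prop)]
    · rfl
    · exact ((Measure.measurable_rnDeriv _ _).ennreal_toReal.smul hKm).aestronglyMeasurable
  rw [integral_rnDeriv_smul hac, integral_shiftNum₁ M hKm hKb] at s4
  rw [← s4, ← s3, ← s2, ← s1]
  refine integral_congr_ae (ae_of_all _ fun w => ?_)
  simp only [hVe, mul_assoc]

/-- Truncation to the interval `[-C, C]`. -/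
def clip (C y : ℝ) : ℝ := max (-|C|) (min |C| y)

theorem abs_clip_le (C y : ℝ) : |clip C y| ≤ |C| := by
  have := abs_nonneg C
  exact abs_le.2 ⟨le_max_left _ _, max_le (by linarith) (min_le_left _ _)⟩

theorem clip_eq {C y : ℝ} (h : |y| ≤ C) : clip C y = y := by
  have h0 := (abs_nonneg y).trans h
  have := abs_le.1 h
  rw [clip, abs_of_nonneg h0, min_eq_right this.2, max_eq_right this.1]

@[fun_prop]
theorem measurable_clip (C : ℝ) : Measurable (clip C) := by unfold clip; fun_prop

theorem integral_obsRewKernel (M : Model Om S O A Op) (x : (Om × S) × A) {f : O × ℝ → ℝ}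
    (hf : Measurable f) {C : ℝ} (hC : ∀ z, |f z| ≤ C) : ∫ z, f z ∂obsRewKernel M x =
      ∫ o, ∫ y, f (o, y) ∂M.kY (x.1.2, o, x.2) ∂M.kO x.1.2 := by
  have hi : Integrable f (obsRewKernel M x) := integrable_of_abs_le hf hC
  rw [obsRewKernel] at hi ⊢
  rw [ProbabilityTheory.integral_compProd hi]
  rfl

theorem measurable_kernel_real {α : Type*} [MeasurableSpace α] (κ : Kernel α A) [IsMarkovKernel κ]
    (a : A) : Measurable fun x => (κ x).real {a} :=
  (κ.measurable_coe (measurableSet_singleton a)).ennreal_toReal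

/-- The integral over the interventional action is a finite sum, moved outside the integral over
`(O,Y)`, so that the value is an integral against the measure produced by the shift function. The
clip, almost surely inactive, makes the integrand bounded everywhere. -/
theorem value_eq {M : Model Om S O A Op} {C : ℝ} (hR : RewardBounded M C) (π : Kernel (Om × O) A)
    [IsMarkovKernel π] : value M π =
      ∫ x, ∑ a, ∫ z, clip C z.2 * (π (x.1, z.1)).real {a} ∂obsRewKernel M (x, a)
        ∂(M.pTilde ⊗ₘ M.kS) := by
  have hπm := fun a => measurable_kernel_real π a
  have hπb : ∀ om o a, |(π (om, o)).real {a}| ≤ 1 := fun om o a => by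
    rw [abs_of_nonneg measureReal_nonneg]; exact measureReal_le_one
  set Y : (((Om × S) × O) × A) → ℝ := fun w => ∫ y, clip C y ∂M.kY (w.1.1.2, w.1.2, w.2) with hY
  have hYm : Measurable Y := measurable_integral_kernel
    (M.kY.comap (fun x : ((Om × S) × O) × A => (x.1.1.2, x.1.2, x.2)) (by fun_prop))
    (f := fun p => clip C p.2) (by fun_prop)
  have hYb : ∀ w, |Y w| ≤ |C| := fun w => abs_integral_le_of_abs_le (abs_clip_le C)
  have hae : ∀ᵐ x ∂inLaw M π, |x.2| ≤ C := by
    unfold inLaw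
    refine Measure.ae_compProd_of_ae_ae (measurableSet_le (by fun_prop) measurable_const) ?_
    exact ae_of_all _ fun x => hR _
  have s1 : value M π = ∫ x, clip C x.2 ∂inLaw M π :=
    integral_congr_ae (hae.mono fun x hx => (clip_eq hx).symm)
  have hYa : Measurable fun v : (Om × S) × O =>
      ∑ a, (π (v.1.1, v.2)).real {a} * Y (v, a) := by
    refine Finset.measurable_sum _ fun a _ => ?_
    exact ((hπm a).comp (by fun_prop)).mul (hYm.comp (by fun_prop))
  have hYab : ∀ v : (Om × S) × O,
      |∑ a, (π (v.1.1, v.2)).real {a} * Y (v, a)| ≤ ∑ _a : A, |C| := by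
    intro v
    refine (Finset.abs_sum_le_sum_abs _ _).trans (Finset.sum_le_sum fun a _ => ?_)
    rw [abs_mul]
    exact (mul_le_of_le_one_left (abs_nonneg _) (hπb _ _ _)).trans (hYb _)
  rw [s1, inLaw, Measure.integral_compProd (integrable_of_abs_le (by fun_prop)
    fun x => abs_clip_le C x.2)]
  change ∫ w, Y w ∂_ = _
  rw [Measure.integral_compProd (integrable_of_abs_le hYm hYb)]
  have s2 : ∀ v : (Om × S) × O, ∫ a, Y (v, a) ∂(π.comap (fun x : (Om × S) × O => (x.1.1, x.2))
      (by fun_prop)) v = ∑ a, (π (v.1.1, v.2)).real {a} * Y (v, a) := by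
    intro v
    rw [Kernel.comap_apply, integral_fintype (f := fun a => Y (v, a)) (integrable_of_abs_le
      (hYm.comp (by fun_prop : Measurable fun a : A => (v, a))) fun a => hYb _)]
    rfl
  simp only [s2]
  rw [Measure.integral_compProd (integrable_of_abs_le hYa hYab)]
  refine integral_congr_ae (ae_of_all _ fun x => ?_)
  simp only [Kernel.comap_apply]
  rw [integral_finsetSum _ fun a _ => ?_]
  · refine Finset.sum_congr rfl fun a _ => ?_
    rw [integral_obsRewKernel M (x, a) (C := |C|)]
    · refine integral_congr_ae (ae_of_all _ fun o => ?_)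
      simp only [hY]
      rw [integral_mul_const, mul_comm]
    · exact (by fun_prop : Measurable fun z : O × ℝ => clip C z.2).mul
        ((hπm a).comp (by fun_prop))
    · intro z
      rw [abs_mul]
      exact (mul_le_of_le_one_right (abs_nonneg _) (hπb _ _ _)).trans (abs_clip_le C _)
  · refine integrable_of_abs_le (C := |C|) ?_ fun o => ?_
    · exact ((hπm a).comp (by fun_prop)).mul (hYm.comp (by fun_prop))
    · rw [abs_mul]
      exact (mul_le_of_le_one_left (abs_nonneg _) (hπb _ _ _)).trans (hYb _)

end ShiftIdentity

/-! ### The weighted moment identity -/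

section WeightedMoments

variable {Om S O A Op : Type*} [MeasurableSpace Om] [MeasurableSpace S] [MeasurableSpace O]
  [Fintype A] [MeasurableSpace A] [MeasurableSingletonClass A] [MeasurableSpace Op] {c : Constants}

theorem Model.nonempty_act (M : Model Om S O A Op) : Nonempty A := by
  have : Nonempty Om := nonempty_of_isProbabilityMeasure M.pOm
  obtain ⟨om⟩ := this
  obtain ⟨s⟩ := nonempty_of_isProbabilityMeasure (M.kS om)
  exact nonempty_of_isProbabilityMeasure (M.piOb s)

theorem isMarkovKernel_of_mem_softmaxClass [Nonempty A] {Φ : Features c Om O A Op}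
    {π : Kernel (Om × O) A} (h : π ∈ softmaxClass Φ) : IsMarkovKernel π := by
  obtain ⟨w, -, h⟩ := h
  refine ⟨fun x => ⟨?_⟩⟩
  rw [← Finset.coe_univ, ← sum_measure_singleton]
  simp only [h x.1 x.2]
  have hpos : 0 < ∑ a', Real.exp (inner ℝ w (Φ.φ₀ (a', x.2, x.1))) :=
    Finset.sum_pos (fun _ _ => Real.exp_pos _) Finset.univ_nonempty
  rw [← ENNReal.ofReal_sum_of_nonneg (fun _ _ => by positivity), ← Finset.sum_div,
    div_self hpos.ne', ENNReal.ofReal_one]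

theorem ignoresMissingness_weight (M : Model Om S O A Op) (b : Om × A × Op → ℝ) (k : Fin 4) :
    IgnoresMissingness (weight M b k) := fun t => by fin_cases k <;> rfl

theorem ignoresMissingness_alpha (π : Kernel (Om × O) A) (h : Bridge Om O A Op) (k : Fin 4) :
    IgnoresMissingness (alpha (S := S) π h k) := fun t => by fin_cases k <;> rfl

/-- Each weight is a function of `Z_k`, so it is an admissible multiplier of the conditional moment.
-/
theorem measurable_weight (M : Model Om S O A Op) {b : Om × A × Op → ℝ} (hb : Measurable b)
    (k : Fin 4) : Measurable[sigmaZ k] (weight M b k) := by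
  have h1 : Measurable fun x => ((lawAOOm M 0).rnDeriv (lawAOOm M 1) x).toReal :=
    (Measure.measurable_rnDeriv _ _).ennreal_toReal
  have h2 : Measurable fun x => ((shiftNum₃ M).rnDeriv (lawAOOm M 2) x).toReal :=
    (Measure.measurable_rnDeriv _ _).ennreal_toReal
  have h3 : Measurable fun x => (M.pTilde.rnDeriv (lawOm M) x).toReal :=
    (Measure.measurable_rnDeriv _ _).ennreal_toReal
  match k with
  | 0 =>
    exact measurable_comap_comp (Z := fun t => (act t, preObs t, nextObs t))
      (hb.comp (by fun_prop : Measurable fun z : A × Om × Op => (z.2.1, z.1, z.2.2)))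
  | 1 =>
    exact measurable_comap_comp (Z := fun t => (act t, obs t, preObs t, nextObs t))
      ((hb.comp (by fun_prop : Measurable fun z : A × O × Om × Op => (z.2.2.1, z.1, z.2.2.2))).mul
      (h1.comp (by fun_prop : Measurable fun z : A × O × Om × Op => (z.1, z.2.1, z.2.2.1))))
  | 2 => exact measurable_comap_comp (Z := fun t => (act t, obs t, preObs t)) h2
  | 3 => exact measurable_comap_comp (Z := fun t => preObs t) h3

theorem ae_abs_rew_le_baseLaw {M : Model Om S O A Op} {C : ℝ} (hR : RewardBounded M C) :
    ∀ᵐ w ∂baseLaw M, |rew (complete w)| ≤ C := by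
  have h := map_base_restrict M Set.univ Set.univ Set.univ
  have h1 : (baseLaw M).withDensity (visWeight M Set.univ Set.univ Set.univ) = baseLaw M := by
    have : visWeight M Set.univ Set.univ Set.univ = 1 := by
      funext b; simp only [visWeight, measure_univ, one_mul, Pi.one_apply]
    rw [this, withDensity_one]
  rw [visEvent_univ, Measure.restrict_univ, h1] at h
  rw [← h, ae_map_iff (by fun_prop) (measurableSet_le (by fun_prop) measurable_const)]
  exact ae_abs_rew_le hR

theorem ae_shiftOm_lt_top {M : Model Om S O A Op} (h : M.pTilde ≪ lawOm M) :
    ∀ᵐ x ∂obsLaw M, shiftOm M x.1.1 < ⊤ := by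
  have hm := measurable_shiftOm M
  refine ae_lt_top (by fun_prop) ?_
  rw [← setLIntegral_univ, ← withDensity_apply _ .univ, obsLaw_withDensity_shiftOm h]
  exact measure_ne_top _ _

/-- Reweighting the pre-observation makes `(O⁻,S,O)` follow its interventional law. -/
theorem integral_shiftOm_mul {M : Model Om S O A Op} (h : M.pTilde ≪ lawOm M)
    {G : (Om × S) × O → ℝ} (hG : Measurable G) {C : ℝ} (hC : ∀ x, |G x| ≤ C) :
    ∫ w, (shiftOm M (preObs (complete w))).toReal * G w.1.1.1.1.1 ∂baseLaw M =
      ∫ x, ∫ o, G (x, o) ∂M.kO x.2 ∂(M.pTilde ⊗ₘ M.kS) := by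
  have hm' : Measurable fun x : (Om × S) × O => shiftOm M x.1.1 :=
    (measurable_shiftOm M).comp (by fun_prop)
  have e1 : ∫ w, (shiftOm M (preObs (complete w))).toReal * G w.1.1.1.1.1 ∂baseLaw M =
      ∫ x, (shiftOm M x.1.1).toReal • G x ∂obsLaw M := by
    have h1 : (baseLaw M).map (fun w => w.1.1.1.1.1) = obsLaw M := by
      have h2 := map_baseLaw_obs M (f := id) measurable_id
      rwa [Measure.map_id] at h2
    rw [← h1, integral_map (by fun_prop)]
    · rfl
    · exact (hm'.ennreal_toReal.smul hG).aestronglyMeasurable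
  rw [e1, ← integral_withDensity_eq_integral_toReal_smul hm' (ae_shiftOm_lt_top h),
    obsLaw_withDensity_shiftOm h, Measure.integral_compProd (integrable_of_abs_le hG hC)]
  rfl

/-- The weighted moments of any tuple of the hypothesis class add up to the difference between the
value predicted by its last component and the value of the policy. -/
theorem sum_integral_alpha_mul_weight {M : Model Om S O A Op} (hR : RewardBounded M c.LY)
    {Φ : Features c Om O A Op} {Pol : Set (Kernel (Om × O) A)} (hPol : Pol ⊆ softmaxClass Φ)
    {L : ℝ} (hL : AlphaBounded S Φ Pol L) (hk : ∀ k, obLaw M (pattern k) ≠ 0)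
    {π : Kernel (Om × O) A} (hπ : π ∈ Pol) {h : Bridge Om O A Op} (hh : h ∈ hypClass Φ)
    {b : Om × A × Op → ℝ} (hb : IsShift M b) (hrat : RatiosExist M)
    (hw : ∀ k, Integrable (weight M b k) (condLaw M k)) :
    ∑ k, ∫ t, alpha π h k t * weight M b k t ∂condLaw M k =
      ∫ om, h.g om ∂M.pTilde - value M π := by
  have := M.nonempty_act
  have hπM := isMarkovKernel_of_mem_softmaxClass (hPol hπ)
  have hαm := fun k => measurable_alpha (S := S) hPol hπ hh k
  have hwm := fun k => (measurable_weight M hb.1 k).mono (sigmaZ_le k) le_rfl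
  have hint := fun k => (integrable_condLaw_iff (hk k) ((ignoresMissingness_alpha π h k).mul
    (ignoresMissingness_weight M b k)) ((hαm k).mul (hwm k))).1
    (integrable_alpha_mul hR hPol hL hπ hh (hw k))
  have hbase := fun k => integral_condLaw (hk k) ((ignoresMissingness_alpha π h k).mul
    (ignoresMissingness_weight M b k)) ((hαm k).mul (hwm k))
  obtain ⟨w₁, w₂, w₃, w₄, a₁, a₂, a₃, a₄, rfl⟩ := mem_hypClass_iff.1 hh
  have hπm := fun a => measurable_kernel_real π a
  have hπb : ∀ om o a, |(π (om, o)).real {a}| ≤ 1 := fun om o a => by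
    rw [abs_of_nonneg measureReal_nonneg]; exact measureReal_le_one
  have m2 : Measurable fun x : A × O × Om => inner ℝ w₂ (Φ.φ₂ x) :=
    measurable_const.inner Φ.meas_φ₂
  have b2 : ∀ x, |inner ℝ w₂ (Φ.φ₂ x)| ≤ c.C₂ := fun x => abs_inner_le a₂ (Φ.norm_φ₂ x)
  have m4 : Measurable fun x : Om => inner ℝ w₄ (Φ.ψ₄ x) := measurable_const.inner Φ.meas_ψ₄
  have b4 : ∀ x, |inner ℝ w₄ (Φ.ψ₄ x)| ≤ c.C₄ := fun x => abs_inner_le a₄ (Φ.norm_ψ₄ x)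
  -- the first two moments
  set P : ((Om × S) × A) × (O × ℝ) → ℝ := fun r =>
    clip c.LY r.2.2 * (π (r.1.1.1, r.2.1)).real {r.1.2} with hP
  have hPm : Measurable P := by
    refine Measurable.mul (by fun_prop) ?_
    have : Measurable fun q : (Om × O) × A => (π q.1).real {q.2} := by
      refine measurable_from_prod_countable_left fun a => ?_
      exact hπm a
    exact this.comp (by fun_prop : Measurable fun r : ((Om × S) × A) × (O × ℝ) =>
      ((r.1.1.1, r.2.1), r.1.2))
  have hPb : ∀ r, |P r| ≤ |c.LY| := fun r => by
    rw [hP, abs_mul]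
    exact (mul_le_of_le_one_right (abs_nonneg _) (hπb _ _ _)).trans (abs_clip_le _ _)
  set H₂ : ((Om × S) × A) × (O × ℝ) → ℝ := fun r =>
    inner ℝ w₂ (Φ.φ₂ (r.1.2, r.2.1, r.1.1.1)) with hH₂
  have hH₂m : Measurable H₂ := m2.comp (by fun_prop)
  have hH₂b : ∀ r, |H₂ r| ≤ c.C₂ := fun r => b2 _
  -- Under the base law both weighted moments carry the density `dens 0` times `b`, so `h₁` cancels
  -- and `h₂ - Y π` remains, to which the shift identity applies.
  have e01 : ∫ t, alpha π (linBridge Φ w₁ w₂ w₃ w₄) 0 t * weight M b 0 t ∂condLaw M 0 +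
      ∫ t, alpha π (linBridge Φ w₁ w₂ w₃ w₄) 1 t * weight M b 1 t ∂condLaw M 1 =
      ∫ x, ∑ a, ∫ z, (H₂ ((x, a), z) - P ((x, a), z)) ∂obsRewKernel M (x, a)
        ∂(M.pTilde ⊗ₘ M.kS) := by
    have hs := integral_shift_mul hk hb (H := fun r => H₂ r - P r) (hH₂m.sub hPm)
      (C := c.C₂ + |c.LY|) fun x => (abs_sub _ _).trans (add_le_add (hH₂b x) (hPb x))
    rw [hbase 0, hbase 1, ← integral_add (hint 0) (hint 1), ← hs]
    refine integral_congr_ae ?_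
    filter_upwards [dens_one_mul_eq hrat hk, ae_abs_rew_le_baseLaw hR] with w hw1 hw2
    have e1 : (dens M 1 w).toReal * ((lawAOOm M 0).rnDeriv (lawAOOm M 1) (aoOm w)).toReal =
        (dens M 0 w).toReal := by rw [← ENNReal.toReal_mul, hw1]
    have e2 : weight M b 1 (complete w) = b (preObs (complete w), act (complete w),
      nextObs (complete w)) * ((lawAOOm M 0).rnDeriv (lawAOOm M 1) (aoOm w)).toReal := rfl
    have e3 : weight M b 0 (complete w) = b (preObs (complete w), act (complete w),
      nextObs (complete w)) := rfl
    have e4 : clip c.LY (effectVars w).2 = rew (complete w) := clip_eq hw2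
    have e5 : alpha π (linBridge Φ w₁ w₂ w₃ w₄) 0 (complete w) +
        alpha π (linBridge Φ w₁ w₂ w₃ w₄) 1 (complete w) =
        H₂ ((causeVars w).1, effectVars w) - P ((causeVars w).1, effectVars w) := by
      simp only [hP, hH₂, e4, alpha]
      have : ∀ p q r : ℝ, p + (q - p - r) = q - r := fun p q r => by ring
      exact this _ _ _
    rw [e2, e3, ← e5]
    change _ = (dens M 0 w).toReal * (b (preObs (complete w), act (complete w),
      nextObs (complete w)) * _)
    linear_combination (alpha π (linBridge Φ w₁ w₂ w₃ w₄) 1 (complete w) *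
      b (preObs (complete w), act (complete w), nextObs (complete w))) * e1
  -- the last two moments
  set G : (Om × S) × O → ℝ := fun x => inner ℝ w₄ (Φ.ψ₄ x.1.1) -
    ∑ a : A, inner ℝ w₂ (Φ.φ₂ (a, x.2, x.1.1)) with hG
  have hsm : Measurable fun x : (Om × S) × O => ∑ a : A, inner ℝ w₂ (Φ.φ₂ (a, x.2, x.1.1)) :=
    Finset.measurable_sum _ fun a _ => m2.comp (by fun_prop)
  have hsb : ∀ x : (Om × S) × O, |∑ a : A, inner ℝ w₂ (Φ.φ₂ (a, x.2, x.1.1))| ≤ ∑ _a : A, c.C₂ :=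
    fun x => (Finset.abs_sum_le_sum_abs _ _).trans (Finset.sum_le_sum fun a _ => b2 _)
  have hGm : Measurable G := (m4.comp (by fun_prop)).sub hsm
  have hGb : ∀ x, |G x| ≤ c.C₄ + ∑ _a : A, c.C₂ := fun x =>
    (abs_sub _ _).trans (add_le_add (b4 _) (hsb x))
  -- Here both densities reduce to `shiftOm`; `h₃` cancels and leaves `g - ∑ h₂`.
  have e23 : ∫ t, alpha π (linBridge Φ w₁ w₂ w₃ w₄) 2 t * weight M b 2 t ∂condLaw M 2 +
      ∫ t, alpha π (linBridge Φ w₁ w₂ w₃ w₄) 3 t * weight M b 3 t ∂condLaw M 3 =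
      ∫ x, ∫ o, G (x, o) ∂M.kO x.2 ∂(M.pTilde ⊗ₘ M.kS) := by
    rw [hbase 2, hbase 3, ← integral_add (hint 2) (hint 3),
      ← integral_shiftOm_mul hrat.2.2 hGm hGb]
    refine integral_congr_ae ?_
    filter_upwards [dens_three_mul_eq hrat] with w hw1
    have e1 : (dens M 2 w).toReal * weight M b 2 (complete w) =
        (shiftOm M (preObs (complete w))).toReal := by
      rw [← hw1, ENNReal.toReal_mul]; rfl
    have e2 : (dens M 3 w).toReal * weight M b 3 (complete w) =
        (shiftOm M (preObs (complete w))).toReal := by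
      rw [shiftOm, ENNReal.toReal_mul, dens_three]; rfl
    have e5 : alpha π (linBridge Φ w₁ w₂ w₃ w₄) 2 (complete w) +
        alpha π (linBridge Φ w₁ w₂ w₃ w₄) 3 (complete w) = G w.1.1.1.1.1 := by
      simp only [alpha, hG]
      rw [add_comm, sub_add_sub_cancel]
      rfl
    rw [← e5]
    linear_combination alpha π (linBridge Φ w₁ w₂ w₃ w₄) 2 (complete w) * e1 +
      alpha π (linBridge Φ w₁ w₂ w₃ w₄) 3 (complete w) * e2
  have hKm : ∀ {F : ((Om × S) × A) × (O × ℝ) → ℝ}, Measurable F →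
      Measurable fun x => ∑ a, ∫ z, F ((x, a), z) ∂obsRewKernel M (x, a) := fun {F} hF =>
    Finset.measurable_sum _ fun a _ => (measurable_integral_kernel (obsRewKernel M) hF).comp
      (by fun_prop : Measurable fun x : Om × S => (x, a))
  have hKb : ∀ {F : ((Om × S) × A) × (O × ℝ) → ℝ} {C : ℝ}, (∀ r, |F r| ≤ C) → ∀ x : Om × S,
      |∑ a, ∫ z, F ((x, a), z) ∂obsRewKernel M (x, a)| ≤ ∑ _a : A, C := fun {F C} hF x =>
    (Finset.abs_sum_le_sum_abs _ _).trans (Finset.sum_le_sum fun a _ =>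
      abs_integral_le_of_abs_le fun z => hF _)
  have i2 : Integrable (fun x => ∑ a, ∫ z, H₂ ((x, a), z) ∂obsRewKernel M (x, a))
      (M.pTilde ⊗ₘ M.kS) := integrable_of_abs_le (hKm hH₂m) (hKb hH₂b)
  have iP : Integrable (fun x => ∑ a, ∫ z, P ((x, a), z) ∂obsRewKernel M (x, a))
      (M.pTilde ⊗ₘ M.kS) := integrable_of_abs_le (hKm hPm) (hKb hPb)
  have i4 : Integrable (fun x : Om × S => inner ℝ w₄ (Φ.ψ₄ x.1)) (M.pTilde ⊗ₘ M.kS) :=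
    integrable_of_abs_le (m4.comp (by fun_prop)) fun x => b4 _
  have f1 : ∀ x : Om × S, ∑ a, ∫ z, (H₂ ((x, a), z) - P ((x, a), z)) ∂obsRewKernel M (x, a) =
      ∑ a, ∫ z, H₂ ((x, a), z) ∂obsRewKernel M (x, a) -
        ∑ a, ∫ z, P ((x, a), z) ∂obsRewKernel M (x, a) := by
    intro x
    rw [← Finset.sum_sub_distrib]
    refine Finset.sum_congr rfl fun a _ => integral_sub ?_ ?_
    · exact integrable_of_abs_le (hH₂m.comp (by fun_prop)) fun z => hH₂b _
    · exact integrable_of_abs_le (hPm.comp (by fun_prop)) fun z => hPb _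
  have f2 : ∀ x : Om × S, ∫ o, G (x, o) ∂M.kO x.2 = inner ℝ w₄ (Φ.ψ₄ x.1) -
      ∑ a, ∫ z, H₂ ((x, a), z) ∂obsRewKernel M (x, a) := by
    intro x
    have hi : ∀ a : A, Integrable (fun o => inner ℝ w₂ (Φ.φ₂ (a, o, x.1))) (M.kO x.2) := fun a =>
      integrable_of_abs_le (m2.comp (by fun_prop)) fun o => b2 _
    simp only [hG]
    rw [integral_sub (integrable_const _) (integrable_finsetSum _ fun a _ => hi a),
      integral_const, probReal_univ, one_smul, integral_finsetSum _ fun a _ => hi a]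
    congr 1
    refine Finset.sum_congr rfl fun a _ => ?_
    rw [integral_obsRewKernel M (x, a) (f := fun z => H₂ ((x, a), z))
      (hH₂m.comp (by fun_prop : Measurable fun z : O × ℝ => ((x, a), z))) fun z => hH₂b _]
    simp only [hH₂, integral_const, probReal_univ, one_smul]
  have f3 : ∫ x, inner ℝ w₄ (Φ.ψ₄ x.1) ∂(M.pTilde ⊗ₘ M.kS) =
      ∫ om, inner ℝ w₄ (Φ.ψ₄ om) ∂M.pTilde := by
    conv_rhs => rw [← Measure.fst_compProd M.pTilde M.kS, Measure.fst]
    rw [integral_map (by fun_prop) m4.aestronglyMeasurable]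
  -- The sums of `h₂` over actions from the two halves now stand under the same law with opposite
  -- signs.
  rw [Fin.sum_univ_four, add_assoc, e01, e23, value_eq hR π]
  simp only [f1, f2]
  rw [integral_sub i2 iP, integral_sub i4 i2, f3]
  simp only [hP, linBridge]
  ring

end WeightedMoments

/-! ### Confidence sets and the regret of pessimistic policies -/

section Regret

theorem abs_integral_mul_le {Ω : Type*} [MeasurableSpace Ω] {ν : Measure Ω} {f g : Ω → ℝ}
    (hf : MemLp f 2 ν) (hg : MemLp g 2 ν) :
    |∫ t, f t * g t ∂ν| ≤ √(∫ t, f t ^ 2 ∂ν) * (eLpNorm g 2 ν).toReal := by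
  have h := integral_mul_norm_le_Lp_mul_Lq (μ := ν) (p := 2) (q := 2)
    (by rw [Real.holderConjugate_iff]; norm_num) (f := f) (g := g) (by simpa using hf)
    (by simpa using hg)
  have e : ∀ u : Ω → ℝ, ∫ a, ‖u a‖ ^ (2 : ℝ) ∂ν = ∫ a, u a ^ 2 ∂ν := fun u => by simp
  rw [e, e, ← Real.sqrt_eq_rpow, ← Real.sqrt_eq_rpow] at h
  have e2 : (eLpNorm g 2 ν).toReal = √(∫ a, g a ^ 2 ∂ν) := by
    rw [hg.eLpNorm_eq_integral_rpow_norm (by norm_num) (by norm_num), ENNReal.toReal_ofReal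
      (by positivity), ENNReal.toReal_ofNat, e, Real.sqrt_eq_rpow]
    norm_num
  rw [e2]
  refine (norm_integral_le_integral_norm (fun t => f t * g t)).trans (le_of_eq_of_le ?_ h)
  simp only [norm_mul]

variable {Om S O A Op : Type*} [MeasurableSpace Om] [MeasurableSpace S] [MeasurableSpace O]
  [MeasurableSpace A] [MeasurableSpace Op] {c : Constants}

theorem empMean_sub {Ω ι : Type*} [Fintype ι] (x : ι → Ω) (f g : Ω → ℝ) :
    empMean x (fun t => f t - g t) = empMean x f - empMean x g := by
  simp only [empMean, Finset.sum_sub_distrib, sub_div]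

theorem empMean_const_mul {Ω ι : Type*} [Fintype ι] (x : ι → Ω) (r : ℝ) (f : Ω → ℝ) :
    empMean x (fun t => r * f t) = r * empMean x f := by
  simp only [empMean, ← Finset.mul_sum, mul_div_assoc]

theorem empMean_mono {Ω ι : Type*} [Fintype ι] (x : ι → Ω) {f g : Ω → ℝ} (h : ∀ t, f t ≤ g t) :
    empMean x f ≤ empMean x g :=
  div_le_div_of_nonneg_right (Finset.sum_le_sum fun i _ => h (x i)) (Nat.cast_nonneg _)

theorem empMean_nonneg {Ω ι : Type*} [Fintype ι] (x : ι → Ω) {f : Ω → ℝ} (h : ∀ t, 0 ≤ f t) :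
    0 ≤ empMean x f := div_nonneg (Finset.sum_nonneg fun i _ => h (x i)) (Nat.cast_nonneg _)

theorem measurable_dualFeat_sigmaZ (Φ : Features c Om O A Op) (k : Fin 4) :
    Measurable[sigmaZ k] (dualFeat (S := S) Φ k) := by
  match k with
  | 0 => exact measurable_comap_comp (Z := fun t => (act t, preObs t, nextObs t)) Φ.meas_ψ₁
  | 1 => exact measurable_comap_comp (Z := fun t => (act t, obs t, preObs t, nextObs t)) Φ.meas_ψ₂
  | 2 => exact measurable_comap_comp (Z := fun t => (act t, obs t, preObs t)) Φ.meas_ψ₃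
  | 3 => exact measurable_comap_comp (Z := fun t => preObs t) Φ.meas_ψ₄

theorem measurable_inner_dualFeat (Φ : Features c Om O A Op) (k : Fin 4)
    (β : EuclideanSpace ℝ (Fin (dualDim c k))) :
    Measurable[sigmaZ k] fun t : Trial Om S O A Op => inner ℝ β (dualFeat Φ k t) := by
  have h : Measurable fun v : EuclideanSpace ℝ (Fin (dualDim c k)) => (inner ℝ β v : ℝ) :=
    measurable_const.inner measurable_id
  exact h.comp (measurable_dualFeat_sigmaZ Φ k)

theorem ignoresMissingness_inner_dualFeat (Φ : Features c Om O A Op) (k : Fin 4)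
    (β : EuclideanSpace ℝ (Fin (dualDim c k))) :
    IgnoresMissingness fun t : Trial Om S O A Op => inner ℝ β (dualFeat Φ k t) :=
  fun t => by fin_cases k <;> rfl

variable [Fintype A] [MeasurableSingletonClass A]

/-- The `k`-th inner maximum of the loss. -/
def lossPart {T : ℕ} (Φ : Features c Om O A Op) (D : Fin T → Trial Om S O A Op)
    (π : Kernel (Om × O) A) (h : Bridge Om O A Op) (k : Fin 4) : ℝ :=
  sSup ((fun θ : Trial Om S O A Op → ℝ =>
    empMean (subData D k) (fun t => alpha π h k t * θ t)
      - 1 / 2 * empMean (subData D k) (fun t => θ t ^ 2)) '' dualClass Φ k)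

/-- The supremum is finite because `α θ - θ² / 2 ≤ α² / 2` pointwise. -/
theorem le_lossPart {T : ℕ} {Φ : Features c Om O A Op} (D : Fin T → Trial Om S O A Op)
    (π : Kernel (Om × O) A) (h : Bridge Om O A Op) (k : Fin 4) {θ : Trial Om S O A Op → ℝ}
    (hθ : θ ∈ dualClass Φ k) : empMean (subData D k) (fun t => alpha π h k t * θ t)
      - 1 / 2 * empMean (subData D k) (fun t => θ t ^ 2) ≤ lossPart Φ D π h k := by
  refine le_csSup ⟨1 / 2 * empMean (subData D k) (fun t => alpha π h k t ^ 2), ?_⟩ ⟨θ, hθ, rfl⟩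
  rintro _ ⟨θ, -, rfl⟩
  simp only
  rw [← empMean_const_mul, ← empMean_const_mul, ← empMean_sub]
  exact empMean_mono _ fun t => by nlinarith [sq_nonneg (alpha π h k t - θ t)]

theorem zero_mem_dualClass {Φ : Features c Om O A Op} {k : Fin 4} (hD : 0 ≤ c.D k) :
    (fun _ => 0) ∈ dualClass (S := S) Φ k := by
  rw [dualClass_eq]
  exact ⟨0, by rwa [norm_zero], by simp only [inner_zero_left]⟩

theorem lossPart_nonneg {T : ℕ} {Φ : Features c Om O A Op} (D : Fin T → Trial Om S O A Op)
    (π : Kernel (Om × O) A) (h : Bridge Om O A Op) {k : Fin 4} (hD : 0 ≤ c.D k) :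
    0 ≤ lossPart Φ D π h k := by
  refine le_of_eq_of_le ?_ (le_lossPart D π h k (zero_mem_dualClass hD))
  simp [empMean]

/-- On the event of uniformly small deviations, the vanishing of the population moments makes the
inner maximum small. -/
theorem lossPart_le {T : ℕ} {M : Model Om S O A Op} {Φ : Features c Om O A Op}
    {Pol : Set (Kernel (Om × O) A)} {D : Fin T → Trial Om S O A Op} {k : Fin 4} {η : ℝ}
    (hU : UniformDev (condLaw M k) Φ Pol k (subData D k) η) (hD : 0 ≤ c.D k)
    {π : Kernel (Om × O) A} (hπ : π ∈ Pol) {h : Bridge Om O A Op} (hh : h ∈ hypClass Φ)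
    (h0 : ∀ θ ∈ dualClass Φ k, ∫ t, alpha π h k t * θ t ∂condLaw M k = 0) :
    lossPart Φ D π h k ≤ η ^ 2 / 8 := by
  refine csSup_le ⟨_, _, zero_mem_dualClass hD, rfl⟩ ?_
  rintro _ ⟨θ, hθ, rfl⟩
  have h1 := (abs_le.1 (hU.1 π hπ h hh θ hθ)).2
  have h2 := (hU.2 θ hθ).1
  rw [h0 θ hθ] at h1
  have h3 := empMean_nonneg (subData D k) fun t => sq_nonneg (θ t)
  simp only
  -- The deviation is at most `3/16` of the empirical second moment plus `(17/256) η²`; the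
  -- quadratic penalty absorbs the former.
  nlinarith [sq_nonneg η]

/-- On the event of uniformly small deviations, a small inner maximum forces the dual representer
of the moment to be small. -/
theorem integral_sq_le_of_lossPart {T : ℕ} {M : Model Om S O A Op} {Φ : Features c Om O A Op}
    {Pol : Set (Kernel (Om × O) A)} {D : Fin T → Trial Om S O A Op} {k : Fin 4} {η : ℝ}
    (hU : UniformDev (condLaw M k) Φ Pol k (subData D k) η)
    {π : Kernel (Om × O) A} (hπ : π ∈ Pol) {h : Bridge Om O A Op} (hh : h ∈ hypClass Φ)
    {β : EuclideanSpace ℝ (Fin (dualDim c k))} (hβ : ‖β‖ ≤ c.D k)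
    (hrep : ∫ t, alpha π h k t * inner ℝ β (dualFeat Φ k t) ∂condLaw M k =
      ∫ t, inner ℝ β (dualFeat Φ k t) * inner ℝ β (dualFeat Φ k t) ∂condLaw M k) :
    13 / 64 * ∫ t, (inner ℝ β (dualFeat Φ k t)) ^ 2 ∂condLaw M k ≤
      lossPart Φ D π h k + 25 / 256 * η ^ 2 := by
  set f : Trial Om S O A Op → ℝ := fun t => inner ℝ β (dualFeat Φ k t) with hf
  -- Half of the representer is tested: its linear gain `I / 2` exceeds the penalty and the
  -- deviations by `13/64 I`, where `I` is the population second moment.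
  have hθ : (fun t => 1 / 2 * f t) ∈ dualClass Φ k := by
    rw [dualClass_eq]
    refine ⟨(1 / 2 : ℝ) • β, ?_, by simp only [hf, real_inner_smul_left]⟩
    rw [norm_smul]
    norm_num
    linarith [norm_nonneg β]
  have h1 := (abs_le.1 (hU.1 π hπ h hh _ hθ)).1
  have h2 := (hU.2 _ hθ).2
  have h3 := le_lossPart D π h k hθ
  have e1 : ∫ t, alpha π h k t * (1 / 2 * f t) ∂condLaw M k = 1 / 2 * ∫ t, f t ^ 2 ∂condLaw M k := by
    have : ∀ t, alpha π h k t * (1 / 2 * f t) = 1 / 2 * (alpha π h k t * f t) := fun t => by ring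
    simp only [this, integral_const_mul, pow_two]
    rw [hrep]
  have e2 : ∫ t, (1 / 2 * f t) ^ 2 ∂condLaw M k = 1 / 4 * ∫ t, f t ^ 2 ∂condLaw M k := by
    rw [← integral_const_mul]
    congr 1; funext t; ring
  rw [e1, e2] at h1
  rw [e2] at h2
  have h4 : 0 ≤ ∫ t, f t ^ 2 ∂condLaw M k := integral_nonneg fun t => sq_nonneg _
  linarith

theorem loss_eq_sum {T : ℕ} (Φ : Features c Om O A Op) (D : Fin T → Trial Om S O A Op)
    (π : Kernel (Om × O) A) (h : Bridge Om O A Op) : loss Φ D π h = ∑ k, lossPart Φ D π h k := rfl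

/-- On the event of uniformly small deviations, the confidence set contains a function predicting
the value of the policy exactly, and all its members predict the value with small error. -/
theorem confSet_of_uniformDev {T : ℕ} {M : Model Om S O A Op} (hR : RewardBounded M c.LY)
    {Φ : Features c Om O A Op} {Pol : Set (Kernel (Om × O) A)} (hPol : Pol ⊆ softmaxClass Φ)
    {L : ℝ} (hL : AlphaBounded S Φ Pol L) (hrad : RadiiOK Φ) (hlin : LinearBridgeExists M Φ Pol)
    (hdual : DualLinear M Φ) (hD0 : ∀ k, 0 ≤ c.D k) (hk : ∀ k, obLaw M (pattern k) ≠ 0)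
    {b : Om × A × Op → ℝ}
    (hb : IsShift M b) (hrat : RatiosExist M) (hw : ∀ k, MemLp (weight M b k) 2 (condLaw M k))
    {D : Fin T → Trial Om S O A Op} {η : Fin 4 → ℝ}
    (hU : ∀ k, UniformDev (condLaw M k) Φ Pol k (subData D k) (η k)) {e : ℝ}
    (he : 5 / 4 * ∑ k, η k ^ 2 < e) {π : Kernel (Om × O) A} (hπ : π ∈ Pol) :
    (∃ g ∈ confSet Φ D e π, ∫ om, g om ∂M.pTilde = value M π) ∧ ∀ g ∈ confSet Φ D e π,
      |∫ om, g om ∂M.pTilde - value M π| ≤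
        4 * √e * ∑ k, (eLpNorm (weight M b k) 2 (condLaw M k)).toReal := by
  have hfin : ∀ k, IsProbabilityMeasure (condLaw M k) := fun k => cond_isProbabilityMeasure (hk k)
  obtain ⟨h₀, hh₀, hz, hrep⟩ := exists_bridge_moments hR hPol hL hrad hlin hdual hk hπ
  have hwi := fun k => (hw k).integrable one_le_two
  have hwm := fun k => measurable_weight M hb.1 k
  have hsum := fun h hh => sum_integral_alpha_mul_weight hR hPol hL hk hπ (h := h) hh hb hrat hwi
  have hfm : ∀ k (β : EuclideanSpace ℝ (Fin (dualDim c k))),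
      Measurable fun t : Trial Om S O A Op => inner ℝ β (dualFeat Φ k t) := fun k β =>
    (measurable_inner_dualFeat Φ k β).mono (sigmaZ_le k) le_rfl
  have hfi : ∀ k (β : EuclideanSpace ℝ (Fin (dualDim c k))),
      Integrable (fun t : Trial Om S O A Op => inner ℝ β (dualFeat Φ k t)) (condLaw M k) :=
    fun k β => integrable_of_abs_le (hfm k β) fun t => abs_inner_le le_rfl (norm_dualFeat_le Φ k t)
  have hbd : BddBelow (loss Φ D π '' hypClass Φ) := by
    refine ⟨0, ?_⟩
    rintro _ ⟨h, -, rfl⟩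
    exact Finset.sum_nonneg fun k _ => lossPart_nonneg D π h (hD0 k)
  have hl0 : loss Φ D π h₀ ≤ (∑ k, η k ^ 2) / 8 := by
    rw [loss_eq_sum, Finset.sum_div]
    refine Finset.sum_le_sum fun k _ => lossPart_le (hU k) (hD0 k) hπ hh₀ fun θ hθ => ?_
    rw [dualClass_eq] at hθ
    obtain ⟨β, -, rfl⟩ := hθ
    exact hz k _ (measurable_inner_dualFeat Φ k β) (ignoresMissingness_inner_dualFeat Φ k β)
      (hfi k β)
  have hE : 0 ≤ ∑ k, η k ^ 2 := Finset.sum_nonneg fun k _ => sq_nonneg _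
  have hinf : 0 ≤ sInf (loss Φ D π '' hypClass Φ) := by
    refine Real.sInf_nonneg ?_
    rintro _ ⟨h, -, rfl⟩
    exact Finset.sum_nonneg fun k _ => lossPart_nonneg D π h (hD0 k)
  refine ⟨⟨h₀.g, ⟨h₀, hh₀, rfl, by linarith⟩, ?_⟩, ?_⟩
  · have h1 := hsum h₀ hh₀
    rw [Finset.sum_eq_zero fun k _ => hz k _ (hwm k) (ignoresMissingness_weight M b k) (hwi k)] at h1
    linarith
  · rintro _ ⟨h, hh, rfl, hle⟩
    -- The infimum of the loss is at most its value at the exact bridge. Since `∑ η² < (4/5) e`, the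
    -- second moment of every representer is then below `16 e`.
    have hle2 : loss Φ D π h ≤ (∑ k, η k ^ 2) / 8 + e :=
      hle.trans (by linarith [csInf_le hbd ⟨h₀, hh₀, rfl⟩])
    choose β hβ hrepβ using hrep h hh
    have hF : ∀ k, 13 / 64 * ∫ t, (inner ℝ (β k) (dualFeat Φ k t)) ^ 2 ∂condLaw M k ≤
        lossPart Φ D π h k + 25 / 256 * η k ^ 2 := fun k =>
      integral_sq_le_of_lossPart (hU k) hπ hh (hβ k) (hrepβ k _ (measurable_inner_dualFeat Φ k _)
        (ignoresMissingness_inner_dualFeat Φ k _) (hfi k _))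
    have hF2 : ∀ k, √(∫ t, (inner ℝ (β k) (dualFeat Φ k t)) ^ 2 ∂condLaw M k) ≤ 4 * √e := by
      intro k
      have h1 : lossPart Φ D π h k ≤ loss Φ D π h := by
        rw [loss_eq_sum]
        exact Finset.single_le_sum (f := fun k => lossPart Φ D π h k)
          (fun k _ => lossPart_nonneg D π h (hD0 k)) (Finset.mem_univ k)
      have h2 : η k ^ 2 ≤ ∑ k, η k ^ 2 :=
        Finset.single_le_sum (f := fun k => η k ^ 2) (fun k _ => sq_nonneg _) (Finset.mem_univ k)
      refine Real.sqrt_le_iff.2 ⟨by positivity, ?_⟩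
      rw [mul_pow, Real.sq_sqrt (by linarith)]
      linarith [hF k]
    rw [← hsum h hh, Finset.mul_sum]
    refine (Finset.abs_sum_le_sum_abs _ _).trans (Finset.sum_le_sum fun k _ => ?_)
    rw [hrepβ k _ (hwm k) (ignoresMissingness_weight M b k) (hwi k)]
    refine (abs_integral_mul_le ?_ (hw k)).trans
      (mul_le_mul_of_nonneg_right (hF2 k) ENNReal.toReal_nonneg)
    exact MemLp.of_bound (hfm k _).aestronglyMeasurable _ (ae_of_all _ fun t =>
      abs_inner_le le_rfl (norm_dualFeat_le Φ k t))

/-- On the event of uniformly small deviations, pessimistic policies are nearly optimal. -/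
theorem subOpt_le_of_uniformDev {T : ℕ} {M : Model Om S O A Op} (hR : RewardBounded M c.LY)
    {Φ : Features c Om O A Op} {Pol : Set (Kernel (Om × O) A)} (hPol : Pol ⊆ softmaxClass Φ)
    {L : ℝ} (hL : AlphaBounded S Φ Pol L) (hrad : RadiiOK Φ) (hlin : LinearBridgeExists M Φ Pol)
    (hdual : DualLinear M Φ) (hD0 : ∀ k, 0 ≤ c.D k) (hk : ∀ k, obLaw M (pattern k) ≠ 0)
    {b : Om × A × Op → ℝ} (hb : IsShift M b) (hrat : RatiosExist M)
    {D : Fin T → Trial Om S O A Op} {η : Fin 4 → ℝ}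
    (hU : ∀ k, UniformDev (condLaw M k) Φ Pol k (subData D k) (η k)) {e : ℝ}
    (he : 5 / 4 * ∑ k, η k ^ 2 < e) {πhat : Kernel (Om × O) A}
    (hπ : IsPessimistic M Φ Pol D e πhat) :
    ENNReal.ofReal (subOpt M Pol πhat) ≤ (∑ k, eLpNorm (weight M b k) 2 (condLaw M k)) *
      ENNReal.ofReal (4 * √e) := by
  have hE : 0 ≤ ∑ k, η k ^ 2 := Finset.sum_nonneg fun k _ => sq_nonneg _
  have he0 : 0 < e := by linarith
  -- With a weight of infinite norm the right side is infinite, since `e > 0`; otherwise all weights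
  -- are square integrable.
  by_cases htop : ∑ k, eLpNorm (weight M b k) 2 (condLaw M k) = ⊤
  · rw [htop, ENNReal.top_mul]
    · exact le_top
    · rw [Ne, ENNReal.ofReal_eq_zero, not_le]; positivity
  have hfin : ∀ k, eLpNorm (weight M b k) 2 (condLaw M k) ≠ ⊤ := fun k h =>
    htop (ENNReal.sum_eq_top.2 ⟨k, Finset.mem_univ k, h⟩)
  have hw : ∀ k, MemLp (weight M b k) 2 (condLaw M k) := fun k =>
    ⟨((measurable_weight M hb.1 k).mono (sigmaZ_le k) le_rfl).aestronglyMeasurable,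
      (hfin k).lt_top⟩
  have key := fun {π} (h : π ∈ Pol) =>
    confSet_of_uniformDev hR hPol hL hrad hlin hdual hD0 hk hb hrat hw hU he h
  set Δ := 4 * √e * ∑ k, (eLpNorm (weight M b k) 2 (condLaw M k)).toReal with hΔ
  have low : ∀ π ∈ Pol, value M π - Δ ≤ pessValue M Φ D e π := by
    intro π h
    obtain ⟨g, hg, -⟩ := (key h).1
    refine le_csInf ⟨_, g, hg, rfl⟩ ?_
    rintro _ ⟨g, hg, rfl⟩
    linarith [(abs_le.1 ((key h).2 g hg)).1]
  have upp : pessValue M Φ D e πhat ≤ value M πhat := by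
    obtain ⟨g, hg, hv⟩ := (key hπ.1).1
    rw [← hv]
    refine csInf_le ⟨value M πhat - Δ, ?_⟩ ⟨g, hg, rfl⟩
    rintro _ ⟨g, hg, rfl⟩
    linarith [(abs_le.1 ((key hπ.1).2 g hg)).1]
  have hsub : subOpt M Pol πhat ≤ Δ := by
    rw [subOpt, sub_le_iff_le_add]
    refine csSup_le ⟨_, πhat, hπ.1, rfl⟩ ?_
    rintro _ ⟨π, h, rfl⟩
    -- Value of the competitor minus `Δ`, its pessimistic value, that of `πhat`, and the value of
    -- `πhat` form an increasing chain.
    linarith [low π h, hπ.2 π h]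
  refine (ENNReal.ofReal_le_ofReal hsub).trans (le_of_eq ?_)
  rw [hΔ, ENNReal.ofReal_mul (by positivity), mul_comm,
    ENNReal.ofReal_sum_of_nonneg fun k _ => ENNReal.toReal_nonneg]
  simp only [ENNReal.ofReal_toReal (hfin _)]

end Regret

/-! ### Massart's bound and critical radii of finitely covered classes -/

section Massart

variable {ι : Type*} [Fintype ι]

/-- The exponential moment factors over coordinates into hyperbolic cosines. -/
theorem signAvg_exp_sum_le (u : ι → ℝ) :
    signAvg (fun ε : ι → Bool => Real.exp (∑ i, sgn (ε i) * u i)) ≤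
      Real.exp ((∑ i, u i ^ 2) / 2) := by
  classical
  have h : ∑ ε : ι → Bool, Real.exp (∑ i, sgn (ε i) * u i) = ∏ i, (2 * Real.cosh (u i)) := by
    have : ∀ i, 2 * Real.cosh (u i) = ∑ b : Bool, Real.exp (sgn b * u i) := fun i => by
      rw [Fintype.sum_bool, Real.cosh_eq]
      simp only [sgn, if_true, Bool.false_eq_true, if_false, one_mul, neg_one_mul]
      ring
    simp only [this, Real.exp_sum]
    rw [Finset.prod_univ_sum, Fintype.piFinset_univ]
  have h2 : signAvg (fun ε : ι → Bool => Real.exp (∑ i, sgn (ε i) * u i)) =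
      ∏ i, Real.cosh (u i) := by
    rw [Finset.prod_mul_distrib, Finset.prod_const, Finset.card_univ] at h
    rw [signAvg, div_eq_iff (by positivity), mul_comm, ← h]
  rw [h2, Finset.sum_div, Real.exp_sum]
  exact Finset.prod_le_prod (fun i _ => (Real.cosh_pos _).le) fun i _ => Real.cosh_le_exp_half_sq _

/-- Massart's finite-class bound. -/
theorem signAvg_le_of_finset {J : Type*} (s : Finset J) (v : J → ι → ℝ) {V l : ℝ} (hl : 0 < l)
    (hv : ∀ j ∈ s, ∑ i, v j i ^ 2 ≤ V) {Z : (ι → Bool) → ℝ}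
    (hZ : ∀ ε, ∃ j ∈ s, Z ε ≤ ∑ i, sgn (ε i) * v j i) :
    signAvg Z ≤ Real.log s.card / l + l * V / 2 := by
  have hs : 0 < (s.card : ℝ) := by
    obtain ⟨j, hj, -⟩ := hZ fun _ => true
    exact_mod_cast Finset.card_pos.2 ⟨j, hj⟩
  have h1 : Real.exp (l * signAvg Z) ≤ s.card * Real.exp (l ^ 2 * V / 2) := by
    rw [← signAvg_const_mul]
    refine (exp_signAvg_le _).trans ?_
    calc signAvg (fun ε => Real.exp (l * Z ε))
        ≤ signAvg (fun ε => ∑ j ∈ s, Real.exp (∑ i, sgn (ε i) * (l * v j i))) := by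
          refine signAvg_mono fun ε => ?_
          obtain ⟨j, hj, h⟩ := hZ ε
          refine le_trans ?_ (Finset.single_le_sum
            (f := fun j => Real.exp (∑ i, sgn (ε i) * (l * v j i)))
            (fun _ _ => (Real.exp_pos _).le) hj)
          simp only [mul_left_comm _ l, ← Finset.mul_sum]
          exact Real.exp_le_exp.2 (mul_le_mul_of_nonneg_left h hl.le)
      _ = ∑ j ∈ s, signAvg (fun ε : ι → Bool => Real.exp (∑ i, sgn (ε i) * (l * v j i))) :=
          signAvg_finsetSum _ _
      _ ≤ ∑ _j ∈ s, Real.exp (l ^ 2 * V / 2) := by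
          refine Finset.sum_le_sum fun j hj => (signAvg_exp_sum_le _).trans ?_
          simp only [mul_pow, ← Finset.mul_sum]
          gcongr
          exact hv j hj
      _ = s.card * Real.exp (l ^ 2 * V / 2) := by rw [Finset.sum_const, nsmul_eq_mul]
  have h2 := Real.log_le_log (Real.exp_pos _) h1
  rw [Real.log_exp, Real.log_mul hs.ne' (Real.exp_pos _).ne', Real.log_exp] at h2
  rw [← mul_le_mul_iff_right₀ hl]
  refine h2.trans (le_of_eq ?_)
  field_simp

/-- A class covered by finitely many cells of small diameter has a small critical radius. -/
theorem isCriticalRadius_of_cells [Nonempty ι] {Ω P K : Type*} {x : ι → Ω} {F : Set (Ω → ℝ)}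
    {Q : Set P} {f : P → Ω → ℝ} (hF : F ⊆ f '' Q) (code : P → K) (s : Finset K)
    (hs : ∀ p ∈ Q, code p ∈ s) {δ : ℝ}
    (hδ : ∀ p ∈ Q, ∀ q ∈ Q, code p = code q → ∀ i, |f p (x i) - f q (x i)| ≤ δ)
    {B r : ℝ} (hB : 0 < B) (hr : 0 < r)
    (hrad : 2 * B ^ 2 * Real.log s.card / Fintype.card ι + 2 * B * δ ≤ r ^ 2) :
    IsCriticalRadius x F B r := by
  classical
  refine ⟨hr, ?_⟩
  set n : ℝ := (Fintype.card ι : ℝ) with hn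
  have hn0 : 0 < n := by rw [hn]; exact_mod_cast Fintype.card_pos
  rw [locRademacher_eq_signAvg]
  by_cases hne : ∃ g ∈ F, √(empMean x (fun ω => g ω ^ 2)) ≤ r
  swap
  -- An empty localized class has complexity zero by the convention for `sSup ∅`.
  · have : ∀ ε : ι → Bool, {y | ∃ g ∈ F, √(empMean x (fun ω => g ω ^ 2)) ≤ r ∧
        y = (∑ i, sgn (ε i) * g (x i)) / Fintype.card ι} = ∅ := fun ε =>
      Set.eq_empty_of_forall_notMem fun y ⟨g, hg, h, _⟩ => hne ⟨g, hg, h⟩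
    simp only [this, Real.sSup_empty, signAvg_const]
    positivity
  obtain ⟨g₀, hg₀, hg₀r⟩ := hne
  set Good : K → P → Prop := fun k p =>
    p ∈ Q ∧ code p = k ∧ √(empMean x (fun ω => f p ω ^ 2)) ≤ r with hGood
  -- Representatives are chosen inside the localized class, so they obey the norm bound without
  -- enlarging the radius.
  set v : K → ι → ℝ := fun k i => if h : ∃ p, Good k p then f h.choose (x i) else 0 with hv
  have hv2 : ∀ k ∈ s, ∑ i, v k i ^ 2 ≤ n * r ^ 2 := by
    intro k _
    by_cases h : ∃ p, Good k p
    · have h2 := h.choose_spec.2.2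
      rw [Real.sqrt_le_left hr.le, empMean, ← hn, div_le_iff₀ hn0] at h2
      simp only [hv, dif_pos h]
      linarith
    · simp only [hv, dif_neg h]
      simp only [ne_eq, OfNat.ofNat_ne_zero, not_false_eq_true, zero_pow, Finset.sum_const_zero]
      positivity
  set Z : (ι → Bool) → ℝ := fun ε => sSup {y | ∃ g ∈ F, √(empMean x (fun ω => g ω ^ 2)) ≤ r ∧
        y = (∑ i, sgn (ε i) * g (x i)) / n} with hZ
  have hsne : s.Nonempty := by
    obtain ⟨p, hp, -⟩ := hF hg₀
    exact ⟨_, hs p hp⟩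
  have hZv : ∀ ε, ∃ k ∈ s, n * Z ε + -(n * δ) ≤ ∑ i, sgn (ε i) * v k i := by
    intro ε
    obtain ⟨k, hk, hmax⟩ := s.exists_max_image (fun k => ∑ i, sgn (ε i) * v k i) hsne
    refine ⟨k, hk, ?_⟩
    have : Z ε ≤ (∑ i, sgn (ε i) * v k i) / n + δ := by
      refine csSup_le ⟨_, g₀, hg₀, hg₀r, rfl⟩ ?_
      rintro _ ⟨g, hg, hgr, rfl⟩
      obtain ⟨p, hp, rfl⟩ := hF hg
      have hex : ∃ q, Good (code p) q := ⟨p, hp, rfl, hgr⟩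
      have hq := hex.choose_spec
      have h1 : ∑ i, sgn (ε i) * f p (x i) ≤ ∑ i, sgn (ε i) * v (code p) i + n * δ := by
        rw [hn, ← nsmul_eq_mul, ← Finset.card_univ, ← Finset.sum_const, ← Finset.sum_add_distrib]
        refine Finset.sum_le_sum fun i _ => ?_
        have h2 := hδ p hp _ hq.1 hq.2.1.symm i
        have h3 : |sgn (ε i) * (f p (x i) - f hex.choose (x i))| ≤ δ := by
          rwa [abs_mul, abs_sgn, one_mul]
        simp only [hv, dif_pos hex]
        have := (abs_le.1 h3).2
        linarith
      rw [div_add' _ _ _ hn0.ne']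
      refine div_le_div_of_nonneg_right ?_ hn0.le
      linarith [hmax _ (hs p hp)]
    rw [div_add' _ _ _ hn0.ne', le_div_iff₀ hn0] at this
    linarith
  -- With `l = 1 / B` the variance term uses half of the allowed `r² / B`; the hypothesis bounds the
  -- entropy and the cell diameter by the other half.
  have hM := signAvg_le_of_finset s v (inv_pos.2 hB) hv2 hZv
  rw [signAvg_add, signAvg_const_mul, signAvg_const] at hM
  have h4 : n * signAvg Z ≤ n * (r ^ 2 / B) := by
    have e : n * (r ^ 2 / B) = n * r ^ 2 / B := by ring
    rw [e, le_div_iff₀ hB]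
    have h5 := mul_le_mul_of_nonneg_right hM hB.le
    have e2 : (Real.log s.card / B⁻¹ + B⁻¹ * (n * r ^ 2) / 2) * B =
      Real.log s.card * B ^ 2 + n * r ^ 2 / 2 := by field_simp
    rw [e2] at h5
    have h6 := mul_le_mul_of_nonneg_right hrad hn0.le
    have e3 : (2 * B ^ 2 * Real.log s.card / n + 2 * B * δ) * n =
      2 * B ^ 2 * Real.log s.card + 2 * B * δ * n := by field_simp
    rw [e3] at h6
    nlinarith
  exact le_of_mul_le_mul_left h4 hn0

end Massart

/-! ### Grids in parameter space and Lipschitz dependence -/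

section Cells

/-- The cell of side length `1 / n` containing `w`. -/
def cellCode (n : ℕ) {d : ℕ} (w : EuclideanSpace ℝ (Fin d)) (i : Fin d) : ℤ := ⌊w i * n⌋

/-- The cells meeting the ball of radius `R`. -/
def cellCodes (n R d : ℕ) : Finset (Fin d → ℤ) :=
  Fintype.piFinset fun _ => Finset.Icc (-((R * n : ℕ) : ℤ)) ((R * n : ℕ) : ℤ)

theorem card_cellCodes (n R d : ℕ) : (cellCodes n R d).card = (2 * (R * n) + 1) ^ d := by
  rw [cellCodes, Fintype.card_piFinset, Finset.prod_const, Int.card_Icc, Finset.card_univ,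
    Fintype.card_fin]
  congr 1
  omega

theorem cellCode_mem {n R d : ℕ} {w : EuclideanSpace ℝ (Fin d)} (hw : ‖w‖ ≤ R) :
    cellCode n w ∈ cellCodes n R d := by
  rw [cellCodes, Fintype.mem_piFinset]
  intro i
  have h1 : |w i| ≤ R := by
    rw [← Real.norm_eq_abs]
    exact (PiLp.norm_apply_le w i).trans hw
  have h2 : |w i * n| ≤ R * n := by
    rw [abs_mul, Nat.abs_cast]
    gcongr
  rw [Finset.mem_Icc, cellCode]
  have h3 := abs_le.1 h2
  constructor
  · refine Int.le_floor.2 ?_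
    push_cast
    exact h3.1
  · have h4 : ((⌊w i * n⌋ : ℤ) : ℝ) ≤ (((R * n : ℕ) : ℤ) : ℝ) := by
      push_cast
      exact (Int.floor_le _).trans h3.2
    exact Int.cast_le.1 h4

/-- Coordinates differ by at most `1/n`; `√d` is bounded crudely by `d`. -/
theorem norm_sub_le_of_cellCode_eq {n d : ℕ} (hn : 0 < n) {w v : EuclideanSpace ℝ (Fin d)}
    (h : cellCode n w = cellCode n v) : ‖w - v‖ ≤ d / n := by
  have hn' : (0 : ℝ) < n := by exact_mod_cast hn
  have h1 : ∀ i, |(w - v) i| ≤ 1 / n := by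
    intro i
    have := Int.abs_sub_lt_one_of_floor_eq_floor (congrFun h i)
    rw [← sub_mul, abs_mul, Nat.abs_cast] at this
    rw [le_div_iff₀ hn']
    exact this.le
  rw [EuclideanSpace.norm_eq]
  refine Real.sqrt_le_iff.2 ⟨by positivity, ?_⟩
  calc ∑ i, ‖(w - v) i‖ ^ 2 ≤ ∑ _i : Fin d, (1 / (n : ℝ)) ^ 2 :=
        Finset.sum_le_sum fun i _ => by
          rw [Real.norm_eq_abs]
          exact pow_le_pow_left₀ (abs_nonneg _) (h1 i) 2
    _ = d * (1 / (n : ℝ)) ^ 2 := by simp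
    _ ≤ (d : ℝ) ^ 2 * (1 / (n : ℝ)) ^ 2 := by
        gcongr
        exact_mod_cast Nat.le_self_pow (by norm_num) d
    _ = (d / n : ℝ) ^ 2 := by ring

theorem abs_inner_sub_inner_le {d : ℕ} {w w' v : EuclideanSpace ℝ (Fin d)} {δ : ℝ}
    (hw : ‖w - w'‖ ≤ δ) (hv : ‖v‖ ≤ 1) : |inner ℝ w v - inner ℝ w' v| ≤ δ := by
  rw [← inner_sub_left]
  exact abs_inner_le hw hv

variable {Om S O A Op : Type*} [MeasurableSpace Om] [MeasurableSpace S] [MeasurableSpace O]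
  [MeasurableSpace A] [MeasurableSpace Op] {c : Constants} [Fintype A]

/-- Numerator and denominator each change by a factor at most `e^δ`, so the probability drops at
most to `e^{-2δ} ≥ 1 - 2δ` times itself. -/
theorem softProb_sub_le (Φ : Features c Om O A Op) {w w' : EuclideanSpace ℝ (Fin c.m₀)} {δ : ℝ}
    (h : ‖w - w'‖ ≤ δ) (om : Om) (o : O) (a : A) :
    softProb Φ w om o a - softProb Φ w' om o a ≤ 2 * δ := by
  have : Nonempty A := ⟨a⟩
  have hd := fun a' => abs_le.1 (abs_inner_sub_inner_le h (Φ.norm_φ₀ (a', o, om)))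
  have h1 : Real.exp (-(2 * δ)) * softProb Φ w om o a ≤ softProb Φ w' om o a := by
    rw [softProb, softProb, ← mul_div_assoc, div_le_div_iff₀ (by positivity) (by positivity)]
    have e1 : Real.exp (-δ) * Real.exp (inner ℝ w (Φ.φ₀ (a, o, om))) ≤
        Real.exp (inner ℝ w' (Φ.φ₀ (a, o, om))) := by
      rw [← Real.exp_add, Real.exp_le_exp]; linarith [(hd a).2]
    have e2 : Real.exp (-δ) * ∑ a', Real.exp (inner ℝ w' (Φ.φ₀ (a', o, om))) ≤
        ∑ a', Real.exp (inner ℝ w (Φ.φ₀ (a', o, om))) := by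
      rw [Finset.mul_sum]
      refine Finset.sum_le_sum fun a' _ => ?_
      rw [← Real.exp_add, Real.exp_le_exp]; linarith [(hd a').1]
    calc _ = (Real.exp (-δ) * Real.exp (inner ℝ w (Φ.φ₀ (a, o, om)))) *
          (Real.exp (-δ) * ∑ a', Real.exp (inner ℝ w' (Φ.φ₀ (a', o, om)))) := by
          rw [show -(2 * δ) = -δ + -δ by ring, Real.exp_add]; ring
      _ ≤ _ := mul_le_mul e1 e2 (by positivity) (by positivity)
  have h2 := Real.add_one_le_exp (-(2 * δ))
  have h3 := softProb_le_one Φ w om o a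
  have h4 := softProb_nonneg Φ w om o a
  have h5 : 0 ≤ δ := (norm_nonneg _).trans h
  nlinarith

theorem abs_softProb_sub_le (Φ : Features c Om O A Op) {w w' : EuclideanSpace ℝ (Fin c.m₀)} {δ : ℝ}
    (h : ‖w - w'‖ ≤ δ) (om : Om) (o : O) (a : A) :
    |softProb Φ w om o a - softProb Φ w' om o a| ≤ 2 * δ :=
  abs_sub_le_iff.2 ⟨softProb_sub_le Φ h om o a,
    softProb_sub_le Φ (by rwa [norm_sub_rev]) om o a⟩

/-- One constant for all four moments: the number of actions comes from the sum in the third, `2 C`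
from the policy term in the second. -/
theorem abs_alphaLin_sub_le (Φ : Features c Om O A Op) {w₀ v₀ : EuclideanSpace ℝ (Fin c.m₀)}
    {w₁ v₁ : EuclideanSpace ℝ (Fin c.m₁)} {w₂ v₂ : EuclideanSpace ℝ (Fin c.m₂)}
    {w₃ v₃ : EuclideanSpace ℝ (Fin c.m₃)} {w₄ v₄ : EuclideanSpace ℝ (Fin c.m₄)} {δ : ℝ}
    (h₀ : ‖w₀ - v₀‖ ≤ δ) (h₁ : ‖w₁ - v₁‖ ≤ δ) (h₂ : ‖w₂ - v₂‖ ≤ δ) (h₃ : ‖w₃ - v₃‖ ≤ δ)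
    (h₄ : ‖w₄ - v₄‖ ≤ δ) (k : Fin 4) {t : Trial Om S O A Op} {C : ℝ} (ht : |rew t| ≤ C) :
    |alphaLin Φ w₀ w₁ w₂ w₃ w₄ k t - alphaLin Φ v₀ v₁ v₂ v₃ v₄ k t| ≤
      (2 + Fintype.card A + 2 * C) * δ := by
  have hδ : 0 ≤ δ := (norm_nonneg _).trans h₀
  have hC : 0 ≤ C := (abs_nonneg _).trans ht
  have e1 := fun x => abs_le.1 (abs_inner_sub_inner_le h₁ (Φ.norm_φ₁ x))
  have e2 := fun x => abs_le.1 (abs_inner_sub_inner_le h₂ (Φ.norm_φ₂ x))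
  have e3 := fun x => abs_le.1 (abs_inner_sub_inner_le h₃ (Φ.norm_φ₃ x))
  have e4 := fun x => abs_le.1 (abs_inner_sub_inner_le h₄ (Φ.norm_ψ₄ x))
  have hA : 0 ≤ (Fintype.card A : ℝ) * δ := by positivity
  have hCδ : 0 ≤ C * δ := by positivity
  match k with
  | 0 =>
    have := e1 (rew t, act t, preObs t, nextObs t)
    simp only [alphaLin]
    exact abs_le.2 ⟨by linarith, by linarith⟩
  | 1 =>
    have h1 := e1 (rew t, act t, preObs t, nextObs t)
    have h2 := e2 (act t, obs t, preObs t)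
    have h3 : |rew t * (softProb Φ w₀ (preObs t) (obs t) (act t) -
        softProb Φ v₀ (preObs t) (obs t) (act t))| ≤ C * (2 * δ) := by
      rw [abs_mul]
      exact mul_le_mul ht (abs_softProb_sub_le Φ h₀ _ _ _) (abs_nonneg _) hC
    rw [mul_sub] at h3
    have h4 := abs_le.1 h3
    simp only [alphaLin]
    exact abs_le.2 ⟨by linarith, by linarith⟩
  | 2 =>
    have h1 := e3 (rew t, act t, preObs t)
    have h2 : |∑ a : A, inner ℝ w₂ (Φ.φ₂ (a, obs t, preObs t)) -
        ∑ a : A, inner ℝ v₂ (Φ.φ₂ (a, obs t, preObs t))| ≤ Fintype.card A * δ := by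
      rw [← Finset.sum_sub_distrib]
      refine (Finset.abs_sum_le_sum_abs _ _).trans ?_
      rw [← nsmul_eq_mul, ← Finset.card_univ, ← Finset.sum_const]
      exact Finset.sum_le_sum fun a _ => abs_le.2 (e2 _)
    have h3 := abs_le.1 h2
    simp only [alphaLin]
    exact abs_le.2 ⟨by linarith, by linarith⟩
  | 3 =>
    have h1 := e3 (rew t, act t, preObs t)
    have h2 := e4 (preObs t)
    simp only [alphaLin]
    exact abs_le.2 ⟨by linarith, by linarith⟩

end Cells

/-! ### Rates of the critical radii -/

section RateOfRadii

/-- A bound for all radii. -/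
def radiusBound (c : Constants) : ℕ :=
  ⌈|c.C₀| + |c.C₁| + |c.C₂| + |c.C₃| + |c.C₄| + ∑ k, |c.D k|⌉₊ + 1

/-- A bound for the total dimension of the parameters of a product class. -/
def dimBound (c : Constants) : ℕ :=
  c.m₀ + c.m₁ + c.m₂ + c.m₃ + c.m₄ + (c.d₁ + c.d₂ + c.d₃ + c.m₄)

theorem abs_D_le (c : Constants) (k : Fin 4) : |c.D k| ≤ ∑ k, |c.D k| :=
  Finset.single_le_sum (f := fun k => |c.D k|) (fun _ _ => abs_nonneg _) (Finset.mem_univ k)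

theorem dualDim_le (c : Constants) (k : Fin 4) : dualDim c k ≤ c.d₁ + c.d₂ + c.d₃ + c.m₄ := by
  fin_cases k <;> simp only [dualDim] <;> omega

variable {Om S O A Op : Type*} [MeasurableSpace Om] [MeasurableSpace S] [MeasurableSpace O]
  [MeasurableSpace A] [MeasurableSpace Op] {c : Constants} [Fintype A]
  [MeasurableSingletonClass A]

theorem isCriticalRadius_dualClass {ι : Type*} [Fintype ι] [Nonempty ι]
    (x : ι → Trial Om S O A Op) (Φ : Features c Om O A Op) (k : Fin 4) {B r : ℝ} (hB : 0 < B)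
    (hr : 0 < r) (hrad : 2 * B ^ 2 *
      (dimBound c * Real.log (2 * (radiusBound c * Fintype.card ι) + 1)) / Fintype.card ι +
        2 * B * (dimBound c / Fintype.card ι) ≤ r ^ 2) :
    IsCriticalRadius x (dualClass Φ k) B r := by
  set n := Fintype.card ι with hn
  have hn0 : 0 < n := Fintype.card_pos
  have hd : (dualDim c k : ℝ) ≤ dimBound c := by
    exact_mod_cast (dualDim_le c k).trans (by unfold dimBound; omega)
  have hlog : 0 ≤ Real.log (2 * (radiusBound c * n) + 1) :=
    Real.log_nonneg (le_add_of_nonneg_left (by positivity))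
  refine isCriticalRadius_of_cells (Q := {β : EuclideanSpace ℝ (Fin (dualDim c k)) | ‖β‖ ≤ c.D k})
    (f := fun β t => inner ℝ β (dualFeat Φ k t)) (δ := dimBound c / n) ?_ (cellCode n)
    (cellCodes n (radiusBound c) (dualDim c k)) ?_ ?_ hB hr ?_
  · rw [dualClass_eq]
    rintro _ ⟨β, hβ, rfl⟩
    exact ⟨β, hβ, rfl⟩
  · intro β hβ
    refine cellCode_mem (le_trans hβ ?_)
    rw [radiusBound]
    push_cast
    refine le_trans ?_ ((Nat.le_ceil _).trans (le_add_of_nonneg_right zero_le_one))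
    have := abs_D_le c k
    have := le_abs_self (c.D k)
    have := abs_nonneg c.C₀; have := abs_nonneg c.C₁; have := abs_nonneg c.C₂
    have := abs_nonneg c.C₃; have := abs_nonneg c.C₄
    linarith
  · intro β _ β' _ h i
    exact abs_inner_sub_inner_le ((norm_sub_le_of_cellCode_eq hn0 h).trans (by gcongr))
      (norm_dualFeat_le Φ k _)
  · refine le_trans ?_ hrad
    rw [card_cellCodes]
    push_cast
    rw [Real.log_pow]
    gcongr

/-- The cells are products of grid cells of side `1/n`. Within a cell the product varies by the
usual two-term splitting; the number of cells is a power, with exponent at most `dimBound`, of a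
linear function of `n`. -/
theorem isCriticalRadius_prodClass {ι : Type*} [Fintype ι] [Nonempty ι]
    {x : ι → Trial Om S O A Op} (hx : ∀ i, |rew (x i)| ≤ c.LY) {Φ : Features c Om O A Op}
    {Pol : Set (Kernel (Om × O) A)} (hPol : Pol ⊆ softmaxClass Φ) {L : ℝ}
    (hL : AlphaBounded S Φ Pol L) (k : Fin 4) {B r : ℝ} (hB : 0 < B) (hr : 0 < r)
    (hrad : 2 * B ^ 2 *
      (dimBound c * Real.log (2 * (radiusBound c * Fintype.card ι) + 1)) / Fintype.card ι +
        2 * B * ((2 + Fintype.card A + 2 * |c.LY| + max 1 L) * max 1 (c.D k) *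
          (dimBound c / Fintype.card ι)) ≤ r ^ 2) :
    IsCriticalRadius x (prodClass Φ Pol k) B r := by
  classical
  set n := Fintype.card ι with hn
  have hn0 : 0 < n := Fintype.card_pos
  have hlog : 0 ≤ Real.log (2 * (radiusBound c * n) + 1) :=
    Real.log_nonneg (le_add_of_nonneg_left (by positivity))
  have hR : |c.C₀| + |c.C₁| + |c.C₂| + |c.C₃| + |c.C₄| + ∑ k, |c.D k| ≤ radiusBound c := by
    rw [radiusBound]
    push_cast
    exact (Nat.le_ceil _).trans (le_add_of_nonneg_right zero_le_one)
  set R := radiusBound c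
  have b0 := abs_nonneg c.C₀
  have b1 := abs_nonneg c.C₁
  have b2 := abs_nonneg c.C₂
  have b3 := abs_nonneg c.C₃
  have b4 := abs_nonneg c.C₄
  have b5 := abs_nonneg (c.D k)
  have b6 := abs_D_le c k
  have hdim : ∀ d : ℕ, d ≤ dimBound c → (d / n : ℝ) ≤ dimBound c / n := fun d h => by
    have : (d : ℝ) ≤ dimBound c := by exact_mod_cast h
    gcongr
  have hdd := dualDim_le c k
  refine isCriticalRadius_of_cells (Q := prodParamSet Φ Pol k) (f := prodLin Φ k)
    (fun g hg => by
      obtain ⟨p, hp, e⟩ := (mem_prodClass_iff hPol).1 hg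
      exact ⟨p, hp, e.symm⟩)
    (fun p => (cellCode n p.1, cellCode n p.2.1, cellCode n p.2.2.1, cellCode n p.2.2.2.1,
      cellCode n p.2.2.2.2.1, cellCode n p.2.2.2.2.2))
    (cellCodes n R c.m₀ ×ˢ cellCodes n R c.m₁ ×ˢ cellCodes n R c.m₂ ×ˢ cellCodes n R c.m₃ ×ˢ
      cellCodes n R c.m₄ ×ˢ cellCodes n R (dualDim c k))
    (δ := (2 + Fintype.card A + 2 * |c.LY| + max 1 L) * max 1 (c.D k) * (dimBound c / n))
    ?_ ?_ hB hr ?_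
  · rintro p ⟨⟨π, -, h0⟩, h1, h2, h3, h4, h5⟩
    simp only [Finset.mem_product]
    refine ⟨cellCode_mem (h0.1.trans ?_), cellCode_mem (h1.trans ?_), cellCode_mem (h2.trans ?_),
      cellCode_mem (h3.trans ?_), cellCode_mem (h4.trans ?_), cellCode_mem (h5.trans ?_)⟩
    · linarith [le_abs_self c.C₀]
    · linarith [le_abs_self c.C₁]
    · linarith [le_abs_self c.C₂]
    · linarith [le_abs_self c.C₃]
    · linarith [le_abs_self c.C₄]
    · linarith [le_abs_self (c.D k)]
  · rintro ⟨w₀, w₁, w₂, w₃, w₄, β⟩ ⟨-, -, -, -, -, h5⟩ ⟨v₀, v₁, v₂, v₃, v₄, γ⟩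
      ⟨⟨π, hπ, h0⟩, h1', h2', h3', h4', -⟩ h i
    simp only [Prod.mk.injEq] at h h5 h0 h1' h2' h3' h4'
    obtain ⟨k0, k1, k2, k3, k4, k5⟩ := h
    have nm : ∀ {d : ℕ} {w v : EuclideanSpace ℝ (Fin d)}, d ≤ dimBound c →
        cellCode n w = cellCode n v → ‖w - v‖ ≤ dimBound c / n := fun hd he =>
      (norm_sub_le_of_cellCode_eq hn0 he).trans (hdim _ hd)
    have hα := abs_alphaLin_sub_le Φ (nm (by unfold dimBound; omega) k0)
      (nm (by unfold dimBound; omega) k1) (nm (by unfold dimBound; omega) k2)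
      (nm (by unfold dimBound; omega) k3) (nm (by unfold dimBound; omega) k4) k
      ((hx i).trans (le_abs_self _))
    have hθ := abs_inner_sub_inner_le (nm (by unfold dimBound; omega) k5)
      (norm_dualFeat_le Φ k (x i))
    have hb : |alphaLin Φ v₀ v₁ v₂ v₃ v₄ k (x i)| ≤ max 1 L := by
      rw [← alpha_linBridge h0 v₁ v₂ v₃ v₄ k]
      exact (hL π hπ _ (mem_hypClass_iff.2 ⟨v₁, v₂, v₃, v₄, h1', h2', h3', h4', rfl⟩) k _
        (hx i)).trans (le_max_right _ _)
    have hβ : |inner ℝ β (dualFeat Φ k (x i))| ≤ max 1 (c.D k) :=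
      (abs_inner_le h5 (norm_dualFeat_le Φ k _)).trans (le_max_right _ _)
    have hm : (1 : ℝ) ≤ max 1 (c.D k) := le_max_left _ _
    have hm' : (0 : ℝ) ≤ max 1 L := zero_le_one.trans (le_max_left _ _)
    have hδ : (0 : ℝ) ≤ dimBound c / n := by positivity
    simp only [prodLin]
    calc _ = |(alphaLin Φ w₀ w₁ w₂ w₃ w₄ k (x i) - alphaLin Φ v₀ v₁ v₂ v₃ v₄ k (x i)) *
          inner ℝ β (dualFeat Φ k (x i)) + alphaLin Φ v₀ v₁ v₂ v₃ v₄ k (x i) *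
          (inner ℝ β (dualFeat Φ k (x i)) - inner ℝ γ (dualFeat Φ k (x i)))| := by
          congr 1; ring
      _ ≤ (2 + Fintype.card A + 2 * |c.LY|) * (dimBound c / n) * max 1 (c.D k) +
          max 1 L * (dimBound c / n) := by
          refine (abs_add_le _ _).trans ?_
          rw [abs_mul, abs_mul]
          gcongr
      _ ≤ (2 + Fintype.card A + 2 * |c.LY|) * (dimBound c / n) * max 1 (c.D k) +
          max 1 L * (dimBound c / n) * max 1 (c.D k) := by
          exact add_le_add le_rfl (le_mul_of_one_le_right (by positivity) hm)
      _ = _ := by ring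
  · refine le_trans ?_ hrad
    simp only [Finset.card_product, card_cellCodes, ← pow_add]
    push_cast
    rw [Real.log_pow]
    gcongr
    unfold dimBound
    omega

/-- `log n - log m ≤ n / m`, and `1 ≤ 2 log m` for `m ≥ 2`. The factor `3` avoids any discussion of
monotonicity below `e`; the lemma compares the larger subsamples with the complete trials. -/
theorem log_div_le_of_le {m n : ℕ} (hm : 2 ≤ m) (hmn : m ≤ n) :
    Real.log n / n ≤ 3 * (Real.log m / m) := by
  have hm0 : (0 : ℝ) < m := by positivity
  have hn0 : (0 : ℝ) < n := by exact_mod_cast (by omega : 0 < n)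
  have hl : 1 / 2 ≤ Real.log m := by
    have := Real.log_two_gt_d9
    have h2 : Real.log 2 ≤ Real.log m := Real.log_le_log (by norm_num) (by exact_mod_cast hm)
    linarith
  have h1 : Real.log n ≤ Real.log m + n / m := by
    have h := Real.log_le_sub_one_of_pos (div_pos hn0 hm0)
    rw [Real.log_div hn0.ne' hm0.ne'] at h
    linarith
  have h2 : (m : ℝ) ≤ n := by exact_mod_cast hmn
  calc Real.log n / n ≤ (Real.log m + n / m) / n := by gcongr
    _ = Real.log m / n + 1 / m := by field_simp
    _ ≤ Real.log m / m + 2 * Real.log m / m := by gcongr; linarith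
    _ = _ := by ring

/-- The factor in the rate of the critical radii. -/
def rateFactor (c : Constants) (κ : ℝ) : ℝ :=
  let b := (1 + |κ|) * (1 + ∑ k, |c.D k|)
  2 * b ^ 2 * (dimBound c * (1 + 2 * Real.log (3 * radiusBound c))) +
    2 * b * ((4 + 2 * |c.LY| + |κ|) * (1 + ∑ k, |c.D k|) * (2 * dimBound c)) + b ^ 2

theorem one_le_radiusBound (c : Constants) : (1 : ℝ) ≤ radiusBound c := by
  rw [radiusBound]; push_cast; exact le_add_of_nonneg_left (by positivity)

theorem log_radiusBound_nonneg (c : Constants) : 0 ≤ Real.log (3 * radiusBound c) :=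
  Real.log_nonneg (by linarith [one_le_radiusBound c])

theorem sum_abs_D_nonneg (c : Constants) : 0 ≤ ∑ k, |c.D k| :=
  Finset.sum_nonneg fun _ _ => abs_nonneg _

theorem rateFactor_nonneg (c : Constants) (κ : ℝ) : 0 ≤ rateFactor c κ := by
  have := log_radiusBound_nonneg c
  have := sum_abs_D_nonneg c
  unfold rateFactor
  positivity

theorem classBound_le {κ L a : ℝ} (ha : 1 ≤ a) (hL : L ≤ κ * a) (k : Fin 4) :
    classBound c L k ≤ (1 + |κ|) * (1 + ∑ k, |c.D k|) * a := by
  have hκ : κ * a ≤ |κ| * a := by gcongr; exact le_abs_self κ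
  have h0 := abs_nonneg κ
  have h1 : max 1 L ≤ (1 + |κ|) * a := max_le (by nlinarith) (by nlinarith)
  have h2 : max 1 (c.D k) ≤ 1 + ∑ k, |c.D k| :=
    max_le (by linarith [sum_abs_D_nonneg c])
      (by linarith [abs_D_le c k, le_abs_self (c.D k)])
  calc classBound c L k ≤ ((1 + |κ|) * a) * (1 + ∑ k, |c.D k|) := by
        unfold classBound; gcongr
    _ = _ := by ring

set_option maxHeartbeats 1000000 in
/-- On data within the reward bound there is a common critical radius of the product class and of
the dual class of the order of the number of actions times `√(log n / n)`. -/
theorem exists_criticalRadius {ι : Type*} [Fintype ι] (hι : 2 ≤ Fintype.card ι)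
    {x : ι → Trial Om S O A Op} (hx : ∀ i, |rew (x i)| ≤ c.LY) {Φ : Features c Om O A Op}
    {Pol : Set (Kernel (Om × O) A)} (hPol : Pol ⊆ softmaxClass Φ) {L κ : ℝ}
    (hL : AlphaBounded S Φ Pol L) (hA : (1 : ℝ) ≤ Fintype.card A)
    (hLκ : L ≤ κ * Fintype.card A) (k : Fin 4) :
    ∃ r, IsCriticalRadius x (prodClass Φ Pol k) (classBound c L k) r ∧
      IsCriticalRadius x (dualClass Φ k) (classBound c L k) r ∧
      r ≤ √(rateFactor c κ) * Fintype.card A *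
        √(Real.log (Fintype.card ι) / Fintype.card ι) := by
  have : Nonempty ι := Fintype.card_pos_iff.1 (by omega)
  set n := Fintype.card ι with hn
  set a : ℝ := (Fintype.card A : ℝ) with ha
  have hn0 : (0 : ℝ) < n := by positivity
  have hB1 : 1 ≤ classBound c L k := one_le_classBound c L k
  have hB : 0 < classBound c L k := by linarith
  have hBle := classBound_le (c := c) hA hLκ k
  have hn2 : (2 : ℝ) ≤ n := by exact_mod_cast hι
  have hl : 1 / 2 ≤ Real.log n := by
    have := Real.log_two_gt_d9
    have h2 : Real.log 2 ≤ Real.log n := Real.log_le_log (by norm_num) hn2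
    linarith
  have hR := one_le_radiusBound c
  have hR0 := log_radiusBound_nonneg c
  have hS := sum_abs_D_nonneg c
  -- Bounded by `log (3 R n)`; the constant `log (3 R)` is absorbed using `log n ≥ 1/2`.
  have hlog : Real.log (2 * (radiusBound c * n) + 1) ≤
      (1 + 2 * Real.log (3 * radiusBound c)) * Real.log n := by
    have h1 : 2 * (radiusBound c * n) + 1 ≤ (3 * radiusBound c) * (n : ℝ) := by
      linarith [one_le_mul_of_one_le_of_one_le hR (one_le_two.trans hn2)]
    have h2 := Real.log_le_log (by positivity) h1
    rw [Real.log_mul (by positivity) (by positivity)] at h2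
    linarith [mul_nonneg hR0 (sub_nonneg.2 hl)]
  have hD : max 1 (c.D k) ≤ 1 + ∑ k, |c.D k| :=
    max_le (by linarith) (by linarith [abs_D_le c k, le_abs_self (c.D k)])
  have hD1 : (1 : ℝ) ≤ max 1 (c.D k) := le_max_left _ _
  have hL1 : (1 : ℝ) ≤ max 1 L := le_max_left _ _
  have hκ0 := abs_nonneg κ
  have hY := abs_nonneg c.LY
  have hκ : κ * a ≤ |κ| * a := by gcongr; exact le_abs_self κ
  have hLm : max 1 L ≤ (1 + |κ|) * a := max_le
    (one_le_mul_of_one_le_of_one_le (le_add_of_nonneg_right hκ0) hA) (by linarith)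
  have hsum : 2 + a + 2 * |c.LY| + max 1 L ≤ (4 + 2 * |c.LY| + |κ|) * a := by
    linarith [mul_nonneg hY (sub_nonneg.2 hA)]
  have hone : 1 / (n : ℝ) ≤ 2 * (Real.log n / n) := by
    rw [← mul_div_assoc]; gcongr; linarith
  have hdn : (dimBound c / n : ℝ) ≤ 2 * dimBound c * (Real.log n / n) := by
    calc (dimBound c / n : ℝ) = dimBound c * (1 / n) := by ring
      _ ≤ dimBound c * (2 * (Real.log n / n)) := by gcongr
      _ = _ := by ring
  have hln : 0 ≤ Real.log n / n := by positivity
  set b := (1 + |κ|) * (1 + ∑ k, |c.D k|) with hb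
  have hb1 : 0 < b := by positivity
  set q := b * a with hq
  have hF : rateFactor c κ * a ^ 2 * (Real.log n / n) =
      2 * q ^ 2 * (dimBound c * ((1 + 2 * Real.log (3 * radiusBound c)) * Real.log n)) / n +
      2 * q * ((4 + 2 * |c.LY| + |κ|) * a * (1 + ∑ k, |c.D k|) *
        (2 * dimBound c * (Real.log n / n))) + q ^ 2 * (Real.log n / n) := by
    simp only [rateFactor, ← hb, hq]
    ring
  -- The last summand of `rateFactor` keeps the radius strictly positive even when all feature
  -- dimensions vanish.
  have hpos : 0 < rateFactor c κ * a ^ 2 * (Real.log n / n) := by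
    rw [hF]
    have : 0 < q ^ 2 * (Real.log n / n) := by positivity
    positivity
  have hsq : (√(rateFactor c κ) * a * √(Real.log n / n)) ^ 2 =
      rateFactor c κ * a ^ 2 * (Real.log n / n) := by
    rw [mul_pow, mul_pow, Real.sq_sqrt (rateFactor_nonneg c κ), Real.sq_sqrt hln]
  have hr : 0 < √(rateFactor c κ) * a * √(Real.log n / n) := by
    rw [← hsq] at hpos
    exact lt_of_le_of_ne (by positivity) fun h => by rw [← h] at hpos; simp at hpos
  have hlog0 : 0 ≤ Real.log (2 * (radiusBound c * n) + 1) :=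
    Real.log_nonneg (le_add_of_nonneg_left (by positivity))
  have hrad : 2 * classBound c L k ^ 2 *
      (dimBound c * Real.log (2 * (radiusBound c * n) + 1)) / n +
        2 * classBound c L k * ((2 + a + 2 * |c.LY| + max 1 L) * max 1 (c.D k) *
          (dimBound c / n)) ≤ (√(rateFactor c κ) * a * √(Real.log n / n)) ^ 2 := by
    rw [hsq, hF]
    refine le_add_of_le_of_nonneg (add_le_add ?_ ?_) (by positivity)
    · gcongr
    · gcongr
  refine ⟨_, isCriticalRadius_prodClass hx hPol hL k hB hr hrad,
    isCriticalRadius_dualClass x Φ k hB hr (le_trans ?_ hrad), le_rfl⟩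
  -- The dual class satisfies the same radius condition, its discretization error being smaller by a
  -- factor at least one.
  gcongr
  refine le_mul_of_one_le_left (by positivity) ?_
  exact one_le_mul_of_one_le_of_one_le (by linarith) hD1

/-- The critical radii can be bounded at the order of the number of actions times
`√(log m / m)`, where `m` is the number of complete trials. -/
theorem exists_boundsCriticalRadii {T : ℕ} {D : Fin T → Trial Om S O A Op}
    (hx : ∀ i, |rew (D i)| ≤ c.LY) {Φ : Features c Om O A Op}
    {Pol : Set (Kernel (Om × O) A)} (hPol : Pol ⊆ softmaxClass Φ) {L κ c₀ ξ : ℝ}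
    (hL : AlphaBounded S Φ Pol L) (hA : (1 : ℝ) ≤ Fintype.card A)
    (hLκ : L ≤ κ * Fintype.card A) (hc₀ : 0 ≤ c₀) (hξ0 : 0 < ξ) (hξ1 : ξ < 1)
    (hD : 2 ≤ size D 1) :
    ∃ η : Fin 4 → ℝ, BoundsCriticalRadii c₀ ξ L Φ Pol D η ∧
      √(∑ k, η k ^ 2) ≤ 2 * c₀ * (2 * √(rateFactor c κ) + (1 + |κ|) * (1 + ∑ k, |c.D k|)) *
        Fintype.card A * √((Real.log (size D 1) + Real.log (1 / ξ)) / size D 1) := by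
  set m := size D 1 with hm
  set a : ℝ := (Fintype.card A : ℝ) with ha
  have hsz : ∀ k, m ≤ size D k := size_one_le D
  choose r hr1 hr2 hr3 using fun k => exists_criticalRadius (x := subData D k)
    (hD.trans (hsz k)) (fun i => hx i) hPol hL hA hLκ k
  have hS := sum_abs_D_nonneg c
  have hm0 : (0 : ℝ) < m := by positivity
  have hlm : 0 ≤ Real.log m := Real.log_natCast_nonneg m
  have hlξ : 0 ≤ Real.log (1 / ξ) := Real.log_nonneg (by rw [le_div_iff₀ hξ0]; linarith)
  set V := (Real.log m + Real.log (1 / ξ)) / m with hV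
  set b := (1 + |κ|) * (1 + ∑ k, |c.D k|) with hb
  have hb0 : 0 < b := by positivity
  have ha0 : 0 < a := by linarith
  have hη : ∀ k, c₀ * (r k + classBound c L k * √(Real.log (1 / ξ) / size D k)) ≤
      c₀ * (2 * √(rateFactor c κ) + b) * a * √V := by
    intro k
    have hmk : (m : ℝ) ≤ size D k := by exact_mod_cast hsz k
    have h1 : √(Real.log (size D k) / size D k) ≤ 2 * √V := by
      rw [Real.sqrt_le_left (by positivity), mul_pow, Real.sq_sqrt (by positivity)]
      refine (log_div_le_of_le hD (hsz k)).trans ?_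
      have : Real.log m / m ≤ V := by rw [hV]; gcongr; linarith
      have : 0 ≤ V := by positivity
      linarith
    have h2 : √(Real.log (1 / ξ) / size D k) ≤ √V := by
      refine Real.sqrt_le_sqrt ?_
      rw [hV]
      gcongr
      linarith
    have h3 := classBound_le (c := c) hA hLκ k
    have h4 : r k ≤ √(rateFactor c κ) * a * (2 * √V) := (hr3 k).trans (by gcongr; exact h1)
    have hB1 : 0 ≤ classBound c L k := zero_le_one.trans (one_le_classBound c L k)
    calc _ ≤ c₀ * (√(rateFactor c κ) * a * (2 * √V) + (b * a) * √V) := by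
          gcongr
      _ = _ := by ring
  refine ⟨fun k => c₀ * (r k + classBound c L k * √(Real.log (1 / ξ) / size D k)),
    fun k => ⟨r k, hr1 k, hr2 k, le_rfl⟩, ?_⟩
  have h0 : ∀ k, 0 ≤ c₀ * (r k + classBound c L k * √(Real.log (1 / ξ) / size D k)) := fun k => by
    have := (hr1 k).1
    have hB1 : 0 ≤ classBound c L k := zero_le_one.trans (one_le_classBound c L k)
    positivity
  refine Real.sqrt_le_iff.2 ⟨by positivity, ?_⟩
  -- Four equal squares add up to the square of twice the common bound.
  refine (Finset.sum_le_sum fun k _ => pow_le_pow_left₀ (h0 k) (hη k) 2).trans (le_of_eq ?_)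
  simp only [Finset.sum_const, Finset.card_univ, Fintype.card_fin, nsmul_eq_mul]
  push_cast
  ring

end RateOfRadii

/-! ### Assembly of the two claims -/

section Main

variable {Om S O A Op : Type*} [MeasurableSpace Om] [MeasurableSpace S] [MeasurableSpace O]
  [Fintype A] [MeasurableSpace A] [MeasurableSingletonClass A] [MeasurableSpace Op] {c : Constants}

theorem ae_forall_abs_rew_le {M : Model Om S O A Op} {C : ℝ} (hR : RewardBounded M C) (T : ℕ) :
    ∀ᵐ D ∂(Measure.pi fun _ : Fin T => obLaw M), ∀ i, |rew (D i)| ≤ C :=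
  ae_all_iff.2 fun i =>
    (Measure.quasiMeasurePreserving_eval (fun _ : Fin T => obLaw M) i).ae (ae_abs_rew_le hR)

theorem RadiiOK.D_nonneg {Φ : Features c Om O A Op} (h : RadiiOK Φ) (k : Fin 4) : 0 ≤ c.D k := by
  obtain ⟨h1, h2, h3, h4, d0, d1, d2, d3⟩ := h
  have hf : ∀ {p q : ℕ} (W : Matrix (Fin p) (Fin q) ℝ), 0 ≤ frob W := fun W => Real.sqrt_nonneg _
  have p1 := mul_nonneg h1 (hf Φ.W₁)
  have p2 := mul_nonneg h1 (hf Φ.W₂)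
  have p3 := mul_nonneg h2 (hf Φ.W₃)
  have p4 := mul_nonneg h2 (hf Φ.W₄)
  have p5 := mul_nonneg h3 (hf Φ.W₅)
  have p6 := mul_nonneg h3 (hf Φ.W₆)
  match k with
  | 0 => linarith
  | 1 => linarith
  | 2 => linarith
  | 3 => linarith

/-- With high probability all pessimistic policies are nearly optimal. -/
theorem measure_not_subOpt_le {M : Model Om S O A Op} (hR : RewardBounded M c.LY)
    {Φ : Features c Om O A Op} {Pol : Set (Kernel (Om × O) A)} (hPol : Pol ⊆ softmaxClass Φ)
    {L : ℝ} (hL : AlphaBounded S Φ Pol L) (hrad : RadiiOK Φ) (hlin : LinearBridgeExists M Φ Pol)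
    (hdual : DualLinear M Φ) {b : Om × A × Op → ℝ} (hb : IsShift M b) (hrat : RatiosExist M)
    {ξ : ℝ} (hξ0 : 0 < ξ) (T : ℕ) : Measure.pi (fun _ : Fin T => obLaw M)
      {D | ¬ (0 < size D 1 → ∀ (η : Fin 4 → ℝ) (e : ℝ) (πhat : Kernel (Om × O) A),
        BoundsCriticalRadii 2000000 ξ L Φ Pol D η → (2 * L ^ 2 + 5 / 4) * ∑ k, η k ^ 2 < e →
        IsPessimistic M Φ Pol D e πhat → ENNReal.ofReal (subOpt M Pol πhat) ≤
          (∑ k, eLpNorm (weight M b k) 2 (condLaw M k)) *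
            ENNReal.ofReal (4 * √e + 4 * √(∑ k, η k ^ 2)))} ≤ ENNReal.ofReal (8 * ξ) := by
  by_cases hp : obLaw M (pattern 1) = 0
  · refine le_of_eq_of_le (measure_mono_null (fun D hD => ?_)
      (ae_iff.1 (ae_size_one_eq_zero hp T))) zero_le
    exact fun h0 => hD fun h => absurd h0 h.ne'
  have hk : ∀ k, obLaw M (pattern k) ≠ 0 := fun k h =>
    hp (measure_mono_null (pattern_one_subset k) h)
  rcases Pol.eq_empty_or_nonempty with rfl | hne
  · refine le_of_eq_of_le (measure_mono_null (t := ∅) (fun D hD => ?_) measure_empty) zero_le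
    exact hD fun _ η e πhat _ _ h => absurd h.1 (Set.notMem_empty _)
  have hC4 : 0 ≤ c.C₄ := by
    rw [hrad.2.2.2.1]
    exact mul_nonneg hrad.2.2.1 (Real.sqrt_nonneg _)
  refine (measure_mono fun D hD => ?_).trans (measure_not_forall_uniformDev_le hR hPol hL
    hrad.D_nonneg hne ⟨hrad.1, hrad.2.1, hrad.2.2.1, hC4⟩ hξ0 T)
  by_contra hcon
  refine hD fun hpos η e πhat hη he hπ => ?_
  have hU : ∀ k, UniformDev (condLaw M k) Φ Pol k (subData D k) (η k) := by
    by_contra h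
    exact hcon ⟨hpos, fun hall => h (hall η hη)⟩
  -- The deterministic regret bound asks for `e > (5/4) ∑ η²`, which the threshold implies since `2
  -- L² ∑ η² ≥ 0`.
  have hE : 0 ≤ ∑ k, η k ^ 2 := Finset.sum_nonneg fun k _ => sq_nonneg _
  have he' : 5 / 4 * ∑ k, η k ^ 2 < e := by
    have := mul_nonneg (mul_nonneg zero_le_two (sq_nonneg L)) hE
    linarith
  refine (subOpt_le_of_uniformDev hR hPol hL hrad hlin hdual hrad.D_nonneg hk hb hrat hU he'
    hπ).trans ?_
  gcongr
  exact le_add_of_nonneg_right (by positivity)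

end Main

end LinPOMDP

end

theorem mainTheorem9 :
    ∃ c₀ C : ℝ, 0 < c₀ ∧ 0 < C ∧
    ∀ (c : LinPOMDP.Constants) (κ : ℝ), ∃ C' : ℝ, 0 < C' ∧
    ∀ {Om S O A Op : Type*} [MeasurableSpace Om] [MeasurableSpace S] [MeasurableSpace O]
      [Fintype A] [MeasurableSpace A] [MeasurableSingletonClass A] [MeasurableSpace Op]
      (M : LinPOMDP.Model Om S O A Op) (Φ : LinPOMDP.Features c Om O A Op)
      (Pol : Set (ProbabilityTheory.Kernel (Om × O) A)) (L ξ : ℝ) (T : ℕ),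
      Pol ⊆ LinPOMDP.softmaxClass Φ →
      LinPOMDP.RewardBounded M c.LY →
      LinPOMDP.RadiiOK Φ →
      LinPOMDP.LinearBridgeExists M Φ Pol →
      LinPOMDP.DualLinear M Φ →
      LinPOMDP.AlphaBounded S Φ Pol L →
      0 < ξ → ξ < 1 →
      (∀ b : Om × A × Op → ℝ, LinPOMDP.IsShift M b → LinPOMDP.RatiosExist M →
        MeasureTheory.Measure.pi (fun _ : Fin T => LinPOMDP.obLaw M)
          {D | ¬ (0 < LinPOMDP.size D 1 →
            ∀ (η : Fin 4 → ℝ) (e : ℝ) (πhat : ProbabilityTheory.Kernel (Om × O) A),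
              LinPOMDP.BoundsCriticalRadii c₀ ξ L Φ Pol D η →
              (2 * L ^ 2 + 5 / 4) * ∑ k, η k ^ 2 < e →
              LinPOMDP.IsPessimistic M Φ Pol D e πhat →
              ENNReal.ofReal (LinPOMDP.subOpt M Pol πhat) ≤
                (∑ k, MeasureTheory.eLpNorm (LinPOMDP.weight M b k) 2 (LinPOMDP.condLaw M k)) *
                  ENNReal.ofReal (C * √e + C * √(∑ k, η k ^ 2)))}
          ≤ ENNReal.ofReal (8 * ξ)) ∧
      (L ≤ κ * Fintype.card A →
        ∀ᵐ D ∂(MeasureTheory.Measure.pi (fun _ : Fin T => LinPOMDP.obLaw M)),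
          2 ≤ LinPOMDP.size D 1 →
          ∃ η : Fin 4 → ℝ, LinPOMDP.BoundsCriticalRadii c₀ ξ L Φ Pol D η ∧
            √(∑ k, η k ^ 2) ≤ C' * Fintype.card A *
              √((Real.log (LinPOMDP.size D 1) + Real.log (1 / ξ)) / LinPOMDP.size D 1)) := by
  
  -- `2000000` is the constant from the localization radii, and `4` comes from the bound `16 e` on
  -- the second moments of the dual representers.
  refine ⟨2000000, 4, by norm_num, by norm_num, fun c κ => ?_⟩
  have hS := LinPOMDP.sum_abs_D_nonneg c
  refine ⟨2 * 2000000 * (2 * √(LinPOMDP.rateFactor c κ) + (1 + |κ|) * (1 + ∑ k, |c.D k|)),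
    by positivity, ?_⟩
  intro Om S O A Op _ _ _ _ _ _ _ M Φ Pol L ξ T hPol hR hrad hlin hdual hL hξ0 hξ1
  refine ⟨fun b hb hrat => ?_, fun hκ => ?_⟩
  · exact LinPOMDP.measure_not_subOpt_le hR hPol hL hrad hlin hdual hb hrat hξ0 T
  -- The model forces at least one action, since its kernels are Markov and the law of `O⁻` is a
  -- probability measure; the bounds linear in `|A|` need this.
  · have := M.nonempty_act
    have hA : (1 : ℝ) ≤ Fintype.card A := by exact_mod_cast Fintype.card_pos (α := A)
    filter_upwards [LinPOMDP.ae_forall_abs_rew_le hR T] with D hx hD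
    exact LinPOMDP.exists_boundsCriticalRadii hx hPol hL hA hκ (by norm_num) hξ0 hξ1 hD
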